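/- **Setting.** Let $\mathbb F\in\{\mathbb R,\mathbb C,\mathbb H\}$, $r\ge1$, and let $m_n>0$ satisfy $m_n\to\infty$, $m_n=o(n)$. For each $n$ let $(Y_{n,i;j})_{j\ge0}$, $i=1,2$, be random $r\times r$ matrix processes over $\mathbb F$, with $Y_{n,1;j}$ self-adjoint, and let $W_n$ be a nonrandom self-adjoint $r\times r$ matrix. A sequence $(v_j)_{j\ge 0}$ is identified with the step function $v(x)=v_{\lfloor m_nx\rfloor}$ on $\mathbb R_+=[0,\infty)$, and $\mathbb F^n$ with the sequences in $\mathbb F^r$ supported on the first $n$ coordinates in lexicographic order; thus $\mathbb F^n\hookrightarrow L^2(\mathbb R_+,\mathbb F^r)$, and "normalized" refers to the $L^2$ norm. Let $T_n$ be the left shift, $T_n^\dagger$ the right shift, $D_n=m_n(T_n-1)$, $\triangle_n=m_n(1-T_n^\dagger)$, $E_n=\mathrm{diag}(m_nI_r,0,0,\dots)$, $R_n$ the projection onto $\mathbb F^n$. The rank $r$ block tridiagonal ensemble is $$H_n=R_n\Bigl(D_n^\dagger D_n+\triangle_nY_{n,1}+\tfrac12\bigl((\triangle_nY_{n,2})T_n+T_n^\dagger(\triangle_nY_{n,2}^\dagger)\bigr)+W_nE_n\Bigr)R_n$$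 acting on $\mathbb F^n$; $\lambda_{n,k}$ denotes its $(k+1)$st lowest eigenvalue, counted with multiplicity ($k<n$). *Assumption 1.* In the compact-uniform topology the processes $Y_{n,i}(x)$, $i=1,2$, are tight, and $Y_{n,1}+\frac12(Y_{n,2}+Y_{n,2}^\dagger)\Rightarrow Y$ in law, where $Y$ is a continuous process of self-adjoint matrices on $[0,\infty)$ with $Y(0)=0$. *Assumption 2.* $Y_{n,i;j}=m_n^{-1}\sum_{k=0}^j\eta_{n,i;k}+\omega_{n,i;j}$ with $\eta_{n,i;j}\ge0$, and there are deterministic continuous nondecreasing unbounded functions $\bar\eta>0$, $\zeta\ge1$ and a tight sequence of random constants $\kappa_n\ge1$ such that for each $n$, almost surely, for all $x,\xi\in[0,\lceil n/r\rceil/m_n)$ with $|\xi-x|\le1$, $$\bar\eta(x)/\kappa_n-\kappa_n\le\eta_{n,1}(x)+\eta_{n,2}(x)\le\kappa_n(1+\bar\eta(x)),\qquad \eta_{n,2}(x)\le2m_n^2,$$ $$|\omega_{n,1}(\xi)-\omega_{n,1}(x)|^2+|\omega_{n,2}(\xi)-\omega_{n,2}(x)|^2\le\kappa_n(1+\bar\eta(x)/\zeta(x)).$$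 *Assumption 3.* For some orthonormal basis $u_1,\dots,u_r$ of $\mathbb F^r$, $W_n=\sum_iw_{n,i}u_iu_i^\dagger$ with $w_{n,i}\in\mathbb R$ and $w_{n,i}\to w_i\in(-\infty,\infty]$; write $W=\sum_iw_iu_iu_i^\dagger$. **The limit.** $C_0^\infty$ is the space of smooth compactly supported $\varphi:\mathbb R_+\to\mathbb F^r$ such that $u_i^\dagger\varphi$ vanishes near $0$ whenever $w_i=\infty$; $L^*$ is its closure in the norm $\|f\|_*^2=\int_0^\infty(|f'|^2+(1+\bar\eta)|f|^2)+\sum_{w_i<\infty}w_i^+|u_i^\dagger f(0)|^2$; and $$\mathcal H(\varphi,f)=\langle\varphi',f'\rangle-\langle\varphi',Yf\rangle-\langle\varphi,Yf'\rangle+\sum_{w_i<\infty}\varphi(0)^\dagger u_i\,w_i\,u_i^\dagger f(0)$$ is the form of $-\frac{d^2}{dx^2}+Y'(x)$ with boundary condition $f'(0)=Wf(0)$ (a Dirichlet condition where $w_i=\infty$). A nonzero $f\in L^*$ is an eigenfunction with eigenvalue $\Lambda\in\mathbb R$ if $\mathcal H(\varphi,f)=\Lambda\langle\varphi,f\rangle$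 for all $\varphi\in C_0^\infty$. $\Lambda_k$ is the $(k+1)$st lowest eigenvalue, counted with multiplicity. **Theorem.** (A) *Deterministic setting.* Let $n$ run through a subsequence along which deterministic data $Y_{n,i},\eta_{n,i},\omega_{n,i},\kappa_n$ satisfy the decomposition and bounds of Assumption 2, $Y_{n,i}$ and $\int_0\eta_{n,i}$ ($i=1,2$) converge uniformly on compacts, $\kappa_n$ converges, and the limit $Y$ of $Y_{n,1}+\frac12(Y_{n,2}+Y_{n,2}^\dagger)$ is continuous with $Y(0)=0$. Then all $\Lambda_k$ are well defined, for every $W$. If Assumption 3 holds then, for each $k$, $\lambda_{n,k}\to\Lambda_k$; any sequence of normalized eigenvectors corresponding to $\lambda_{n,k}$ is pre-compact in $L^2$; and each of its subsequential limits is a (normalized) eigenfunction corresponding to $\Lambda_k$. The convergence is uniform over $W_n,W\ge-b$: for all $b,k$ and $\varepsilon>0$ there are $\delta>0$, $R$ such that for all large $n$ in the subsequence, all orthonormal bases $u$, all $w_{n,i}\in[-b,\infty)$ and $w_i\in[-b,\infty]$ such that for each $i$ either $w_{n,i},w_i>R$, or $w_i<\infty$ and $|w_{n,i}-w_i|<\delta$,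 one has $|\lambda_{n,k}-\Lambda_k|<\varepsilon$, and every normalized eigenvector for $\lambda_{n,k}$ is within $\varepsilon$ in $L^2$ of a finite sum of eigenfunctions with eigenvalues within $\varepsilon$ of $\Lambda_k$; moreover the set of all normalized eigenvectors corresponding to $\lambda_{n,k}$, over all $n>k$ in the subsequence and all $W_n\ge-b$, is pre-compact in $L^2$. (B) *Distributional statement.* Under Assumptions 1 and 2, almost surely all $\Lambda_k$ are well defined for all $W$ simultaneously. For finitely many indices $k_a$ and pairs $(W_n^{(a)},W^{(a)})$ satisfying Assumption 3, the vectors $(\lambda^{(a)}_{n,k_a})_a$ converge jointly in law, along the full sequence, to $(\Lambda^{(a)}_{k_a})_a$. For any random normalized eigenvectors $v_n^{(a)}$ corresponding to $\lambda^{(a)}_{n,k_a}$, each sequence $(v_n^{(a)})_n$ is tight in $L^2$, and every subsequence has a further subsequence along which $(\lambda^{(a)}_{n,k_a},v^{(a)}_n)_a$ converges jointly in law in the norm topology to $(\Lambda^{(a)}_{k_a},f^{(a)})_a$, where, on some probability space carrying a copy of $Y$, almost surely each $f^{(a)}$ is a normalized eigenfunction corresponding to $\Lambda^{(a)}_{k_a}$.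 -/

import Mathlib

open MeasureTheory Filter Topology Set
open scoped NNReal ENNReal Matrix BoundedContinuousFunction

noncomputable section

namespace BlockTridiagonal

/-! ### Scalars -/

/-- `F` is the real field, the complex field or the skew field of quaternions, with its conjugation
and its absolute value. -/
class ClassicalScalar (F : Type) [NormedDivisionRing F] [NormedAlgebra ℝ F] [StarRing F] :
    Prop where
  out : (∃ e : F ≃⋆ₐ[ℝ] ℝ, ∀ x, ‖e x‖ = ‖x‖) ∨ (∃ e : F ≃⋆ₐ[ℝ] ℂ, ∀ x, ‖e x‖ = ‖x‖) ∨
    (∃ e : F ≃⋆ₐ[ℝ] Quaternion ℝ, ∀ x, ‖e x‖ = ‖x‖)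

instance : ClassicalScalar ℝ := ⟨Or.inl ⟨StarAlgEquiv.refl _ _, fun _ => rfl⟩⟩
instance : ClassicalScalar ℂ := ⟨Or.inr (Or.inl ⟨StarAlgEquiv.refl _ _, fun _ => rfl⟩)⟩
instance : ClassicalScalar (Quaternion ℝ) := ⟨Or.inr (Or.inr ⟨StarAlgEquiv.refl _ _, fun _ => rfl⟩)⟩

/-- Column vectors `F ^ r` with the Euclidean norm. -/
abbrev Vec (F : Type) (r : ℕ) : Type := EuclideanSpace F (Fin r)

/-- `r × r` matrices over `F`. -/
abbrev Mat (F : Type) (r : ℕ) : Type := Matrix (Fin r) (Fin r) F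

/-- The space `L²(ℝ₊, F ^ r)`. -/
abbrev L2 (F : Type) (r : ℕ) [NormedDivisionRing F] : Type :=
  Lp (Vec F r) 2 (volume.restrict (Ici (0 : ℝ)))

/-- The space of matrix-valued paths on `[0, ∞)` with the compact-uniform topology. -/
abbrev PathSpace (F : Type) (r : ℕ) : Type := UniformOnFun ℝ≥0 (Mat F r) {K | IsCompact K}

/-- A path regarded as a point of the path space. -/
def toPath {F : Type} {r : ℕ} (Y : ℝ≥0 → Mat F r) : PathSpace F r :=
  UniformOnFun.ofFun {K | IsCompact K} Y

section Basic

variable {F : Type} [NormedDivisionRing F] [NormedAlgebra ℝ F] [StarRing F] {r : ℕ}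

/-- The product `M v` of a matrix and a column vector. -/
def act (M : Mat F r) (v : Vec F r) : Vec F r := WithLp.toLp 2 (M *ᵥ v.ofLp)

/-- The `F`-valued inner product `v† w`. -/
def dag (v w : Vec F r) : F := star v.ofLp ⬝ᵥ w.ofLp

/-- Positive semidefiniteness of a self-adjoint matrix: `v† M v` is real and nonnegative. -/
def PSD (M : Mat F r) : Prop :=
  M.IsHermitian ∧ ∀ v : Vec F r, ∃ c : ℝ, 0 ≤ c ∧ dag v (act M v) = algebraMap ℝ F c

/-- The usual order `A ≤ B` of matrices. -/
def MatLE (A B : Mat F r) : Prop := PSD (B - A)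

/-- The spectral (Euclidean operator) norm of a matrix. -/
def specNorm (M : Mat F r) : ℝ := sSup {t : ℝ | ∃ v : Vec F r, ‖v‖ ≤ 1 ∧ t = ‖act M v‖}

/-- `u` is an orthonormal basis of `F ^ r`. -/
def OrthoBasis (u : Fin r → Vec F r) : Prop :=
  ∀ i j, dag (u i) (u j) = if i = j then 1 else 0

/-- The self-adjoint matrix `∑ i, w i • u i (u i)†`. -/
def specMat (u : Fin r → Vec F r) (w : Fin r → ℝ) : Mat F r :=
  ∑ i, w i • Matrix.vecMulVec (u i).ofLp (star (u i).ofLp)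

/-! ### Tightness and convergence in law -/

/-- Tightness of the laws of `X n` on the topological space `S`. -/
def TightInLaw {S : Type*} [TopologicalSpace S] {Ω : ℕ → Type*} [∀ n, MeasurableSpace (Ω n)]
    (P : ∀ n, Measure (Ω n)) (X : ∀ n, Ω n → S) : Prop :=
  ∀ ε : ℝ≥0∞, 0 < ε → ∃ K : Set S, IsCompact K ∧ ∀ n, P n {ω | X n ω ∉ K} ≤ ε

/-- Convergence in law of `X n` to `Z`, tested against bounded continuous functionals on `S`. -/
def TendstoInLaw {S : Type*} [TopologicalSpace S] {Ω : ℕ → Type*} [∀ n, MeasurableSpace (Ω n)]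
    (P : ∀ n, Measure (Ω n)) (X : ∀ n, Ω n → S) {Ω' : Type*} [MeasurableSpace Ω']
    (P' : Measure Ω') (Z : Ω' → S) : Prop :=
  ∀ Φ : S →ᵇ ℝ, Tendsto (fun n => ∫ ω, Φ (X n ω) ∂(P n)) atTop (𝓝 (∫ ω, Φ (Z ω) ∂P'))

/-- Equality in law. -/
def EqualInLaw {S : Type*} [TopologicalSpace S] {Ω : Type*} [MeasurableSpace Ω] (P : Measure Ω)
    (X : Ω → S) {Ω' : Type*} [MeasurableSpace Ω'] (P' : Measure Ω') (Z : Ω' → S) : Prop :=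
  ∀ Φ : S →ᵇ ℝ, ∫ ω, Φ (X ω) ∂P = ∫ ω, Φ (Z ω) ∂P'

/-! ### The discrete operator -/

/-- The embedding of sequences on `{0, 1, 2, …}` as step functions on `[0, ∞)`, step `1 / m`. -/
def step {A : Type*} (m : ℝ) (a : ℕ → A) (x : ℝ≥0) : A := a ⌊m * (x : ℝ)⌋₊

/-- The right shift `T†`. -/
def prev {A : Type*} [Zero A] (a : ℕ → A) (j : ℕ) : A := if j = 0 then 0 else a (j - 1)

/-- The difference quotient `D = m (T - 1)`. -/
def diff (m : ℝ) (v : ℕ → Vec F r) (j : ℕ) : Vec F r := m • (v (j + 1) - v j)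

/-- The adjoint `D† = m (T† - 1)`. -/
def diffAdj (m : ℝ) (v : ℕ → Vec F r) (j : ℕ) : Vec F r := m • (prev v j - v j)

/-- The increments `△Y = m (1 - T†) Y`. -/
def tri (m : ℝ) (Y : ℕ → Mat F r) (j : ℕ) : Mat F r := m • (Y j - prev Y j)

/-- The potential operator
`V = diag (△Y₁) + (1/2) (diag (△Y₂) T + T† diag (△Y₂†))`. -/
def potential (m : ℝ) (Y₁ Y₂ : ℕ → Mat F r) (v : ℕ → Vec F r) (j : ℕ) : Vec F r :=
  act (tri m Y₁ j) (v j) + (1 / 2 : ℝ) •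
    (act (tri m Y₂ j) (v (j + 1)) + prev (fun l => act (tri m Y₂ l)ᴴ (v l)) j)

/-- The boundary operator `W E`, with `E = diag (m, 0, 0, …)`. -/
def boundary (m : ℝ) (W : Mat F r) (v : ℕ → Vec F r) (j : ℕ) : Vec F r :=
  if j = 0 then act W (m • v 0) else 0

/-- The projection `R` onto the first `n` coordinates, in lexicographic order. -/
def trunc (n : ℕ) (v : ℕ → Vec F r) (j : ℕ) : Vec F r :=
  WithLp.toLp 2 fun i => if j * r + (i : ℕ) < n then (v j).ofLp i else 0

/-- The operator `H = R (D† D + V + W E) R`. -/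
def discreteH (n : ℕ) (m : ℝ) (Y₁ Y₂ : ℕ → Mat F r) (W : Mat F r) (v : ℕ → Vec F r) :
    ℕ → Vec F r :=
  trunc n fun j => diffAdj m (diff m (trunc n v)) j + potential m Y₁ Y₂ (trunc n v) j +
    boundary m W (trunc n v) j

/-- `V ∈ L²(ℝ₊, F ^ r)` is the embedding of an eigenvector `v ∈ F ^ n` of the `n × n` matrix `H`,
with eigenvalue `l`. The condition `trunc n v = v` says that `v` belongs to `F ^ n`. -/
def IsDiscreteEigen (n : ℕ) (m : ℝ) (Y₁ Y₂ : ℕ → Mat F r) (W : Mat F r) (l : ℝ) (V : L2 F r) :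
    Prop :=
  V ≠ 0 ∧ ∃ v : ℕ → Vec F r, trunc n v = v ∧ (∀ j, discreteH n m Y₁ Y₂ W v j = l • v j) ∧
    V =ᵐ[volume.restrict (Ici (0 : ℝ))] fun x => step m v x.toNNReal

/-! ### The continuum form -/

/-- A boundary condition `W = ∑ i, w i u i (u i)†` with `w i ∈ (-∞, ∞]`. -/
def IsBoundaryCondition (u : Fin r → Vec F r) (w : Fin r → EReal) : Prop :=
  OrthoBasis u ∧ ∀ i, w i ≠ ⊥

/-- Test functions: smooth and compactly supported on `[0, ∞)`, with Dirichlet components vanishing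
near the origin. -/
def IsTest (u : Fin r → Vec F r) (w : Fin r → EReal) (φ : ℝ → Vec F r) : Prop :=
  ContDiff ℝ ((⊤ : ℕ∞) : WithTop ℕ∞) φ ∧ HasCompactSupport φ ∧
    ∀ i, w i = ⊤ → ∃ δ > 0, ∀ x ∈ Icc (0 : ℝ) δ, dag (u i) (φ x) = 0

/-- The square of the `L*` norm of a function `f` with derivative `g`. As `EReal.toReal ⊤ = 0`, the
formal Dirichlet terms are zero. -/
def starNormSq (ηbar : ℝ≥0 → ℝ) (u : Fin r → Vec F r) (w : Fin r → EReal) (f g : ℝ → Vec F r) :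
    ℝ≥0∞ :=
  (∫⁻ x in Ici (0 : ℝ), (‖g x‖ₑ ^ 2 + ENNReal.ofReal (1 + ηbar x.toNNReal) * ‖f x‖ₑ ^ 2)) +
    ∑ i, ENNReal.ofReal (max (w i).toReal 0) * ‖dag (u i) (f 0)‖ₑ ^ 2

/-- The continuous function `f` belongs to `L*`, the closure of the test functions in the `L*` norm,
and `g` is its derivative. -/
def MemLstar (ηbar : ℝ≥0 → ℝ) (u : Fin r → Vec F r) (w : Fin r → EReal) (f g : ℝ → Vec F r) :
    Prop :=
  ContinuousOn f (Ici 0) ∧ AEStronglyMeasurable g (volume.restrict (Ici (0 : ℝ))) ∧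
    ∃ φ : ℕ → ℝ → Vec F r, (∀ k, IsTest u w (φ k)) ∧
      Tendsto (fun k => starNormSq ηbar u w (fun x => φ k x - f x) fun x => deriv (φ k) x - g x)
        atTop (𝓝 0)

/-- The inner product `∫ f† g` on the half-line. -/
def ip (f g : ℝ → Vec F r) : F := ∫ x in Ici (0 : ℝ), dag (f x) (g x)

/-- The sesquilinear form
`⟨φ', f'⟩ - ⟨φ', Y f⟩ - ⟨φ, Y f'⟩ + φ(0)† W f(0)`, where `φ'` and `g` are the derivatives of `φ` and
`f`; the Dirichlet part of the boundary term is zero. -/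
def form (Y : ℝ≥0 → Mat F r) (u : Fin r → Vec F r) (w : Fin r → EReal) (φ f g : ℝ → Vec F r) : F :=
  ip (deriv φ) g - ip (deriv φ) (fun x => act (Y x.toNNReal) (f x)) -
    ip φ (fun x => act (Y x.toNNReal) (g x)) +
    dag (φ 0) (act (specMat u fun i => (w i).toReal) (f 0))

/-- `V` is an eigenfunction of `-d²/dx² + Y'` with boundary condition `f'(0) = W f(0)`, with
eigenvalue `Λ`, in the weak sense. -/
def IsContinuumEigen (ηbar : ℝ≥0 → ℝ) (Y : ℝ≥0 → Mat F r) (u : Fin r → Vec F r)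
    (w : Fin r → EReal) (Λ : ℝ) (V : L2 F r) : Prop :=
  V ≠ 0 ∧ ∃ f g : ℝ → Vec F r, MemLstar ηbar u w f g ∧
    V =ᵐ[volume.restrict (Ici (0 : ℝ))] f ∧
    ∀ φ, IsTest u w φ → form Y u w φ f g = Λ • ip φ f

/-! ### Ordered eigenvalues -/

/-- The levels `a` below or at which there are at least `k + 1` eigenvalues, counted with
multiplicity (over `F`), of the eigenvalue problem `E`. -/
def eigLevels (E : ℝ → L2 F r → Prop) (k : ℕ) : Set ℝ :=
  {a | ∃ (μ : Fin (k + 1) → ℝ) (V : Fin (k + 1) → L2 F r),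
    (∀ i j, ip (V i) (V j) = if i = j then 1 else 0) ∧ ∀ i, E (μ i) (V i) ∧ μ i ≤ a}

/-- The `(k + 1)`st lowest eigenvalue of `H`; meaningful for `k < n`. -/
def discreteEig (n : ℕ) (m : ℝ) (Y₁ Y₂ : ℕ → Mat F r) (W : Mat F r) (k : ℕ) : ℝ :=
  sInf (eigLevels (IsDiscreteEigen n m Y₁ Y₂ W) k)

/-- The `(k + 1)`st lowest eigenvalue of the continuum problem. -/
def continuumEig (ηbar : ℝ≥0 → ℝ) (Y : ℝ≥0 → Mat F r) (u : Fin r → Vec F r) (w : Fin r → EReal)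
    (k : ℕ) : ℝ :=
  sInf (eigLevels (IsContinuumEigen ηbar Y u w) k)

/-! ### Assumptions -/

/-- The comparison functions: `ηbar > 0` and `ζ ≥ 1`, continuous, nondecreasing, unbounded. -/
structure IsComparison (ηbar ζ : ℝ≥0 → ℝ) : Prop where
  cont_eta : Continuous ηbar
  mono_eta : Monotone ηbar
  pos_eta : ∀ x, 0 < ηbar x
  unbdd_eta : ¬ BddAbove (range ηbar)
  cont_zeta : Continuous ζ
  mono_zeta : Monotone ζ
  one_le_zeta : ∀ x, 1 ≤ ζ x
  unbdd_zeta : ¬ BddAbove (range ζ)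

/-- The scale factors: positive, tending to infinity, and `o(n)`. -/
structure IsScale (m : ℕ → ℝ) : Prop where
  pos : ∀ n, 0 < m n
  tendsto : Tendsto m atTop atTop
  isLittleO : m =o[atTop] fun n : ℕ => (n : ℝ)

/-- The decomposition `Y j = m⁻¹ ∑_{k ≤ j} η k + ω j` with `η ≥ 0`. -/
def Decomposes (m : ℝ) (Y η ω : ℕ → Mat F r) : Prop :=
  ∀ j, PSD (η j) ∧ Y j = m⁻¹ • ∑ k ∈ Finset.range (j + 1), η k + ω j

/-- The growth and oscillation bounds on `[0, ⌈n / r⌉ / m)`, with constant `κ`. -/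
def GrowthBounds (n : ℕ) (m κ : ℝ) (ηbar ζ : ℝ≥0 → ℝ) (η₁ η₂ ω₁ ω₂ : ℕ → Mat F r) : Prop :=
  (∀ x : ℝ≥0, (x : ℝ) < (⌈(n : ℝ) / r⌉₊ : ℝ) / m →
    MatLE ((ηbar x / κ - κ) • (1 : Mat F r)) (step m η₁ x + step m η₂ x) ∧
    MatLE (step m η₁ x + step m η₂ x) ((κ * (1 + ηbar x)) • (1 : Mat F r)) ∧
    MatLE (step m η₂ x) ((2 * m ^ 2) • (1 : Mat F r))) ∧
  ∀ x ξ : ℝ≥0, (x : ℝ) < (⌈(n : ℝ) / r⌉₊ : ℝ) / m → (ξ : ℝ) < (⌈(n : ℝ) / r⌉₊ : ℝ) / m →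
    |(ξ : ℝ) - x| ≤ 1 →
    specNorm (step m ω₁ ξ - step m ω₁ x) ^ 2 + specNorm (step m ω₂ ξ - step m ω₂ x) ^ 2 ≤
      κ * (1 + ηbar x / ζ x)

/-- The combination `Y₁ + (1/2) (Y₂ + Y₂†)`. -/
def combine {ι : Type*} (Y₁ Y₂ : ι → Mat F r) (x : ι) : Mat F r :=
  Y₁ x + (1 / 2 : ℝ) • (Y₂ x + (Y₂ x)ᴴ)

/-- A continuous process on `[0, ∞)` of self-adjoint matrices, starting at zero. -/
structure IsContinuousProcess {Ω : Type*} [MeasurableSpace Ω] (Y : Ω → ℝ≥0 → Mat F r) : Prop where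
  meas : ∀ x i j, StronglyMeasurable fun ω => Y ω x i j
  cont : ∀ ω, Continuous (Y ω)
  zero : ∀ ω, Y ω 0 = 0
  herm : ∀ ω x, (Y ω x).IsHermitian

/-- The integrated potentials are random processes, the diagonal ones self-adjoint. -/
structure IsPotentialProcess {Ω : ℕ → Type*} [∀ n, MeasurableSpace (Ω n)]
    (Y₁ Y₂ : ∀ n, Ω n → ℕ → Mat F r) : Prop where
  meas₁ : ∀ n l i j, StronglyMeasurable fun ω => Y₁ n ω l i j
  meas₂ : ∀ n l i j, StronglyMeasurable fun ω => Y₂ n ω l i j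
  herm : ∀ n ω l, (Y₁ n ω l).IsHermitian

/-- Tightness and convergence in law with respect to the compact-uniform topology. -/
structure TightConvergent {Ω : ℕ → Type*} [∀ n, MeasurableSpace (Ω n)] (P : ∀ n, Measure (Ω n))
    (m : ℕ → ℝ) (Y₁ Y₂ : ∀ n, Ω n → ℕ → Mat F r) {Ω' : Type*} [MeasurableSpace Ω']
    (P' : Measure Ω') (Y : Ω' → ℝ≥0 → Mat F r) : Prop where
  tight₁ : TightInLaw P fun n ω => toPath (step (m n) (Y₁ n ω))
  tight₂ : TightInLaw P fun n ω => toPath (step (m n) (Y₂ n ω))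
  limit : IsContinuousProcess Y
  conv : TendstoInLaw P (fun n ω => toPath (combine (step (m n) (Y₁ n ω)) (step (m n) (Y₂ n ω))))
    P' fun ω => toPath (Y ω)

/-- Growth and oscillation bounds for the random ensemble. -/
def GrowthOscillation {Ω : ℕ → Type*} [∀ n, MeasurableSpace (Ω n)] (P : ∀ n, Measure (Ω n))
    (m : ℕ → ℝ) (Y₁ Y₂ : ∀ n, Ω n → ℕ → Mat F r) (ηbar ζ : ℝ≥0 → ℝ) : Prop :=
  ∃ (η₁ η₂ ω₁ ω₂ : ∀ n, Ω n → ℕ → Mat F r) (κ : ∀ n, Ω n → ℝ),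
    (∀ n l i j, StronglyMeasurable fun ω => η₁ n ω l i j) ∧
    (∀ n l i j, StronglyMeasurable fun ω => η₂ n ω l i j) ∧
    (∀ n, Measurable (κ n)) ∧ (∀ n ω, 1 ≤ κ n ω) ∧ TightInLaw P κ ∧
    ∀ n, ∀ᵐ ω ∂(P n), Decomposes (m n) (Y₁ n ω) (η₁ n ω) (ω₁ n ω) ∧
      Decomposes (m n) (Y₂ n ω) (η₂ n ω) (ω₂ n ω) ∧
      GrowthBounds n (m n) (κ n ω) ηbar ζ (η₁ n ω) (η₂ n ω) (ω₁ n ω) (ω₂ n ω)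

/-- Critical or subcritical perturbation: `W n = ∑ i, wn n i u i (u i)†` with
`wn n i → w i ∈ (-∞, ∞]`. -/
structure IsSubcritical (u : Fin r → Vec F r) (wn : ℕ → Fin r → ℝ) (w : Fin r → EReal) :
    Prop where
  bc : IsBoundaryCondition u w
  tendsto : ∀ i, Tendsto (fun n => (wn n i : EReal)) atTop (𝓝 (w i))

/-- Uniform convergence on compact sets. -/
def TendstoCompactly {A : Type*} [UniformSpace A] (f : ℕ → ℝ≥0 → A) (g : ℝ≥0 → A) : Prop :=
  ∀ K : Set ℝ≥0, IsCompact K → TendstoUniformlyOn f g atTop K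

/-- The deterministic setting of a pathwise coupling along the subsequence `s`: the growth and
oscillation bounds hold with constants `κ j`; the processes `Y₁`, `Y₂`, the integrals
`∫₀ η₁`, `∫₀ η₂` and the constants `κ j` converge; and `Y` is the continuous limit of
`Y₁ + (1/2) (Y₂ + Y₂†)`. -/
def IsCoupled (m : ℕ → ℝ) (ηbar ζ : ℝ≥0 → ℝ) (s : ℕ → ℕ) (Y₁ Y₂ : ℕ → ℕ → Mat F r)
    (Y : ℝ≥0 → Mat F r) : Prop :=
  (∀ n l, (Y₁ n l).IsHermitian) ∧ Continuous Y ∧ Y 0 = 0 ∧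
  ∃ (η₁ η₂ ω₁ ω₂ : ℕ → ℕ → Mat F r) (κ : ℕ → ℝ) (κlim : ℝ)
    (Ylim₁ Ylim₂ ηlim₁ ηlim₂ : ℝ≥0 → Mat F r),
    (∀ j, 1 ≤ κ j ∧ Decomposes (m (s j)) (Y₁ (s j)) (η₁ j) (ω₁ j) ∧
      Decomposes (m (s j)) (Y₂ (s j)) (η₂ j) (ω₂ j) ∧
      GrowthBounds (s j) (m (s j)) (κ j) ηbar ζ (η₁ j) (η₂ j) (ω₁ j) (ω₂ j)) ∧
    TendstoCompactly (fun j => step (m (s j)) (Y₁ (s j))) Ylim₁ ∧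
    TendstoCompactly (fun j => step (m (s j)) (Y₂ (s j))) Ylim₂ ∧
    TendstoCompactly (fun j x => Matrix.of fun a b =>
      ∫ t in (0 : ℝ)..x, step (m (s j)) (η₁ j) t.toNNReal a b) ηlim₁ ∧
    TendstoCompactly (fun j x => Matrix.of fun a b =>
      ∫ t in (0 : ℝ)..x, step (m (s j)) (η₂ j) t.toNNReal a b) ηlim₂ ∧
    Tendsto κ atTop (𝓝 κlim) ∧
    Y = combine Ylim₁ Ylim₂

/-- `x` and `w` are close in `(-∞, ∞]`: both exceed `R`, or `w` is finite and they differ by less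
than `δ`. These relations generate the uniform structure of the compact interval `[-b, ∞]`. -/
def CloseExt (δ R x : ℝ) (w : EReal) : Prop :=
  (R < x ∧ (R : EReal) < w) ∨ (w ≠ ⊥ ∧ w ≠ ⊤ ∧ |x - w.toReal| < δ)

end Basic

end BlockTridiagonal

end

open BlockTridiagonal

/-!
The discrete operators are studied through their quadratic forms. The growth and oscillation bounds
make these forms coercive, uniformly in the size: kinetic energy, weighted mass and the positive
part of the boundary term are dominated by the form and the mass (`energy_bounds`). The summation by
parts behind this moves the noise `ω` off the difference quotients at the cost of a small part of the
energy, and the matrices `η` dominate the weight. As the weight is unbounded, lattice functions of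
bounded energy converge along subsequences: locally uniformly, in `L²`, and weakly for the difference
quotients (`exists_latticeLimit`).

The discrete form of a sampled smooth test function against such a sequence converges to the
continuum form (`Approx.tendsto_dform_test`). Hence limits of unit eigenvectors are weak
eigenfunctions of norm one (`Approx.exists_eigen_limit`). This bounds the discrete eigenvalues from
below by those of the limit. Conversely, continuum eigenfunctions are limits of test functions in
the `L*` norm, and the minimax principle for their samples bounds the discrete eigenvalues from
above. Together these show that the limit eigenvalues are well defined and that the discrete ones
converge to them (`Approx.isLeast`).

All this is done for moving boundary data: bases `u' j → u` and weights `x j i → w i ∈ (-∞, ∞]`.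
Test functions are rotated by `rot (u' j) u`, so that Dirichlet components vanish exactly. Since
orthonormal bases and weights in `[-b, ∞]` form a compact set, a sequence that violates uniformity
would have a convergent subsequence, to which the above applies (`Approx.uniform`).

For the random ensemble no coupling is constructed. By tightness, outcomes can be restricted to sets
of probability close to one, such that each sequence of outcomes in them is along a subsequence a
deterministic instance of the problem (`seqLikely_good`). Paths are encoded by their values at
countably many points, a Polish space, and Prokhorov's theorem gives limit laws of paths together
with eigenvalues and eigenvectors. Such a law is carried by limits along sequences of outcomes
(`exists_limit_law`), so the deterministic theorem holds almost surely under it. The limit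
eigenvalue is then a function of the path whose graph carries the law, which makes it measurable up
to null sets (`aemeasurable_of_graph`) and identifies the limit law.
-/


set_option linter.unusedSectionVars false

noncomputable section

namespace BlockTridiagonal

open MulOpposite
open ContinuousLinearMap (adjoint)
open ENNReal (ofReal)
open Finset (range sum_congr mul_sum sum_add_distrib sum_le_sum sum_sub_distrib smul_sum
  sum_nonneg sum_comm single_le_sum sum_mul sum_const sum_eq_zero sum_range_succ
  abs_sum_le_sum_abs)

variable {F : Type} [NormedDivisionRing F] [NormedAlgebra ℝ F] [StarRing F] [ClassicalScalar F]
  {r : ℕ} {η ζ : ℝ≥0 → ℝ} {C b : ℝ} {n : ℕ → ℕ} {m : ℕ → ℝ} {Y₁ Y₂ : ℕ → ℕ → Mat F r}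
  {Y : ℝ≥0 → Mat F r} {u' : ℕ → Fin r → Vec F r} {x : ℕ → Fin r → ℝ}
  {u : Fin r → Vec F r} {w : Fin r → EReal} {φ f g : ℝ → Vec F r}
  {E : Type*} [NormedAddCommGroup E] [InnerProductSpace ℝ E]

local notation "⟪" x ", " y "⟫" => inner ℝ x y

local notation "ℝ₊" => Ici (0 : ℝ)

/-! ### The scalar field as a real Hilbert space -/

section Scalars

/-- The properties of the real part that are shared by the three classical fields. -/
structure IsRealPart (F : Type) [NormedDivisionRing F] [NormedAlgebra ℝ F] [StarRing F]
    (re : F →ₗ[ℝ] ℝ) : Prop where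
  star_mul_self : ∀ a : F, star a * a = algebraMap ℝ F (‖a‖ ^ 2)
  re_algebraMap : ∀ t : ℝ, re (algebraMap ℝ F t) = t
  re_star : ∀ a, re (star a) = re a
  re_mul_comm : ∀ a b, re (a * b) = re (b * a)
  abs_re_le : ∀ a, |re a| ≤ ‖a‖
  eq_of_star_eq : ∀ a : F, star a = a → a = algebraMap ℝ F (re a)
  star_smul : ∀ (t : ℝ) (a : F), star (t • a) = t • star a
  norm_star : ∀ a : F, ‖star a‖ = ‖a‖

theorem IsRealPart.of_equiv {K : Type} [NormedDivisionRing K] [NormedAlgebra ℝ K] [StarRing K]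
    {re : K →ₗ[ℝ] ℝ} (h : IsRealPart K re) (e : F ≃⋆ₐ[ℝ] K) (he : ∀ x, ‖e x‖ = ‖x‖) :
    IsRealPart F (re.comp (e : F →ₗ[ℝ] K)) where
  star_mul_self a := by
    apply EquivLike.injective e
    rw [map_mul, map_star, h.star_mul_self, he]
    exact (AlgHomClass.commutes e _).symm
  re_algebraMap t := by
    have : e (algebraMap ℝ F t) = algebraMap ℝ K t := AlgHomClass.commutes e _
    simpa [this] using h.re_algebraMap t
  re_star a := by simpa [map_star] using h.re_star (e a)
  re_mul_comm a b := by simpa using h.re_mul_comm (e a) (e b)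
  abs_re_le a := by simpa [he] using h.abs_re_le (e a)
  eq_of_star_eq a ha := by
    apply EquivLike.injective e
    have h1 : star (e a) = e a := by rw [← map_star, ha]
    have := h.eq_of_star_eq _ h1
    have h2 := AlgHomClass.commutes e (re (e a))
    rw [this] at h2 ⊢
    simpa [h.re_algebraMap] using h2.symm
  star_smul t a := by
    apply EquivLike.injective e
    rw [map_star, map_smul, map_smul, map_star, h.star_smul]
  norm_star a := by rw [← he, map_star, h.norm_star, he]

theorem isRealPart_real : IsRealPart ℝ LinearMap.id where
  star_mul_self a := by simp [sq]
  re_algebraMap t := by simp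
  re_star a := by simp
  re_mul_comm a b := by simp [mul_comm]
  abs_re_le a := by simp
  eq_of_star_eq a _ := by simp
  star_smul t a := by simp
  norm_star a := by simp

theorem isRealPart_complex : IsRealPart ℂ Complex.reLm where
  star_mul_self a := by simpa using Complex.conj_mul' a
  re_algebraMap t := by simp
  re_star a := by simp
  re_mul_comm a b := by simp [mul_comm]
  abs_re_le a := Complex.abs_re_le_norm a
  eq_of_star_eq a h := by simpa using (Complex.conj_eq_iff_re.1 h).symm
  star_smul t a := by simp
  norm_star a := by simp

theorem isRealPart_quaternion :
    IsRealPart (Quaternion ℝ) ⟨⟨fun a => a.re, fun _ _ => rfl⟩, fun _ _ => rfl⟩ where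
  star_mul_self a := by
    rw [Quaternion.star_mul_self, Quaternion.normSq_eq_norm_mul_self, sq]; rfl
  re_algebraMap t := rfl
  re_star a := Quaternion.re_star a
  re_mul_comm a b := by
    change (a * b).re = (b * a).re
    rw [Quaternion.re_mul, Quaternion.re_mul]; ring
  abs_re_le a := by
    have h1 : ‖a‖ ^ 2 = a.re ^ 2 + a.imI ^ 2 + a.imJ ^ 2 + a.imK ^ 2 := by
      rw [sq ‖a‖, ← Quaternion.normSq_eq_norm_mul_self, Quaternion.normSq_def']
    apply abs_le_of_sq_le_sq _ (norm_nonneg _)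
    change a.re ^ 2 ≤ ‖a‖ ^ 2
    nlinarith [sq_nonneg a.imI, sq_nonneg a.imJ, sq_nonneg a.imK]
  eq_of_star_eq a h := Quaternion.star_eq_self.1 h
  star_smul t a := by simp
  norm_star a := by simp

variable (F) in

theorem exists_isRealPart : ∃ re : F →ₗ[ℝ] ℝ, IsRealPart F re := by
  rcases ClassicalScalar.out (F := F) with ⟨e, he⟩ | ⟨e, he⟩ | ⟨e, he⟩
  · exact ⟨_, isRealPart_real.of_equiv e he⟩
  · exact ⟨_, isRealPart_complex.of_equiv e he⟩
  · exact ⟨_, isRealPart_quaternion.of_equiv e he⟩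

/-- The real part. -/
def re : F →ₗ[ℝ] ℝ := Classical.choose (exists_isRealPart F)

theorem isRealPart_re : IsRealPart F (re : F →ₗ[ℝ] ℝ) := Classical.choose_spec (exists_isRealPart F)

instance : FiniteDimensional ℝ F := by
  rcases ClassicalScalar.out (F := F) with ⟨e, -⟩ | ⟨e, -⟩ | ⟨e, -⟩ <;>
    exact LinearEquiv.finiteDimensional e.symm.toAlgEquiv.toLinearEquiv

instance : StarModule ℝ F := ⟨fun t a => by simpa using isRealPart_re.star_smul t a⟩

instance : NormedStarGroup F := ⟨fun a => (isRealPart_re.norm_star a).le⟩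

/-- The real inner product `re (star a * b)` on the scalars. -/
instance instInnerScalar : InnerProductSpace ℝ F where
  inner a b := re (star a * b)
  norm_sq_eq_re_inner a := by
    rw [isRealPart_re.star_mul_self, isRealPart_re.re_algebraMap]; rfl
  conj_inner_symm a b := by
    simpa using ((isRealPart_re (F := F)).re_star (star b * a)).symm
  add_left a b c := by simp [add_mul]
  smul_left a b t := by simp

theorem inner_scalar (a b : F) : ⟪a, b⟫ = re (star a * b) := rfl

theorem re_star_mul_self (a : F) : re (star a * a) = ‖a‖ ^ 2 := by
  rw [isRealPart_re.star_mul_self, isRealPart_re.re_algebraMap]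

theorem eq_zero_of_re_star_mul {a : F} (h : ∀ c : F, re (star c * a) = 0) : a = 0 := by
  have := h a
  rwa [← inner_scalar, inner_self_eq_zero] at this

instance : ProperSpace F := FiniteDimensional.proper ℝ F
instance : SecondCountableTopology F := by infer_instance

end Scalars

/-! ### Vectors and matrices -/

section Vectors

theorem re_dag (v w : Vec F r) : re (dag v w) = ⟪v, w⟫ := by
  simp [dag, dotProduct, PiLp.inner_apply, inner_scalar]

theorem dag_add_right (u v w : Vec F r) : dag u (v + w) = dag u v + dag u w := by
  simp [dag, dotProduct_add]

theorem dag_sub_right (u v w : Vec F r) : dag u (v - w) = dag u v - dag u w := by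
  simp [dag, dotProduct_sub]

theorem dag_sub_left (u v w : Vec F r) : dag (u - v) w = dag u w - dag v w := by
  simp [dag, sub_dotProduct]

@[simp] theorem dag_zero_right (u : Vec F r) : dag u 0 = 0 := by simp [dag]

@[simp] theorem dag_zero_left (u : Vec F r) : dag 0 u = 0 := by simp [dag]

theorem dag_smul_right (t : ℝ) (u v : Vec F r) : dag u (t • v) = t • dag u v := by
  simp [dag, dotProduct_smul]

theorem dag_smul_left (t : ℝ) (u v : Vec F r) : dag (t • u) v = t • dag u v := by
  simp [dag, smul_dotProduct]

theorem dag_op_right (c : F) (u v : Vec F r) : dag u (op c • v) = dag u v * c := by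
  simp [dag, dotProduct_smul]

theorem dag_op_left (c : F) (u v : Vec F r) : dag (op c • u) v = star c * dag u v := by
  simp [dag, dotProduct, mul_sum, mul_assoc]

theorem star_dag (u v : Vec F r) : star (dag u v) = dag v u := by simp [dag, dotProduct]

theorem dag_sum_right {ι : Type*} (s : Finset ι) (u : Vec F r) (v : ι → Vec F r) :
    dag u (∑ i ∈ s, v i) = ∑ i ∈ s, dag u (v i) := by
  simp [dag, dotProduct_sum]

theorem re_star_mul_dag (c : F) (u v : Vec F r) : re (star c * dag u v) = ⟪op c • u, v⟫ := by
  rw [← re_dag, dag_op_left]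

theorem norm_dag_le (u v : Vec F r) : ‖dag u v‖ ≤ ‖u‖ * ‖v‖ := by
  by_cases h0 : dag u v = 0
  · rw [h0, norm_zero]; positivity
  have h1 : ‖dag u v‖ ^ 2 ≤ ‖dag u v‖ * ‖u‖ * ‖v‖ := by
    calc ‖dag u v‖ ^ 2 = ⟪op (dag u v) • u, v⟫ := by
          rw [← re_star_mul_dag, ← inner_scalar, real_inner_self_eq_norm_sq]
      _ ≤ ‖op (dag u v) • u‖ * ‖v‖ := real_inner_le_norm _ _
      _ ≤ _ := by
          gcongr
          exact (norm_smul_le _ _).trans (by rw [norm_op])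
  have := norm_pos_iff.2 h0
  nlinarith

theorem dag_self (u : Vec F r) : dag u u = algebraMap ℝ F (‖u‖ ^ 2) := by
  rw [isRealPart_re.eq_of_star_eq _ (star_dag u u), re_dag, real_inner_self_eq_norm_sq]

theorem act_add (M : Mat F r) (u v : Vec F r) : act M (u + v) = act M u + act M v := by
  ext i; simp [act, Matrix.mulVec_add]

theorem act_smul (M : Mat F r) (t : ℝ) (v : Vec F r) : act M (t • v) = t • act M v := by
  ext i; simp [act, Matrix.mulVec_smul]

theorem act_op (M : Mat F r) (c : F) (v : Vec F r) : act M (op c • v) = op c • act M v := by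
  ext i; simp [act, Matrix.mulVec_smul]

theorem dag_act (M : Mat F r) (u v : Vec F r) : dag u (act M v) = dag (act Mᴴ u) v := by
  simp [dag, act, Matrix.dotProduct_mulVec, Matrix.star_mulVec]

/-- A matrix as a real linear operator. -/
def opr : Mat F r →ₗ[ℝ] (Vec F r →L[ℝ] Vec F r) where
  toFun M := LinearMap.toContinuousLinearMap
    { toFun := act M, map_add' := act_add M, map_smul' := act_smul M }
  map_add' M N := by ext v i; simp [act, Matrix.add_mulVec]
  map_smul' t M := by ext v i; simp [act, Matrix.smul_mulVec]

@[simp] theorem opr_apply (M : Mat F r) (v : Vec F r) : opr M v = act M v := rfl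

theorem inner_act (M : Mat F r) (u v : Vec F r) : ⟪u, act M v⟫ = ⟪act Mᴴ u, v⟫ := by
  rw [← re_dag, ← re_dag, dag_act]

theorem opr_conjTranspose (M : Mat F r) : opr Mᴴ = adjoint (opr M) := by
  rw [ContinuousLinearMap.eq_adjoint_iff]
  intro u v
  simp [inner_act]

@[simp] theorem opr_one : opr (1 : Mat F r) = 1 := by
  ext v i; simp [act]

theorem norm_act_le_specNorm (M : Mat F r) : ‖opr M‖ ≤ specNorm M := by
  have hb : BddAbove {t : ℝ | ∃ v : Vec F r, ‖v‖ ≤ 1 ∧ t = ‖act M v‖} := by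
    refine ⟨‖opr M‖, ?_⟩
    rintro t ⟨v, hv, rfl⟩
    calc ‖opr M v‖ ≤ ‖opr M‖ * ‖v‖ := (opr M).le_opNorm v
      _ ≤ ‖opr M‖ * 1 := by gcongr
      _ = _ := mul_one _
  apply ContinuousLinearMap.opNorm_le_of_unit_norm
  · exact Real.sSup_nonneg (by rintro t ⟨v, hv, rfl⟩; positivity)
  · intro v hv
    exact le_csSup hb ⟨v, hv.le, rfl⟩

theorem continuous_opr : Continuous (opr : Mat F r →ₗ[ℝ] (Vec F r →L[ℝ] Vec F r)) :=
  LinearMap.continuous_of_finiteDimensional _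

theorem uniformContinuous_opr : UniformContinuous (opr : Mat F r →ₗ[ℝ] (Vec F r →L[ℝ] Vec F r)) :=
  uniformContinuous_addMonoidHom_of_continuous (f := (opr : Mat F r →ₗ[ℝ] _)) continuous_opr

theorem PSD.inner_nonneg {M : Mat F r} (h : PSD M) (v : Vec F r) : 0 ≤ ⟪v, opr M v⟫ := by
  obtain ⟨c, hc, h2⟩ := h.2 v
  rw [opr_apply, ← re_dag, h2, isRealPart_re.re_algebraMap]
  exact hc

theorem inner_opr_symm {M : Mat F r} (h : M.IsHermitian) (u v : Vec F r) :
    ⟪u, opr M v⟫ = ⟪opr M u, v⟫ := by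
  rw [opr_apply, inner_act, h.eq, opr_apply]

theorem MatLE.inner_le {A B : Mat F r} (h : MatLE A B) (v : Vec F r) :
    ⟪v, opr A v⟫ ≤ ⟪v, opr B v⟫ := by
  have := PSD.inner_nonneg h v
  simp only [map_sub, sub_apply, inner_sub_right] at this
  linarith

/-! ### Orthonormal bases -/

theorem OrthoBasis.sum_op_dag (hu : OrthoBasis u) (v : Vec F r) :
    ∑ i, op (dag (u i) v) • u i = v := by
  let U : Mat F r := Matrix.of fun a i => u i a
  have h1 : Uᴴ * U = 1 := by
    ext i j
    have := hu i j
    simpa [Matrix.mul_apply, dag, dotProduct, U, Matrix.one_apply] using this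
  have h2 : U * Uᴴ = 1 := mul_eq_one_comm.1 h1
  ext a
  have h3 : (U *ᵥ (Uᴴ *ᵥ v.ofLp)) a = v a := by rw [Matrix.mulVec_mulVec, h2, Matrix.one_mulVec]
  rw [← h3]
  simp [Matrix.mulVec, dotProduct, dag, U]

theorem OrthoBasis.dag_eq_sum (hu : OrthoBasis u) (v w : Vec F r) :
    dag v w = ∑ i, star (dag (u i) v) * dag (u i) w := by
  conv_lhs => rw [← hu.sum_op_dag w]
  rw [dag_sum_right]
  simp [dag_op_right, star_dag]

theorem OrthoBasis.norm_sq_eq (hu : OrthoBasis u) (v : Vec F r) :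
    ‖v‖ ^ 2 = ∑ i, ‖dag (u i) v‖ ^ 2 := by
  rw [← real_inner_self_eq_norm_sq, ← re_dag, hu.dag_eq_sum, map_sum]
  simp [re_star_mul_self]

theorem act_specMat (u : Fin r → Vec F r) (x : Fin r → ℝ) (v : Vec F r) :
    act (specMat u x) v = ∑ i, x i • (op (dag (u i) v) • u i) := by
  ext a
  simp [act, specMat, Matrix.sum_mulVec, Matrix.vecMulVec, Matrix.mulVec,
    dotProduct, dag, mul_sum, smul_sum, mul_assoc]

theorem dag_act_specMat (u : Fin r → Vec F r) (x : Fin r → ℝ) (v w : Vec F r) :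
    dag v (act (specMat u x) w) = ∑ i, x i • (star (dag (u i) v) * dag (u i) w) := by
  rw [act_specMat, dag_sum_right]
  simp [dag_smul_right, dag_op_right, star_dag]

theorem inner_act_specMat_self (u : Fin r → Vec F r) (x : Fin r → ℝ) (v : Vec F r) :
    ⟪v, act (specMat u x) v⟫ = ∑ i, x i * ‖dag (u i) v‖ ^ 2 := by
  rw [← re_dag, dag_act_specMat, map_sum]
  simp [re_star_mul_self]

theorem isHermitian_specMat (u : Fin r → Vec F r) (x : Fin r → ℝ) : (specMat u x).IsHermitian := by
  ext a b
  simp [specMat, Matrix.sum_apply, Matrix.vecMulVec]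

theorem continuous_dag : Continuous fun p : Vec F r × Vec F r => dag p.1 p.2 := by
  unfold dag dotProduct
  fun_prop

end Vectors

/-! ### Discrete energies -/

section Discrete

/-- The difference quotient of a sequence in a real vector space. -/
def dq (m : ℝ) (v : ℕ → E) (l : ℕ) : E := m • (v (l + 1) - v l)

/-- The kinetic energy of a lattice function on the first `N` sites, for the spacing `1 / m`. -/
def kin (m : ℝ) (N : ℕ) (v : ℕ → E) : ℝ := m⁻¹ * ∑ l ∈ range N, ‖dq m v l‖ ^ 2

/-- The weighted mass of a lattice function on the first `N` sites. -/
def wmass (m : ℝ) (N : ℕ) (h : ℕ → ℝ) (v : ℕ → E) : ℝ := m⁻¹ * ∑ l ∈ range N, h l * ‖v l‖ ^ 2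

/-- The weights of the lattice sites. -/
def latticeWeight (H : ℝ≥0 → ℝ) (m : ℝ) (l : ℕ) : ℝ := H (l / m : ℝ).toNNReal

/-- The square of the discrete `L²` norm. -/
def mass (m : ℝ) (N : ℕ) (v : ℕ → E) : ℝ := m⁻¹ * ∑ l ∈ range N, ‖v l‖ ^ 2

theorem kin_nonneg {m : ℝ} (hm : 0 < m) (N : ℕ) (v : ℕ → E) : 0 ≤ kin m N v := by
  unfold kin; positivity

theorem mass_nonneg {m : ℝ} (hm : 0 < m) (N : ℕ) (v : ℕ → E) : 0 ≤ mass m N v := by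
  unfold mass; positivity

theorem wmass_nonneg {m : ℝ} (hm : 0 < m) (N : ℕ) {h : ℕ → ℝ} (hh : ∀ l, 0 ≤ h l) (v : ℕ → E) :
    0 ≤ wmass m N h v := by
  unfold wmass
  have : 0 ≤ ∑ l ∈ range N, h l * ‖v l‖ ^ 2 := sum_nonneg fun l _ => mul_nonneg (hh l) (sq_nonneg _)
  positivity

/-- Summation of a shifted nonnegative sequence that vanishes at the end point. -/
theorem sum_shift_le {N : ℕ} {a : ℕ → ℝ} (ha : ∀ l, 0 ≤ a l) (hN : a N = 0) :
    ∑ l ∈ range N, a (l + 1) ≤ ∑ l ∈ range N, a l := by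
  have h1 := sum_range_succ a N
  have h2 := Finset.sum_range_succ' a N
  have := ha 0
  linarith

theorem wmass_shift_le {m : ℝ} (hm : 0 < m) {N : ℕ} {h : ℕ → ℝ} (hh : ∀ l, 0 ≤ h l)
    (hmono : Monotone h) {v : ℕ → E} (hv : v N = 0) :
    m⁻¹ * ∑ l ∈ range N, h l * ‖v (l + 1)‖ ^ 2 ≤ wmass m N h v := by
  unfold wmass
  gcongr m⁻¹ * ?_
  refine le_trans (sum_le_sum fun l _ => ?_)
    (sum_shift_le (a := fun l => h l * ‖v l‖ ^ 2) (fun l => mul_nonneg (hh l) (sq_nonneg _))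
      (by simp [hv]))
  exact mul_le_mul_of_nonneg_right (hmono (Nat.le_succ l)) (sq_nonneg _)

theorem mass_eq_wmass (m : ℝ) (N : ℕ) (v : ℕ → E) : mass m N v = wmass m N (fun _ => 1) v := by
  simp [mass, wmass]

theorem norm_dq {m : ℝ} (hm : 0 < m) (v : ℕ → E) (l : ℕ) : ‖v (l + 1) - v l‖ = m⁻¹ * ‖dq m v
    l‖ := by
  rw [dq, norm_smul, Real.norm_of_nonneg hm.le, inv_mul_cancel_left₀ hm.ne']

theorem mul_le_amgm {τ : ℝ} (hτ : 0 < τ) (x y : ℝ) : x * y ≤ τ * x ^ 2 + (4 * τ)⁻¹ * y ^ 2 := by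
  have : τ * x ^ 2 + (4 * τ)⁻¹ * y ^ 2 - x * y = τ * (x - (2 * τ)⁻¹ * y) ^ 2 := by field_simp; ring
  have : 0 ≤ τ * (x - (2 * τ)⁻¹ * y) ^ 2 := by positivity
  linarith

/-- The discrete trace inequality. -/
theorem norm_sq_le_kin_mass {m : ℝ} (hm : 0 < m) {N : ℕ} {v : ℕ → E} (hv : ∀ l, N ≤ l → v l = 0)
    {τ : ℝ} (hτ : 0 < τ) (p : ℕ) : ‖v p‖ ^ 2 ≤ τ * kin m N v + τ⁻¹ * mass m N v := by
  have key : ∀ l, ‖v l‖ ^ 2 - ‖v (l + 1)‖ ^ 2 ≤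
      m⁻¹ * (τ * ‖dq m v l‖ ^ 2 + (2 * τ)⁻¹ * (‖v l‖ ^ 2 + ‖v (l + 1)‖ ^ 2)) := by
    intro l
    have h1 : ‖v l‖ - ‖v (l + 1)‖ ≤ m⁻¹ * ‖dq m v l‖ := by
      rw [← norm_dq hm, norm_sub_rev]; exact norm_sub_norm_le _ _
    set a := ‖v l‖
    set b := ‖v (l + 1)‖
    set d := ‖dq m v l‖
    have ha : 0 ≤ a := norm_nonneg _
    have hb : 0 ≤ b := norm_nonneg _
    have h2 : d * (a + b) ≤ τ * d ^ 2 + (2 * τ)⁻¹ * (a ^ 2 + b ^ 2) := by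
      have h3 : (2 * τ)⁻¹ * (a ^ 2 + b ^ 2) ≥ (4 * τ)⁻¹ * (a + b) ^ 2 := by
        have : (2 * τ)⁻¹ = 2 * (4 * τ)⁻¹ := by field_simp; norm_num
        rw [this]
        have : 0 < (4 * τ)⁻¹ := by positivity
        nlinarith [sq_nonneg (a - b)]
      linarith [mul_le_amgm hτ d (a + b)]
    calc a ^ 2 - b ^ 2 = (a - b) * (a + b) := by ring
      _ ≤ (m⁻¹ * d) * (a + b) := by gcongr
      _ = m⁻¹ * (d * (a + b)) := by ring
      _ ≤ _ := by gcongr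
  by_cases hp : N ≤ p
  · rw [hv p hp]
    have := kin_nonneg hm N v
    have := mass_nonneg hm N v
    simp; positivity
  have hp' : p ≤ N := by omega
  have tel : ‖v p‖ ^ 2 = ∑ l ∈ Finset.Ico p N, (‖v l‖ ^ 2 - ‖v (l + 1)‖ ^ 2) := by
    rw [Finset.sum_Ico_eq_sum_range]
    have := Finset.sum_range_sub' (fun i => ‖v (p + i)‖ ^ 2) (N - p)
    simp only [add_zero, Nat.add_sub_cancel' hp', hv N le_rfl] at this
    simpa [add_assoc] using this.symm
  rw [tel]
  calc _ ≤ ∑ l ∈ Finset.Ico p N, m⁻¹ * (τ * ‖dq m v l‖ ^ 2 +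
        (2 * τ)⁻¹ * (‖v l‖ ^ 2 + ‖v (l + 1)‖ ^ 2)) := sum_le_sum fun l _ => key l
    _ ≤ ∑ l ∈ range N, m⁻¹ * (τ * ‖dq m v l‖ ^ 2 + (2 * τ)⁻¹ * (‖v l‖ ^ 2 + ‖v (l + 1)‖ ^ 2)) := by
        apply Finset.sum_le_sum_of_subset_of_nonneg
        · intro l; simp
        · intros; positivity
    _ = τ * kin m N v + (2 * τ)⁻¹ * (mass m N v + m⁻¹ * ∑ l ∈ range N, ‖v (l + 1)‖ ^ 2) := by
        simp only [kin, mass, ← mul_sum, sum_add_distrib]; ring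
    _ ≤ τ * kin m N v + (2 * τ)⁻¹ * (mass m N v + mass m N v) := by
        gcongr
        exact mul_le_mul_of_nonneg_left
          (sum_shift_le (a := fun l => ‖v l‖ ^ 2) (fun _ => sq_nonneg _) (by simp [hv N le_rfl]))
          (by positivity)
    _ = _ := by field_simp; ring

/-- Hölder continuity of lattice functions of finite kinetic energy. -/
theorem norm_sub_sq_le_kin {m : ℝ} (hm : 0 < m) {N : ℕ} {v : ℕ → E} (hv : ∀ l, N ≤ l → v l = 0)
    {p q : ℕ} (hpq : p ≤ q) : ‖v q - v p‖ ^ 2 ≤ ((q - p : ℕ) : ℝ) / m * kin m N v := by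
  have tel : v q - v p = ∑ l ∈ Finset.Ico p q, (v (l + 1) - v l) := by rw [Finset.sum_Ico_sub _ hpq]
  have h0 : ∀ l, N ≤ l → dq m v l = 0 := fun l hl => by simp [dq, hv l hl, hv (l + 1) (by omega)]
  have h1 : ‖v q - v p‖ ≤ ∑ l ∈ Finset.Ico p q, m⁻¹ * ‖dq m v l‖ := by
    rw [tel]
    refine (norm_sum_le _ _).trans (le_of_eq (sum_congr rfl fun l _ => norm_dq hm v l))
  have h2 : ∑ l ∈ Finset.Ico p q, ‖dq m v l‖ ^ 2 ≤ ∑ l ∈ range N, ‖dq m v l‖ ^ 2 := by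
    rw [Finset.sum_subset (Finset.range_mono (le_max_left N q)) fun l _ hl => by
      simp [h0 l (by simpa using hl)]]
    refine Finset.sum_le_sum_of_subset_of_nonneg (fun l hl => ?_) fun _ _ _ => sq_nonneg _
    simp only [Finset.mem_Ico, Finset.mem_range] at hl ⊢
    omega
  calc ‖v q - v p‖ ^ 2 ≤ (∑ l ∈ Finset.Ico p q, m⁻¹ * ‖dq m v l‖) ^ 2 := by gcongr
    _ ≤ ((Finset.Ico p q).card : ℝ) * ∑ l ∈ Finset.Ico p q, (m⁻¹ * ‖dq m v l‖) ^ 2 :=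
        sq_sum_le_card_mul_sum_sq
    _ = ((q - p : ℕ) : ℝ) * (m⁻¹ ^ 2 * ∑ l ∈ Finset.Ico p q, ‖dq m v l‖ ^ 2) := by
        simp [mul_pow, mul_sum]
    _ ≤ ((q - p : ℕ) : ℝ) * (m⁻¹ ^ 2 * ∑ l ∈ range N, ‖dq m v l‖ ^ 2) := by gcongr
    _ = _ := by rw [kin]; field_simp

/-- Summation by parts for operator-valued sequences. -/
theorem sum_inner_sub_prev (f : ℕ → E →L[ℝ] E) (v w : ℕ → E) (N : ℕ) :
    ∑ l ∈ range N, ⟪v l, (f l - prev f l) (w l)⟫ =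
      ∑ l ∈ range N, (⟪v l, f l (w l)⟫ - ⟪v (l + 1), f l (w (l + 1))⟫) + ⟪v N, prev f N (w N)⟫ := by
  induction N with
  | zero => simp [prev]
  | succ N ih =>
    rw [sum_range_succ, sum_range_succ, ih]
    simp only [sub_apply, inner_sub_right, prev, Nat.add_sub_cancel, if_neg (Nat.succ_ne_zero N)]
    ring

/-- The average of a sequence over the window `l, …, l + L - 1`. -/
def avg {V : Type*} [AddCommGroup V] [Module ℝ V] (L : ℕ) (f : ℕ → V) (l : ℕ) : V :=
  (L : ℝ)⁻¹ • ∑ p ∈ range L, f (l + p)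

theorem avg_succ_sub {V : Type*} [AddCommGroup V] [Module ℝ V] (L : ℕ) (f : ℕ → V) (l : ℕ) :
    avg L f (l + 1) - avg L f l = (L : ℝ)⁻¹ • (f (l + L) - f l) := by
  have h1 := sum_range_succ (fun p => f (l + p)) L
  have h2 := Finset.sum_range_succ' (fun p => f (l + p)) L
  simp only [avg, ← smul_sub]
  congr 1
  have h3 : ∑ p ∈ range L, f (l + 1 + p) = ∑ p ∈ range L, f (l + (p + 1)) :=
    sum_congr rfl fun p _ => by rw [add_assoc, add_comm 1 p]
  rw [h3]
  rw [h1] at h2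
  simp only [add_zero] at h2
  rw [sub_eq_sub_iff_add_eq_add, ← h2]; abel

theorem norm_sub_avg_le {V : Type*} [NormedAddCommGroup V] [NormedSpace ℝ V] {L : ℕ} (hL : 1 ≤ L)
    {f : ℕ → V} {l : ℕ} (h : ∀ p < L, ‖f l - f (l + p)‖ ≤ C) : ‖f l - avg L f l‖ ≤ C := by
  have hL' : (0 : ℝ) < L := by exact_mod_cast hL
  have : f l - avg L f l = (L : ℝ)⁻¹ • ∑ p ∈ range L, (f l - f (l + p)) := by
    rw [sum_sub_distrib, smul_sub, avg, sum_const, Finset.card_range,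
      ← Nat.cast_smul_eq_nsmul ℝ, smul_smul, inv_mul_cancel₀ hL'.ne', one_smul]
  rw [this, norm_smul, norm_inv, Real.norm_of_nonneg hL'.le]
  calc (L : ℝ)⁻¹ * ‖∑ p ∈ range L, (f l - f (l + p))‖ ≤ (L : ℝ)⁻¹ * (L * C) := by
        gcongr
        refine (norm_sum_le_of_le _ fun p hp => h p (Finset.mem_range.1 hp)).trans ?_
        simp
    _ = C := by field_simp

theorem abs_inner_apply_le (A : E →L[ℝ] E) (v w : E) : |⟪v, A w⟫| ≤ ‖A‖ * (‖v‖ * ‖w‖) := by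
  calc |⟪v, A w⟫| ≤ ‖v‖ * ‖A w‖ := abs_real_inner_le_norm _ _
    _ ≤ ‖v‖ * (‖A‖ * ‖w‖) := by gcongr; exact A.le_opNorm w
    _ = _ := by ring

/-- A noise whose oscillation over unit distance is controlled is a small form perturbation: it is
split into its window average, whose increments are controlled, and a remainder of controlled size,
which is summed by parts. -/
theorem abs_sum_noise_le {N L : ℕ} {m τ ε K β : ℝ} (hm : 0 < m) (hL : 1 ≤ L) (hLm : m ≤ 2 * L)
    (hτ : 0 < τ) (hε : 0 ≤ ε) (hK : 0 ≤ K) {h : ℕ → ℝ} (hh : ∀ l, 0 ≤ h l) (hmono : Monotone h)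
    {ω : ℕ → E →L[ℝ] E}
    (osc : ∀ l p, l ≤ p → p ≤ l + L → ‖ω l - ω p‖ ^ 2 ≤ ε * h l + K) (hβ : ‖ω 0‖ ≤ β)
    {v w : ℕ → E} (hv : v N = 0) :
    |∑ l ∈ range N, ⟪v l, (ω l - prev ω l) (w l)⟫| ≤
      τ * (kin m N v + kin m N w) + ((4 * τ)⁻¹ + 1 / 2) *
        (ε * (wmass m N h v + wmass m N h w) + (K + 1) * (mass m N v + mass m N w)) +
      (β + √(ε * h 0 + K)) * (‖v 0‖ * ‖w 0‖) := by
  have hL' : (0 : ℝ) < L := by exact_mod_cast hL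
  have hpos : ∀ l, 0 ≤ ε * h l + K := fun l => add_nonneg (mul_nonneg hε (hh l)) hK
  have osc' : ∀ l p, l ≤ p → p ≤ l + L → ‖ω l - ω p‖ ≤ √(ε * h l + K) := fun l p h1 h2 =>
    Real.le_sqrt_of_sq_le (osc l p h1 h2)
  set a : ℕ → E →L[ℝ] E := avg L ω with ha
  set ρ : ℕ → E →L[ℝ] E := fun l => ω l - a l with hρ
  have hρb : ∀ l, ‖ρ l‖ ≤ √(ε * h l + K) := fun l =>
    norm_sub_avg_le hL fun p hp => osc' _ _ (by omega) (by omega)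
  have hsplit : ∀ l, ω l - prev ω l = (a l - prev a l) + (ρ l - prev ρ l) := by
    intro l
    by_cases hl : l = 0
    · simp [prev, hl, hρ]
    · simp only [prev, if_neg hl, hρ]; abel
  -- the averaged part
  have hA : ∀ l, |⟪v l, (a l - prev a l) (w l)⟫| ≤
      m⁻¹ * ((ε * h l + (K + 1)) * (1 / 2) * (‖v l‖ ^ 2 + ‖w l‖ ^ 2)) +
        if l = 0 then (β + √(ε * h 0 + K)) * (‖v 0‖ * ‖w 0‖) else 0 := by
    intro l
    rcases l with _ | l
    · have h1 : ‖a 0‖ ≤ β + √(ε * h 0 + K) := by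
        have : a 0 = ω 0 - ρ 0 := by simp [hρ]
        rw [this]
        exact (norm_sub_le _ _).trans (add_le_add hβ (hρb 0))
      have h2 := abs_inner_apply_le (a 0) (v 0) (w 0)
      have h3 : 0 ≤ m⁻¹ * ((ε * h 0 + (K + 1)) * (1 / 2) * (‖v 0‖ ^ 2 + ‖w 0‖ ^ 2)) := by
        have := hpos 0
        have : 0 ≤ ε * h 0 + (K + 1) := by linarith
        positivity
      have h4 : ‖a 0‖ * (‖v 0‖ * ‖w 0‖) ≤ (β + √(ε * h 0 + K)) * (‖v 0‖ * ‖w 0‖) := by gcongr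
      simp only [prev, if_true, sub_zero]
      linarith
    · simp only [prev, if_neg (Nat.succ_ne_zero l), Nat.add_sub_cancel, add_zero]
      have h1 : ‖a (l + 1) - a l‖ ≤ m⁻¹ * (ε * h (l + 1) + (K + 1)) := by
        rw [ha, avg_succ_sub, norm_smul, norm_inv, Real.norm_of_nonneg hL'.le]
        have h2 : ‖ω (l + L) - ω l‖ ≤ √(ε * h l + K) := by
          rw [norm_sub_rev]; exact osc' _ _ (by omega) le_rfl
        have h3 : √(ε * h l + K) ≤ (ε * h (l + 1) + (K + 1)) / 2 := by
          have h5 : ε * h l ≤ ε * h (l + 1) := mul_le_mul_of_nonneg_left (hmono (Nat.le_succ l)) hε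
          have h4 := Real.sq_sqrt (hpos l)
          nlinarith [sq_nonneg (√(ε * h l + K) - 1)]
        have h4 : (L : ℝ)⁻¹ ≤ 2 * m⁻¹ := by
          rw [← div_eq_mul_inv, inv_eq_one_div, div_le_div_iff₀ hL' hm]; linarith
        calc (L : ℝ)⁻¹ * ‖ω (l + L) - ω l‖ ≤ (2 * m⁻¹) * ((ε * h (l + 1) + (K + 1)) / 2) := by
              gcongr; exact h2.trans h3
          _ = _ := by ring
      have h2 := abs_inner_apply_le (a (l + 1) - a l) (v (l + 1)) (w (l + 1))
      have h3 : ‖v (l + 1)‖ * ‖w (l + 1)‖ ≤ (1 / 2) * (‖v (l + 1)‖ ^ 2 + ‖w (l + 1)‖ ^ 2) := by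
        nlinarith [sq_nonneg (‖v (l + 1)‖ - ‖w (l + 1)‖)]
      calc _ ≤ ‖a (l + 1) - a l‖ * (‖v (l + 1)‖ * ‖w (l + 1)‖) := h2
        _ ≤ (m⁻¹ * (ε * h (l + 1) + (K + 1))) *
            ((1 / 2) * (‖v (l + 1)‖ ^ 2 + ‖w (l + 1)‖ ^ 2)) := by
            refine mul_le_mul h1 h3 (by positivity) ?_
            have := hpos (l + 1)
            have : 0 ≤ ε * h (l + 1) + (K + 1) := by linarith
            positivity
        _ = _ := by ring
  -- the remainder
  have hR : ∀ l, |⟪v l, ρ l (w l)⟫ - ⟪v (l + 1), ρ l (w (l + 1))⟫| ≤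
      m⁻¹ * (τ * (‖dq m v l‖ ^ 2 + ‖dq m w l‖ ^ 2) +
        (4 * τ)⁻¹ * ((ε * h l + K) * (‖w l‖ ^ 2 + ‖v (l + 1)‖ ^ 2))) := by
    intro l
    have e1 : ⟪v l, ρ l (w l)⟫ - ⟪v (l + 1), ρ l (w (l + 1))⟫ =
        -⟪v (l + 1) - v l, ρ l (w l)⟫ - ⟪v (l + 1), ρ l (w (l + 1) - w l)⟫ := by
      simp only [map_sub, inner_sub_left, inner_sub_right]; ring
    have h1 := abs_inner_apply_le (ρ l) (v (l + 1) - v l) (w l)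
    have h2 := abs_inner_apply_le (ρ l) (v (l + 1)) (w (l + 1) - w l)
    rw [norm_dq hm] at h1 h2
    set s := √(ε * h l + K) with hs
    have hs2 : s ^ 2 = ε * h l + K := Real.sq_sqrt (hpos l)
    have hs0 : 0 ≤ s := Real.sqrt_nonneg _
    have amgm : ∀ x y : ℝ, s * (x * y) ≤ τ * x ^ 2 + (4 * τ)⁻¹ * ((ε * h l + K) * y ^ 2) := by
      intro x y
      rw [← hs2, ← mul_pow, mul_left_comm]
      exact mul_le_amgm hτ _ _
    rw [e1]
    calc |-⟪v (l + 1) - v l, ρ l (w l)⟫ - ⟪v (l + 1), ρ l (w (l + 1) - w l)⟫|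
        ≤ |⟪v (l + 1) - v l, ρ l (w l)⟫| + |⟪v (l + 1), ρ l (w (l + 1) - w l)⟫| := by
          refine (abs_sub _ _).trans ?_
          rw [abs_neg]
      _ ≤ s * (m⁻¹ * ‖dq m v l‖ * ‖w l‖) + s * (‖v (l + 1)‖ * (m⁻¹ * ‖dq m w l‖)) := by
          refine add_le_add (h1.trans ?_) (h2.trans ?_) <;>
            exact mul_le_mul_of_nonneg_right (hρb l) (by positivity)
      _ = m⁻¹ * (s * (‖dq m v l‖ * ‖w l‖) + s * (‖dq m w l‖ * ‖v (l + 1)‖)) := by ring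
      _ ≤ m⁻¹ * ((τ * ‖dq m v l‖ ^ 2 + (4 * τ)⁻¹ * ((ε * h l + K) * ‖w l‖ ^ 2)) +
          (τ * ‖dq m w l‖ ^ 2 + (4 * τ)⁻¹ * ((ε * h l + K) * ‖v (l + 1)‖ ^ 2))) := by
          gcongr <;> exact amgm _ _
      _ = _ := by ring
  have hsum : ∑ l ∈ range N, ⟪v l, (ω l - prev ω l) (w l)⟫ =
      ∑ l ∈ range N, ⟪v l, (a l - prev a l) (w l)⟫ +
      ∑ l ∈ range N, (⟪v l, ρ l (w l)⟫ - ⟪v (l + 1), ρ l (w (l + 1))⟫) := by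
    have := sum_inner_sub_prev ρ v w N
    rw [hv, inner_zero_left, add_zero] at this
    rw [← this, ← sum_add_distrib]
    refine sum_congr rfl fun l _ => ?_
    rw [hsplit l, add_apply, inner_add_right]
  have b1 : |∑ l ∈ range N, ⟪v l, (a l - prev a l) (w l)⟫| ≤
      1 / 2 * (ε * (wmass m N h v + wmass m N h w) + (K + 1) * (mass m N v + mass m N w)) +
      (β + √(ε * h 0 + K)) * (‖v 0‖ * ‖w 0‖) := by
    refine (abs_sum_le_sum_abs _ _).trans ((sum_le_sum fun l _ => hA l).trans ?_)
    rw [sum_add_distrib]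
    refine add_le_add (le_of_eq ?_) ?_
    · simp only [wmass, mass, mul_sum, ← sum_add_distrib]
      refine sum_congr rfl fun l _ => by ring
    · have hβ0 : 0 ≤ β := (norm_nonneg _).trans hβ
      rw [Finset.sum_ite_eq' (range N) 0]
      split_ifs
      · exact le_rfl
      · positivity
  have b2 : |∑ l ∈ range N, (⟪v l, ρ l (w l)⟫ - ⟪v (l + 1), ρ l (w (l + 1))⟫)| ≤
      τ * (kin m N v + kin m N w) + (4 * τ)⁻¹ *
        (ε * (wmass m N h v + wmass m N h w) + K * (mass m N v + mass m N w)) := by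
    refine (abs_sum_le_sum_abs _ _).trans ((sum_le_sum fun l _ => hR l).trans ?_)
    have e : ∑ l ∈ range N, m⁻¹ * (τ * (‖dq m v l‖ ^ 2 + ‖dq m w l‖ ^ 2) +
        (4 * τ)⁻¹ * ((ε * h l + K) * (‖w l‖ ^ 2 + ‖v (l + 1)‖ ^ 2))) =
        τ * (kin m N v + kin m N w) + (4 * τ)⁻¹ *
        (ε * (wmass m N h w + m⁻¹ * ∑ l ∈ range N, h l * ‖v (l + 1)‖ ^ 2) +
          K * (mass m N w + m⁻¹ * ∑ l ∈ range N, 1 * ‖v (l + 1)‖ ^ 2)) := by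
      simp only [kin, wmass, mass, mul_sum, ← sum_add_distrib]
      refine sum_congr rfl fun l _ => by ring
    rw [e]
    have s1 := wmass_shift_le hm hh hmono hv
    have s2 := wmass_shift_le hm (h := fun _ => 1) (fun _ => zero_le_one) monotone_const hv
    rw [← mass_eq_wmass] at s2
    have : ε * (wmass m N h w + m⁻¹ * ∑ l ∈ range N, h l * ‖v (l + 1)‖ ^ 2) +
          K * (mass m N w + m⁻¹ * ∑ l ∈ range N, 1 * ‖v (l + 1)‖ ^ 2) ≤
        ε * (wmass m N h v + wmass m N h w) + K * (mass m N v + mass m N w) := by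
      have := mul_le_mul_of_nonneg_left s1 hε
      have := mul_le_mul_of_nonneg_left s2 hK
      linarith
    gcongr
  rw [hsum]
  refine (abs_add_le _ _).trans ((add_le_add b1 b2).trans ?_)
  have : 0 ≤ (4 * τ)⁻¹ * (mass m N v + mass m N w) := by
    have := mass_nonneg hm N v
    have := mass_nonneg hm N w
    positivity
  linarith

end Discrete

section Coercivity

/-- The scaled increments `m (A l - A (l - 1))`. -/
def incr (m : ℝ) (A : ℕ → E →L[ℝ] E) (l : ℕ) : E →L[ℝ] E := m • (A l - prev A l)

/-- The bilinear form of `D† D + V` on lattice functions supported on the first `N` sites, without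
the boundary term. -/
def iform (m : ℝ) (N : ℕ) (A₁ A₂ : ℕ → E →L[ℝ] E) (v w : ℕ → E) : ℝ :=
  m⁻¹ * ∑ l ∈ range N, (⟪dq m v l, dq m w l⟫ + ⟪v l, incr m A₁ l (w l)⟫ +
    1 / 2 * (⟪v l, incr m A₂ l (w (l + 1))⟫ + ⟪incr m A₂ l (v (l + 1)), w l⟫))

/-- The growth and oscillation bounds on the operators of the potential, with the oscillation
controlled by an arbitrarily small multiple of the growth. -/
structure SiteBounds (N : ℕ) (m κ ε K β : ℝ) (h : ℕ → ℝ) (A₁ A₂ η₁ η₂ ω₁ ω₂ : ℕ → E →L[ℝ] E) :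
    Prop where
  nonneg : ∀ l, 0 ≤ h l
  mono : Monotone h
  dec₁ : ∀ l, A₁ l = m⁻¹ • ∑ k ∈ range (l + 1), η₁ k + ω₁ l
  dec₂ : ∀ l, A₂ l = m⁻¹ • ∑ k ∈ range (l + 1), η₂ k + ω₂ l
  pos₁ : ∀ l v, 0 ≤ ⟪v, η₁ l v⟫
  pos₂ : ∀ l v, 0 ≤ ⟪v, η₂ l v⟫
  symm₂ : ∀ l u v, ⟪u, η₂ l v⟫ = ⟪η₂ l u, v⟫
  lower : ∀ l < N, ∀ v, (h l / κ - κ) * ‖v‖ ^ 2 ≤ ⟪v, η₁ l v⟫ + ⟪v, η₂ l v⟫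
  upper : ∀ l < N, ∀ v, ⟪v, η₁ l v⟫ + ⟪v, η₂ l v⟫ ≤ κ * (1 + h l) * ‖v‖ ^ 2
  upper₂ : ∀ l < N, ∀ v, ⟪v, η₂ l v⟫ ≤ 2 * m ^ 2 * ‖v‖ ^ 2
  osc₁ : ∀ l < N, ∀ p < N, l ≤ p → ((p - l : ℕ) : ℝ) ≤ m → ‖ω₁ l - ω₁ p‖ ^ 2 ≤ ε * h l + K
  osc₂ : ∀ l < N, ∀ p < N, l ≤ p → ((p - l : ℕ) : ℝ) ≤ m → ‖ω₂ l - ω₂ p‖ ^ 2 ≤ ε * h l + K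
  init₁ : ‖ω₁ 0‖ ≤ β
  init₂ : ‖ω₂ 0‖ ≤ β

theorem incr_of_dec {m : ℝ} (hm : 0 < m) {A η ω : ℕ → E →L[ℝ] E}
    (hd : ∀ l, A l = m⁻¹ • ∑ k ∈ range (l + 1), η k + ω l) (l : ℕ) :
    incr m A l = η l + m • (ω l - prev ω l) := by
  rcases l with _ | l
  · simp [incr, prev, hd, smul_smul, mul_inv_cancel₀ hm.ne']
  · simp only [incr, prev, hd, if_neg (Nat.succ_ne_zero l), Nat.add_sub_cancel]
    rw [sum_range_succ _ (l + 1)]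
    have : m⁻¹ • (∑ k ∈ range (l + 1), η k + η (l + 1)) + ω (l + 1) -
        (m⁻¹ • ∑ k ∈ range (l + 1), η k + ω l) =
        m⁻¹ • η (l + 1) + (ω (l + 1) - ω l) := by rw [smul_add]; abel
    rw [this, smul_add, smul_smul, mul_inv_cancel₀ hm.ne', one_smul]

/-- Truncating the index of the noise at the last site. -/
theorem osc_min {N L : ℕ} {m ε K : ℝ} (hN : 0 < N) (hL : (L : ℝ) ≤ m) (hε : 0 ≤ ε) {h : ℕ → ℝ}
    (hmono : Monotone h) {ω : ℕ → E →L[ℝ] E}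
    (osc : ∀ l < N, ∀ p < N, l ≤ p → ((p - l : ℕ) : ℝ) ≤ m → ‖ω l - ω p‖ ^ 2 ≤ ε * h l + K)
    (l p : ℕ) (h1 : l ≤ p) (h2 : p ≤ l + L) :
    ‖ω (min l (N - 1)) - ω (min p (N - 1))‖ ^ 2 ≤ ε * h l + K := by
  have := osc (min l (N - 1)) (by omega) (min p (N - 1)) (by omega) (by omega) (by
    refine le_trans ?_ hL
    exact_mod_cast (by omega : min p (N - 1) - min l (N - 1) ≤ L))
  refine this.trans ?_
  gcongr
  exact hmono (min_le_left _ _)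

theorem shift_energy_le {m : ℝ} (hm : 0 < m) {N : ℕ} {h : ℕ → ℝ} (hh : ∀ l, 0 ≤ h l)
    (hmono : Monotone h) {v : ℕ → E} (hv : ∀ l, N ≤ l → v l = 0) :
    kin m N (fun j => v (j + 1)) ≤ kin m N v ∧ wmass m N h (fun j => v (j + 1)) ≤ wmass m N h v ∧
      mass m N (fun j => v (j + 1)) ≤ mass m N v := by
  refine ⟨?_, wmass_shift_le hm hh hmono (hv N le_rfl), ?_⟩
  · unfold kin
    gcongr m⁻¹ * ?_
    exact sum_shift_le (a := fun l => ‖dq m v l‖ ^ 2) (fun _ => sq_nonneg _)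
      (by simp [dq, hv N le_rfl, hv (N + 1) (by omega)])
  · rw [mass_eq_wmass, mass_eq_wmass]
    exact wmass_shift_le hm (h := fun _ => 1) (fun _ => zero_le_one) monotone_const (hv N le_rfl)

/-- A positive operator bounded by `2 m²` couples neighbouring sites coercively, up to two thirds
of the kinetic energy. -/
theorem coupling_lower {A : E →L[ℝ] E} (hs : ∀ u v, ⟪u, A v⟫ = ⟪A u, v⟫) (hp : ∀ v, 0 ≤ ⟪v, A v⟫)
    (hb : ∀ v, ⟪v, A v⟫ ≤ 2 * b * ‖v‖ ^ 2) (v w : E) :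
    1 / 4 * ⟪v, A v⟫ - 2 / 3 * (b * ‖w - v‖ ^ 2) ≤ ⟪v, A w⟫ := by
  have h1 := hp ((3 : ℝ) • v + (2 : ℝ) • (w - v))
  have h2 := hb (w - v)
  have h3 : ⟪w - v, A v⟫ = ⟪v, A (w - v)⟫ := by rw [hs, real_inner_comm]
  simp only [map_add, map_smul, inner_add_left, inner_add_right, inner_smul_left, inner_smul_right,
    RCLike.conj_to_real] at h1
  have h4 : ⟪v, A w⟫ = ⟪v, A v⟫ + ⟪v, A (w - v)⟫ := by
    rw [← inner_add_right, ← map_add, add_sub_cancel]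
  nlinarith

theorem coupling_abs {A : E →L[ℝ] E} (hs : ∀ u v, ⟪u, A v⟫ = ⟪A u, v⟫) (hp : ∀ v, 0 ≤ ⟪v, A v⟫)
    (v w : E) : |⟪v, A w⟫| ≤ 1 / 2 * (⟪v, A v⟫ + ⟪w, A w⟫) := by
  have h1 := hp (v + w)
  have h2 := hp (v - w)
  have h3 : ⟪w, A v⟫ = ⟪v, A w⟫ := by rw [hs, real_inner_comm]
  simp only [map_add, map_sub, inner_add_left, inner_add_right, inner_sub_left,
    inner_sub_right] at h1 h2
  rw [abs_le]
  constructor <;> linarith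

/-- Splitting of the form into kinetic energy, growth and noise. -/
theorem iform_self_eq {m : ℝ} (hm : 0 < m) (N : ℕ) {A₁ A₂ η₁ η₂ ω₁ ω₂ : ℕ → E →L[ℝ] E}
    (h₁ : ∀ l, A₁ l = m⁻¹ • ∑ k ∈ range (l + 1), η₁ k + ω₁ l)
    (h₂ : ∀ l, A₂ l = m⁻¹ • ∑ k ∈ range (l + 1), η₂ k + ω₂ l) (v : ℕ → E) :
    iform m N A₁ A₂ v v = kin m N v +
      m⁻¹ * ∑ l ∈ range N, (⟪v l, η₁ l (v l)⟫ + ⟪v l, η₂ l (v (l + 1))⟫) +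
      (∑ l ∈ range N, ⟪v l, (ω₁ (min l (N - 1)) - prev (fun j => ω₁ (min j (N - 1))) l) (v l)⟫ +
       ∑ l ∈ range N,
        ⟪v l, (ω₂ (min l (N - 1)) - prev (fun j => ω₂ (min j (N - 1))) l) (v (l + 1))⟫) := by
  simp only [iform, kin, mul_sum, ← sum_add_distrib]
  refine sum_congr rfl fun l hl => ?_
  have hl' : l < N := Finset.mem_range.1 hl
  have e1 : min l (N - 1) = l := by omega
  have e2 : ∀ ω : ℕ → E →L[ℝ] E, prev (fun j => ω (min j (N - 1))) l = prev ω l := by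
    intro ω
    unfold prev
    split_ifs
    · rfl
    · have : min (l - 1) (N - 1) = l - 1 := by omega
      simp only [this]
  rw [e1, e2, e2, real_inner_comm (v l) (incr m A₂ l (v (l + 1))), incr_of_dec hm h₁,
    incr_of_dec hm h₂, real_inner_self_eq_norm_sq]
  simp only [add_apply, smul_apply, inner_add_right, inner_smul_right]
  field_simp
  ring

set_option maxHeartbeats 800000 in
/-- Coercivity of the discrete form, uniformly in the lattice spacing. -/
theorem iform_bounds {κ K β h₀ : ℝ} (hκ : 1 ≤ κ) (hK : 0 ≤ K) (hβ : 0 ≤ β) (hh₀ : 0 ≤ h₀) :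
    ∃ C : ℝ, 0 < C ∧ ∀ (N : ℕ) (m : ℝ) (h : ℕ → ℝ) (A₁ A₂ η₁ η₂ ω₁ ω₂ : ℕ → E →L[ℝ] E), 1 ≤ m →
      h 0 ≤ h₀ → SiteBounds N m κ (1 / (304 * κ)) K β h A₁ A₂ η₁ η₂ ω₁ ω₂ →
      ∀ v : ℕ → E, (∀ l, N ≤ l → v l = 0) →
        1 / 6 * kin m N v + 1 / (8 * κ) * wmass m N h v ≤ iform m N A₁ A₂ v v + C * mass m N v ∧
        |iform m N A₁ A₂ v v| ≤ C * (kin m N v + wmass m N h v + mass m N v) := by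
  have hκ0 : 0 < κ := by linarith
  set ε := 1 / (304 * κ) with hε
  have hε0 : 0 < ε := by positivity
  set B := β + √(ε * h₀ + K) with hB
  have hB0 : 0 ≤ B := by positivity
  set σ := (36 * (B + 1))⁻¹ with hσ
  have hσ0 : 0 < σ := by positivity
  have hBσ : 2 * B * σ ≤ 1 / 18 := by
    rw [hσ, ← div_eq_mul_inv, div_le_iff₀ (by positivity)]; linarith
  refine ⟨38 * (K + 1) + 2 * B * σ⁻¹ + κ + 2 + 2 * κ, by positivity, ?_⟩
  intro N m h A₁ A₂ η₁ η₂ ω₁ ω₂ hm1 hh hs v hv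
  have hm : 0 < m := by linarith
  have hk := kin_nonneg hm N v
  have hS := mass_nonneg hm N v
  have hW := wmass_nonneg hm N hs.nonneg v
  rcases Nat.eq_zero_or_pos N with rfl | hN
  · have : iform m 0 A₁ A₂ v v = 0 := by simp [iform]
    have k0 : kin m 0 v = 0 := by simp [kin]
    have w0 : wmass m 0 h v = 0 := by simp [wmass]
    have s0 : mass m 0 v = 0 := by simp [mass]
    simp [this, k0, w0, s0]
  obtain ⟨k1, w1, s1⟩ := shift_energy_le hm hs.nonneg hs.mono hv
  have hL1 : 1 ≤ ⌊m⌋₊ := Nat.one_le_floor_iff _ |>.2 hm1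
  have hLm : (⌊m⌋₊ : ℝ) ≤ m := Nat.floor_le hm.le
  have hLm2 : m ≤ 2 * (⌊m⌋₊ : ℝ) := by
    have := Nat.lt_floor_add_one m
    have : (1 : ℝ) ≤ ⌊m⌋₊ := by exact_mod_cast hL1
    linarith
  have t1 := abs_sum_noise_le (N := N) (L := ⌊m⌋₊) (τ := 1 / 36) (w := v) hm hL1 hLm2 (by norm_num)
    hε0.le hK hs.nonneg hs.mono (ω := fun j => ω₁ (min j (N - 1)))
    (osc_min hN hLm hε0.le hs.mono hs.osc₁) (by simpa using hs.init₁) (hv N le_rfl)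
  have t2 := abs_sum_noise_le (N := N) (L := ⌊m⌋₊) (τ := 1 / 36) (w := fun j => v (j + 1)) hm hL1
    hLm2 (by norm_num) hε0.le hK hs.nonneg hs.mono (ω := fun j => ω₂ (min j (N - 1)))
    (osc_min hN hLm hε0.le hs.mono hs.osc₂) (by simpa using hs.init₂) (hv N le_rfl)
  have hBB : β + √(ε * h 0 + K) ≤ B := by rw [hB]; gcongr
  have v0 := norm_sq_le_kin_mass hm hv hσ0 0
  have v1 := norm_sq_le_kin_mass hm hv hσ0 1
  have vv : ‖v 0‖ * ‖v 1‖ ≤ σ * kin m N v + σ⁻¹ * mass m N v := by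
    nlinarith [sq_nonneg (‖v 0‖ - ‖v 1‖)]
  have vv0 : ‖v 0‖ * ‖v 0‖ ≤ σ * kin m N v + σ⁻¹ * mass m N v := by rw [← sq]; exact v0
  have X0 : 0 ≤ σ * kin m N v + σ⁻¹ * mass m N v := by positivity
  have p1 : (β + √(ε * h 0 + K)) * (‖v 0‖ * ‖v 0‖) ≤ B * (σ * kin m N v + σ⁻¹ * mass m N v) := by
    gcongr
  have p2 : (β + √(ε * h 0 + K)) * (‖v 0‖ * ‖v (0 + 1)‖) ≤
      B * (σ * kin m N v + σ⁻¹ * mass m N v) := by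
    gcongr
  have pB : 2 * (B * (σ * kin m N v + σ⁻¹ * mass m N v)) ≤
      1 / 18 * kin m N v + 2 * B * σ⁻¹ * mass m N v := by
    have := mul_le_mul_of_nonneg_right hBσ hk
    linarith
  set n1 := ∑ l ∈ range N, ⟪v l, (ω₁ (min l (N - 1)) - prev (fun j => ω₁ (min j (N - 1))) l) (v l)⟫
  set n2 := ∑ l ∈ range N,
    ⟪v l, (ω₂ (min l (N - 1)) - prev (fun j => ω₂ (min j (N - 1))) l) (v (l + 1))⟫
  have noise : |n1 + n2| ≤ 1 / 6 * kin m N v + 38 * ε * wmass m N h v +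
      (38 * (K + 1) + 2 * B * σ⁻¹) * mass m N v := by
    refine (abs_add_le _ _).trans ((add_le_add t1 t2).trans ?_)
    have e1 := mul_le_mul_of_nonneg_left w1 hε0.le
    have e2 := mul_le_mul_of_nonneg_left s1 (show 0 ≤ K + 1 by linarith)
    norm_num only
    linarith
  have hεκ : 38 * ε = 1 / (8 * κ) := by rw [hε]; field_simp; norm_num
  rw [hεκ] at noise
  have split := iform_self_eq hm N hs.dec₁ hs.dec₂ v
  set g := m⁻¹ * ∑ l ∈ range N, (⟪v l, η₁ l (v l)⟫ + ⟪v l, η₂ l (v (l + 1))⟫)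
  have g_low : 1 / (4 * κ) * wmass m N h v - κ / 4 * mass m N v - 2 / 3 * kin m N v ≤ g := by
    have : 1 / (4 * κ) * wmass m N h v - κ / 4 * mass m N v - 2 / 3 * kin m N v =
        m⁻¹ * ∑ l ∈ range N, (1 / 4 * ((h l / κ - κ) * ‖v l‖ ^ 2) - 2 / 3 * ‖dq m v l‖ ^ 2) := by
      simp only [wmass, mass, kin, mul_sum, ← sum_sub_distrib]
      refine sum_congr rfl fun l _ => ?_
      field_simp
    rw [this]
    refine mul_le_mul_of_nonneg_left (sum_le_sum fun l hl => ?_) (by positivity)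
    have hl' := Finset.mem_range.1 hl
    have c := coupling_lower (hs.symm₂ l) (hs.pos₂ l) (b := m ^ 2) (hs.upper₂ l hl') (v l)
      (v (l + 1))
    have c2 := hs.lower l hl' (v l)
    have c3 := hs.pos₁ l (v l)
    have c4 : ‖dq m v l‖ ^ 2 = m ^ 2 * ‖v (l + 1) - v l‖ ^ 2 := by
      rw [dq, norm_smul, Real.norm_of_nonneg hm.le, mul_pow]
    rw [c4]
    linarith
  have g_up : |g| ≤ 2 * κ * (mass m N v + wmass m N h v) := by
    have b1 : |g| ≤ m⁻¹ * ∑ l ∈ range N, (κ * (1 + h l) * ‖v l‖ ^ 2 +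
        1 / 2 * (κ * (1 + h l) * ‖v (l + 1)‖ ^ 2)) := by
      simp only [g]
      rw [abs_mul, abs_of_pos (inv_pos.2 hm)]
      refine mul_le_mul_of_nonneg_left ((abs_sum_le_sum_abs _ _).trans
        (sum_le_sum fun l hl => ?_)) (by positivity)
      have hl' := Finset.mem_range.1 hl
      have c := coupling_abs (hs.symm₂ l) (hs.pos₂ l) (v l) (v (l + 1))
      have c1 := hs.upper l hl' (v l)
      have c2 := hs.upper l hl' (v (l + 1))
      have c3 := hs.pos₁ l (v l)
      have c4 := hs.pos₁ l (v (l + 1))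
      have c5 := hs.pos₂ l (v l)
      refine (abs_add_le _ _).trans ?_
      rw [abs_of_nonneg c3]
      linarith
    have e : m⁻¹ * ∑ l ∈ range N, (κ * (1 + h l) * ‖v l‖ ^ 2 +
        1 / 2 * (κ * (1 + h l) * ‖v (l + 1)‖ ^ 2)) = κ * (mass m N v + wmass m N h v) +
        κ / 2 * (mass m N (fun j => v (j + 1)) + wmass m N h (fun j => v (j + 1))) := by
      simp only [wmass, mass, mul_sum, ← sum_add_distrib]
      refine sum_congr rfl fun l _ => by ring
    rw [e] at b1
    have := mul_le_mul_of_nonneg_left (add_le_add s1 w1) (show 0 ≤ κ / 2 by positivity)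
    have : 0 ≤ κ * (mass m N v + wmass m N h v) := by positivity
    linarith
  have c8 : 1 / (8 * κ) ≤ 1 := by
    rw [div_le_one (by positivity)]; linarith
  have c48 : 1 / (4 * κ) = 2 * (1 / (8 * κ)) := by field_simp; norm_num
  have hn := abs_le.1 noise
  have hσS : 0 ≤ 2 * B * σ⁻¹ * mass m N v := by positivity
  have hKS : 0 ≤ K * mass m N v := by positivity
  have hκS : 0 ≤ κ * mass m N v := by positivity
  constructor
  · rw [c48] at g_low
    rw [split]
    linarith [hn.1]
  · rw [split]
    have a1 := abs_add_le (kin m N v + g) (n1 + n2)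
    have a2 := abs_add_le (kin m N v) g
    rw [abs_of_nonneg hk] at a2
    have a3 := mul_le_mul_of_nonneg_right c8 hW
    have a4 : 0 ≤ (38 * (K + 1) + 2 * B * σ⁻¹ + κ) * kin m N v := by positivity
    have a5 : 0 ≤ (38 * (K + 1) + 2 * B * σ⁻¹ + κ) * wmass m N h v := by positivity
    have a6 : 0 ≤ κ * kin m N v := by positivity
    linarith

end Coercivity

/-! ### Step functions in `L²ℝ₊` -/

/-- Lebesgue measure on the half-line. -/
abbrev halfLine : Measure ℝ := volume.restrict ℝ₊

local notation "MemL2(" f ")" => MemLp f 2 halfLine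

section Step

variable {V : Type*} [NormedAddCommGroup V]

theorem stronglyMeasurable_step {A : Type*} [TopologicalSpace A] (m : ℝ) (a : ℕ → A) :
    StronglyMeasurable fun x : ℝ => step m a x.toNNReal := by
  have h : Measurable fun x : ℝ => ⌊m * ((x.toNNReal : ℝ≥0) : ℝ)⌋₊ := by fun_prop
  exact (StronglyMeasurable.of_discrete (f := a)).comp_measurable h

theorem step_eq_sum_indicator {m : ℝ} (hm : 0 < m) {N : ℕ} {a : ℕ → V}
    (ha : ∀ l, N ≤ l → a l = 0) {x : ℝ} (hx : 0 ≤ x) :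
    step m a x.toNNReal =
      ∑ l ∈ range N, (Ico (l / m) ((l + 1) / m)).indicator (fun _ => a l) x := by
  have hfl : ∀ l : ℕ, x ∈ Ico ((l : ℝ) / m) ((l + 1) / m) ↔ ⌊m * x⌋₊ = l := by
    intro l
    rw [Nat.floor_eq_iff (by positivity), mem_Ico, div_le_iff₀ hm, lt_div_iff₀ hm, mul_comm x m]
  have h1 : step m a x.toNNReal = a ⌊m * x⌋₊ := by simp [step, hx]
  rw [h1]
  by_cases hN : ⌊m * x⌋₊ < N
  · rw [Finset.sum_eq_single_of_mem ⌊m * x⌋₊ (Finset.mem_range.2 hN)]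
    · rw [indicator_of_mem ((hfl _).2 rfl)]
    · intro l _ hl
      rw [indicator_of_notMem]
      rw [hfl]; exact hl.symm
  · rw [ha _ (by omega), sum_eq_zero]
    intro l hl
    rw [indicator_of_notMem]
    rw [hfl]
    have := Finset.mem_range.1 hl
    omega

theorem halfLine_Ico {m : ℝ} (hm : 0 < m) (l : ℕ) :
    halfLine (Ico ((l : ℝ) / m) ((l + 1) / m)) = ofReal m⁻¹ := by
  have hsub : Ico ((l : ℝ) / m) ((l + 1) / m) ⊆ Ici 0 := fun x hx => le_trans (by positivity) hx.1
  rw [Measure.restrict_apply measurableSet_Ico, inter_eq_self_of_subset_left hsub, Real.volume_Ico]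
  congr 1; field_simp; ring

theorem step_ae_eq {m : ℝ} (hm : 0 < m) {N : ℕ} {a : ℕ → V} (ha : ∀ l, N ≤ l → a l = 0) :
    (fun x : ℝ => step m a x.toNNReal) =ᵐ[halfLine]
      fun x => ∑ l ∈ range N, (Ico (l / m) ((l + 1) / m)).indicator (fun _ => a l) x := by
  filter_upwards [ae_restrict_mem measurableSet_Ici] with x hx
  exact step_eq_sum_indicator hm ha hx

theorem memLp_step {m : ℝ} (hm : 0 < m) {N : ℕ} {a : ℕ → V} (ha : ∀ l, N ≤ l → a l = 0)
    (p : ℝ≥0∞) : MemLp (fun x : ℝ => step m a x.toNNReal) p halfLine := by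
  refine MemLp.ae_eq (step_ae_eq hm ha).symm (memLp_finsetSum _ fun l _ => ?_)
  exact memLp_indicator_const p measurableSet_Ico _ (Or.inr (by rw [halfLine_Ico hm]; simp))

theorem integral_step [NormedSpace ℝ V] [CompleteSpace V] {m : ℝ} (hm : 0 < m) {N : ℕ} {a : ℕ → V}
    (ha : ∀ l, N ≤ l → a l = 0) :
    ∫ x in ℝ₊, step m a x.toNNReal = m⁻¹ • ∑ l ∈ range N, a l := by
  rw [integral_congr_ae (step_ae_eq hm ha), integral_finsetSum, smul_sum]
  · refine sum_congr rfl fun l _ => ?_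
    rw [integral_indicator_const _ measurableSet_Ico, measureReal_def, halfLine_Ico hm,
      ENNReal.toReal_ofReal (by positivity)]
  · intro l _
    exact (integrable_indicator_iff measurableSet_Ico).2
      (integrableOn_const (by rw [halfLine_Ico hm]; simp) (by simp))

end Step

section StepL

/-- `L²` functions on the half-line. -/
abbrev LE (E : Type*) [NormedAddCommGroup E] : Type _ := Lp E 2 halfLine

open Classical in
/-- The step function of a lattice function, as an element of `L²`; the junk value `0` is never
attained for lattice functions of finite support. -/
def stepL (m : ℝ) (v : ℕ → E) : LE E :=
  if h : MemL2(fun x : ℝ => step m v x.toNNReal) then h.toLp else 0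

theorem coeFn_stepL {m : ℝ} (hm : 0 < m) {N : ℕ} {v : ℕ → E} (hv : ∀ l, N ≤ l → v l = 0) :
    stepL m v =ᵐ[halfLine] fun x => step m v x.toNNReal := by
  rw [stepL, dif_pos (memLp_step hm hv 2)]
  exact MemLp.coeFn_toLp _

theorem inner_stepL {m : ℝ} (hm : 0 < m) {N N' : ℕ} {v w : ℕ → E} (hv : ∀ l, N ≤ l → v l = 0)
    (hw : ∀ l, N' ≤ l → w l = 0) :
    ⟪stepL m v, stepL m w⟫ = m⁻¹ * ∑ l ∈ range N, ⟪v l, w l⟫ := by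
  rw [L2.inner_def, ← smul_eq_mul, ← integral_step hm (a := fun l => ⟪v l, w l⟫)
    (fun l hl => by simp [hv l hl])]
  refine integral_congr_ae ?_
  filter_upwards [coeFn_stepL hm hv, coeFn_stepL hm hw] with x h1 h2
  rw [h1, h2]; rfl

theorem norm_stepL_sq {m : ℝ} (hm : 0 < m) {N : ℕ} {v : ℕ → E} (hv : ∀ l, N ≤ l → v l = 0) :
    ‖stepL m v‖ ^ 2 = mass m N v := by
  rw [← real_inner_self_eq_norm_sq, inner_stepL hm hv hv]
  simp [mass]

theorem dq_eq_zero {m : ℝ} {N : ℕ} {v : ℕ → E} (hv : ∀ l, N ≤ l → v l = 0) :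
    ∀ l, N ≤ l → dq m v l = 0 := fun l hl => by
  simp [dq, hv l hl, hv (l + 1) (by omega)]

theorem norm_stepL_dq_sq {m : ℝ} (hm : 0 < m) {N : ℕ} {v : ℕ → E} (hv : ∀ l, N ≤ l → v l = 0) :
    ‖stepL m (dq m v)‖ ^ 2 = kin m N v := by
  rw [norm_stepL_sq hm (dq_eq_zero hv)]; rfl

theorem norm_LE_sq (V : LE E) : ‖V‖ ^ 2 = ∫ x in ℝ₊, ‖V x‖ ^ 2 := by
  rw [← real_inner_self_eq_norm_sq, L2.inner_def]
  simp

theorem integrable_norm_sq (V : LE E) : Integrable (fun x => ‖V x‖ ^ 2) halfLine :=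
  (Lp.memLp V).integrable_norm_pow (by norm_num)

theorem eLpNorm_two_eq (h : ℝ → E) :
    eLpNorm h 2 halfLine = (∫⁻ x in ℝ₊, ‖h x‖ₑ ^ 2) ^ (1 / 2 : ℝ) := by
  rw [eLpNorm_eq_lintegral_rpow_enorm_toReal two_ne_zero ENNReal.ofNat_ne_top]
  simp

theorem tendsto_eLpNorm_of_dominated {f : ℕ → ℝ → E} {G : ℝ → ℝ} (hG : MemL2(G))
    (hf : ∀ k, AEStronglyMeasurable (f k) halfLine) (hb : ∀ k, ∀ᵐ x ∂halfLine, ‖f k x‖ ≤ G x)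
    (h0 : ∀ᵐ x ∂halfLine, Tendsto (fun k => f k x) atTop (𝓝 0)) :
    Tendsto (fun k => eLpNorm (f k) 2 halfLine) atTop (𝓝 0) := by
  have h := tendsto_lintegral_of_dominated_convergence' (μ := halfLine) (f := fun _ => 0)
    (F := fun k x => ‖f k x‖ₑ ^ 2) (fun x => ‖G x‖ₑ ^ 2) (fun k => (hf k).enorm.pow_const 2)
    (fun k => by
      filter_upwards [hb k] with x hx
      rw [← ofReal_norm, ← ofReal_norm, Real.norm_eq_abs]
      gcongr
      exact hx.trans (le_abs_self _))
    (fun h => hG.2.ne (by rw [eLpNorm_two_eq, h]; simp))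
    (by filter_upwards [h0] with x hx using by simpa using ENNReal.Tendsto.pow (n := 2) hx.enorm)
  have h' := ((ENNReal.continuous_rpow_const (y := 1 / 2)).tendsto _).comp h
  simp only [eLpNorm_two_eq]
  simpa [Function.comp_def] using h'

/-- Dominated convergence in `L²` on bounded intervals. -/
theorem tendsto_toLp_of_dominated {Ψ : ℕ → LE E} {Ψ₀ : LE E} {R B : ℝ}
    (hR : ∀ j, ∀ᵐ x ∂halfLine, ‖Ψ j x‖ ≤ (Icc 0 R).indicator (fun _ => B) x)
    (hlim : ∀ᵐ x ∂halfLine, Tendsto (fun j => Ψ j x) atTop (𝓝 (Ψ₀ x))) :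
    Tendsto Ψ atTop (𝓝 Ψ₀) := by
  have hG : MemL2((Icc 0 R).indicator fun _ => B) := memLp_indicator_const 2 measurableSet_Icc B
      (Or.inr ((Measure.restrict_apply_le _ _).trans_lt measure_Icc_lt_top).ne)
  refine (Lp.tendsto_Lp_iff_tendsto_eLpNorm' _ _).2 (tendsto_eLpNorm_of_dominated (hG.add hG)
    (fun j => (Lp.memLp (Ψ j)).1.sub (Lp.memLp Ψ₀).1) (fun j => ?_) ?_)
  · filter_upwards [ae_all_iff.2 hR, hlim] with x h1 h2
    exact (norm_sub_le _ _).trans (add_le_add (h1 j) (le_of_tendsto' h2.norm h1))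
  · filter_upwards [hlim] with x hx
    simpa using hx.sub_const (Ψ₀ x)

/-- Strong convergence tested against bounded weak convergence. -/
theorem tendsto_inner_of_weak {H : Type*} [NormedAddCommGroup H] [InnerProductSpace ℝ H]
    {Ψ G : ℕ → H} {Ψ₀ G₀ : H} (hΨ : Tendsto Ψ atTop (𝓝 Ψ₀)) (hC : ∀ j, ‖G j‖ ≤ C)
    (hG : ∀ ψ : H, Tendsto (fun j => ⟪ψ, G j⟫) atTop (𝓝 ⟪ψ, G₀⟫)) :
    Tendsto (fun j => ⟪Ψ j, G j⟫) atTop (𝓝 ⟪Ψ₀, G₀⟫) := by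
  have h1 : Tendsto (fun j => ⟪Ψ j - Ψ₀, G j⟫) atTop (𝓝 0) := by
    refine squeeze_zero_norm (a := fun j => ‖Ψ j - Ψ₀‖ * C) (fun j => ?_) ?_
    · exact (norm_inner_le_norm _ _).trans (mul_le_mul_of_nonneg_left (hC j) (norm_nonneg _))
    · simpa using (tendsto_iff_norm_sub_tendsto_zero.1 hΨ).mul_const C
  have h2 := h1.add (hG Ψ₀)
  simpa [inner_sub_left] using h2

theorem separableSpace_LE [FiniteDimensional ℝ E] : TopologicalSpace.SeparableSpace (LE E) := by
  have : ProperSpace E := FiniteDimensional.proper ℝ E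
  have : Fact ((2 : ℝ≥0∞) ≠ ⊤) := ⟨by norm_num⟩
  infer_instance

/-- Bounded sequences in `L²` have weakly convergent subsequences. -/
theorem exists_weak_limit [FiniteDimensional ℝ E] {G : ℕ → LE E} (hC : ∀ j, ‖G j‖ ≤ C) :
    ∃ (t : ℕ → ℕ) (g : LE E), StrictMono t ∧
      ∀ ψ : LE E, Tendsto (fun j => ⟪ψ, G (t j)⟫) atTop (𝓝 ⟪ψ, g⟫) := by
  have : TopologicalSpace.SeparableSpace (LE E) := separableSpace_LE
  have : CompleteSpace E := FiniteDimensional.complete ℝ E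
  have hs := WeakDual.isSeqCompact_closedBall ℝ (LE E) 0 C
  have hmem : ∀ j, StrongDual.toWeakDual (InnerProductSpace.toDual ℝ (LE E) (G j)) ∈
      WeakDual.toStrongDual ⁻¹' Metric.closedBall (0 : StrongDual ℝ (LE E)) C := by
    intro j
    have : ‖InnerProductSpace.toDual ℝ (LE E) (G j)‖ ≤ C := by
      rw [LinearIsometryEquiv.norm_map]; exact hC j
    exact (dist_zero_right (InnerProductSpace.toDual ℝ (LE E) (G j))).trans_le this
  obtain ⟨a, _, t, ht, hlim⟩ := hs hmem
  refine ⟨t, (InnerProductSpace.toDual ℝ (LE E)).symm (WeakDual.toStrongDual a), ht, fun ψ => ?_⟩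
  have h1 : Tendsto (fun j => (StrongDual.toWeakDual
      (InnerProductSpace.toDual ℝ (LE E) (G (t j)))) ψ) atTop (𝓝 (a ψ)) :=
    ((WeakDual.eval_continuous ψ).tendsto a).comp hlim
  have e1 : ⟪ψ, (InnerProductSpace.toDual ℝ (LE E)).symm (WeakDual.toStrongDual a)⟫ = a ψ := by
    rw [real_inner_comm, InnerProductSpace.toDual_symm_apply]; rfl
  rw [e1]
  refine h1.congr fun j => ?_
  rw [real_inner_comm]; rfl

end StepL

/-! ### Compactness of lattice functions of bounded energy -/

section Limits

/-- Lattice functions `v j` with spacing `1 / m j` converge to `f` locally uniformly and in `L²`,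
and their difference quotients converge to `g` weakly in `L²`. -/
structure LatticeLimit (m : ℕ → ℝ) (v : ℕ → ℕ → E) (f g : ℝ → E) : Prop where
  cont : Continuous f
  memLp : MemL2(f)
  memLp_deriv : MemL2(g)
  unif : ∀ R : ℝ≥0, TendstoUniformlyOn (fun j => step (m j) (v j)) (fun x => f x) atTop (Iic R)
  tendsto : Tendsto (fun j => stepL (m j) (v j)) atTop (𝓝 memLp.toLp)
  weak : ∀ ψ : LE E, Tendsto (fun j => ⟪ψ, stepL (m j) (dq (m j) (v j))⟫) atTop
    (𝓝 ⟪ψ, memLp_deriv.toLp⟫)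
  bdd : ∃ C, ∀ j, ‖stepL (m j) (dq (m j) (v j))‖ ≤ C

theorem LatticeLimit.tendsto_zero {v : ℕ → ℕ → E} {f g : ℝ → E} (h : LatticeLimit m v f g) :
    Tendsto (fun j => v j 0) atTop (𝓝 (f 0)) := by
  simpa [step] using (h.unif 0).tendsto_at (mem_Iic.2 le_rfl)

theorem step_holder {m : ℝ} (hm : 0 < m) {N : ℕ} {v : ℕ → E} (hv : ∀ l, N ≤ l → v l = 0)
    (x y : ℝ≥0) : ‖step m v x - step m v y‖ ^ 2 ≤ (|(x : ℝ) - y| + m⁻¹) * kin m N v := by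
  wlog hxy : y ≤ x generalizing x y
  · rw [norm_sub_rev, abs_sub_comm]
    exact this y x (le_of_not_ge hxy)
  have hxy' : (y : ℝ) ≤ x := by exact_mod_cast hxy
  have hfl : ⌊m * (y : ℝ)⌋₊ ≤ ⌊m * (x : ℝ)⌋₊ := Nat.floor_mono (by gcongr)
  refine (norm_sub_sq_le_kin hm hv hfl).trans ?_
  gcongr
  · exact kin_nonneg hm N v
  rw [abs_of_nonneg (by linarith), div_le_iff₀ hm, add_mul, inv_mul_cancel₀ hm.ne']
  rw [Nat.cast_sub hfl]
  have h1 := Nat.floor_le (show 0 ≤ m * (x : ℝ) by positivity)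
  have h2 := Nat.lt_floor_add_one (m * (y : ℝ))
  linarith

variable (hm : ∀ j, 0 < m j) (hmt : Tendsto m atTop atTop) {N : ℕ → ℕ} {v : ℕ → ℕ → E}
  (hv : ∀ j l, N j ≤ l → v j l = 0)

include hm hmt hv in
/-- Lattice functions of bounded energy converge locally uniformly along a subsequence. -/
theorem exists_locally_uniform_limit [FiniteDimensional ℝ E]
    (hk : ∀ j, kin (m j) (N j) (v j) ≤ C) (hS : ∀ j, mass (m j) (N j) (v j) ≤ C) :
    ∃ (t : ℕ → ℕ) (f : ℝ≥0 → E), StrictMono t ∧ Continuous f ∧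
      ∀ R : ℝ≥0, TendstoUniformlyOn (fun j => step (m (t j)) (v (t j))) f atTop (Iic R) := by
  have : ProperSpace E := FiniteDimensional.proper ℝ E
  have hC : 0 ≤ C := (kin_nonneg (hm 0) _ _).trans (hk 0)
  have hol : ∀ j x y, ‖step (m j) (v j) x - step (m j) (v j) y‖ ^ 2 ≤
      (|(x : ℝ) - y| + (m j)⁻¹) * C := fun j x y =>
    (step_holder (hm j) (hv j) x y).trans
      (mul_le_mul_of_nonneg_left (hk j) (by have := hm j; positivity))
  have hbd : ∀ j l, ‖v j l‖ ≤ √(2 * C) := by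
    intro j l
    apply Real.le_sqrt_of_sq_le
    have := norm_sq_le_kin_mass (hm j) (hv j) one_pos l
    have := hk j
    have := hS j
    norm_num at *; linarith
  -- convergence at the points `k / (n + 1)`, by diagonal extraction
  let pt : ℕ × ℕ → ℝ≥0 := fun p => p.1 / (p.2 + 1 : ℕ)
  have hK : IsCompact (Set.univ.pi fun _ : ℕ × ℕ => Metric.closedBall (0 : E) √(2 * C)) :=
    isCompact_univ_pi fun _ => isCompact_closedBall _ _
  obtain ⟨a, -, t, ht, hlim⟩ := hK.isSeqCompact
    (x := fun j p => step (m j) (v j) (pt p)) (fun j p _ => by simpa [step] using hbd j _)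
  rw [tendsto_pi_nhds] at hlim
  have hmt' : Tendsto (fun j => (m (t j))⁻¹) atTop (𝓝 0) :=
    tendsto_inv_atTop_zero.comp (hmt.comp ht.tendsto_atTop)
  have near : ∀ (R : ℝ≥0) (ε : ℝ), 0 < ε → ∃ J, ∀ x ≤ R, ∃ b : E, ∀ j ≥ J,
      ‖step (m (t j)) (v (t j)) x - b‖ < ε := by
    intro R ε hε
    have hδ : 0 < (ε / 2) ^ 2 / (2 * (C + 1)) := by positivity
    obtain ⟨n, hn⟩ := exists_nat_one_div_lt hδ
    have e1 : ∀ᶠ j in atTop, ∀ k ∈ range (⌊((n + 1 : ℕ) : ℝ≥0) * R⌋₊ + 1),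
        ‖step (m (t j)) (v (t j)) (pt (k, n)) - a (k, n)‖ < ε / 2 := by
      rw [Finset.eventually_all]
      intro k _
      have := (tendsto_iff_norm_sub_tendsto_zero.1 (hlim (k, n)))
      exact this.eventually (gt_mem_nhds (by positivity))
    have e2 := hmt'.eventually (gt_mem_nhds hδ)
    obtain ⟨J, hJ⟩ := eventually_atTop.1 (e1.and e2)
    refine ⟨J, fun x hx => ⟨a (⌊((n + 1 : ℕ) : ℝ≥0) * x⌋₊, n), fun j hj => ?_⟩⟩
    obtain ⟨h1, h2⟩ := hJ j hj
    set k := ⌊((n + 1 : ℕ) : ℝ≥0) * x⌋₊ with hk'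
    have hkR : k ∈ range (⌊((n + 1 : ℕ) : ℝ≥0) * R⌋₊ + 1) := by
      rw [Finset.mem_range, Nat.lt_succ_iff]
      exact Nat.floor_mono (by gcongr)
    have h3 := h1 k hkR
    have hn0 : (0 : ℝ) < (n : ℝ) + 1 := by positivity
    have hd : |(x : ℝ) - pt (k, n)| ≤ 1 / ((n : ℝ) + 1) := by
      have l1 : (k : ℝ≥0) ≤ ((n + 1 : ℕ) : ℝ≥0) * x := Nat.floor_le (by positivity)
      have l2 : ((n + 1 : ℕ) : ℝ≥0) * x < (k : ℝ≥0) + 1 := Nat.lt_floor_add_one _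
      have l1' : (k : ℝ) ≤ ((n : ℝ) + 1) * x := by exact_mod_cast l1
      have l2' : ((n : ℝ) + 1) * x < (k : ℝ) + 1 := by exact_mod_cast l2
      have e : ((pt (k, n) : ℝ≥0) : ℝ) = k / ((n : ℝ) + 1) := by simp [pt]
      rw [e]
      have e' : (x : ℝ) - k / ((n : ℝ) + 1) = (((n : ℝ) + 1) * x - k) / ((n : ℝ) + 1) := by
        field_simp
      rw [e', abs_of_nonneg (div_nonneg (by linarith) hn0.le)]
      gcongr; linarith
    have h4 : ‖step (m (t j)) (v (t j)) x - step (m (t j)) (v (t j)) (pt (k, n))‖ < ε / 2 := by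
      apply lt_of_pow_lt_pow_left₀ 2 (by positivity)
      refine (hol _ _ _).trans_lt ?_
      have : |(x : ℝ) - pt (k, n)| + (m (t j))⁻¹ < (ε / 2) ^ 2 / (C + 1) := by
        have : (ε / 2) ^ 2 / (C + 1) = 2 * ((ε / 2) ^ 2 / (2 * (C + 1))) := by field_simp
        linarith
      calc _ ≤ (|(x : ℝ) - pt (k, n)| + (m (t j))⁻¹) * (C + 1) := by
            have := hm (t j)
            gcongr; linarith
        _ < (ε / 2) ^ 2 / (C + 1) * (C + 1) := by gcongr
        _ = _ := by field_simp
    calc _ ≤ ‖step (m (t j)) (v (t j)) x - step (m (t j)) (v (t j)) (pt (k, n))‖ +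
          ‖step (m (t j)) (v (t j)) (pt (k, n)) - a (k, n)‖ := norm_sub_le_norm_sub_add_norm_sub _ _
            _
      _ < ε := by linarith
  have hcau : ∀ x, CauchySeq fun j => step (m (t j)) (v (t j)) x := by
    intro x
    rw [Metric.cauchySeq_iff']
    intro ε hε
    obtain ⟨J, hJ⟩ := near x (ε / 2) (by positivity)
    obtain ⟨b, hb⟩ := hJ x le_rfl
    refine ⟨J, fun j hj => ?_⟩
    rw [dist_eq_norm]
    have h1 := hb j hj
    have h2 := hb J le_rfl
    rw [norm_sub_rev] at h2
    exact (norm_sub_le_norm_sub_add_norm_sub _ b _).trans_lt (by linarith)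
  choose f hf using fun x => cauchySeq_tendsto_of_complete (hcau x)
  refine ⟨t, f, ht, ?_, ?_⟩
  · have hfH : ∀ x y, ‖f x - f y‖ ^ 2 ≤ |(x : ℝ) - y| * C := by
      intro x y
      have h1 := (((hf x).sub (hf y)).norm).pow 2
      have h2 : Tendsto (fun j => (|(x : ℝ) - y| + (m (t j))⁻¹) * C) atTop
          (𝓝 ((|(x : ℝ) - y| + 0) * C)) := (tendsto_const_nhds.add hmt').mul_const C
      rw [add_zero] at h2
      exact le_of_tendsto_of_tendsto' h1 h2 fun j => hol _ _ _
    rw [continuous_iff_continuousAt]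
    intro x
    rw [ContinuousAt, tendsto_iff_norm_sub_tendsto_zero]
    have h3 : Tendsto (fun y : ℝ≥0 => |(y : ℝ) - x| * C) (𝓝 x) (𝓝 (|(x : ℝ) - x| * C)) :=
      Continuous.tendsto (by fun_prop) x
    have h4 : Tendsto (fun y : ℝ≥0 => ‖f y - f x‖ ^ 2) (𝓝 x) (𝓝 0) :=
      squeeze_zero (fun _ => sq_nonneg _) (fun y => hfH y x) (by simpa using h3)
    simpa [Real.sqrt_sq (norm_nonneg _)] using h4.sqrt
  · intro R
    rw [Metric.tendstoUniformlyOn_iff]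
    intro ε hε
    obtain ⟨J, hJ⟩ := near R (ε / 3) (by positivity)
    refine eventually_atTop.2 ⟨J, fun j hj x hx => ?_⟩
    obtain ⟨b, hb⟩ := hJ x hx
    have h1 : ‖f x - b‖ ≤ ε / 3 :=
      le_of_tendsto ((hf x).sub_const b).norm (eventually_atTop.2 ⟨J, fun i hi => (hb i hi).le⟩)
    have h2 := hb j hj
    rw [norm_sub_rev] at h2
    rw [dist_eq_norm]
    exact (norm_sub_le_norm_sub_add_norm_sub _ b _).trans_lt (by linarith)

include hmt in
theorem tendsto_floor_div (x : ℝ≥0) :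
    Tendsto (fun j => ((⌊m j * (x : ℝ)⌋₊ : ℝ) / m j).toNNReal) atTop (𝓝 x) := by
  have h := (tendsto_nat_floor_mul_div_atTop (R := ℝ) x.2).comp hmt
  have h2 := (continuous_real_toNNReal.tendsto _).comp h
  simp only [NNReal.val_eq_coe, Real.toNNReal_coe] at h2
  refine h2.congr fun j => ?_
  simp [mul_comm]

theorem exists_gt_of_unbounded {H : ℝ≥0 → ℝ} (Hu : ¬ BddAbove (range H)) (c : ℝ) :
    ∃ x, c < H x := by
  by_contra hcon
  push Not at hcon
  exact Hu ⟨c, by rintro _ ⟨x, rfl⟩; exact hcon x⟩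

/-- The mass of a lattice function outside a large interval is controlled by its weighted mass. -/
theorem norm_step_sq_le_of_lt {m : ℝ} (hm : 1 ≤ m) {H : ℝ≥0 → ℝ} (Hmono : Monotone H)
    (Hpos : ∀ x, 0 < H x) (v : ℕ → E) {R x : ℝ≥0} (hx : R + 1 < x) :
    ‖step m v x‖ ^ 2 ≤ (H R)⁻¹ * step m (fun l => latticeWeight H m l * ‖v l‖ ^ 2) x := by
  have hm0 : 0 < m := by linarith
  have h1 : R ≤ ((⌊m * (x : ℝ)⌋₊ : ℝ) / m).toNNReal := by
    rw [Real.le_toNNReal_iff_coe_le (by positivity), le_div_iff₀ hm0]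
    have h2 := Nat.lt_floor_add_one (m * (x : ℝ))
    have h3 : (R : ℝ) + 1 < x := by exact_mod_cast hx
    nlinarith
  have h2 := Hmono h1
  have h3 := Hpos R
  simp only [step, latticeWeight]
  rw [inv_mul_eq_div, le_div_iff₀ h3, mul_comm]
  gcongr

theorem step_integrable {m : ℝ} (hm : 0 < m) {N : ℕ} {a : ℕ → ℝ} (ha : ∀ l, N ≤ l → a l = 0) :
    Integrable (fun x : ℝ => step m a x.toNNReal) halfLine :=
  memLp_one_iff_integrable.1 (memLp_step hm ha 1)

theorem integral_step_wmass {m : ℝ} (hm : 0 < m) {N : ℕ} (h : ℕ → ℝ) {v : ℕ → E}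
    (hv : ∀ l, N ≤ l → v l = 0) :
    ∫ x in ℝ₊, step m (fun l => h l * ‖v l‖ ^ 2) x.toNNReal = wmass m N h v := by
  rw [integral_step hm (N := N) (fun l hl => by simp [hv l hl])]; rfl

include hm hmt hv in
/-- Locally uniform convergence and the control of the weighted mass give convergence in `L²`. -/
theorem cauchySeq_stepL {H : ℝ≥0 → ℝ} (Hmono : Monotone H) (Hpos : ∀ x, 0 < H x)
    (Hu : ¬ BddAbove (range H))
    (hW : ∀ j, wmass (m j) (N j) (latticeWeight H (m j)) (v j) ≤ C)
    {f : ℝ≥0 → E} (hf : ∀ R, TendstoUniformlyOn (fun j => step (m j) (v j)) f atTop (Iic R)) :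
    CauchySeq fun j => stepL (m j) (v j) := by
  have hC : 0 ≤ C := (wmass_nonneg (hm 0) _ (fun l => (Hpos _).le) _).trans (hW 0)
  rw [Metric.cauchySeq_iff]
  intro δ hδ
  obtain ⟨R, hR⟩ := exists_gt_of_unbounded Hu (8 * (C + 1) / δ ^ 2)
  have hRpos := Hpos R
  have hR' : (H R)⁻¹ * (4 * C) < δ ^ 2 / 2 := by
    rw [div_lt_iff₀ (by positivity)] at hR
    rw [inv_mul_lt_iff₀ hRpos]; linarith
  set c : ℝ := δ ^ 2 / 4 / (R + 1) with hc
  have hε : 0 < c := by positivity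
  obtain ⟨J, hJ⟩ := eventually_atTop.1 ((Metric.tendstoUniformlyOn_iff.1 (hf (R + 1)) (√c / 2)
    (by positivity)).and (hmt.eventually_ge_atTop 1))
  refine ⟨J, fun i hi j hj => ?_⟩
  set q : ℕ → ℝ → ℝ := fun i x =>
    step (m i) (fun l => latticeWeight H (m i) l * ‖v i l‖ ^ 2) x.toNNReal
  have hq : ∀ i, Integrable (q i) halfLine := fun i =>
    step_integrable (hm i) (N := N i) fun l hl => by simp [hv i l hl]
  have hqC : ∀ i, ∫ x in ℝ₊, q i x ≤ C := fun i =>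
    (integral_step_wmass (hm i) _ (hv i)).trans_le (hW i)
  have np : ∀ i x, 0 ≤ q i x := fun i x => mul_nonneg (Hpos _).le (sq_nonneg _)
  have hI : Integrable ((Icc (0 : ℝ) (R + 1)).indicator fun _ => c) halfLine := by
    refine (integrable_indicator_iff measurableSet_Icc).2 (integrableOn_const ?_ (by simp))
    exact ((Measure.restrict_apply_le _ _).trans_lt (by simp)).ne
  have hI2 : Integrable (fun x => 2 * (H R)⁻¹ * (q i x + q j x)) halfLine :=
    ((hq i).add (hq j)).const_mul (2 * (H R)⁻¹)
  rw [dist_eq_norm]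
  apply lt_of_pow_lt_pow_left₀ 2 hδ.le
  rw [norm_LE_sq]
  refine (integral_mono_ae (integrable_norm_sq _) (hI.add hI2) ?_).trans_lt ?_
  · filter_upwards [coeFn_stepL (hm i) (hv i), coeFn_stepL (hm j) (hv j),
      Lp.coeFn_sub (stepL (m i) (v i)) (stepL (m j) (v j)), ae_restrict_mem measurableSet_Ici]
      with x h1 h2 h3 hx
    rw [h3]
    simp only [Pi.add_apply, Pi.sub_apply, h1, h2]
    have hx0 : (0 : ℝ) ≤ x := hx
    have n1 := np i x
    have n2 := np j x
    by_cases hxR : x ∈ Icc (0 : ℝ) (R + 1)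
    · rw [indicator_of_mem hxR]
      have hmem : x.toNNReal ∈ Iic (R + 1) := by
        rw [mem_Iic, Real.toNNReal_le_iff_le_coe]; exact hxR.2
      have a1 := (hJ i hi).1 _ hmem
      have a2 := (hJ j hj).1 _ hmem
      have a3 : ‖step (m i) (v i) x.toNNReal - step (m j) (v j) x.toNNReal‖ ≤ √c := by
        rw [← dist_eq_norm]
        refine (dist_triangle_left _ _ (f x.toNNReal)).trans ?_
        linarith
      have a4 := pow_le_pow_left₀ (norm_nonneg _) a3 2
      rw [Real.sq_sqrt hε.le] at a4
      have : 0 ≤ (2 * (H R)⁻¹) * (q i x + q j x) := by positivity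
      linarith
    · rw [indicator_of_notMem hxR]
      have hgt : R + 1 < x.toNNReal := by
        rw [Real.lt_toNNReal_iff_coe_lt]
        simp only [mem_Icc, not_and, not_le] at hxR
        exact_mod_cast hxR hx0
      have a1 := norm_step_sq_le_of_lt (hJ i hi).2 Hmono Hpos (v i) hgt
      have a2 := norm_step_sq_le_of_lt (hJ j hj).2 Hmono Hpos (v j) hgt
      have a3 := norm_sub_le (step (m i) (v i) x.toNNReal) (step (m j) (v j) x.toNNReal)
      have a4 := pow_le_pow_left₀ (norm_nonneg _) a3 2
      change _ ≤ (H R)⁻¹ * q i x at a1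
      change _ ≤ (H R)⁻¹ * q j x at a2
      nlinarith [sq_nonneg (‖step (m i) (v i) x.toNNReal‖ - ‖step (m j) (v j) x.toNNReal‖)]
  · have e : (R + 1 : ℝ) * c = δ ^ 2 / 4 := by rw [hc]; field_simp
    simp only [Pi.add_apply]
    rw [integral_add hI hI2, integral_const_mul, integral_add (hq i) (hq j),
      integral_indicator_const _ measurableSet_Icc, measureReal_def,
      Measure.restrict_apply measurableSet_Icc, inter_eq_self_of_subset_left Icc_subset_Ici_self,
      Real.volume_Icc, smul_eq_mul, sub_zero, ENNReal.toReal_ofReal (by positivity), e]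
    have := mul_le_mul_of_nonneg_left (add_le_add (hqC i) (hqC j))
      (show 0 ≤ 2 * (H R)⁻¹ by positivity)
    have : 0 < δ ^ 2 := by positivity
    linarith

include hm hv in
theorem ae_eq_of_tendsto_stepL {f : ℝ≥0 → E}
    (hf : ∀ R, TendstoUniformlyOn (fun j => step (m j) (v j)) f atTop (Iic R))
    {V : LE E} (hV : Tendsto (fun j => stepL (m j) (v j)) atTop (𝓝 V)) :
    V =ᵐ[halfLine] fun x => f x.toNNReal := by
  obtain ⟨s, hs, hae⟩ := (tendstoInMeasure_of_tendsto_Lp hV).exists_seq_tendsto_ae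
  have hall : ∀ᵐ x ∂halfLine, ∀ j, stepL (m j) (v j) x = step (m j) (v j) x.toNNReal :=
    ae_all_iff.2 fun j => coeFn_stepL (hm j) (hv j)
  filter_upwards [hae, hall] with x h1 h2
  have h3 := ((hf x.toNNReal).tendsto_at (mem_Iic.2 le_rfl)).comp hs.tendsto_atTop
  refine tendsto_nhds_unique h1 (h3.congr fun j => ?_)
  rw [Function.comp_apply, h2]

end Limits

section Limits

variable (hm : ∀ j, 0 < m j) (hmt : Tendsto m atTop atTop) {N : ℕ → ℕ} {v : ℕ → ℕ → E}
  (hv : ∀ j l, N j ≤ l → v j l = 0)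

include hm hmt hv in
/-- The limit of lattice functions is the integral of the weak limit of the difference quotients. -/
theorem LatticeLimit.eq_integral [CompleteSpace E] {f g : ℝ → E} (h : LatticeLimit m v f g) {x : ℝ}
    (hx : 0 ≤ x) :
    f x = f 0 + ∫ t in (0 : ℝ)..x, g t := by
  rw [← sub_eq_iff_eq_add']
  refine ext_inner_left ℝ fun e => ?_
  have hfin : halfLine (Ico 0 x) ≠ ⊤ := ((Measure.restrict_apply_le _ _).trans_lt (by simp)).ne
  set ψ : LE E := indicatorConstLp 2 measurableSet_Ico hfin e with hψ
  set c : ℕ → ℕ → E := fun j l => if l < ⌊m j * x⌋₊ then e else 0 with hc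
  have hcz : ∀ j l, ⌊m j * x⌋₊ ≤ l → c j l = 0 := fun j l hl => by simp [hc, hl]
  have hstrong : Tendsto (fun j => stepL (m j) (c j)) atTop (𝓝 ψ) := by
    refine tendsto_toLp_of_dominated (R := x) (B := ‖e‖) (fun j => ?_) ?_
    · filter_upwards [coeFn_stepL (hm j) (hcz j), ae_restrict_mem measurableSet_Ici] with y hy hy0
      rw [hy]
      by_cases hyx : y ∈ Icc 0 x
      · rw [indicator_of_mem hyx]
        simp only [step, hc]
        split_ifs <;> simp
      · rw [indicator_of_notMem hyx]
        simp only [mem_Icc, not_and, not_le] at hyx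
        have hy1 := hyx hy0
        rw [step, hcz]; · simp
        refine Nat.floor_mono ?_
        rw [Real.coe_toNNReal _ hy0]
        have := hm j
        gcongr
    · have hall : ∀ᵐ y ∂halfLine, ∀ j, stepL (m j) (c j) y = step (m j) (c j) y.toNNReal :=
        ae_all_iff.2 fun j => coeFn_stepL (hm j) (hcz j)
      have hne : ∀ᵐ y ∂halfLine, y ≠ x := by
        refine ae_restrict_of_ae ?_
        exact (measure_singleton x : volume {x} = 0) |> fun h => compl_mem_ae_iff.2 h
      filter_upwards [hall, ae_restrict_mem measurableSet_Ici, hne,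
        indicatorConstLp_coeFn (p := 2) (hs := measurableSet_Ico) (hμs := hfin) (c := e)]
        with y h1 hy0 hyx h2
      have hy0' : (0 : ℝ) ≤ y := hy0
      rw [hψ, h2]
      simp only [h1, step, Real.coe_toNNReal _ hy0']
      rcases lt_or_gt_of_ne hyx with hlt | hgt
      · rw [indicator_of_mem (show y ∈ Ico 0 x from ⟨hy0', hlt⟩)]
        refine tendsto_const_nhds.congr' ?_
        filter_upwards [hmt.eventually_ge_atTop ((x - y)⁻¹)] with j hj
        have hj2 : 1 ≤ m j * (x - y) := by
          have : 0 < x - y := by linarith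
          rwa [inv_eq_one_div, div_le_iff₀ this] at hj
        have : ⌊m j * y⌋₊ < ⌊m j * x⌋₊ := by
          have h0 : 0 ≤ m j * y := by have := hm j; positivity
          rw [Nat.lt_iff_add_one_le, ← Nat.floor_add_one h0]
          exact Nat.floor_mono (by linarith)
        simp [hc, this]
      · rw [indicator_of_notMem (by simp [hgt.le])]
        refine tendsto_const_nhds.congr fun j => ?_
        rw [hcz]
        have := hm j
        exact Nat.floor_mono (by gcongr)
  obtain ⟨C, hC⟩ := h.bdd
  have h1 := tendsto_inner_of_weak hstrong hC h.weak
  have e1 : ⟪ψ, h.memLp_deriv.toLp⟫ = ⟪e, ∫ t in (0 : ℝ)..x, g t⟫ := by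
    rw [hψ, L2.inner_indicatorConstLp_eq_inner_setIntegral, intervalIntegral.integral_of_le hx,
      integral_Ioc_eq_integral_Ioo, ← integral_Ico_eq_integral_Ioo,
      Measure.restrict_restrict_of_subset Ico_subset_Ici_self]
    congr 1
    refine integral_congr_ae ?_
    exact ae_mono (Measure.restrict_mono Ico_subset_Ici_self le_rfl)
      (MemLp.coeFn_toLp h.memLp_deriv)
  rw [e1] at h1
  have e2 : ∀ j, ⟪stepL (m j) (c j), stepL (m j) (dq (m j) (v j))⟫ =
      ⟪e, step (m j) (v j) x.toNNReal - step (m j) (v j) 0⟫ := by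
    intro j
    rw [inner_stepL (hm j) (hcz j) (dq_eq_zero (hv j))]
    have : ∀ l ∈ range ⌊m j * x⌋₊, ⟪c j l, dq (m j) (v j) l⟫ =
        m j * (⟪e, v j (l + 1)⟫ - ⟪e, v j l⟫) := by
      intro l hl
      simp only [hc, if_pos (Finset.mem_range.1 hl), dq, inner_smul_right, inner_sub_right]
    rw [sum_congr rfl this, ← mul_sum, Finset.sum_range_sub (fun l => ⟪e, v j l⟫),
      inv_mul_cancel_left₀ (hm j).ne', inner_sub_right]
    simp [step, hx]
  have h2 : Tendsto (fun j => ⟪e, step (m j) (v j) x.toNNReal - step (m j) (v j) 0⟫) atTop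
      (𝓝 ⟪e, f x - f 0⟫) := by
    have a1 := (h.unif x.toNNReal).tendsto_at (mem_Iic.2 le_rfl)
    have a2 := (h.unif 0).tendsto_at (mem_Iic.2 le_rfl)
    simp only [Real.coe_toNNReal _ hx, NNReal.coe_zero] at a1 a2
    exact (tendsto_const_nhds (x := e)).inner (a1.sub a2)
  exact tendsto_nhds_unique h2 (by simpa only [e2] using h1)

include hm hmt hv in
/-- Fatou's lemma for the weighted mass. -/
theorem lintegral_weight_le {H : ℝ≥0 → ℝ} (Hcont : Continuous H) (Hpos : ∀ x, 0 < H x)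
    (hW : ∀ j, wmass (m j) (N j) (latticeWeight H (m j)) (v j) ≤ C)
    {f : ℝ → E} (hf : ∀ x : ℝ≥0, Tendsto (fun j => step (m j) (v j) x) atTop (𝓝 (f x))) :
    ∫⁻ x in ℝ₊, ofReal (H x.toNNReal) * ‖f x‖ₑ ^ 2 ≤ ofReal C := by
  set F : ℕ → ℝ → ℝ≥0∞ := fun j x =>
    ofReal (step (m j) (fun l => latticeWeight H (m j) l * ‖v j l‖ ^ 2) x.toNNReal) with hF
  have hlim : ∀ᵐ x ∂halfLine, Tendsto (fun j => F j x) atTop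
      (𝓝 (ofReal (H x.toNNReal) * ‖f x‖ₑ ^ 2)) := by
    filter_upwards [ae_restrict_mem measurableSet_Ici] with x hx
    have hx' : ((x.toNNReal : ℝ≥0) : ℝ) = x := Real.coe_toNNReal _ hx
    have h1 := (Hcont.tendsto _).comp (tendsto_floor_div hmt x.toNNReal)
    have h2 := (((hf x.toNNReal).norm).pow 2)
    have h3 := ENNReal.tendsto_ofReal (h1.mul h2)
    rw [hx', ENNReal.ofReal_mul (Hpos _).le, ENNReal.ofReal_pow (norm_nonneg _), ofReal_norm] at h3
    refine h3.congr fun j => ?_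
    simp only [hF, step, latticeWeight, Function.comp_apply, hx']
  calc ∫⁻ x in ℝ₊, ofReal (H x.toNNReal) * ‖f x‖ₑ ^ 2
      = ∫⁻ x in ℝ₊, liminf (fun j => F j x) atTop :=
        lintegral_congr_ae (hlim.mono fun x hx => hx.liminf_eq.symm)
    _ ≤ liminf (fun j => ∫⁻ x in ℝ₊, F j x) atTop := by
        refine lintegral_liminf_le fun j => ?_
        exact ((stronglyMeasurable_step _ _).measurable).ennreal_ofReal
    _ ≤ liminf (fun _ : ℕ => ofReal C) atTop := by
        refine liminf_le_liminf (.of_forall fun j => ?_)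
        rw [hF, ← ofReal_integral_eq_lintegral_ofReal, integral_step_wmass (hm j) _ (hv j)]
        · exact ENNReal.ofReal_le_ofReal (hW j)
        · exact step_integrable (hm j) (N := N j) fun l hl => by simp [hv j l hl]
        · exact .of_forall fun x => mul_nonneg (Hpos _).le (sq_nonneg _)
    _ = ofReal C := by simp

include hm hmt hv in
/-- Lattice functions of bounded energy have subsequential limits. -/
theorem exists_latticeLimit [FiniteDimensional ℝ E] {H : ℝ≥0 → ℝ} (Hmono : Monotone H)
    (Hpos : ∀ x, 0 < H x) (Hu : ¬ BddAbove (range H))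
    (hk : ∀ j, kin (m j) (N j) (v j) ≤ C) (hS : ∀ j, mass (m j) (N j) (v j) ≤ C)
    (hW : ∀ j, wmass (m j) (N j) (latticeWeight H (m j)) (v j) ≤ C) :
    ∃ (t : ℕ → ℕ) (f g : ℝ → E), StrictMono t ∧
      LatticeLimit (fun j => m (t j)) (fun j => v (t j)) f g := by
  have : CompleteSpace E := FiniteDimensional.complete ℝ E
  obtain ⟨t₁, f, ht₁, hfc, hf⟩ := exists_locally_uniform_limit hm hmt hv hk hS
  have hb : ∀ j, ‖stepL (m (t₁ j)) (dq (m (t₁ j)) (v (t₁ j)))‖ ≤ √C := fun j =>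
    Real.le_sqrt_of_sq_le (by rw [norm_stepL_dq_sq (hm _) (hv _)]; exact hk _)
  obtain ⟨t₂, g, ht₂, hg⟩ := exists_weak_limit hb
  have hcau := cauchySeq_stepL (fun j => hm (t₁ j)) (hmt.comp ht₁.tendsto_atTop)
    (fun j => hv (t₁ j)) Hmono Hpos Hu (fun j => hW (t₁ j)) hf
  obtain ⟨V, hV⟩ := cauchySeq_tendsto_of_complete hcau
  have hVf := ae_eq_of_tendsto_stepL (fun j => hm (t₁ j)) (fun j => hv (t₁ j)) hf hV
  have hfL : MemL2(fun x : ℝ => f x.toNNReal) := (Lp.memLp V).ae_eq hVf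
  refine ⟨t₁ ∘ t₂, fun x => f x.toNNReal, g, ht₁.comp ht₂,
    ⟨by fun_prop, hfL, Lp.memLp g, ?_, ?_, ?_, ⟨√C, fun j => hb (t₂ j)⟩⟩⟩
  · intro R
    simp only [Real.toNNReal_coe]
    exact fun u hu => ht₂.tendsto_atTop.eventually (hf R u hu)
  · have : hfL.toLp = V := Lp.ext (hfL.coeFn_toLp.trans hVf.symm)
    rw [this]
    exact hV.comp ht₂.tendsto_atTop
  · intro ψ
    rw [Lp.toLp_coeFn]
    exact hg ψ

end Limits

/-! ### Density of the test functions -/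

section Density

open scoped ContDiff

theorem norm_smul_le_of_le_one {c : ℝ} (hc : ‖c‖ ≤ 1) (v : E) : ‖c • v‖ ≤ ‖v‖ := by
  rw [norm_smul]; exact mul_le_of_le_one_left (norm_nonneg _) hc

/-- Square integrable functions on the half-line are approximated by smooth functions that vanish
near the origin. -/
theorem exists_smooth_near [FiniteDimensional ℝ E] {g : ℝ → E} (hg : MemL2(g)) {ε : ℝ}
    (hε : 0 < ε) : ∃ (h : ℝ → E) (δ : ℝ), 0 < δ ∧ ContDiff ℝ ∞ h ∧ (∀ x ≤ δ, h x = 0) ∧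
      MemL2(h) ∧ eLpNorm (fun x => h x - g x) 2 halfLine ≤ ofReal ε := by
  obtain ⟨h, hcs, hsm, hap⟩ := ((memLp_indicator_iff_restrict measurableSet_Ici).2
    hg).exist_eLpNorm_sub_le (by norm_num) (by norm_num) (half_pos hε)
  have hh : MemL2(h) := (hsm.continuous.memLp_of_hasCompactSupport hcs).restrict _
  set s : ℕ → ℝ → ℝ := fun k x => Real.smoothTransition ((k + 1) * x - 1) with hs
  have hss : ∀ k, ContDiff ℝ ∞ (s k) := fun k => Real.smoothTransition.contDiff.comp (by fun_prop)
  have hle : ∀ k x, ‖s k x - 1‖ ≤ 1 := fun k x => by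
    rw [Real.norm_eq_abs, abs_le]
    constructor <;> linarith [Real.smoothTransition.nonneg ((k + 1) * x - 1),
      Real.smoothTransition.le_one ((k + 1) * x - 1)]
  have hm : ∀ k, MemL2(fun x => (s k x - 1) • h x) := fun k =>
    hh.of_le (((hss k).continuous.sub continuous_const).smul hsm.continuous).aestronglyMeasurable
      (.of_forall fun x => norm_smul_le_of_le_one (hle k x) _)
  have hlim := tendsto_eLpNorm_of_dominated hh.norm (fun k => (hm k).1)
    (fun k => .of_forall fun x => norm_smul_le_of_le_one (hle k x) _) (by
    filter_upwards [ae_restrict_mem measurableSet_Ici, ae_restrict_of_ae (Measure.ae_ne volume 0)]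
      with x hx hx0
    have hx' : 0 < x := lt_of_le_of_ne hx (Ne.symm hx0)
    refine tendsto_const_nhds.congr' ?_
    filter_upwards [eventually_ge_atTop ⌈2 / x⌉₊] with k hk
    have h1 : 2 / x ≤ k := Nat.ceil_le.1 hk
    rw [div_le_iff₀ hx'] at h1
    rw [show s k x = 1 from Real.smoothTransition.one_of_one_le (by nlinarith), sub_self,
      zero_smul])
  obtain ⟨k, hk⟩ := (hlim.eventually (gt_mem_nhds (ENNReal.ofReal_pos.2 (half_pos hε)))).exists
  have e1 : (fun x => s k x • h x) = fun x => (s k x - 1) • h x + h x := by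
    ext x; rw [sub_smul, one_smul, sub_add_cancel]
  refine ⟨fun x => s k x • h x, 1 / (k + 1), by positivity, (hss k).smul hsm, fun x hx => ?_,
    e1 ▸ (hm k).add hh, ?_⟩
  · rw [le_div_iff₀ (by positivity)] at hx
    change s k x • h x = 0
    rw [show s k x = 0 from Real.smoothTransition.zero_of_nonpos (by linarith), zero_smul]
  · have e2 : (fun x => s k x • h x - g x) = (fun x => (s k x - 1) • h x) + fun x => h x - g x := by
      ext x; rw [Pi.add_apply, sub_smul, one_smul, sub_add_sub_cancel]
    rw [e2, ← add_halves ε, ENNReal.ofReal_add (half_pos hε).le (half_pos hε).le]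
    refine (eLpNorm_add_le (hm k).1 (hh.1.sub hg.1) one_le_two).trans (add_le_add hk.le ?_)
    rw [← eLpNorm_neg]
    refine (eLpNorm_congr_ae ?_).trans_le
      ((eLpNorm_mono_measure (ν := halfLine) _ Measure.restrict_le_self).trans hap)
    filter_upwards [ae_restrict_mem measurableSet_Ici] with x hx
    simp [indicator_of_mem hx]

/-- The Cauchy–Schwarz inequality for primitives. -/
theorem norm_integral_le_of_eLpNorm {h : ℝ → E} (hh : MemL2(h)) {ε : ℝ} (hε : 0 ≤ ε)
    (hb : eLpNorm h 2 halfLine ≤ ofReal ε) {x : ℝ} (hx : 0 ≤ x) :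
    ‖∫ t in (0 : ℝ)..x, h t‖ ≤ ε * √x := by
  have hle : volume.restrict (Ioc 0 x) ≤ halfLine :=
    Measure.restrict_mono (fun y hy => hy.1.le) le_rfl
  rw [intervalIntegral.integral_of_le hx, ← ENNReal.ofReal_le_ofReal_iff (by positivity),
    ofReal_norm, ENNReal.ofReal_mul hε, Real.sqrt_eq_rpow, ← ENNReal.ofReal_rpow_of_nonneg hx
      (by norm_num)]
  refine (enorm_integral_le_lintegral_enorm _).trans ?_
  rw [← eLpNorm_one_eq_lintegral_enorm]
  refine (eLpNorm_le_eLpNorm_mul_rpow_measure_univ one_le_two (hh.1.mono_measure hle)).trans ?_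
  refine mul_le_mul' ((eLpNorm_mono_measure _ hle).trans hb) (le_of_eq ?_)
  rw [Measure.restrict_apply_univ, Real.volume_Ioc, sub_zero]
  norm_num

theorem tendsto_ofReal_one_div : Tendsto (fun n : ℕ => ofReal (1 / ((n : ℝ) + 1))) atTop (𝓝 0) := by
  simpa using ENNReal.tendsto_ofReal tendsto_one_div_add_atTop_nhds_zero_nat

/-- A function of finite energy is approximated by smooth compactly supported functions that are
constant near the origin. The approximation integrates a smooth approximation of the derivative and
then cuts off, so that no product rule for `f` itself is needed. -/
theorem exists_smooth_approx [FiniteDimensional ℝ E] {f g : ℝ → E} (hf : MemL2(f))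
    (hg : MemL2(g)) (hfg : ∀ x, 0 ≤ x → f x = f 0 + ∫ t in (0 : ℝ)..x, g t) {W : ℝ → ℝ}
    (hW : Continuous W) (hWf : MemL2(fun x => W x • f x)) {τ : ℝ≥0∞} (hτ : 0 < τ) :
    ∃ φ : ℝ → E, ContDiff ℝ ∞ φ ∧ HasCompactSupport φ ∧ (∃ δ > 0, ∀ x ∈ Icc (0 : ℝ) δ, φ x = f 0) ∧
      eLpNorm (fun x => deriv φ x - g x) 2 halfLine ≤ τ + τ + τ ∧
      eLpNorm (fun x => W x • (φ x - f x)) 2 halfLine ≤ τ + τ := by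
  have : CompleteSpace E := FiniteDimensional.complete ℝ E
  let χ : ContDiffBump (0 : ℝ) := ⟨1, 2, by norm_num, by norm_num⟩
  have hχ : ContDiff ℝ ∞ χ := χ.contDiff
  have hχ' := hχ.continuous_deriv (by simp)
  obtain ⟨B, hB⟩ := hχ'.bounded_above_of_compact_support χ.hasCompactSupport.deriv
  -- the cutoff functions and the truncation errors, which vanish in the limit
  set a : ℕ → ℝ := fun k => 1 / ((k : ℝ) + 1) with ha
  have ha0 : Tendsto a atTop (𝓝 0) := tendsto_one_div_add_atTop_nhds_zero_nat
  have hapos : ∀ k, 0 < a k := fun k => by positivity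
  have ha1 : ∀ k, ‖a k‖ ≤ 1 := fun k => by
    rw [Real.norm_of_nonneg (hapos k).le, ha, div_le_one (by positivity)]
    linarith [Nat.cast_nonneg (α := ℝ) k]
  have hcd : ∀ k x, deriv (fun x => χ (a k * x)) x = a k * deriv χ (a k * x) := fun k x =>
    deriv_comp_mul_left (a k) χ x
  have hax : ∀ x, Tendsto (fun k => a k * x) atTop (𝓝 0) := fun x => by simpa using ha0.mul_const x
  have hc1 : ∀ x, Tendsto (fun k => χ (a k * x) - 1) atTop (𝓝 0) := fun x => by
    have := ((hχ.continuous.tendsto 0).comp (hax x)).sub_const 1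
    rwa [χ.one_of_mem_closedBall (Metric.mem_closedBall_self zero_le_one), sub_self] at this
  have hcle : ∀ x, ‖χ x - 1‖ ≤ 1 ∧ ‖χ x‖ ≤ 1 := fun x => by
    rw [Real.norm_eq_abs, Real.norm_eq_abs, abs_le, abs_le]
    have := χ.nonneg (x := x); have := χ.le_one (x := x)
    constructor <;> constructor <;> linarith
  have hcont : ∀ k, Continuous fun x => χ (a k * x) := fun k => hχ.continuous.comp (by fun_prop)
  have hcont' : ∀ k, Continuous fun x => a k * deriv χ (a k * x) := fun k =>
    continuous_const.mul (hχ'.comp (by fun_prop))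
  have hm1 : ∀ k, AEStronglyMeasurable (fun x => (χ (a k * x) - 1) • g x +
      (a k * deriv χ (a k * x)) • f x) halfLine := fun k =>
    (((hcont k).sub continuous_const).aestronglyMeasurable.smul hg.1).add
      ((hcont' k).aestronglyMeasurable.smul hf.1)
  have hm2 : ∀ k, AEStronglyMeasurable (fun x => (χ (a k * x) - 1) • W x • f x) halfLine :=
    fun k => ((hcont k).sub continuous_const).aestronglyMeasurable.smul hWf.1
  have t1 := tendsto_eLpNorm_of_dominated (hg.norm.add (hf.norm.const_mul B)) hm1
    (fun k => .of_forall fun x => by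
      refine (norm_add_le _ _).trans (add_le_add ?_ ?_)
      · exact norm_smul_le_of_le_one (hcle _).1 _
      · rw [norm_smul, norm_mul]
        exact mul_le_mul_of_nonneg_right ((mul_le_of_le_one_left (norm_nonneg _) (ha1 k)).trans
          (hB _)) (norm_nonneg _))
    (.of_forall fun x => by
      simpa using ((hc1 x).smul_const (g x)).add
        ((ha0.mul ((hχ'.tendsto 0).comp (hax x))).smul_const (f x)))
  have t2 := tendsto_eLpNorm_of_dominated hWf.norm hm2
    (fun k => .of_forall fun x => norm_smul_le_of_le_one (hcle _).1 _)
    (.of_forall fun x => by simpa using (hc1 x).smul_const (W x • f x))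
  obtain ⟨k, hk1, hk2⟩ := ((t1.eventually (gt_mem_nhds hτ)).and
    (t2.eventually (gt_mem_nhds hτ))).exists
  set c : ℝ → ℝ := fun x => χ (a k * x) with hc
  have hcs : HasCompactSupport c := by
    simpa only [smul_eq_mul] using χ.hasCompactSupport.comp_smul (hapos k).ne'
  have hcsm : ContDiff ℝ ∞ c := hχ.comp (by fun_prop)
  have hcL : ∀ {θ : ℝ → ℝ}, HasCompactSupport θ → Continuous θ →
      MemL2(fun x => θ x * √x) := fun h1 h2 =>
    ((h2.mul Real.continuous_sqrt).memLp_of_hasCompactSupport h1.mul_right).restrict _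
  have hd : Continuous (deriv c) := hcsm.continuous_deriv (by simp)
  have hD := hcL hcs.deriv hd
  have hD' := hcL (hcs.mul_left (f := W)) (hW.mul hcsm.continuous)
  -- the accuracy of the smooth approximation of the derivative, given the cutoff
  have he := tendsto_ofReal_one_div
  have he' : ∀ {D : ℝ≥0∞}, D < ⊤ → ∀ᶠ n : ℕ in atTop, ofReal (1 / ((n : ℝ) + 1)) * D < τ :=
    fun hD => (by simpa using ENNReal.Tendsto.mul_const he (Or.inr hD.ne) :
      Tendsto _ _ (𝓝 (0 : ℝ≥0∞))).eventually (gt_mem_nhds hτ)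
  obtain ⟨n, hn0, hn1, hn2⟩ := ((he.eventually (gt_mem_nhds hτ)).and
    ((he' hD.2).and (he' hD'.2))).exists
  have hε : (0 : ℝ) < 1 / (n + 1) := by positivity
  obtain ⟨h, δ, hδ, hsm, hvan, hhL, hap⟩ := exists_smooth_near hg hε
  set p : ℝ → E := fun x => f 0 + ∫ t in (0 : ℝ)..x, h t with hp
  have hpd : ∀ x, HasDerivAt p (h x) x := fun x =>
    ((hsm.continuous.integral_hasStrictDerivAt 0 x).hasDerivAt).const_add _
  have hpsm : ContDiff ℝ ∞ p := contDiff_infty_iff_deriv.2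
    ⟨fun x => (hpd x).differentiableAt, by rwa [show deriv p = h from funext fun x =>
      (hpd x).deriv]⟩
  have hpf : ∀ᵐ x ∂halfLine, ‖p x - f x‖ ≤ 1 / (n + 1) * √x := by
    filter_upwards [ae_restrict_mem measurableSet_Ici] with x hx
    have hii : ∀ k : ℝ → E, MemL2(k) → IntervalIntegrable k volume 0 x := fun k hk => by
      rw [intervalIntegrable_iff_integrableOn_Ioc_of_le hx]
      exact (hk.mono_measure (Measure.restrict_mono (fun y hy => hy.1.le) le_rfl) :
        MemLp k 2 (volume.restrict (Ioc 0 x))).integrable one_le_two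
    rw [hfg x hx, hp]
    simp only [add_sub_add_left_eq_sub]
    rw [← intervalIntegral.integral_sub (hii h hhL) (hii g hg)]
    exact norm_integral_le_of_eLpNorm (hhL.sub hg) hε.le hap hx
  have hpm : AEStronglyMeasurable (fun x => p x - f x) halfLine :=
    hpsm.continuous.aestronglyMeasurable.sub hf.1
  have hq : ∀ {θ : ℝ → ℝ}, eLpNorm (fun x => θ x • (p x - f x)) 2 halfLine ≤
      ofReal (1 / (n + 1)) * eLpNorm (fun x => θ x * √x) 2 halfLine := fun {θ} =>
    eLpNorm_le_mul_eLpNorm_of_ae_le_mul (by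
      filter_upwards [hpf] with x hx
      rw [norm_smul, norm_mul, Real.norm_of_nonneg (Real.sqrt_nonneg x), mul_left_comm]
      gcongr) _
  refine ⟨fun x => c x • p x, hcsm.smul hpsm, hcs.smul_right, ⟨min δ 1, by positivity,
    fun x hx => ?_⟩, ?_, ?_⟩
  · have h0 : ∫ t in (0 : ℝ)..x, h t = 0 := by
      rw [intervalIntegral.integral_congr (g := fun _ => 0) fun t ht => hvan t ?_]
      · simp
      · rw [uIcc_of_le hx.1] at ht
        exact ht.2.trans (hx.2.trans (min_le_left _ _))
    have h1 : c x = 1 := χ.one_of_mem_closedBall (by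
      rw [Metric.mem_closedBall, dist_zero_right, norm_mul, Real.norm_of_nonneg hx.1]
      exact mul_le_one₀ (ha1 k) hx.1 (hx.2.trans (min_le_right _ _)))
    change c x • (f 0 + ∫ t in (0 : ℝ)..x, h t) = f 0
    rw [h0, h1, add_zero, one_smul]
  · have e : (fun x => deriv (fun x => c x • p x) x - g x) = ((fun x => c x • (h x - g x)) +
        fun x => deriv c x • (p x - f x)) + fun x => (c x - 1) • g x + (a k * deriv χ (a k * x)) • f
          x := by
      ext x
      have h1 : deriv (fun x => c x • p x) x = c x • h x + deriv c x • p x :=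
        ((hcsm.differentiable (by simp) x).hasDerivAt.smul (hpd x)).deriv
      simp only [Pi.add_apply, h1, show deriv c x = _ from hcd k x]
      module
    have m1 : AEStronglyMeasurable (fun x => c x • (h x - g x)) halfLine :=
      hcsm.continuous.aestronglyMeasurable.smul (hhL.1.sub hg.1)
    have m2 := hd.aestronglyMeasurable (μ := halfLine).smul hpm
    rw [e]
    refine (eLpNorm_add_le (m1.add m2) (hm1 k) one_le_two).trans (add_le_add
      ((eLpNorm_add_le m1 m2 one_le_two).trans (add_le_add ?_ (hq.trans hn1.le))) hk1.le)
    refine (eLpNorm_mono fun x => ?_).trans (hap.trans hn0.le)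
    exact norm_smul_le_of_le_one (hcle _).2 _
  · have e : (fun x => W x • (c x • p x - f x)) = (fun x => (W x * c x) • (p x - f x)) +
        fun x => (c x - 1) • W x • f x := by
      ext x; simp only [Pi.add_apply]; module
    rw [e]
    exact (eLpNorm_add_le ((hW.mul hcsm.continuous).aestronglyMeasurable.smul hpm) (hm2 k)
      one_le_two).trans (add_le_add (hq.trans hn2.le) hk2.le)

end Density

section Lstar

/-- Functions of finite energy that satisfy the Dirichlet conditions belong to `L*`. -/
theorem memLstar_of_energy {η : ℝ≥0 → ℝ} (Hc : Continuous η) (Hpos : ∀ x, 0 < η x)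
    (hf : Continuous f)
    (hfL : MemL2(f)) (hg : MemL2(g))
    (hfg : ∀ x, 0 ≤ x → f x = f 0 + ∫ t in (0 : ℝ)..x, g t)
    (hint : ∫⁻ x in ℝ₊, ofReal (η x.toNNReal) * ‖f x‖ₑ ^ 2 < ⊤)
    (hdir : ∀ i, w i = ⊤ → dag (u i) (f 0) = 0) : MemLstar η u w f g := by
  set W : ℝ → ℝ := fun x => √(1 + η x.toNNReal) with hWdef
  have hW : Continuous W := by fun_prop
  have hp : ∀ x : ℝ, 0 ≤ 1 + η x.toNNReal := fun x => by linarith [Hpos x.toNNReal]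
  have hWe : ∀ x (v : Vec F r), ‖W x • v‖ₑ ^ 2 = ofReal (1 + η x.toNNReal) * ‖v‖ₑ ^ 2 :=
    fun x v => by
      rw [← ofReal_norm, ← ofReal_norm, norm_smul, Real.norm_of_nonneg (Real.sqrt_nonneg _),
        ← ENNReal.ofReal_pow (by positivity), ← ENNReal.ofReal_pow (norm_nonneg _),
        ← ENNReal.ofReal_mul (hp x), mul_pow, Real.sq_sqrt (hp x)]
  have hsq : ∀ h : ℝ → Vec F r, ∫⁻ x in ℝ₊, ‖h x‖ₑ ^ 2 = eLpNorm h 2 halfLine ^ 2 :=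
    fun h => by rw [eLpNorm_two_eq, ← ENNReal.rpow_mul_natCast]; norm_num
  have hWf : MemL2(fun x => W x • f x) := by
    refine ⟨(hW.smul hf).aestronglyMeasurable, ?_⟩
    have : ∫⁻ x in ℝ₊, ‖W x • f x‖ₑ ^ 2 < ⊤ := by
      simp only [hWe, ENNReal.ofReal_add zero_le_one (Hpos _).le, ENNReal.ofReal_one, add_mul,
        one_mul]
      rw [lintegral_add_left' (hfL.1.enorm.pow_const 2), hsq]
      exact ENNReal.add_lt_top.2 ⟨ENNReal.pow_lt_top hfL.2, hint⟩
    rw [eLpNorm_two_eq]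
    exact ENNReal.rpow_lt_top_of_nonneg (by norm_num) this.ne
  set e : ℕ → ℝ≥0∞ := fun k => ofReal (1 / ((k : ℝ) + 1)) with he
  have hz : Tendsto e atTop (𝓝 0) := tendsto_ofReal_one_div
  choose φ h1 h2 h3 h4 h5 using fun k : ℕ => exists_smooth_approx hfL hg hfg hW hWf
    (show 0 < e k from ENNReal.ofReal_pos.2 (by positivity))
  refine ⟨hf.continuousOn, hg.1, φ, fun k => ⟨h1 k, h2 k, fun i hi => ?_⟩, ?_⟩
  · obtain ⟨δ, hδ, hφ⟩ := h3 k
    exact ⟨δ, hδ, fun x hx => by rw [hφ x hx, hdir i hi]⟩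
  · have hz' := (ENNReal.Tendsto.pow (n := 2) ((hz.add hz).add hz)).add
      (ENNReal.Tendsto.pow (n := 2) (hz.add hz))
    simp only [add_zero, ne_eq, two_ne_zero, not_false_eq_true, zero_pow] at hz'
    refine tendsto_of_tendsto_of_tendsto_of_le_of_le tendsto_const_nhds hz' (fun _ => zero_le)
      fun k => ?_
    obtain ⟨δ, hδ, hφ⟩ := h3 k
    have h0 : φ k 0 - f 0 = 0 := by rw [hφ 0 ⟨le_rfl, hδ.le⟩, sub_self]
    have hm : AEStronglyMeasurable (fun x => deriv (φ k) x - g x) halfLine :=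
      ((h1 k).continuous_deriv (by simp)).aestronglyMeasurable.sub hg.1
    simp only [starNormSq, h0, dag_zero_right, enorm_zero, ← hWe]
    rw [lintegral_add_left' (hm.enorm.pow_const 2), hsq, hsq]
    simpa using add_le_add (pow_le_pow_left' (h4 k) 2) (pow_le_pow_left' (h5 k) 2)

end Lstar

/-! ### Convergence of the discrete forms -/

section FormLimit

/-- Lattice functions `φd j` on the lattices of mesh `1 / m j` that are supported in `[0, R)`,
uniformly bounded together with their difference quotients, and converge, again together with their
difference quotients, to `φ` and `φ'`. -/
structure TestLimit (m : ℕ → ℝ) (φd : ℕ → ℕ → E) (φ φ' : ℝ → E) (R B : ℝ) : Prop where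
  nonneg : 0 ≤ B
  cont : Continuous φ
  cont_deriv : Continuous φ'
  supp : ∀ (j l : ℕ), R * m j ≤ l → φd j l = 0
  bound : ∀ j l, ‖φd j l‖ ≤ B
  dbound : ∀ j l, ‖dq (m j) (φd j) l‖ ≤ B
  lim : ∀ K : ℝ≥0, TendstoUniformlyOn (fun j => step (m j) (φd j)) (fun x => φ x) atTop (Iic K)
  dlim : ∀ x : ℝ≥0, Tendsto (fun j => step (m j) (dq (m j) (φd j)) x) atTop (𝓝 (φ' x))

/-- A lattice function that vanishes from `R` on is supported on the first `⌈R m⌉` sites. -/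
theorem supp_ceil {R m : ℝ} {a : ℕ → E} (h : ∀ l : ℕ, R * m ≤ l → a l = 0) :
    ∀ l, ⌈R * m⌉₊ ≤ l → a l = 0 := fun l hl =>
  h l ((Nat.le_ceil _).trans (by exact_mod_cast hl))

theorem norm_step_le_indicator {m R B : ℝ} (hm : 1 ≤ m) (hB : 0 ≤ B) {a : ℕ → E}
    (hs : ∀ l : ℕ, R * m ≤ l → a l = 0) (hb : ∀ l : ℕ, l < R * m → ‖a l‖ ≤ B) {x : ℝ}
    (hx : 0 ≤ x) : ‖step m a x.toNNReal‖ ≤ (Icc 0 (R + 1)).indicator (fun _ => B) x := by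
  simp only [step, Real.coe_toNNReal _ hx]
  by_cases h : (⌊m * x⌋₊ : ℝ) < R * m
  · have h1 : m * x < ⌊m * x⌋₊ + 1 := Nat.lt_floor_add_one _
    rw [indicator_of_mem (show x ∈ Icc 0 (R + 1) from ⟨hx, by nlinarith⟩)]
    exact hb _ h
  · rw [hs _ (not_lt.1 h), norm_zero]
    exact indicator_nonneg (fun _ _ => hB) _

/-- Bounded lattice functions with common support that converge pointwise converge in `L²`. -/
theorem tendsto_stepL_of_pointwise (hm : ∀ j, 1 ≤ m j) {R B : ℝ} (hB : 0 ≤ B)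
    {a : ℕ → ℕ → E} (hs : ∀ j l : ℕ, R * m j ≤ l → a j l = 0)
    (hb : ∀ j l : ℕ, l < R * m j → ‖a j l‖ ≤ B) {Ψ : LE E} {ψ : ℝ → E} (hΨ : Ψ =ᵐ[halfLine] ψ)
    (hlim : ∀ᵐ x ∂halfLine, Tendsto (fun j => step (m j) (a j) x.toNNReal) atTop (𝓝 (ψ x))) :
    Tendsto (fun j => stepL (m j) (a j)) atTop (𝓝 Ψ) := by
  have hc : ∀ j, stepL (m j) (a j) =ᵐ[halfLine] fun x => step (m j) (a j) x.toNNReal := fun j =>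
    coeFn_stepL (zero_lt_one.trans_le (hm j)) (supp_ceil (hs j))
  refine tendsto_toLp_of_dominated (R := R + 1) (B := B) (fun j => ?_) ?_
  · filter_upwards [hc j, ae_restrict_mem measurableSet_Ici] with x hx hx0
    rw [hx]
    exact norm_step_le_indicator (hm j) hB (hs j) (hb j) hx0
  · filter_upwards [hΨ, ae_all_iff.2 hc, hlim] with x h1 h2 h3
    rw [h1]
    simpa only [h2] using h3

theorem tendsto_stepL_act (hm : ∀ j, 1 ≤ m j) {R b B : ℝ} (hb0 : 0 ≤ b) (hB : 0 ≤ B)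
    {T : ℕ → ℕ → E →L[ℝ] E} {T₀ : ℝ → E →L[ℝ] E} {a : ℕ → ℕ → E} {a₀ : ℝ → E}
    (hs : ∀ j l : ℕ, R * m j ≤ l → a j l = 0) (hT : ∀ j l : ℕ, l < R * m j → ‖T j l‖ ≤ b)
    (ha : ∀ j l, ‖a j l‖ ≤ B)
    (hTl : ∀ᵐ x ∂halfLine, Tendsto (fun j => step (m j) (T j) x.toNNReal) atTop (𝓝 (T₀ x)))
    (hal : ∀ᵐ x ∂halfLine, Tendsto (fun j => step (m j) (a j) x.toNNReal) atTop (𝓝 (a₀ x)))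
    {Ψ : LE E} (hΨ : Ψ =ᵐ[halfLine] fun x => T₀ x (a₀ x)) :
    Tendsto (fun j => stepL (m j) fun l => T j l (a j l)) atTop (𝓝 Ψ) := by
  refine tendsto_stepL_of_pointwise hm (mul_nonneg hb0 hB)
    (fun j l hl => by rw [hs j l hl, map_zero])
    (fun j l hl => ?_) hΨ ?_
  · exact (ContinuousLinearMap.le_opNorm _ _).trans
      (mul_le_mul (hT j l hl) (ha j l) (norm_nonneg _) hb0)
  · filter_upwards [hTl, hal] with x h1 h2
    exact (isBoundedBilinearMap_apply.continuous.tendsto (T₀ x, a₀ x)).comp (h1.prodMk_nhds h2)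

theorem eq_zero_of_tendsto_step (hmt : Tendsto m atTop atTop) {a : ℕ → ℕ → E} {R : ℝ}
    (hs : ∀ j l : ℕ, R * m j ≤ l → a j l = 0) {x : ℝ≥0} (hx : R < x) {c : E}
    (h : Tendsto (fun j => step (m j) (a j) x) atTop (𝓝 c)) : c = 0 := by
  refine tendsto_nhds_unique h (tendsto_const_nhds.congr' ?_)
  filter_upwards [hmt.eventually_ge_atTop (1 / (x - R)), hmt.eventually_gt_atTop 0] with j hj hj0
  have h1 : m j * x < ⌊m j * x⌋₊ + 1 := Nat.lt_floor_add_one _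
  rw [div_le_iff₀ (by linarith)] at hj
  exact (hs j _ (by nlinarith)).symm

theorem dq_eq_zero_of_le {R m : ℝ} {a : ℕ → E} (hs : ∀ l : ℕ, R * m ≤ l → a l = 0) :
    ∀ l : ℕ, R * m ≤ l → dq m a l = 0 := fun l hl => by
  rw [dq, hs _ hl, hs _ (hl.trans (by push_cast; linarith)), sub_zero, smul_zero]

theorem ae_tendsto_toNNReal {X : Type*} [TopologicalSpace X] {a : ℕ → ℝ≥0 → X} {b : ℝ → X}
    (h : ∀ x : ℝ≥0, Tendsto (fun j => a j x) atTop (𝓝 (b x))) :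
    ∀ᵐ x ∂halfLine, Tendsto (fun j => a j x.toNNReal) atTop (𝓝 (b x)) := by
  filter_upwards [ae_restrict_mem measurableSet_Ici] with x hx
  simpa only [Real.coe_toNNReal _ (mem_Ici.1 hx)] using h x.toNNReal

theorem TestLimit.eq_zero (hmt : Tendsto m atTop atTop) {φd : ℕ → ℕ → E}
    {φ φ' : ℝ → E} {R B : ℝ} (h : TestLimit m φd φ φ' R B) {x : ℝ} (hx0 : 0 ≤ x) (hx : R < x) :
    φ x = 0 ∧ φ' x = 0 := by
  rw [← Real.coe_toNNReal x hx0] at hx ⊢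
  exact ⟨eq_zero_of_tendsto_step hmt h.supp hx ((h.lim _).tendsto_at (mem_Iic.2 le_rfl)),
    eq_zero_of_tendsto_step hmt (fun j => dq_eq_zero_of_le (h.supp j)) hx (h.dlim _)⟩

/-- A continuous function that vanishes beyond `R` is square integrable. -/
theorem memLp_of_vanish {φ : ℝ → E} (hc : Continuous φ) {R : ℝ}
    (hR : ∀ x, 0 ≤ x → R < x → φ x = 0) :
    MemL2(φ) := by
  obtain ⟨B, hB⟩ := (isCompact_Icc (a := (0 : ℝ)) (b := R)).exists_bound_of_continuousOn
    hc.continuousOn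
  have h1 : MemL2((Icc 0 R).indicator fun _ => B) := memLp_indicator_const 2 measurableSet_Icc B
      (Or.inr ((Measure.restrict_apply_le _ _).trans_lt measure_Icc_lt_top).ne)
  refine MemLp.of_le h1 hc.aestronglyMeasurable ?_
  filter_upwards [ae_restrict_mem measurableSet_Ici] with x hx
  by_cases hxR : x ∈ Icc 0 R
  · rw [indicator_of_mem hxR]
    exact (hB x hxR).trans (le_abs_self B)
  · rw [hR x hx (by simp only [mem_Icc, not_and, not_le] at hxR; exact hxR hx)]
    simp

theorem TestLimit.latticeLimit (hm : ∀ j, 1 ≤ m j) (hmt : Tendsto m atTop atTop)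
    {φd : ℕ → ℕ → E} {φ φ' : ℝ → E} {R B : ℝ} (h : TestLimit m φd φ φ' R B) :
    LatticeLimit m φd φ φ' := by
  have hL := memLp_of_vanish h.cont fun x h0 hx => (h.eq_zero hmt h0 hx).1
  have hL' := memLp_of_vanish h.cont_deriv fun x h0 hx => (h.eq_zero hmt h0 hx).2
  have t2 : Tendsto (fun j => stepL (m j) (dq (m j) (φd j))) atTop (𝓝 hL'.toLp) :=
    tendsto_stepL_of_pointwise hm h.nonneg (fun j => dq_eq_zero_of_le (h.supp j))
      (fun j l _ => h.dbound j l) hL'.coeFn_toLp (ae_tendsto_toNNReal h.dlim)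
  refine ⟨h.cont, hL, hL', h.lim, ?_, fun ψ => (tendsto_const_nhds.inner t2), ?_⟩
  · exact tendsto_stepL_of_pointwise hm h.nonneg h.supp (fun j l _ => h.bound j l) hL.coeFn_toLp
      (ae_tendsto_toNNReal fun x => (h.lim x).tendsto_at (mem_Iic.2 le_rfl))
  · obtain ⟨C, hC⟩ := t2.norm.bddAbove_range
    exact ⟨C, fun j => hC ⟨j, rfl⟩⟩

/-- The step functions of a locally uniformly convergent sequence are locally uniformly bounded. -/
theorem exists_step_bound {A : Type*} [NormedAddCommGroup A] (hm : ∀ j, 1 ≤ m j)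
    {a : ℕ → ℕ → A} {Z : ℝ≥0 → A} {R : ℝ}
    (ha : ∀ K, TendstoUniformlyOn (fun j => step (m j) (a j)) Z atTop (Iic K)) :
    ∃ B, 0 ≤ B ∧ ∀ j l : ℕ, l < R * m j → ‖a j l‖ ≤ B := by
  have hb : ∀ j, ∃ B, ∀ l : ℕ, l < R * m j → ‖a j l‖ ≤ B := fun j =>
    ⟨∑ l ∈ range ⌈R * m j⌉₊, ‖a j l‖, fun l hl =>
      single_le_sum (f := fun l => ‖a j l‖) (fun _ _ => norm_nonneg _)
        (Finset.mem_range.2 (Nat.lt_ceil.2 hl))⟩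
  choose b hb using hb
  have hu := Metric.uniformCauchySeqOn_iff.1 (ha R.toNNReal).uniformCauchySeqOn 1 one_pos
  obtain ⟨J, hJ⟩ := hu
  obtain ⟨b', hb'⟩ : ∃ b', ∀ x ∈ Iic R.toNNReal, ‖step (m J) (a J) x‖ ≤ b' := by
    refine ⟨∑ l ∈ range (⌊m J * (R.toNNReal : ℝ)⌋₊ + 1), ‖a J l‖, fun x hx => ?_⟩
    refine single_le_sum (f := fun l => ‖a J l‖) (fun _ _ => norm_nonneg _)
      (Finset.mem_range.2 (Nat.lt_succ_of_le (Nat.floor_mono ?_)))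
    have := hm J
    have hx' : (x : ℝ) ≤ R.toNNReal := by exact_mod_cast hx
    gcongr
  refine ⟨∑ j ∈ range J, |b j| + |b'| + 1, by positivity, fun j l hl => ?_⟩
  have h0 : 0 ≤ ∑ j ∈ range J, |b j| := sum_nonneg fun _ _ => abs_nonneg _
  by_cases hj : j < J
  · have h1 := single_le_sum (f := fun j => |b j|) (fun _ _ => abs_nonneg _) (Finset.mem_range.2 hj)
    have h2 := (hb j l hl).trans (le_abs_self _)
    have h3 := abs_nonneg b'
    have h1 : |b j| ≤ ∑ j ∈ range J, |b j| := h1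
    linarith
  · have hmj := hm j
    have hm0 : 0 < m j := by linarith
    set x : ℝ≥0 := (l / m j : ℝ).toNNReal with hx
    have hxc : (x : ℝ) = l / m j := Real.coe_toNNReal _ (by positivity)
    have hxl : step (m j) (a j) x = a j l := by
      rw [step, hxc, mul_div_cancel₀ _ hm0.ne', Nat.floor_natCast]
    have hxR : x ∈ Iic R.toNNReal := by
      rw [mem_Iic, ← NNReal.coe_le_coe]
      refine le_trans ?_ (Real.le_coe_toNNReal R)
      rw [hxc, div_le_iff₀ hm0]; exact hl.le
    have h1 := hJ J le_rfl j (not_lt.1 hj) x hxR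
    have h2 := hb' x hxR
    rw [dist_eq_norm] at h1
    have h3 := norm_sub_norm_le (step (m j) (a j) x) (step (m J) (a J) x)
    rw [norm_sub_rev, hxl] at h3
    rw [hxl] at h1
    have := le_abs_self b'
    linarith

/-- The jumps of locally uniformly convergent step functions tend to zero almost everywhere. A fixed
member of the sequence jumps at countably many points only. -/
theorem ae_tendsto_jump {A : Type*} [NormedAddCommGroup A] (hm : ∀ j, 1 ≤ m j)
    (hmt : Tendsto m atTop atTop) {a : ℕ → ℕ → A} {Z : ℝ≥0 → A}
    (ha : ∀ K, TendstoUniformlyOn (fun j => step (m j) (a j)) Z atTop (Iic K)) :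
    ∀ᵐ x ∂halfLine, Tendsto (fun j => step (m j) (fun l => a j l - prev (a j) l) x.toNNReal) atTop
      (𝓝 0) := by
  have hcount : (⋃ J : ℕ, ⋃ k : ℕ, {(k : ℝ) / m J}).Countable :=
    countable_iUnion fun J => countable_iUnion fun k => countable_singleton _
  filter_upwards [ae_restrict_mem measurableSet_Ici,
    ae_restrict_of_ae (measure_eq_zero_iff_ae_notMem.1 (hcount.measure_zero volume))] with x hx hxn
  have hx0' : (0 : ℝ) ≤ x := hx
  have hxn' : ∀ J k : ℕ, (k : ℝ) / m J ≠ x := by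
    intro J k h
    exact hxn (mem_iUnion.2 ⟨J, mem_iUnion.2 ⟨k, h.symm⟩⟩)
  have hx0 : 0 < x := lt_of_le_of_ne hx0' (by simpa using hxn' 0 0)
  rw [Metric.tendsto_atTop]
  intro ε hε
  obtain ⟨J, hJ⟩ := Metric.uniformCauchySeqOn_iff.1 (ha x.toNNReal).uniformCauchySeqOn (ε / 2)
    (by positivity)
  have hmJ : 0 < m J := by linarith [hm J]
  -- the distance from `x` to the previous jump of the fixed member
  have hfr : (⌊m J * x⌋₊ : ℝ) < m J * x := by
    refine lt_of_le_of_ne (Nat.floor_le (by positivity)) fun h => hxn' J ⌊m J * x⌋₊ ?_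
    rw [h]; field_simp
  have hinv : Tendsto (fun j => (m j)⁻¹) atTop (𝓝 0) := tendsto_inv_atTop_zero.comp hmt
  have hev : ∀ᶠ j in atTop, (m j)⁻¹ < x ∧ (m j)⁻¹ < x - ⌊m J * x⌋₊ / m J := by
    refine (hinv.eventually (gt_mem_nhds hx0)).and (hinv.eventually (gt_mem_nhds ?_))
    rw [sub_pos, div_lt_iff₀ hmJ]; linarith
  obtain ⟨J', hJ'⟩ := eventually_atTop.1 hev
  refine ⟨max J J', fun j hj => ?_⟩
  obtain ⟨h1, h2⟩ := hJ' j ((le_max_right _ _).trans hj)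
  have hjJ : J ≤ j := (le_max_left _ _).trans hj
  have hmj : 0 < m j := by linarith [hm j]
  set y : ℝ := x - (m j)⁻¹ with hy
  have hy0 : 0 ≤ y := by rw [hy]; linarith
  have hyx : y ≤ x := by rw [hy]; have := inv_pos.2 hmj; linarith
  have hfl : m j * y = m j * x - 1 := by rw [hy]; field_simp
  have hfl1 : 1 ≤ m j * x := by
    have : (m j)⁻¹ * m j ≤ x * m j := by gcongr
    rw [inv_mul_cancel₀ hmj.ne'] at this; linarith
  have hge : ⌊m j * x⌋₊ ≠ 0 := by
    have := Nat.le_floor (show ((1 : ℕ) : ℝ) ≤ m j * x by simpa using hfl1)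
    omega
  have e1 : step (m j) (fun l => a j l - prev (a j) l) x.toNNReal =
      step (m j) (a j) x.toNNReal - step (m j) (a j) y.toNNReal := by
    simp only [step, Real.coe_toNNReal _ hx0', Real.coe_toNNReal _ hy0, prev, if_neg hge]
    rw [hfl, Nat.floor_sub_one]
  have e2 : step (m J) (a J) y.toNNReal = step (m J) (a J) x.toNNReal := by
    simp only [step, Real.coe_toNNReal _ hx0', Real.coe_toNNReal _ hy0]
    congr 1
    refine le_antisymm (Nat.floor_mono (by gcongr)) (Nat.le_floor ?_)
    have : (⌊m J * x⌋₊ : ℝ) / m J ≤ y := by rw [hy]; linarith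
    rw [div_le_iff₀ hmJ] at this
    linarith
  have d1 := hJ J le_rfl j hjJ x.toNNReal (mem_Iic.2 le_rfl)
  have d2 := hJ J le_rfl j hjJ y.toNNReal (mem_Iic.2 (Real.toNNReal_mono hyx))
  rw [dist_zero_right, e1]
  rw [dist_eq_norm] at d1 d2
  rw [e2] at d2
  have := norm_sub_le (step (m J) (a J) x.toNNReal - step (m j) (a j) y.toNNReal)
    (step (m J) (a J) x.toNNReal - step (m j) (a j) x.toNNReal)
  rw [sub_sub_sub_cancel_left] at this
  linarith

/-- The interior form in terms of the combined potential, with the two errors caused by the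
shifts in the off-diagonal part. -/
theorem iform_eq_combined [CompleteSpace E] {m : ℝ} (hm : 0 < m) (N : ℕ) {A₁ A₂ A : ℕ → E →L[ℝ] E}
    (hA : ∀ l, A l = A₁ l + (1 / 2 : ℝ) • (A₂ l + adjoint (A₂ l)))
    {v w : ℕ → E} (hv : v N = 0) :
    iform m N A₁ A₂ v w = m⁻¹ * ∑ l ∈ range N, ⟪dq m v l, dq m w l⟫ -
      m⁻¹ * ∑ l ∈ range N, ⟪dq m v l, A l (w l)⟫ -
      m⁻¹ * ∑ l ∈ range N, ⟪v (l + 1), A l (dq m w l)⟫ +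
      1 / 2 * (m⁻¹ * ∑ l ∈ range N, ⟪v l, (A₂ l - prev A₂ l) (dq m w l)⟫) +
      1 / 2 * (m⁻¹ * ∑ l ∈ range N, ⟪(A₂ l - prev A₂ l) (dq m v l), w l⟫) := by
  have h1 := sum_inner_sub_prev A v w N
  rw [hv, inner_zero_left, add_zero] at h1
  have e1 : ∀ l, ⟪v l, A l (w l)⟫ - ⟪v (l + 1), A l (w (l + 1))⟫ =
      -(m⁻¹ * (⟪dq m v l, A l (w l)⟫ + ⟪v (l + 1), A l (dq m w l)⟫)) := by
    intro l
    simp only [dq, map_smul, map_sub, inner_smul_left, inner_smul_right, RCLike.conj_to_real,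
      inner_sub_left, inner_sub_right]
    field_simp; ring
  have e2 : ∀ l, ⟪v l, incr m A₁ l (w l)⟫ +
      1 / 2 * (⟪v l, incr m A₂ l (w (l + 1))⟫ + ⟪incr m A₂ l (v (l + 1)), w l⟫) =
      m * ⟪v l, (A l - prev A l) (w l)⟫ + 1 / 2 * ⟪v l, (A₂ l - prev A₂ l) (dq m w l)⟫ +
      1 / 2 * ⟪(A₂ l - prev A₂ l) (dq m v l), w l⟫ := by
    intro l
    have ep : A l - prev A l = (A₁ l - prev A₁ l) + (1 / 2 : ℝ) •
        ((A₂ l - prev A₂ l) + adjoint (A₂ l - prev A₂ l)) := by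
      rcases l with _ | l
      · simp only [prev, if_true, sub_zero, hA]
      · simp only [prev, if_neg (Nat.succ_ne_zero l), Nat.add_sub_cancel, hA, map_sub]
        module
    have eadj : ⟪v l, (adjoint (A₂ l - prev A₂ l)) (w l)⟫ =
        ⟪(A₂ l - prev A₂ l) (v l), w l⟫ := ContinuousLinearMap.adjoint_inner_right _ _ _
    rw [ep]
    generalize adjoint (A₂ l - prev A₂ l) = T at eadj
    have ew : dq m w l = m • (w (l + 1) - w l) := rfl
    have ev : dq m v l = m • (v (l + 1) - v l) := rfl
    rw [ew, ev]
    simp only [incr, add_apply, smul_apply, map_smul, map_sub, inner_smul_left, inner_smul_right,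
      RCLike.conj_to_real, inner_sub_left, inner_sub_right, inner_add_right, eadj]
    ring
  have e3 : iform m N A₁ A₂ v w = m⁻¹ * ∑ l ∈ range N, (⟪dq m v l, dq m w l⟫ +
      (m * ⟪v l, (A l - prev A l) (w l)⟫ + 1 / 2 * ⟪v l, (A₂ l - prev A₂ l) (dq m w l)⟫ +
      1 / 2 * ⟪(A₂ l - prev A₂ l) (dq m v l), w l⟫)) := by
    unfold iform
    refine congrArg _ (sum_congr rfl fun l _ => ?_)
    rw [add_assoc, e2]
  rw [e3]
  simp only [sum_add_distrib, ← mul_sum]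
  rw [h1]
  simp only [e1, Finset.sum_neg_distrib, ← mul_sum, sum_add_distrib]
  field_simp
  ring

theorem iform_eq_of_supp {m : ℝ} {A₁ A₂ : ℕ → E →L[ℝ] E} {v w : ℕ → E} {N N' : ℕ}
    (hv : ∀ l, N ≤ l → v l = 0) (hw : ∀ l, N' ≤ l → w l = 0) :
    iform m N A₁ A₂ v w = iform m N' A₁ A₂ v w := by
  have key : ∀ (N₀ M : ℕ), N₀ ≤ M → ((∀ l, N₀ ≤ l → v l = 0) ∨ (∀ l, N₀ ≤ l → w l = 0)) →
      iform m N₀ A₁ A₂ v w = iform m M A₁ A₂ v w := by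
    intro N₀ M hM h
    unfold iform
    congr 1
    refine Finset.sum_subset (Finset.range_mono hM) fun l _ hl => ?_
    have hl' : N₀ ≤ l := by simpa using hl
    rcases h with h | h <;> simp [dq, h l hl', h (l + 1) (by omega)]
  rw [key N (max N N') (le_max_left _ _) (Or.inl hv),
    key N' (max N N') (le_max_right _ _) (Or.inr hw)]

/-- The discrete form tested against convergent test functions converges to the continuum form. -/
theorem tendsto_iform_test [FiniteDimensional ℝ E] [CompleteSpace E] (hm : ∀ j, 1 ≤ m j)
    (hmt : Tendsto m atTop atTop) {A₁ A₂ : ℕ → ℕ → E →L[ℝ] E} {Y Z : ℝ≥0 → E →L[ℝ] E}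
    (hYc : Continuous Y)
    (hY : ∀ K, TendstoUniformlyOn (fun j => step (m j) fun l => A₁ j l +
      (1 / 2 : ℝ) • (A₂ j l + adjoint (A₂ j l))) Y atTop (Iic K))
    (hZ : ∀ K, TendstoUniformlyOn (fun j => step (m j) (A₂ j)) Z atTop (Iic K))
    {φd : ℕ → ℕ → E} {φ φ' : ℝ → E} {R B : ℝ} (hφ : TestLimit m φd φ φ' R B)
    {N : ℕ → ℕ} {v : ℕ → ℕ → E} (hv : ∀ j l, N j ≤ l → v j l = 0) {f g : ℝ → E}
    (h : LatticeLimit m v f g) :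
    Tendsto (fun j => iform (m j) (N j) (A₁ j) (A₂ j) (φd j) (v j)) atTop
      (𝓝 ((∫ x in ℝ₊, ⟪φ' x, g x⟫) - (∫ x in ℝ₊, ⟪φ' x, Y x.toNNReal (f x)⟫) -
        ∫ x in ℝ₊, ⟪φ x, Y x.toNNReal (g x)⟫)) := by
  set A : ℕ → ℕ → E →L[ℝ] E := fun j l => A₁ j l + (1 / 2 : ℝ) • (A₂ j l + adjoint (A₂ j l)) with hA
  have hm0 : ∀ j, 0 < m j := fun j => zero_lt_one.trans_le (hm j)
  set N' : ℕ → ℕ := fun j => ⌈R * m j⌉₊ with hN'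
  have hsup : ∀ j l, N' j ≤ l → φd j l = 0 := fun j => supp_ceil (hφ.supp j)
  have hds : ∀ j l : ℕ, R * m j ≤ l → dq (m j) (φd j) l = 0 := fun j => dq_eq_zero_of_le (hφ.supp j)
  have hss : ∀ j l : ℕ, R * m j ≤ l → φd j (l + 1) = 0 := fun j l hl =>
    hφ.supp j _ (hl.trans (by push_cast; linarith))
  obtain ⟨BA, hBA0, hBA⟩ := exists_step_bound (R := R) hm hY
  obtain ⟨BZ, hBZ0, hBZ⟩ := exists_step_bound (R := R) hm hZ
  have hB0 := hφ.nonneg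
  obtain ⟨C, hC⟩ := h.bdd
  -- pointwise limits of the test functions and of the potential
  have p1 : ∀ x : ℝ≥0, Tendsto (fun j => step (m j) (φd j) x) atTop (𝓝 (φ x)) := fun x =>
    (hφ.lim x).tendsto_at (mem_Iic.2 le_rfl)
  have p2 : ∀ x : ℝ≥0, Tendsto (fun j => step (m j) (fun l => φd j (l + 1)) x) atTop
      (𝓝 (φ x)) := fun x => by
    have h1 := (p1 x).add ((tendsto_inv_atTop_zero.comp hmt).smul (hφ.dlim x))
    rw [zero_smul, add_zero] at h1
    refine h1.congr fun j => ?_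
    simp only [step, dq, Function.comp_apply, smul_smul, inv_mul_cancel₀ (hm0 j).ne', one_smul]
    abel
  have hadj : Continuous fun T : E →L[ℝ] E => adjoint T := ContinuousLinearMap.adjoint.continuous
  have pA : ∀ᵐ x ∂halfLine, Tendsto (fun j => step (m j) (fun l => adjoint (A j l)) x.toNNReal)
      atTop (𝓝 (adjoint (Y x.toNNReal))) := .of_forall fun x =>
    (hadj.tendsto _).comp ((hY x.toNNReal).tendsto_at (mem_Iic.2 le_rfl))
  have pJ := ae_tendsto_jump hm hmt hZ
  have pJ' : ∀ᵐ x ∂halfLine, Tendsto (fun j => step (m j)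
      (fun l => adjoint (A₂ j l - prev (A₂ j) l)) x.toNNReal) atTop (𝓝 0) := by
    filter_upwards [pJ] with x hx
    have := (hadj.tendsto _).comp hx
    rwa [map_zero] at this
  have hz : ∀ x : ℝ, 0 ≤ x → R < x → φ x = 0 ∧ φ' x = 0 := fun x h0 hx => hφ.eq_zero hmt h0 hx
  have hcY : Continuous fun x : ℝ => adjoint (Y x.toNNReal) :=
    hadj.comp (hYc.comp continuous_real_toNNReal)
  have hL' : MemL2(φ') := memLp_of_vanish hφ.cont_deriv fun x h0 hx => (hz x h0 hx).2
  have hL1 : MemL2(fun x => adjoint (Y x.toNNReal) (φ' x)) :=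
    memLp_of_vanish (hcY.clm_apply hφ.cont_deriv) (R := R) fun x h0 hx => by
      rw [(hz x h0 hx).2, map_zero]
  have hL2 : MemL2(fun x => adjoint (Y x.toNNReal) (φ x)) :=
    memLp_of_vanish (hcY.clm_apply hφ.cont) (R := R) fun x h0 hx => by rw [(hz x h0 hx).1, map_zero]
  have hBA' : ∀ j l : ℕ, l < R * m j → ‖adjoint (A j l)‖ ≤ BA :=
    fun j l hl => by rw [LinearIsometryEquiv.norm_map]; exact hBA j l hl
  have hjb : ∀ j l : ℕ, l < R * m j → ‖A₂ j l - prev (A₂ j) l‖ ≤ BZ + BZ := fun j l hl => by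
    refine (norm_sub_le _ _).trans (add_le_add (hBZ j l hl) ?_)
    rcases l with _ | l
    · simpa [prev] using hBZ0
    · simp only [prev, if_neg (Nat.succ_ne_zero l), Nat.add_sub_cancel]
      exact hBZ j l (lt_trans (by push_cast; linarith) hl)
  have hjb' : ∀ j l : ℕ, l < R * m j → ‖adjoint (A₂ j l - prev (A₂ j) l)‖ ≤ BZ + BZ := fun j l hl =>
    by rw [LinearIsometryEquiv.norm_map]; exact hjb j l hl
  -- strong convergence of the test side
  have s1 : Tendsto (fun j => stepL (m j) (dq (m j) (φd j))) atTop (𝓝 hL'.toLp) :=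
    tendsto_stepL_of_pointwise hm hB0 hds (fun j l _ => hφ.dbound j l) hL'.coeFn_toLp
      (ae_tendsto_toNNReal hφ.dlim)
  have s2 := tendsto_stepL_act hm hBA0 hB0 hds hBA' hφ.dbound pA (ae_tendsto_toNNReal hφ.dlim)
    hL1.coeFn_toLp
  have s3 := tendsto_stepL_act hm hBA0 hB0 hss hBA' (fun j l => hφ.bound j (l + 1)) pA
    (ae_tendsto_toNNReal p2)
    hL2.coeFn_toLp
  have z0 : ((0 : LE E) : ℝ → E) =ᵐ[halfLine] fun _ => 0 := Lp.coeFn_zero _ _ _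
  have s4 := tendsto_stepL_act (Ψ := 0) hm (add_nonneg hBZ0 hBZ0) hB0 hφ.supp hjb' hφ.bound pJ'
    (ae_tendsto_toNNReal p1) (by simpa using z0)
  have s5 := tendsto_stepL_act (Ψ := 0) hm (add_nonneg hBZ0 hBZ0) hB0 hds hjb hφ.dbound pJ
    (ae_tendsto_toNNReal hφ.dlim) (by simpa using z0)
  -- the products
  have t1 := tendsto_inner_of_weak s1 hC h.weak
  have t2 := s2.inner h.tendsto (𝕜 := ℝ)
  have t3 := tendsto_inner_of_weak s3 hC h.weak
  have t4 := tendsto_inner_of_weak s4 hC h.weak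
  have t5 := s5.inner h.tendsto (𝕜 := ℝ)
  have hlim := (((t1.sub t2).sub t3).add (t4.const_mul (1 / 2))).add (t5.const_mul (1 / 2))
  simp only [inner_zero_left, mul_zero, add_zero] at hlim
  have hi : ∀ {a b : LE E} {a' b' : ℝ → E}, a =ᵐ[halfLine] a' → b =ᵐ[halfLine] b' →
      ⟪a, b⟫ = ∫ x in ℝ₊, ⟪a' x, b' x⟫ := fun ha hb => by
    rw [L2.inner_def]
    refine integral_congr_ae ?_
    filter_upwards [ha, hb] with x h1 h2
    rw [h1, h2]
  rw [hi hL'.coeFn_toLp h.memLp_deriv.coeFn_toLp, hi hL1.coeFn_toLp h.memLp.coeFn_toLp,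
    hi hL2.coeFn_toLp h.memLp_deriv.coeFn_toLp] at hlim
  simp only [ContinuousLinearMap.adjoint_inner_left] at hlim
  refine hlim.congr fun j => ?_
  have zz : ∀ (T : ℕ → E →L[ℝ] E) (a : ℕ → E), (∀ l, N' j ≤ l → a l = 0) →
      ∀ l, N' j ≤ l → T l (a l) = 0 := fun T a ha l hl => by rw [ha l hl, map_zero]
  have hds' := dq_eq_zero (m := m j) (hsup j)
  have hss' : ∀ l, N' j ≤ l → φd j (l + 1) = 0 := fun l hl => hsup j _ (by omega)
  have hdv := dq_eq_zero (m := m j) (hv j)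
  rw [inner_stepL (hm0 j) hds' hdv,
    inner_stepL (hm0 j) (zz (fun l => adjoint (A j l)) _ hds') (hv j),
    inner_stepL (hm0 j) (zz (fun l => adjoint (A j l)) _ hss') hdv,
    inner_stepL (hm0 j) (zz (fun l => adjoint (A₂ j l - prev (A₂ j) l)) _ (hsup j)) hdv,
    inner_stepL (hm0 j) (zz (fun l => A₂ j l - prev (A₂ j) l) _ hds') (hv j),
    ← iform_eq_of_supp (hsup j) (hv j),
    iform_eq_combined (hm0 j) (N' j) (A := A j) (fun l => rfl) (hsup j _ le_rfl)]
  simp only [ContinuousLinearMap.adjoint_inner_left]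

end FormLimit

section Discretize

variable {E' : Type*} [NormedAddCommGroup E'] [NormedSpace ℝ E']

open scoped ContDiff

/-- The lattice function obtained by sampling `φ` and applying the operator `A`. -/
def discretize (m : ℝ) (A : E' →L[ℝ] E) (φ : ℝ → E') (l : ℕ) : E := A (φ (l / m))

theorem vanish_of_hasCompactSupport {φ : ℝ → E'} (h : HasCompactSupport φ) :
    ∃ R, ∀ x, R < x → φ x = 0 ∧ deriv φ x = 0 := by
  obtain ⟨R, hR⟩ := h.isCompact.isBounded.subset_closedBall 0
  have key : ∀ x, R < x → x ∉ tsupport φ := fun x hx h' => by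
    have := hR h'
    rw [Metric.mem_closedBall, Real.dist_eq, sub_zero] at this
    linarith [le_abs_self x]
  exact ⟨R, fun x hx => ⟨image_eq_zero_of_notMem_tsupport (key x hx),
    image_eq_zero_of_notMem_tsupport fun h' => key x hx (tsupport_deriv_subset h')⟩⟩

theorem exists_testLimit (hm : ∀ j, 1 ≤ m j) (hmt : Tendsto m atTop atTop)
    {A : ℕ → E' →L[ℝ] E} {A₀ : E' →L[ℝ] E} (hA : Tendsto A atTop (𝓝 A₀)) {φ : ℝ → E'}
      (hφ : ContDiff ℝ ∞ φ)
    (hc : HasCompactSupport φ) :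
    ∃ R B, TestLimit m (fun j => discretize (m j) (A j) φ) (fun x => A₀ (φ x))
      (fun x => A₀ (deriv φ x)) R B := by
  have hm0 : ∀ j, 0 < m j := fun j => zero_lt_one.trans_le (hm j)
  have hd : Differentiable ℝ φ := hφ.differentiable (by simp)
  have hcd : Continuous (deriv φ) := hφ.continuous_deriv (by simp)
  obtain ⟨B₁, hB₁⟩ := hφ.continuous.bounded_above_of_compact_support hc
  obtain ⟨B₂, hB₂⟩ := hcd.bounded_above_of_compact_support hc.deriv
  obtain ⟨a, ha⟩ := hA.norm.bddAbove_range
  have ha' : ∀ j, ‖A j‖ ≤ a := fun j => ha ⟨j, rfl⟩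
  have ha0 : 0 ≤ a := (norm_nonneg _).trans (ha' 0)
  have hB₁0 : 0 ≤ B₁ := (norm_nonneg _).trans (hB₁ 0)
  have hB₂0 : 0 ≤ B₂ := (norm_nonneg _).trans (hB₂ 0)
  obtain ⟨R, hR⟩ := vanish_of_hasCompactSupport hc
  have hLip : ∀ x y, ‖φ x - φ y‖ ≤ B₂ * |x - y| := fun x y => by
    have := (convex_univ (𝕜 := ℝ) (E := ℝ)).norm_image_sub_le_of_norm_deriv_le (f := φ) (C := B₂)
      (fun z _ => hd z) (fun z _ => hB₂ z) (Set.mem_univ y) (Set.mem_univ x)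
    simpa using this
  have hdq : ∀ j l, dq (m j) (discretize (m j) (A j) φ) l =
      A j (m j • (φ (l / m j + (m j)⁻¹) - φ (l / m j))) := fun j l => by
    simp only [dq, discretize, map_smul, map_sub]
    congr 4
    push_cast
    rw [add_div, one_div]
  refine ⟨R + 1, a * B₁ + a * B₂, by positivity, A₀.continuous.comp hφ.continuous,
    A₀.continuous.comp hcd, ?_, ?_, ?_, ?_, ?_⟩
  · intro j l hl
    rw [discretize, (hR _ _).1, map_zero]
    have : R + 1 ≤ l / m j := by rwa [le_div_iff₀ (hm0 j)]
    linarith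
  · intro j l
    refine ((A j).le_opNorm _).trans ?_
    have : ‖A j‖ * ‖φ (l / m j)‖ ≤ a * B₁ := mul_le_mul (ha' j) (hB₁ _) (norm_nonneg _) ha0
    have : 0 ≤ a * B₂ := by positivity
    linarith
  · intro j l
    rw [hdq]
    refine ((A j).le_opNorm _).trans ?_
    have h1 : ‖m j • (φ (l / m j + (m j)⁻¹) - φ (l / m j))‖ ≤ B₂ := by
      rw [norm_smul, Real.norm_of_nonneg (hm0 j).le]
      have := hLip (l / m j + (m j)⁻¹) (l / m j)
      rw [add_sub_cancel_left, abs_of_pos (inv_pos.2 (hm0 j))] at this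
      calc m j * ‖φ (l / m j + (m j)⁻¹) - φ (l / m j)‖ ≤ m j * (B₂ * (m j)⁻¹) := by
            have := hm0 j; gcongr
        _ = B₂ := by have := (hm0 j).ne'; field_simp
    have : ‖A j‖ * ‖m j • (φ (l / m j + (m j)⁻¹) - φ (l / m j))‖ ≤ a * B₂ :=
      mul_le_mul (ha' j) h1 (norm_nonneg _) ha0
    have : 0 ≤ a * B₁ := by positivity
    linarith
  · intro K
    rw [Metric.tendstoUniformlyOn_iff]
    intro ε hε
    have h1 : Tendsto (fun j => a * (B₂ * (m j)⁻¹) + ‖A j - A₀‖ * B₁) atTop (𝓝 0) := by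
      have e1 := ((tendsto_inv_atTop_zero.comp hmt).const_mul B₂).const_mul a
      have e2 := (tendsto_iff_norm_sub_tendsto_zero.1 hA).mul_const B₁
      simpa using e1.add e2
    filter_upwards [h1.eventually (gt_mem_nhds hε)] with j hj x _
    refine lt_of_le_of_lt ?_ hj
    rw [dist_eq_norm, norm_sub_rev]
    simp only [step, discretize]
    have hx0 : (0 : ℝ) ≤ x := x.2
    have h2 : |(⌊m j * (x : ℝ)⌋₊ : ℝ) / m j - x| ≤ (m j)⁻¹ := by
      have h3 := Nat.floor_le (show 0 ≤ m j * (x : ℝ) by have := hm0 j; positivity)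
      have h4 := Nat.lt_floor_add_one (m j * (x : ℝ))
      rw [abs_le, ← one_div]
      constructor
      · rw [neg_le_sub_iff_le_add, ← add_div, le_div_iff₀ (hm0 j)]; linarith
      · have : (⌊m j * (x : ℝ)⌋₊ : ℝ) / m j ≤ x := by rw [div_le_iff₀ (hm0 j)]; linarith
        have : 0 < 1 / m j := by have := hm0 j; positivity
        linarith
    have e : A j (φ (⌊m j * (x : ℝ)⌋₊ / m j)) - A₀ (φ x) =
        A j (φ (⌊m j * (x : ℝ)⌋₊ / m j) - φ x) + (A j - A₀) (φ x) := by
      simp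
    rw [e]
    refine (norm_add_le _ _).trans (add_le_add (((A j).le_opNorm _).trans
      (mul_le_mul (ha' j) ?_ (norm_nonneg _) ha0)) (((A j - A₀).le_opNorm _).trans ?_))
    · exact (hLip _ _).trans (by gcongr)
    · have := hB₁ x; gcongr
  · intro x
    have hy : Tendsto (fun j => (⌊m j * (x : ℝ)⌋₊ : ℝ) / m j) atTop (𝓝 (x : ℝ)) := by
      have h := (tendsto_nat_floor_mul_div_atTop (R := ℝ) x.2).comp hmt
      refine h.congr fun j => ?_
      simp [mul_comm]
    have hinv : Tendsto (fun j => (m j)⁻¹) atTop (𝓝 0) := tendsto_inv_atTop_zero.comp hmt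
    have hst : HasStrictDerivAt φ (deriv φ x) x :=
      (hφ.contDiffAt.of_le (m := 1) (by simp)).hasStrictDerivAt (by simp)
    have hq : Tendsto (fun j => m j • (φ (⌊m j * (x : ℝ)⌋₊ / m j + (m j)⁻¹) -
        φ (⌊m j * (x : ℝ)⌋₊ / m j))) atTop (𝓝 (deriv φ x)) := by
      have h1 := hst.isLittleO
      have h2 : Tendsto (fun j => ((⌊m j * (x : ℝ)⌋₊ : ℝ) / m j + (m j)⁻¹,
          (⌊m j * (x : ℝ)⌋₊ : ℝ) / m j)) atTop (𝓝 ((x : ℝ), (x : ℝ))) := by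
        have := hy.add hinv
        rw [add_zero] at this
        exact this.prodMk_nhds hy
      have h3 := h1.comp_tendsto h2
      rw [Asymptotics.isLittleO_iff] at h3
      rw [Metric.tendsto_atTop]
      intro ε hε
      obtain ⟨J, hJ⟩ := eventually_atTop.1 (h3 (show 0 < ε / 2 by positivity))
      refine ⟨J, fun j hj => ?_⟩
      have h4 := hJ j hj
      have hmj := hm0 j
      simp only [Function.comp_apply, add_sub_cancel_left,
        ContinuousLinearMap.toSpanSingleton_apply,
        norm_inv, Real.norm_of_nonneg hmj.le] at h4
      rw [dist_eq_norm]
      have e : m j • (φ (⌊m j * (x : ℝ)⌋₊ / m j + (m j)⁻¹) - φ (⌊m j * (x : ℝ)⌋₊ / m j)) -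
          deriv φ x = m j • (φ (⌊m j * (x : ℝ)⌋₊ / m j + (m j)⁻¹) - φ (⌊m j * (x : ℝ)⌋₊ / m j) -
            (m j)⁻¹ • deriv φ x) := by
        rw [smul_sub _ _ ((m j)⁻¹ • _), smul_smul, mul_inv_cancel₀ hmj.ne', one_smul]
      rw [e, norm_smul, Real.norm_of_nonneg hmj.le]
      calc _ ≤ m j * (ε / 2 * (m j)⁻¹) := by gcongr
        _ = ε / 2 := by field_simp
        _ < ε := by linarith
    simp only [step, hdq]
    have := (isBoundedBilinearMap_apply (𝕜 := ℝ) (E := E') (F := E)).continuous.tendsto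
      (A₀, deriv φ x)
    exact this.comp (hA.prodMk_nhds hq)

end Discretize

section Ensemble

/-- The unitary operator that carries the orthonormal basis `u` to the orthonormal basis `u'`. -/
def rot (u' u : Fin r → Vec F r) : Vec F r →L[ℝ] Vec F r :=
  opr (∑ i, Matrix.vecMulVec (u' i).ofLp (star (u i).ofLp))

theorem rot_apply (u' u : Fin r → Vec F r) (v : Vec F r) :
    rot u' u v = ∑ i, op (dag (u i) v) • u' i := by
  ext a
  simp [rot, act, Matrix.vecMulVec, Matrix.mulVec,
    dotProduct, dag, mul_sum, mul_assoc]

theorem rot_self (hu : OrthoBasis u) : rot u u = 1 := by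
  ext1 v
  rw [rot_apply, hu.sum_op_dag]; rfl

theorem rot_op (u' u : Fin r → Vec F r) (c : F) (v : Vec F r) :
    rot u' u (op c • v) = op c • rot u' u v := act_op _ _ _

theorem dag_rot {u' : Fin r → Vec F r} (hu' : OrthoBasis u') (u : Fin r → Vec F r) (i : Fin r)
    (v : Vec F r) : dag (u' i) (rot u' u v) = dag (u i) v := by
  rw [rot_apply, dag_sum_right]
  simp [dag_op_right, hu' i]

theorem continuous_rot (u : Fin r → Vec F r) : Continuous fun u' => rot u' u := by
  unfold rot
  refine continuous_opr.comp (continuous_finsetSum _ fun i _ => ?_)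
  refine continuous_matrix fun a b => ?_
  simp only [Matrix.vecMulVec_apply]
  fun_prop

theorem isClosed_orthoBasis : IsClosed {u : Fin r → Vec F r | OrthoBasis u} := by
  have h : {u : Fin r → Vec F r | OrthoBasis u} = ⋂ i, ⋂ j, {u : Fin r → Vec F r |
      dag (u i) (u j) = if i = j then 1 else 0} := by
    ext u; simp [OrthoBasis]
  rw [h]
  refine isClosed_iInter fun i => isClosed_iInter fun j => isClosed_eq ?_ continuous_const
  have h2 : Continuous fun u : Fin r → Vec F r => (u i, u j) := by fun_prop
  exact continuous_dag.comp h2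

theorem OrthoBasis.of_tendsto (hu' : ∀ j, OrthoBasis (u' j)) (hu : Tendsto u' atTop (𝓝 u)) :
    OrthoBasis u :=
  isClosed_orthoBasis.mem_of_tendsto hu (.of_forall hu')

/-- The number of sites occupied by `F ^ n`. -/
def sites (r n : ℕ) : ℕ := ⌈(n : ℝ) / r⌉₊

/-- The real bilinear form of the discrete operator, including the boundary term. -/
def dform (n : ℕ) (m : ℝ) (Y₁ Y₂ : ℕ → Mat F r) (u : Fin r → Vec F r) (x : Fin r → ℝ)
    (v w : ℕ → Vec F r) : ℝ :=
  iform m (sites r n) (fun l => opr (Y₁ l)) (fun l => opr (Y₂ l)) v w +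
    ⟪v 0, act (specMat u x) (w 0)⟫

/-- Discrete data that satisfy the growth and oscillation bounds with the constant `C`. -/
def IsGood (η ζ : ℝ≥0 → ℝ) (C : ℝ) (n : ℕ) (m : ℝ) (Y₁ Y₂ : ℕ → Mat F r) : Prop :=
  0 < n ∧ 1 ≤ m ∧ (∀ l, (Y₁ l).IsHermitian) ∧ ‖opr (Y₁ 0)‖ ≤ C ∧ ‖opr (Y₂ 0)‖ ≤ C ∧
  ∃ (η₁ η₂ ω₁ ω₂ : ℕ → Mat F r) (κ : ℝ), 1 ≤ κ ∧ κ ≤ C ∧ Decomposes m Y₁ η₁ ω₁ ∧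
    Decomposes m Y₂ η₂ ω₂ ∧ GrowthBounds n m κ η ζ η₁ η₂ ω₁ ω₂

theorem norm_le_of_inner_bound {A : Vec F r →L[ℝ] Vec F r}
    (hs : ∀ u v, ⟪u, A v⟫ = ⟪A u, v⟫) (hp : ∀ v, 0 ≤ ⟪v, A v⟫) {c : ℝ}
    (hc : 0 ≤ c) (hb : ∀ v, ⟪v, A v⟫ ≤ c * ‖v‖ ^ 2) : ‖A‖ ≤ c := by
  refine ContinuousLinearMap.opNorm_le_of_unit_norm hc fun v hv => ?_
  by_cases h0 : A v = 0
  · rw [h0, norm_zero]; exact hc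
  have hn : 0 < ‖A v‖ := norm_pos_iff.2 h0
  set u : Vec F r := (‖A v‖)⁻¹ • A v with hu
  have hu1 : ‖u‖ = 1 := by rw [hu, norm_smul, norm_inv, norm_norm, inv_mul_cancel₀ hn.ne']
  have h1 := (abs_le.1 (coupling_abs hs hp u v)).2
  have h2 := hb u
  have h3 := hb v
  rw [hu1] at h2; rw [hv] at h3
  have h4 : ⟪u, A v⟫ = ‖A v‖ := by
    rw [hu, real_inner_smul_left, real_inner_self_eq_norm_sq]; field_simp
  linarith

theorem exists_ratio_le (hc : IsComparison η ζ) {ε : ℝ} (hε : 0 < ε) :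
    ∃ K, 0 ≤ K ∧ ∀ x, η x / ζ x ≤ ε * η x + K := by
  obtain ⟨x₀, hx₀⟩ := exists_gt_of_unbounded hc.unbdd_zeta ε⁻¹
  refine ⟨η x₀, (hc.pos_eta _).le, fun x => ?_⟩
  have h1 := hc.one_le_zeta x
  have h2 := hc.pos_eta x
  have h0 := hc.pos_eta x₀
  rw [div_le_iff₀ (by linarith)]
  rcases le_total x x₀ with h | h
  · have := hc.mono_eta h
    have h3 : 0 < ε * η x := by positivity
    nlinarith
  · have h3 : ε⁻¹ ≤ ζ x := hx₀.le.trans (hc.mono_zeta h)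
    have h4 : 1 ≤ ε * ζ x := by
      calc 1 = ε * ε⁻¹ := (mul_inv_cancel₀ hε.ne').symm
        _ ≤ ε * ζ x := by gcongr
    have h5 : 0 ≤ η x₀ * ζ x := by positivity
    nlinarith

theorem IsGood.siteBounds (hr : 0 < r) (hc : IsComparison η ζ) (hC : 1 ≤ C) :
    ∃ K β, 0 ≤ K ∧ 0 ≤ β ∧ ∀ (n : ℕ) (m : ℝ) (Y₁ Y₂ : ℕ → Mat F r), IsGood η ζ C n m Y₁ Y₂ →
      ∃ η₁ η₂ ω₁ ω₂ : ℕ → Vec F r →L[ℝ] Vec F r,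
        SiteBounds (sites r n) m C (1 / (304 * C)) K β (latticeWeight η m)
          (fun l => opr (Y₁ l)) (fun l => opr (Y₂ l)) η₁ η₂ ω₁ ω₂ := by
  obtain ⟨K₀, hK₀, hK⟩ := exists_ratio_le hc (show 0 < 1 / (304 * C ^ 2) by positivity)
  have h00 := hc.pos_eta 0
  refine ⟨C * (1 + K₀), C + C * (1 + η 0), by positivity, by positivity, ?_⟩
  rintro n m Y₁ Y₂ ⟨hn, hm, hherm, hY1, hY2, η₁, η₂, ω₁, ω₂, κ, hκ1, hκC, hd1, hd2, hg⟩
  have hm0 : 0 < m := by linarith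
  have hN : 0 < sites r n := Nat.ceil_pos.2 (by positivity)
  have hxc : ∀ l : ℕ, (((l / m : ℝ).toNNReal : ℝ≥0) : ℝ) = l / m := fun l =>
    Real.coe_toNNReal _ (by positivity)
  have hx : ∀ l < sites r n, (((l / m : ℝ).toNNReal : ℝ≥0) : ℝ) < (⌈(n : ℝ) / r⌉₊ : ℝ) / m := by
    intro l hl
    rw [hxc]
    have : (l : ℝ) < (⌈(n : ℝ) / r⌉₊ : ℝ) := by exact_mod_cast hl
    gcongr
  have hst : ∀ {A : Type} (a : ℕ → A) (l : ℕ), step m a (l / m : ℝ).toNNReal = a l := by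
    intro A a l
    rw [step, hxc, mul_div_cancel₀ _ hm0.ne', Nat.floor_natCast]
  have hη0 : ∀ l, 0 < latticeWeight η m l := fun l => hc.pos_eta _
  have hκ0 : 0 < κ := by linarith
  have hw0 : latticeWeight η m 0 = η 0 := by simp [latticeWeight]
  have one_inner : ∀ (c : ℝ) (v : Vec F r), ⟪v, (opr (c • (1 : Mat F r)) v)⟫ = c * ‖v‖ ^ 2 := by
    intro c v
    rw [map_smul, opr_one]
    simp [inner_smul_right]
  have hpos1 : ∀ l v, 0 ≤ ⟪v, opr (η₁ l) v⟫ := fun l v => (hd1 l).1.inner_nonneg v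
  have hpos2 : ∀ l v, 0 ≤ ⟪v, opr (η₂ l) v⟫ := fun l v => (hd2 l).1.inner_nonneg v
  have hup : ∀ l < sites r n, ∀ v, ⟪v, opr (η₁ l) v⟫ + ⟪v, opr (η₂ l) v⟫ ≤
      C * (1 + latticeWeight η m l) * ‖v‖ ^ 2 := by
    intro l hl v
    have := (hg.1 _ (hx l hl)).2.1.inner_le v
    rw [hst, hst, one_inner, map_add, add_apply, inner_add_right] at this
    refine this.trans ?_
    have := hη0 l
    change κ * (1 + latticeWeight η m l) * ‖v‖ ^ 2 ≤ _
    gcongr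
  have hosc : ∀ l < sites r n, ∀ p < sites r n, l ≤ p → ((p - l : ℕ) : ℝ) ≤ m →
      ‖opr (ω₁ l) - opr (ω₁ p)‖ ^ 2 ≤ 1 / (304 * C) * latticeWeight η m l + C * (1 + K₀) ∧
      ‖opr (ω₂ l) - opr (ω₂ p)‖ ^ 2 ≤ 1 / (304 * C) * latticeWeight η m l + C * (1 + K₀) := by
    intro l hl p hp hlp hpm
    have h1 := hg.2 _ _ (hx l hl) (hx p hp) (by
      rw [hxc, hxc, ← sub_div, abs_div, abs_of_pos hm0, div_le_iff₀ hm0, one_mul,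
        ← Nat.cast_sub hlp, abs_of_nonneg (Nat.cast_nonneg _)]
      exact hpm)
    rw [hst, hst, hst, hst] at h1
    have h2 : κ * (1 + η (l / m : ℝ).toNNReal / ζ (l / m : ℝ).toNNReal) ≤
        1 / (304 * C) * latticeWeight η m l + C * (1 + K₀) := by
      have h3 := hK (l / m : ℝ).toNNReal
      change _ ≤ 1 / (304 * C ^ 2) * latticeWeight η m l + K₀ at h3
      have h4 := hη0 l
      calc κ * (1 + η (l / m : ℝ).toNNReal / ζ (l / m : ℝ).toNNReal)
          ≤ κ * (1 + (1 / (304 * C ^ 2) * latticeWeight η m l + K₀)) := by gcongr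
        _ ≤ C * (1 + (1 / (304 * C ^ 2) * latticeWeight η m l + K₀)) := by gcongr
        _ = _ := by field_simp; ring
    have hn : ∀ ω : ℕ → Mat F r, ‖opr (ω l) - opr (ω p)‖ ^ 2 ≤ specNorm (ω p - ω l) ^ 2 := by
      intro ω
      refine pow_le_pow_left₀ (norm_nonneg _) ((norm_sub_rev (opr (ω l)) (opr (ω p))).trans_le ?_) 2
      rw [← map_sub]
      exact norm_act_le_specNorm _
    have q1 := hn ω₁
    have q2 := hn ω₂
    have q3 := sq_nonneg (specNorm (ω₁ p - ω₁ l))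
    have q4 := sq_nonneg (specNorm (ω₂ p - ω₂ l))
    constructor <;> linarith
  have hinit : ∀ (Y θ ω : ℕ → Mat F r), Decomposes m Y θ ω → ‖opr (Y 0)‖ ≤ C →
      (∀ v, ⟪v, opr (θ 0) v⟫ ≤ C * (1 + η 0) * ‖v‖ ^ 2) →
      ‖opr (ω 0)‖ ≤ C + C * (1 + η 0) := by
    intro Y θ ω hd hY hb
    have h1 := (hd 0).2
    have h2 : opr (ω 0) = opr (Y 0) - m⁻¹ • opr (θ 0) := by
      rw [h1]; simp
    have h3 : ‖opr (θ 0)‖ ≤ C * (1 + η 0) :=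
      norm_le_of_inner_bound (inner_opr_symm (hd 0).1.1) (hd 0).1.inner_nonneg (by positivity) hb
    rw [h2]
    have h4 : ‖m⁻¹ • opr (θ 0)‖ ≤ C * (1 + η 0) := by
      refine ContinuousLinearMap.opNorm_le_bound _ (by positivity) fun v => ?_
      rw [smul_apply, norm_smul, Real.norm_of_nonneg (by positivity)]
      exact (mul_le_of_le_one_left (norm_nonneg _) (inv_le_one_of_one_le₀ hm)).trans
        ((opr (θ 0)).le_of_opNorm_le h3 v)
    exact (norm_sub_le (opr (Y 0)) (m⁻¹ • opr (θ 0))).trans (add_le_add hY h4)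
  refine ⟨fun l => opr (η₁ l), fun l => opr (η₂ l), fun l => opr (ω₁ l), fun l => opr (ω₂ l), ?_⟩
  refine ⟨fun l => (hη0 l).le, ?_, ?_, ?_, hpos1, hpos2, fun l => inner_opr_symm (hd2 l).1.1, ?_,
    hup, ?_, fun l hl p hp h1 h2 => (hosc l hl p hp h1 h2).1,
    fun l hl p hp h1 h2 => (hosc l hl p hp h1 h2).2, ?_, ?_⟩
  · intro a b hab
    refine hc.mono_eta (Real.toNNReal_mono ?_)
    have : (a : ℝ) ≤ b := by exact_mod_cast hab
    gcongr
  · intro l; simp only [(hd1 l).2, map_add, map_smul, map_sum]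
  · intro l; simp only [(hd2 l).2, map_add, map_smul, map_sum]
  · intro l hl v
    have := (hg.1 _ (hx l hl)).1.inner_le v
    rw [hst, hst, one_inner, map_add, add_apply, inner_add_right] at this
    refine le_trans ?_ this
    have h4 := hη0 l
    change _ ≤ (latticeWeight η m l / κ - κ) * ‖v‖ ^ 2
    gcongr
  · intro l hl v
    have := (hg.1 _ (hx l hl)).2.2.inner_le v
    rwa [hst, one_inner] at this
  · refine hinit _ _ _ hd1 hY1 fun v => ?_
    have h1 := hup 0 hN v
    have h2 := hpos2 0 v
    rw [hw0] at h1
    linarith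
  · refine hinit _ _ _ hd2 hY2 fun v => ?_
    have h1 := hup 0 hN v
    have h2 := hpos1 0 v
    rw [hw0] at h1
    linarith

end Ensemble

section EnsembleForm

/-- Coercivity of the discrete form, uniformly over good data and over boundary terms bounded
below. -/
theorem energy_bounds (hr : 0 < r) (hc : IsComparison η ζ) (hC : 1 ≤ C) (b : ℝ) :
    ∃ K₁ K₂, 0 < K₁ ∧ 0 < K₂ ∧ ∀ (n : ℕ) (m : ℝ) (Y₁ Y₂ : ℕ → Mat F r),
      IsGood η ζ C n m Y₁ Y₂ → ∀ v : ℕ → Vec F r, (∀ l, sites r n ≤ l → v l = 0) →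
      (∀ (u : Fin r → Vec F r) (x : Fin r → ℝ), OrthoBasis u → (∀ i, -b ≤ x i) →
        kin m (sites r n) v + wmass m (sites r n) (latticeWeight η m) v +
          ∑ i, max (x i) 0 * ‖dag (u i) (v 0)‖ ^ 2 ≤
        K₁ * dform n m Y₁ Y₂ u x v v + K₂ * mass m (sites r n) v) ∧
      |iform m (sites r n) (fun l => opr (Y₁ l)) (fun l => opr (Y₂ l)) v v| ≤
        K₂ * (kin m (sites r n) v + wmass m (sites r n) (latticeWeight η m) v +
          mass m (sites r n) v) := by
  obtain ⟨K, β, hK, hβ, hsb⟩ := IsGood.siteBounds (F := F) hr hc hC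
  obtain ⟨C₀, hC₀, hif⟩ := iform_bounds (E := Vec F r) hC hK hβ (hc.pos_eta 0).le
  set τ : ℝ := 1 / (12 * (|b| + 1)) with hτ
  have hb0 := abs_nonneg b
  have hτ0 : 0 < τ := by positivity
  have hbτ : |b| * τ ≤ 1 / 12 := by
    rw [hτ, mul_one_div, div_le_iff₀ (by positivity)]; linarith
  refine ⟨12 * C, 12 * C * (C₀ + |b| * τ⁻¹) + C₀, by positivity, by positivity, ?_⟩
  intro n m Y₁ Y₂ hg v hv
  obtain ⟨η₁, η₂, ω₁, ω₂, hS⟩ := hsb n m Y₁ Y₂ hg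
  have hm : 1 ≤ m := hg.2.1
  have hm0 : 0 < m := by linarith
  have h0 : latticeWeight η m 0 ≤ η 0 := by simp [latticeWeight]
  obtain ⟨h1, h2⟩ := hif _ m _ _ _ _ _ _ _ hm h0 hS v hv
  have hk := kin_nonneg hm0 (sites r n) v
  have hw := wmass_nonneg hm0 (sites r n) (h := latticeWeight η m) (fun l => (hc.pos_eta _).le) v
  have hM := mass_nonneg hm0 (sites r n) v
  refine ⟨fun u x hu hx => ?_, h2.trans ?_⟩
  · have hbd : ∑ i, max (x i) 0 * ‖dag (u i) (v 0)‖ ^ 2 - |b| * ‖v 0‖ ^ 2 ≤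
        ⟪v 0, act (specMat u x) (v 0)⟫ := by
      rw [inner_act_specMat_self, hu.norm_sq_eq (v 0), mul_sum, ← sum_sub_distrib]
      refine sum_le_sum fun i _ => ?_
      rw [← sub_mul]
      refine mul_le_mul_of_nonneg_right ?_ (sq_nonneg _)
      have := hx i
      have := le_abs_self b
      rcases le_total (x i) 0 with h | h
      · rw [max_eq_right h]; linarith
      · rw [max_eq_left h]; linarith
    have htr := norm_sq_le_kin_mass hm0 hv hτ0 0
    have htr' : |b| * ‖v 0‖ ^ 2 ≤ 1 / 12 * kin m (sites r n) v +
        |b| * τ⁻¹ * mass m (sites r n) v := by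
      calc |b| * ‖v 0‖ ^ 2 ≤ |b| * (τ * kin m (sites r n) v + τ⁻¹ * mass m (sites r n) v) := by
            gcongr
        _ = |b| * τ * kin m (sites r n) v + |b| * τ⁻¹ * mass m (sites r n) v := by ring
        _ ≤ _ := by gcongr
    have hS0 : 0 ≤ ∑ i, max (x i) 0 * ‖dag (u i) (v 0)‖ ^ 2 :=
      sum_nonneg fun i _ => mul_nonneg (le_max_right _ _) (sq_nonneg _)
    rw [dform]
    generalize (∑ i, max (x i) 0 * ‖dag (u i) (v 0)‖ ^ 2) = S at hbd hS0 ⊢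
    generalize ⟪v 0, act (specMat u x) (v 0)⟫ = D at hbd ⊢
    generalize kin m (sites r n) v = k at *
    generalize wmass m (sites r n) (latticeWeight η m) v = w at *
    generalize mass m (sites r n) v = M at *
    generalize iform m (sites r n) (fun l => opr (Y₁ l)) (fun l => opr (Y₂ l)) v v = I at *
    generalize |b| * τ⁻¹ = q at *
    generalize |b| * ‖v 0‖ ^ 2 = z at *
    have key : 1 / 12 * k + 1 / (8 * C) * w + S ≤ I + D + (C₀ + q) * M := by linarith
    have e1 : 12 * C * (1 / (8 * C) * w) = 3 / 2 * w := by field_simp; ring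
    have key2 := mul_le_mul_of_nonneg_left key (show 0 ≤ 12 * C by positivity)
    have : k ≤ 12 * C * (1 / 12 * k) := by nlinarith
    have : S ≤ 12 * C * S := by nlinarith
    have : 0 ≤ C₀ * M := by positivity
    linarith
  · have : 0 ≤ 12 * C * (C₀ + |b| * τ⁻¹) := by positivity
    gcongr
    linarith

/-! ### The continuum form -/

theorem integrable_dag (hf : MemL2(f)) (hg : MemL2(g)) :
    Integrable (fun x => dag (f x) (g x)) halfLine := by
  have h1 : Integrable (fun x => ‖f x‖ * ‖g x‖) halfLine := hf.norm.integrable_mul hg.norm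
  refine h1.mono' (continuous_dag.comp_aestronglyMeasurable (hf.1.prodMk hg.1)) ?_
  exact .of_forall fun x => norm_dag_le _ _

theorem re_integral {f : ℝ → F} (hf : Integrable f halfLine) :
    re (∫ x in ℝ₊, f x) = ∫ x in ℝ₊, re (f x) :=
  ((LinearMap.toContinuousLinearMap (re : F →ₗ[ℝ] ℝ)).integral_comp_comm hf).symm

theorem re_ip (hf : MemL2(f)) (hg : MemL2(g)) : re (ip f g) = ∫ x in ℝ₊, ⟪f x, g x⟫ := by
  rw [ip, re_integral (integrable_dag hf hg)]
  simp only [re_dag]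

theorem ip_op_left (hf : MemL2(f)) (hg : MemL2(g)) (c : F) :
    ip (fun x => op c • f x) g = star c * ip f g := by
  simp only [ip, dag_op_left]
  exact integral_const_mul_of_integrable (integrable_dag hf hg)

theorem IsTest.vanish (h : IsTest u w φ) : ∃ R, ∀ x, R < x → φ x = 0 ∧ deriv φ x = 0 :=
  vanish_of_hasCompactSupport h.2.1

theorem IsTest.cont (h : IsTest u w φ) : Continuous φ := h.1.continuous

theorem IsTest.cont_deriv (h : IsTest u w φ) : Continuous (deriv φ) := h.1.continuous_deriv
    (by simp)

theorem IsTest.memLp (h : IsTest u w φ) : MemL2(φ) := by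
  obtain ⟨R, hR⟩ := h.vanish
  exact memLp_of_vanish h.cont fun x _ hx => (hR x hx).1

theorem IsTest.memLp_deriv (h : IsTest u w φ) : MemL2(deriv φ) := by
  obtain ⟨R, hR⟩ := h.vanish
  exact memLp_of_vanish h.cont_deriv fun x _ hx => (hR x hx).2

theorem IsTest.op_smul (h : IsTest u w φ) (c : F) : IsTest u w fun x => op c • φ x := by
  refine ⟨h.1.const_smul (op c), ?_, fun i hi => ?_⟩
  · refine h.2.1.comp_left (g := fun v : Vec F r => op c • v) (smul_zero _)
  · obtain ⟨δ, hδ, h'⟩ := h.2.2 i hi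
    exact ⟨δ, hδ, fun x hx => by rw [dag_op_right, h' x hx, zero_mul]⟩

theorem IsTest.deriv_op (h : IsTest u w φ) (c : F) :
    deriv (fun x => op c • φ x) = fun x => op c • deriv φ x := by
  ext1 x
  exact deriv_fun_const_smul (op c) (h.1.differentiable (by simp) x)

theorem continuous_act_path (hY : Continuous Y)
    (hφ : Continuous φ) : Continuous fun x : ℝ => act (Y x.toNNReal) (φ x) := by
  have h1 : Continuous fun x : ℝ => opr (Y x.toNNReal) :=
    continuous_opr.comp (hY.comp continuous_real_toNNReal)
  exact h1.clm_apply hφ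

theorem IsTest.memLp_act (h : IsTest u w φ) (hY : Continuous Y) :
    MemL2(fun x => act (Y x.toNNReal)ᴴ (φ x)) ∧
      MemL2(fun x => act (Y x.toNNReal)ᴴ (deriv φ x)) := by
  obtain ⟨R, hR⟩ := h.vanish
  have hY' : Continuous fun x => (Y x)ᴴ := hY.matrix_conjTranspose
  refine ⟨memLp_of_vanish (R := R) (continuous_act_path hY' h.cont) fun x _ hx => ?_,
    memLp_of_vanish (R := R) (continuous_act_path hY' h.cont_deriv) fun x _ hx => ?_⟩
  · rw [(hR x hx).1]; exact map_zero (opr _)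
  · rw [(hR x hx).2]; exact map_zero (opr _)

/-- The four terms of the form, with the potential moved to the test function. -/
theorem form_eq (Y : ℝ≥0 → Mat F r) (u : Fin r → Vec F r) (w : Fin r → EReal)
    (φ f g : ℝ → Vec F r) :
    form Y u w φ f g = ip (deriv φ) g - ip (fun x => act (Y x.toNNReal)ᴴ (deriv φ x)) f -
      ip (fun x => act (Y x.toNNReal)ᴴ (φ x)) g +
      ∑ i, (w i).toReal • (star (dag (u i) (φ 0)) * dag (u i) (f 0)) := by
  simp only [form, ip, dag_act, dag_act_specMat, dag_act]
  rw [← dag_act_specMat, dag_act]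

theorem re_form (hY : Continuous Y) (hφ : IsTest u w φ) (hf : MemL2(f)) (hg : MemL2(g)) :
    re (form Y u w φ f g) = (∫ x in ℝ₊, ⟪deriv φ x, g x⟫) -
      (∫ x in ℝ₊, ⟪deriv φ x, opr (Y x.toNNReal) (f x)⟫) -
      (∫ x in ℝ₊, ⟪φ x, opr (Y x.toNNReal) (g x)⟫) +
      ∑ i, (w i).toReal * re (star (dag (u i) (φ 0)) * dag (u i) (f 0)) := by
  obtain ⟨h1, h2⟩ := hφ.memLp_act hY
  rw [form_eq, map_add, map_sub, map_sub, re_ip hφ.memLp_deriv hg, re_ip h2 hf, re_ip h1 hg,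
    map_sum]
  simp only [map_smul, smul_eq_mul, opr_apply, inner_act]

theorem form_op_left (hY : Continuous Y) (hφ : IsTest u w φ) (hf : MemL2(f))
    (hg : MemL2(g)) (c : F) :
    form Y u w (fun x => op c • φ x) f g = star c * form Y u w φ f g := by
  obtain ⟨h1, h2⟩ := hφ.memLp_act hY
  rw [form_eq, form_eq, hφ.deriv_op c]
  simp only [act_op, ip_op_left hφ.memLp_deriv hg, ip_op_left h2 hf, ip_op_left h1 hg, dag_op_right,
    star_mul, mul_add, mul_sub, mul_sum, mul_smul_comm, mul_assoc]

theorem isCompact_Iic_nnreal (K : ℝ≥0) : IsCompact (Iic K) := by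
  rw [← Icc_bot]; exact isCompact_Icc

end EnsembleForm

/-! ### Spectral theory of self-adjoint matrices over the scalars -/

section Spectral

theorem exists_min_eigenvector {U : Type*} [NormedAddCommGroup U] [InnerProductSpace ℝ U]
    [FiniteDimensional ℝ U] [Nontrivial U] (T : U →ₗ[ℝ] U) (hT : T.IsSymmetric) :
    ∃ (x : U) (l : ℝ), ‖x‖ = 1 ∧ T x = l • x ∧ ∀ y, l * ‖y‖ ^ 2 ≤ ⟪y, T y⟫ := by
  have : Nonempty (Fin (Module.finrank ℝ U)) := ⟨⟨0, Module.finrank_pos⟩⟩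
  set e := hT.eigenvectorBasis rfl
  obtain ⟨i, hi⟩ := Finite.exists_min (hT.eigenvalues rfl)
  refine ⟨e i, hT.eigenvalues rfl i, e.norm_eq_one i, hT.apply_eigenvectorBasis rfl i, fun y => ?_⟩
  rw [← real_inner_self_eq_norm_sq, ← e.sum_inner_mul_inner y y, ← e.sum_inner_mul_inner y (T y),
    mul_sum]
  refine sum_le_sum fun j _ => ?_
  have h : ⟪e j, T y⟫ = hT.eigenvalues rfl j * ⟪e j, y⟫ := by
    rw [← hT, hT.apply_eigenvectorBasis, ← real_inner_smul_left]; rfl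
  rw [h, real_inner_comm]
  nlinarith [mul_le_mul_of_nonneg_right (hi j) (mul_self_nonneg ⟪e j, y⟫)]

variable {n : ℕ}

/-- Linear combinations over `F` with scalars on the right. -/
def comb {ι : Type*} [Fintype ι] (e : ι → Vec F n) : (ι → F) →ₗ[ℝ] Vec F n where
  toFun c := ∑ i, op (c i) • e i
  map_add' c d := by simp [add_smul, sum_add_distrib]
  map_smul' t c := by
    simp only [Pi.smul_apply, RingHom.id_apply, smul_sum]
    refine sum_congr rfl fun i _ => ?_
    ext a
    simp

theorem comb_apply {ι : Type*} [Fintype ι] (e : ι → Vec F n) (c : ι → F) :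
    comb e c = ∑ i, op (c i) • e i := rfl

theorem finrank_vec : Module.finrank ℝ (Vec F n) = n * Module.finrank ℝ F := by
  rw [(WithLp.linearEquiv 2 ℝ (Fin n → F)).finrank_eq, Module.finrank_pi_fintype]
  simp

theorem finrank_scalar_pos : 0 < Module.finrank ℝ F := Module.finrank_pos

/-- Fewer linear conditions over `F` than the dimension have a nonzero solution. -/
theorem exists_ne_zero_dag {A : Type*} [AddCommGroup A] [Module ℝ A] [FiniteDimensional ℝ A]
    (L : A →ₗ[ℝ] Vec F n) {k d : ℕ} (hd : Module.finrank ℝ A = d * Module.finrank ℝ F)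
    (hk : k < d) (e : Fin k → Vec F n) : ∃ v, v ≠ 0 ∧ ∀ i, dag (e i) (L v) = 0 := by
  let M : A →ₗ[ℝ] (Fin k → F) :=
    { toFun := fun v i => dag (e i) (L v)
      map_add' := fun u v => by ext i; simp [dag_add_right]
      map_smul' := fun t v => by ext i; simp [dag_smul_right] }
  have hM : LinearMap.ker M ≠ ⊥ := by
    refine LinearMap.ker_ne_bot_of_finrank_lt ?_
    rw [hd, Module.finrank_pi_fintype]
    simp only [sum_const, Finset.card_univ, Fintype.card_fin, smul_eq_mul]
    exact Nat.mul_lt_mul_of_pos_right hk finrank_scalar_pos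
  obtain ⟨v, hv, hv0⟩ := (Submodule.ne_bot_iff _).1 hM
  exact ⟨v, hv0, fun i => congrFun (LinearMap.mem_ker.1 hv) i⟩

theorem dag_symm_of_symmetric {T : Vec F n →ₗ[ℝ] Vec F n} (hT : T.IsSymmetric)
    (hop : ∀ (c : F) v, T (op c • v) = op c • T v) (u v : Vec F n) : dag u (T v) = dag (T u) v := by
  rw [← sub_eq_zero]
  refine eq_zero_of_re_star_mul fun c => ?_
  rw [mul_sub, map_sub, re_star_mul_dag, re_star_mul_dag, ← hop, hT, sub_self]

/-- The first `k` vectors of an orthonormal eigenbasis over `F`, ordered by the eigenvalues; each is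
a minimizer of the Rayleigh quotient on the orthogonal complement of its predecessors. -/
def IsEigenFlag (T : Vec F n →ₗ[ℝ] Vec F n) (k : ℕ) (e : ℕ → Vec F n) (l : ℕ → ℝ) : Prop :=
  ∀ i < k, dag (e i) (e i) = 1 ∧ (∀ j < i, dag (e j) (e i) = 0) ∧ T (e i) = l i • e i ∧
    ∀ v, (∀ j < i, dag (e j) v = 0) → l i * ‖v‖ ^ 2 ≤ ⟪v, T v⟫

theorem exists_eigenFlag {T : Vec F n →ₗ[ℝ] Vec F n} (hT : T.IsSymmetric)
    (hop : ∀ (c : F) v, T (op c • v) = op c • T v) {k : ℕ} (hk : k ≤ n) :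
    ∃ e l, IsEigenFlag T k e l := by
  induction k with
  | zero => exact ⟨0, 0, fun i hi => absurd hi (Nat.not_lt_zero i)⟩
  | succ k ih =>
    obtain ⟨e, l, h⟩ := ih (by omega)
    let U : Submodule ℝ (Vec F n) :=
      { carrier := {v | ∀ j < k, dag (e j) v = 0}
        add_mem' := fun {a b} ha hb j hj => by rw [dag_add_right, ha j hj, hb j hj, add_zero]
        zero_mem' := fun j hj => dag_zero_right _
        smul_mem' := fun t v hv j hj => by rw [dag_smul_right, hv j hj, smul_zero] }
    have hU : ∀ v, v ∈ U ↔ ∀ j < k, dag (e j) v = 0 := fun v => Iff.rfl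
    have hinv : ∀ v ∈ U, T v ∈ U := fun v hv j hj => by
      rw [dag_symm_of_symmetric hT hop, (h j hj).2.2.1, dag_smul_left, hv j hj, smul_zero]
    obtain ⟨v, hv0, hv⟩ := exists_ne_zero_dag LinearMap.id finrank_vec
      (show k < n by omega) fun i : Fin k => e i
    have : Nontrivial U := ⟨⟨⟨v, fun j hj => hv ⟨j, hj⟩⟩, 0, fun h' =>
      hv0 (congrArg Subtype.val h')⟩⟩
    obtain ⟨x, μ, hx1, hx2, hx3⟩ := exists_min_eigenvector (U := U) (T.restrict hinv)
      (fun a b => hT (a : Vec F n) b)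
    have hxn : ‖(x : Vec F n)‖ = 1 := hx1
    refine ⟨Function.update e k x, Function.update l k μ, fun i hi => ?_⟩
    have hlt : ∀ j < k, Function.update e k (x : Vec F n) j = e j := fun j hj =>
      Function.update_of_ne hj.ne _ _
    rcases Nat.lt_succ_iff_lt_or_eq.1 hi with hi | rfl
    · obtain ⟨h1, h2, h3, h4⟩ := h i hi
      rw [hlt i hi, Function.update_of_ne hi.ne]
      refine ⟨h1, fun j hj => ?_, h3, fun v hv => h4 v fun j hj => ?_⟩
      · rw [hlt j (hj.trans hi)]; exact h2 j hj
      · rw [← hlt j (hj.trans hi)]; exact hv j hj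
    · rw [Function.update_self, Function.update_self]
      refine ⟨by rw [dag_self, hxn]; simp, fun j hj => ?_, ?_, fun v hv => ?_⟩
      · rw [hlt j hj]; exact x.2 j hj
      · exact congrArg Subtype.val hx2
      · exact hx3 ⟨v, fun j hj => by rw [← hlt j hj]; exact hv j hj⟩

variable {T : Vec F n →ₗ[ℝ] Vec F n} {k : ℕ} {e : ℕ → Vec F n} {l : ℕ → ℝ}

theorem IsEigenFlag.orthonormal (h : IsEigenFlag T k e l) {i j : ℕ} (hi : i < k) (hj : j < k) :
    dag (e i) (e j) = if i = j then 1 else 0 := by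
  rcases lt_trichotomy i j with hij | rfl | hij
  · rw [if_neg hij.ne, (h j hj).2.1 i hij]
  · rw [if_pos rfl, (h i hi).1]
  · rw [if_neg hij.ne', ← star_dag, (h i hi).2.1 j hij, star_zero]

theorem IsEigenFlag.norm_eq_one (h : IsEigenFlag T k e l) {i : ℕ} (hi : i < k) : ‖e i‖ = 1 := by
  have h1 := congrArg re (h i hi).1
  rw [re_dag, real_inner_self_eq_norm_sq] at h1
  have h2 : re (1 : F) = 1 := by
    have := (isRealPart_re (F := F)).re_algebraMap 1
    simpa using this
  rw [h2] at h1
  exact (pow_eq_one_iff_of_nonneg (norm_nonneg _) two_ne_zero).1 h1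

theorem IsEigenFlag.mono (h : IsEigenFlag T k e l) {i j : ℕ} (hij : i ≤ j) (hj : j < k) :
    l i ≤ l j := by
  have h1 := (h i (hij.trans_lt hj)).2.2.2 (e j) fun p hp => by
    rw [h.orthonormal (by omega) hj, if_neg (by omega)]
  rw [(h j hj).2.2.1, real_inner_smul_right, real_inner_self_eq_norm_sq, h.norm_eq_one hj] at h1
  simpa using h1

/-- The easy half of the minimax principle. -/
theorem IsEigenFlag.le_of_comb (h : IsEigenFlag T (k + 1) e l) {v : Fin (k + 1) → Vec F n} {a : ℝ}
    (hv : ∀ c : Fin (k + 1) → F, c ≠ 0 → comb v c ≠ 0)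
    (ha : ∀ c, ⟪comb v c, T (comb v c)⟫ ≤ a * ‖comb v c‖ ^ 2) : l k ≤ a := by
  obtain ⟨c, hc, hd⟩ := exists_ne_zero_dag (comb v) (by simp [Module.finrank_pi_fintype])
    (Nat.lt_succ_self k) fun i : Fin k => e i
  have h1 := (h k (Nat.lt_succ_self k)).2.2.2 (comb v c) fun j hj => hd ⟨j, hj⟩
  have h2 := ha c
  have h3 : 0 < ‖comb v c‖ ^ 2 := by
    have := norm_pos_iff.2 (hv c hc)
    positivity
  exact le_of_mul_le_mul_right (h1.trans h2) h3

variable {ι : Type*} [Fintype ι] [DecidableEq ι] {e : ι → Vec F n}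
  (he : ∀ i j, dag (e i) (e j) = if i = j then 1 else 0)
  (hop : ∀ (c : F) v, T (op c • v) = op c • T v) {μ : ι → ℝ} (hμ : ∀ i, T (e i) = μ i • e i)

include he hop hμ in
/-- The quadratic form on combinations of orthonormal eigenvectors. -/
theorem inner_comb_eigen (c : ι → F) : ⟪comb e c, T (comb e c)⟫ = ∑ i, μ i * ‖c i‖ ^ 2 := by
  rw [← re_dag]
  conv_lhs => rw [comb_apply e c, map_sum, dag_sum_right, map_sum]
  refine sum_congr rfl fun i _ => ?_
  rw [hop, hμ, smul_comm, dag_smul_right, map_smul, smul_eq_mul, dag_op_right, ← star_dag,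
    dag_sum_right]
  simp only [dag_op_right, he, ite_mul, one_mul, zero_mul, Finset.sum_ite_eq, Finset.mem_univ,
    if_true]
  rw [re_star_mul_self]

include he in
theorem norm_comb_sq (c : ι → F) : ‖comb e c‖ ^ 2 = ∑ i, ‖c i‖ ^ 2 := by
  have := inner_comb_eigen he (T := LinearMap.id) (fun _ _ => rfl) (μ := 1) (by simp) c
  simpa [real_inner_self_eq_norm_sq] using this

include he in
theorem comb_ne_zero {c : ι → F} (hc : c ≠ 0) : comb e c ≠ 0 := by
  intro h
  have h1 := norm_comb_sq he c
  rw [h, norm_zero, zero_pow two_ne_zero, eq_comm,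
    Finset.sum_eq_zero_iff_of_nonneg fun _ _ => sq_nonneg _] at h1
  exact hc (funext fun i => by simpa using h1 i (Finset.mem_univ i))

include he hop hμ in
theorem inner_comb_le {a : ℝ} (ha : ∀ i, μ i ≤ a) (c : ι → F) :
    ⟪comb e c, T (comb e c)⟫ ≤ a * ‖comb e c‖ ^ 2 := by
  rw [inner_comb_eigen he hop hμ, norm_comb_sq he, mul_sum]
  exact sum_le_sum fun i _ => mul_le_mul_of_nonneg_right (ha i) (sq_nonneg _)

end Spectral

/-! ### The discrete operator as a self-adjoint matrix -/

section DiscreteOperator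

variable {n : ℕ}

/-- The lattice function of a vector in `F ^ n`, in lexicographic order. -/
def toSites (r : ℕ) (x : Vec F n) (j : ℕ) : Vec F r :=
  WithLp.toLp 2 fun i => if h : j * r + (i : ℕ) < n then x ⟨j * r + i, h⟩ else 0

/-- The vector of the first `n` coordinates of a lattice function. -/
def ofSites (hr : 0 < r) (n : ℕ) (v : ℕ → Vec F r) : Vec F n :=
  WithLp.toLp 2 fun a => v ((a : ℕ) / r) ⟨(a : ℕ) % r, Nat.mod_lt _ hr⟩

theorem trunc_toSites (x : Vec F n) : trunc n (toSites r x) = toSites r x := by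
  ext j i
  simp only [trunc, toSites]
  split_ifs <;> rfl

theorem trunc_trunc (v : ℕ → Vec F r) : trunc n (trunc n v) = trunc n v := by
  ext j i
  simp only [trunc]
  split_ifs <;> rfl

theorem toSites_ofSites (hr : 0 < r) (v : ℕ → Vec F r) : toSites r (ofSites hr n v) = trunc n
    v := by
  ext j i
  simp only [trunc, toSites, ofSites]
  split_ifs with h
  · have h1 : (j * r + (i : ℕ)) / r = j := by
      rw [mul_comm, Nat.mul_add_div hr, Nat.div_eq_of_lt i.2, add_zero]
    have h2 : (j * r + (i : ℕ)) % r = i := by rw [mul_comm, Nat.mul_add_mod, Nat.mod_eq_of_lt i.2]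
    simp only [h1, h2]
  · rfl

theorem ofSites_toSites (hr : 0 < r) (x : Vec F n) : ofSites hr n (toSites r x) = x := by
  ext a
  have h : (a : ℕ) / r * r + (a : ℕ) % r = a := Nat.div_add_mod' _ _
  simp only [toSites, ofSites, h, a.2, dif_pos]

theorem le_sites_mul (hr : 0 < r) (n : ℕ) : n ≤ sites r n * r := by
  have h : (n : ℝ) / r ≤ sites r n := Nat.le_ceil _
  have hr' : (0 : ℝ) < r := by exact_mod_cast hr
  rw [div_le_iff₀ hr'] at h
  exact_mod_cast h

theorem supp_of_trunc (hr : 0 < r) {v : ℕ → Vec F r} (hv : trunc n v = v) :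
    ∀ l, sites r n ≤ l → v l = 0 := by
  intro l hl
  rw [← hv]
  ext i
  simp only [trunc]
  rw [if_neg]
  · rfl
  · have := le_sites_mul hr n
    have := Nat.mul_le_mul_right r hl
    omega

theorem trunc_of_supp {R : ℕ} (hR : R * r ≤ n) {v : ℕ → Vec F r} (hv : ∀ l, R ≤ l → v l = 0) :
    trunc n v = v := by
  ext l i
  simp only [trunc]
  split_ifs with h
  · rfl
  · rw [hv l]
    · rfl
    · by_contra hl
      have h1 : (l + 1) * r ≤ R * r := Nat.mul_le_mul_right r (by omega)
      have := i.2
      rw [add_mul] at h1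
      omega

theorem sum_dag_toSites (hr : 0 < r) (x y : Vec F n) :
    ∑ l ∈ range (sites r n), dag (toSites r x l) (toSites r y l) = dag x y := by
  set g : ℕ → F := fun a => if h : a < n then star (x ⟨a, h⟩) * y ⟨a, h⟩ else 0 with hg
  have h1 : ∀ l, dag (toSites r x l) (toSites r y l) = ∑ i ∈ range r, g (l * r + i) := by
    intro l
    rw [Finset.sum_range]
    simp only [dag, dotProduct, toSites, hg, Pi.star_apply]
    refine sum_congr rfl fun i _ => ?_
    split_ifs
    · rfl
    · simp
  have h2 : ∀ N, ∑ l ∈ range N, ∑ i ∈ range r, g (l * r + i) = ∑ a ∈ range (N * r), g a := by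
    intro N
    induction N with
    | zero => simp
    | succ N ih => rw [sum_range_succ, ih, add_mul, one_mul, Finset.sum_range_add]
  simp only [h1]
  rw [h2, ← Finset.sum_subset (Finset.range_mono (le_sites_mul hr n)), Finset.sum_range]
  · simp only [dag, dotProduct, hg, Pi.star_apply]
    refine sum_congr rfl fun i _ => ?_
    rw [dif_pos i.2]
  · intro a _ ha
    simp only [hg]
    rw [dif_neg (by simpa using ha)]

theorem inner_trunc_right {v : ℕ → Vec F r} (hv : trunc n v = v) (w : ℕ → Vec F r) (l : ℕ) :
    ⟪v l, trunc n w l⟫ = ⟪v l, w l⟫ := by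
  rw [← re_dag, ← re_dag, ← hv]
  congr 1
  simp only [dag, dotProduct, trunc, Pi.star_apply]
  refine sum_congr rfl fun i _ => ?_
  split_ifs <;> simp

variable (m : ℝ) (Y₁ Y₂ : ℕ → Mat F r) (W : Mat F r)

theorem trunc_add (v w : ℕ → Vec F r) : trunc n (v + w) = trunc n v + trunc n w := by
  ext j i; simp only [trunc, Pi.add_apply, PiLp.add_apply]; split_ifs <;> simp

theorem trunc_op (c : F) (v : ℕ → Vec F r) :
    trunc n (fun j => op c • v j) = fun j => op c • trunc n v j := by
  ext j i; simp only [trunc, PiLp.smul_apply]; split_ifs <;> simp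

theorem discreteH_add (v w : ℕ → Vec F r) : discreteH n m Y₁ Y₂ W (v + w) =
    discreteH n m Y₁ Y₂ W v + discreteH n m Y₁ Y₂ W w := by
  simp only [discreteH]
  rw [← trunc_add, trunc_add v w]
  congr 1
  ext1 j
  simp only [diffAdj, diff, potential, boundary, prev, Pi.add_apply, act_add]
  split_ifs
  all_goals simp only [smul_add, act_add]; module

theorem discreteH_op (c : F) (v : ℕ → Vec F r) : discreteH n m Y₁ Y₂ W (fun j => op c • v j) =
    fun j => op c • discreteH n m Y₁ Y₂ W v j := by
  simp only [discreteH]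
  rw [← trunc_op, trunc_op c v]
  congr 1
  ext1 j
  have hs : ∀ (t : ℝ) (x : Vec F r), t • op c • x = op c • t • x := fun t x => smul_comm _ _ _
  simp only [diffAdj, diff, prev, potential, boundary, act_op, ← smul_sub, hs]
  split_ifs <;> simp only [smul_add, smul_sub, smul_zero, hs]

/-- The discrete operator on `F ^ n`, as a real linear map. -/
def hOp (hr : 0 < r) (n : ℕ) : Vec F n →ₗ[ℝ] Vec F n where
  toFun x := ofSites hr n (discreteH n m Y₁ Y₂ W (toSites r x))
  map_add' x y := by
    have : toSites r (x + y) = toSites r x + toSites r y := by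
      ext j i; simp only [toSites, Pi.add_apply, PiLp.add_apply]; split_ifs <;> simp
    rw [this, discreteH_add]; ext a; simp [ofSites]
  map_smul' t x := by
    have e : ∀ {k : ℕ} (y : Vec F k), t • y = op (algebraMap ℝ F t) • y := fun y => by
      ext i; simp [Algebra.smul_def, Algebra.commutes]
    have : toSites r (t • x) = fun j => op (algebraMap ℝ F t) • toSites r x j := by
      ext j i; simp only [toSites, e, PiLp.smul_apply]; split_ifs <;> simp
    rw [this, discreteH_op]; ext a; simp [ofSites, Algebra.smul_def, Algebra.commutes]

theorem hOp_op (hr : 0 < r) (c : F) (x : Vec F n) :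
    hOp m Y₁ Y₂ W hr n (op c • x) = op c • hOp m Y₁ Y₂ W hr n x := by
  have : toSites r (op c • x) = fun j => op c • toSites r x j := by
    ext j i; simp only [toSites, PiLp.smul_apply]; split_ifs <;> simp
  change ofSites hr n (discreteH n m Y₁ Y₂ W (toSites r (op c • x))) =
    op c • ofSites hr n (discreteH n m Y₁ Y₂ W (toSites r x))
  rw [this, discreteH_op]; ext a; simp [ofSites]

theorem toSites_hOp (hr : 0 < r) (x : Vec F n) :
    toSites r (hOp m Y₁ Y₂ W hr n x) = discreteH n m Y₁ Y₂ W (toSites r x) := by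
  change toSites r (ofSites hr n _) = _
  rw [toSites_ofSites, discreteH, trunc_trunc]

theorem toSites_injective (hr : 0 < r) : Function.Injective (toSites r : Vec F n → ℕ → Vec F r) :=
  fun x y h => by rw [← ofSites_toSites hr x, h, ofSites_toSites hr y]

variable {m Y₁ W} (hm : 0 < m) (hr : 0 < r) (hY : ∀ l, (Y₁ l).IsHermitian) (u : Fin r → Vec F r)
  (x : Fin r → ℝ)

include hm hr in
/-- The quadratic form of the discrete operator. -/
theorem sum_inner_discreteH {v w : ℕ → Vec F r} (hv : trunc n v = v) (hw : trunc n w = w) :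
    ∑ l ∈ range (sites r n), ⟪v l, discreteH n m Y₁ Y₂ (specMat u x) w l⟫ =
      m * dform n m Y₁ Y₂ u x v w := by
  have hvs := supp_of_trunc hr hv
  set N := sites r n with hN
  have hsh : ∀ a : ℕ → Vec F r, ∑ l ∈ range N, ⟪v l, prev a l⟫ =
      ∑ l ∈ range N, ⟪v (l + 1), a l⟫ := by
    intro a
    have h1 := sum_range_succ (fun l => ⟪v l, prev a l⟫) N
    rw [hvs N le_rfl, inner_zero_left, add_zero, Finset.sum_range_succ'] at h1
    rw [← h1]
    simp [prev]
  have hbd : ∑ l ∈ range N, ⟪v l, boundary m (specMat u x) w l⟫ =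
      m * ⟪v 0, act (specMat u x) (w 0)⟫ := by
    by_cases h0 : 0 < N
    · rw [Finset.sum_eq_single_of_mem 0 (Finset.mem_range.2 h0)]
      · simp [boundary, act_smul, real_inner_smul_right]
      · intro l _ hl; simp [boundary, hl]
    · have : v 0 = 0 := hvs 0 (by omega)
      have h00 : N = 0 := by omega
      simp [this, h00]
  have hop : ∀ (A : ℕ → Mat F r) l, opr (tri m A l) = incr m (fun l => opr (A l)) l := by
    intro A l
    simp only [tri, incr, map_smul, map_sub, prev]
    split_ifs <;> simp
  have hdq : ∀ a : ℕ → Vec F r, diff m a = dq m a := fun a => rfl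
  have e : ∀ l, ⟪v l, discreteH n m Y₁ Y₂ (specMat u x) w l⟫ =
      m * (⟪v l, prev (dq m w) l⟫ - ⟪v l, dq m w l⟫) +
      (⟪v l, incr m (fun l => opr (Y₁ l)) l (w l)⟫ + 1 / 2 *
        (⟪v l, incr m (fun l => opr (Y₂ l)) l (w (l + 1))⟫ +
          ⟪v l, prev (fun l => act (tri m Y₂ l)ᴴ (w l)) l⟫)) +
      ⟪v l, boundary m (specMat u x) w l⟫ := by
    intro l
    rw [discreteH, inner_trunc_right hv, hw, diffAdj, hdq, potential, ← hop, ← hop]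
    simp only [inner_add_right, real_inner_smul_right, inner_sub_right, opr_apply]
  simp only [e, sum_add_distrib, ← mul_sum, sum_sub_distrib, hsh, hbd]
  have e1 : ∀ S D : ℝ, m * (m⁻¹ * S + D) = S + m * D := fun S D => by field_simp
  rw [dform, iform, e1, ← hN]
  have e2 : ∀ l, ⟪v (l + 1), act (tri m Y₂ l)ᴴ (w l)⟫ =
      ⟪incr m (fun l => opr (Y₂ l)) l (v (l + 1)), w l⟫ := by
    intro l
    rw [inner_act, Matrix.conjTranspose_conjTranspose, ← opr_apply, hop]
  have e3 : ∀ l, ⟪dq m v l, dq m w l⟫ = m * (⟪v (l + 1), dq m w l⟫ - ⟪v l, dq m w l⟫) := by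
    intro l
    conv_lhs => rw [dq]
    rw [real_inner_smul_left, inner_sub_left]
  simp only [e2, e3, sum_add_distrib, ← mul_sum, sum_sub_distrib]
  ring

include hY in
theorem dform_symm (v w : ℕ → Vec F r) : dform n m Y₁ Y₂ u x v w = dform n m Y₁ Y₂ u x w v := by
  have hinc : ∀ l (a b : Vec F r), ⟪a, incr m (fun l => opr (Y₁ l)) l b⟫ =
      ⟪b, incr m (fun l => opr (Y₁ l)) l a⟫ := by
    intro l a b
    have hp : ∀ a b : Vec F r, ⟪a, prev (fun l => opr (Y₁ l)) l b⟫ =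
        ⟪b, prev (fun l => opr (Y₁ l)) l a⟫ := by
      intro a b
      simp only [prev]
      split_ifs
      · simp
      · rw [inner_opr_symm (hY _), real_inner_comm]
    simp only [incr, smul_apply, sub_apply, real_inner_smul_right, inner_sub_right]
    rw [hp, inner_opr_symm (hY _), real_inner_comm]
  unfold dform iform
  congr 1
  · congr 1
    refine sum_congr rfl fun l _ => ?_
    rw [real_inner_comm (dq m w l), hinc, real_inner_comm (w l), real_inner_comm (v l)]
    ring
  · rw [← opr_apply, inner_opr_symm (isHermitian_specMat u x), real_inner_comm, opr_apply]

include hr in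
theorem sum_inner_toSites (x y : Vec F n) :
    ∑ l ∈ range (sites r n), ⟪toSites r x l, toSites r y l⟫ = ⟪x, y⟫ := by
  simp only [← re_dag]
  rw [← map_sum, sum_dag_toSites hr]

include hm hr in
theorem inner_hOp (a b : Vec F n) : ⟪a, hOp m Y₁ Y₂ (specMat u x) hr n b⟫ =
      m * dform n m Y₁ Y₂ u x (toSites r a) (toSites r b) := by
  rw [← sum_inner_toSites hr, toSites_hOp,
    sum_inner_discreteH Y₂ hm hr u x (trunc_toSites a) (trunc_toSites b)]

include hm hr hY in
theorem hOp_symmetric : (hOp m Y₁ Y₂ (specMat u x) hr n).IsSymmetric := by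
  intro a b
  rw [real_inner_comm, inner_hOp _ hm, inner_hOp _ hm, dform_symm Y₂ hY]

/-! ### Eigenvectors of the discrete operator in `L²` -/

theorem ip_congr {f f' g g' : ℝ → Vec F r} (hf : f =ᵐ[halfLine] f') (hg : g =ᵐ[halfLine] g') :
    ip f g = ip f' g' := by
  refine integral_congr_ae ?_
  filter_upwards [hf, hg] with x h1 h2
  rw [h1, h2]

theorem re_ip_L2 (V V' : L2 F r) : re (ip V V') = ⟪V, V'⟫ := by
  rw [re_ip (Lp.memLp V) (Lp.memLp V'), L2.inner_def]

theorem star_ip (V W : L2 F r) : star (ip V W) = ip W V := by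
  have h := ((starL' ℝ : F ≃L[ℝ] F) : F →L[ℝ] F).integral_comp_comm
    (integrable_dag (Lp.memLp V) (Lp.memLp W))
  refine h.symm.trans (integral_congr_ae (ae_of_all _ fun x => ?_))
  exact star_dag _ _

theorem ip_self (V : L2 F r) : ip V V = algebraMap ℝ F (‖V‖ ^ 2) := by
  rw [isRealPart_re.eq_of_star_eq _ (star_ip V V), re_ip_L2, real_inner_self_eq_norm_sq]

include hm in
theorem ip_stepL {N : ℕ} {v w : ℕ → Vec F r} (hv : ∀ l, N ≤ l → v l = 0)
    (hw : ∀ l, N ≤ l → w l = 0) :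
    ip (stepL m v) (stepL m w) = m⁻¹ • ∑ l ∈ range N, dag (v l) (w l) := by
  rw [ip_congr (coeFn_stepL hm hv) (coeFn_stepL hm hw), ip,
    ← integral_step hm (a := fun l => dag (v l) (w l)) (N := N) fun l hl => by simp [hv l hl]]
  rfl

include hm hr in
theorem ip_stepL_toSites (x y : Vec F n) :
    ip (stepL m (toSites r x)) (stepL m (toSites r y)) = m⁻¹ • dag x y := by
  rw [ip_stepL hm (supp_of_trunc hr (trunc_toSites x)) (supp_of_trunc hr (trunc_toSites y)),
    sum_dag_toSites hr]

include hm hr in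
theorem norm_stepL_toSites (x : Vec F n) : ‖stepL m (toSites r x)‖ ^ 2 = m⁻¹ * ‖x‖ ^ 2 := by
  rw [norm_stepL_sq hm (supp_of_trunc hr (trunc_toSites x)), mass, ← real_inner_self_eq_norm_sq x,
    ← sum_inner_toSites hr]
  simp only [real_inner_self_eq_norm_sq]

include hm hr in
theorem isDiscreteEigen_iff {l : ℝ} {V : L2 F r} :
    IsDiscreteEigen n m Y₁ Y₂ W l V ↔ ∃ x : Vec F n, x ≠ 0 ∧ hOp m Y₁ Y₂ W hr n x = l • x ∧
      V = stepL m (toSites r x) := by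
  constructor
  · rintro ⟨hV, v, h1, h2, h3⟩
    have hvx : toSites r (ofSites hr n v) = v := by rw [toSites_ofSites, h1]
    have hVe : V = stepL m (toSites r (ofSites hr n v)) := by
      rw [hvx]
      exact Lp.ext (h3.trans (coeFn_stepL hm (supp_of_trunc hr h1)).symm)
    refine ⟨ofSites hr n v, fun h0 => hV ?_, ?_, hVe⟩
    · have := norm_stepL_toSites hm hr (ofSites hr n v)
      rw [← hVe, h0, norm_zero, zero_pow two_ne_zero, mul_zero] at this
      exact norm_eq_zero.1 (pow_eq_zero_iff two_ne_zero |>.1 this)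
    · refine toSites_injective hr ?_
      rw [toSites_hOp, hvx]
      ext1 j
      rw [h2 j]
      conv_lhs => rw [← hvx]
      ext i
      simp only [toSites, PiLp.smul_apply]
      split_ifs <;> simp
  · rintro ⟨x, hx, h1, rfl⟩
    refine ⟨fun h0 => hx ?_, toSites r x, trunc_toSites x, fun j => ?_,
      coeFn_stepL hm (supp_of_trunc hr (trunc_toSites x))⟩
    · have := norm_stepL_toSites hm hr x
      rw [h0, norm_zero, zero_pow two_ne_zero, eq_comm, mul_eq_zero] at this
      rcases this with h | h
      · exact absurd h (inv_pos.2 hm).ne'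
      · exact norm_eq_zero.1 (pow_eq_zero_iff two_ne_zero |>.1 h)
    · rw [← toSites_hOp _ _ _ _ hr, h1]
      ext i
      simp only [toSites, PiLp.smul_apply]
      split_ifs <;> simp

include hm hr in
theorem exists_orthonormal_of_isDiscreteEigen {k : ℕ} {μ : Fin (k + 1) → ℝ}
    {V : Fin (k + 1) → L2 F r} (hV : ∀ i j, ip (V i) (V j) = if i = j then 1 else 0)
    (hE : ∀ i, IsDiscreteEigen n m Y₁ Y₂ W (μ i) (V i)) :
    ∃ y : Fin (k + 1) → Vec F n, (∀ i j, dag (y i) (y j) = if i = j then 1 else 0) ∧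
      ∀ i, hOp m Y₁ Y₂ W hr n (y i) = μ i • y i := by
  choose y hy using fun i => (isDiscreteEigen_iff _ hm hr).1 (hE i)
  refine ⟨fun i => (√m)⁻¹ • y i, fun i j => ?_, fun i => by rw [map_smul, (hy i).2.1, smul_comm]⟩
  have := hV i j
  rw [(hy i).2.2, (hy j).2.2, ip_stepL_toSites hm hr] at this
  rw [dag_smul_left, dag_smul_right, smul_smul, ← this, ← mul_inv, Real.mul_self_sqrt hm.le]

include hm hr hY in
/-- The ordered eigenvalues of the discrete operator are those of an orthonormal eigenbasis. -/
theorem exists_flag_isLeast : ∃ e l, IsEigenFlag (hOp m Y₁ Y₂ (specMat u x) hr n) n e l ∧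
      (∀ k < n, IsLeast (eigLevels (IsDiscreteEigen n m Y₁ Y₂ (specMat u x)) k) (l k) ∧
        discreteEig n m Y₁ Y₂ (specMat u x) k = l k) ∧
      ∃ V : ℕ → L2 F r, (∀ i < n, ∀ j < n, ip (V i) (V j) = if i = j then 1 else 0) ∧
        ∀ i < n, IsDiscreteEigen n m Y₁ Y₂ (specMat u x) (l i) (V i) := by
  obtain ⟨e, l, h⟩ := exists_eigenFlag (hOp_symmetric (n := n) Y₂ hm hr hY u x)
    (hOp_op m Y₁ Y₂ (specMat u x) hr) le_rfl
  set V : ℕ → L2 F r := fun i => stepL m (toSites r (√m • e i))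
  have hV : ∀ i < n, ∀ j < n, ip (V i) (V j) = if i = j then 1 else 0 := fun i hi j hj => by
    rw [ip_stepL_toSites hm hr, dag_smul_left, dag_smul_right, smul_smul, smul_smul,
      h.orthonormal hi hj, mul_assoc, Real.mul_self_sqrt hm.le, inv_mul_cancel₀ hm.ne', one_smul]
  have hE : ∀ i < n, IsDiscreteEigen n m Y₁ Y₂ (specMat u x) (l i) (V i) := fun i hi => by
    refine (isDiscreteEigen_iff _ hm hr).2 ⟨√m • e i, ?_, ?_, rfl⟩
    · exact smul_ne_zero (Real.sqrt_pos.2 hm).ne' fun h0 => by simpa [h0] using h.norm_eq_one hi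
    · rw [map_smul, (h i hi).2.2.1, smul_comm]
  have hleast : ∀ k < n, IsLeast (eigLevels (IsDiscreteEigen n m Y₁ Y₂ (specMat u x)) k) (l k) := by
    intro k hk
    refine ⟨⟨fun i => l i, fun i => V i, fun i j => ?_, fun i => ⟨hE i (by omega),
      h.mono (by omega) hk⟩⟩, ?_⟩
    · rw [hV i (by omega) j (by omega)]
      simp only [Fin.ext_iff]
    · rintro a ⟨μ, V, hV, hE⟩
      obtain ⟨y, hort, hy⟩ := exists_orthonormal_of_isDiscreteEigen Y₂ hm hr hV fun i => (hE i).1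
      have hflag : IsEigenFlag (hOp m Y₁ Y₂ (specMat u x) hr n) (k + 1) e l := fun i hi =>
        h i (by omega)
      exact hflag.le_of_comb (fun c hc => comb_ne_zero hort hc)
        (inner_comb_le hort (hOp_op m Y₁ Y₂ (specMat u x) hr) hy fun i => (hE i).2)
  exact ⟨e, l, h, fun k hk => ⟨hleast k hk, (hleast k hk).csInf_eq⟩, V, hV, hE⟩

include hm hr hY in
theorem isLeast_discreteEig {k : ℕ} (hk : k < n) :
    IsLeast (eigLevels (IsDiscreteEigen n m Y₁ Y₂ (specMat u x)) k)
      (discreteEig n m Y₁ Y₂ (specMat u x) k) := by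
  obtain ⟨e, l, _, h, -⟩ := exists_flag_isLeast (n := n) Y₂ hm hr hY u x
  rw [(h k hk).2]
  exact (h k hk).1

include hm hr hY in
/-- Orthonormal eigenvectors for the `k + 1` lowest eigenvalues. -/
theorem exists_eigenvectors {k : ℕ} (hk : k < n) :
    ∃ V : Fin (k + 1) → L2 F r, (∀ i j, ip (V i) (V j) = if i = j then 1 else 0) ∧
      ∀ i : Fin (k + 1), IsDiscreteEigen n m Y₁ Y₂ (specMat u x)
        (discreteEig n m Y₁ Y₂ (specMat u x) i) (V i) ∧
        discreteEig n m Y₁ Y₂ (specMat u x) i ≤ discreteEig n m Y₁ Y₂ (specMat u x) k := by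
  obtain ⟨e, l, h, hl, V, hV, hE⟩ := exists_flag_isLeast (n := n) Y₂ hm hr hY u x
  refine ⟨fun i => V i, fun i j => ?_, fun i => ?_⟩
  · rw [hV i (by omega) j (by omega)]
    simp only [Fin.ext_iff]
  · rw [(hl i (by omega)).2, (hl k hk).2]
    exact ⟨hE i (by omega), h.mono (by omega) hk⟩

theorem toSites_comb_ofSites (hr : 0 < r) {ι : Type*} [Fintype ι] {v : ι → ℕ → Vec F r}
    (hv : ∀ i, trunc n (v i) = v i) (c : ι → F) :
    toSites r (comb (fun i => ofSites hr n (v i)) c) = fun l => ∑ i, op (c i) • v i l := by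
  have h1 : comb (fun i => ofSites hr n (v i)) c = ofSites hr n fun l => ∑ i, op (c i) • v i l := by
    rw [comb_apply]; ext a; simp [ofSites]
  rw [h1, toSites_ofSites]
  ext j i
  have h2 : ∀ p, (v p j).ofLp i = if j * r + (i : ℕ) < n then (v p j).ofLp i else 0 := fun p => by
    conv_lhs => rw [← hv p]
    rfl
  simp only [trunc]
  split_ifs with hlt
  · rfl
  · simp only [if_neg hlt] at h2
    simp [h2]

include hm hr hY in
/-- The minimax upper bound for the eigenvalues. -/
theorem discreteEig_le_of_comb {k : ℕ} (hk : k < n) {v : Fin (k + 1) → Vec F n} {a : ℝ}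
    (hv : ∀ c : Fin (k + 1) → F, c ≠ 0 → comb v c ≠ 0)
    (ha : ∀ c, ⟪comb v c, hOp m Y₁ Y₂ (specMat u x) hr n (comb v c)⟫ ≤ a * ‖comb v c‖ ^ 2) :
    discreteEig n m Y₁ Y₂ (specMat u x) k ≤ a := by
  obtain ⟨e, l, h, hl, -⟩ := exists_flag_isLeast (n := n) Y₂ hm hr hY u x
  have hflag : IsEigenFlag (hOp m Y₁ Y₂ (specMat u x) hr n) (k + 1) e l := fun i hi =>
    h i (by omega)
  exact (hl k hk).2.trans_le (hflag.le_of_comb hv ha)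

include hm hr hY in
/-- The minimax upper bound for the eigenvalues, in terms of lattice functions. -/
theorem discreteEig_le {k : ℕ} (hk : k < n)
    {v : Fin (k + 1) → ℕ → Vec F r} (hv : ∀ i, trunc n (v i) = v i) {a : ℝ}
    (h0 : ∀ c : Fin (k + 1) → F, c ≠ 0 → (fun l => ∑ i, op (c i) • v i l) ≠ 0)
    (ha : ∀ c : Fin (k + 1) → F,
      dform n m Y₁ Y₂ u x (fun l => ∑ i, op (c i) • v i l) (fun l => ∑ i, op (c i) • v i l) ≤
        a * mass m (sites r n) fun l => ∑ i, op (c i) • v i l) :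
    discreteEig n m Y₁ Y₂ (specMat u x) k ≤ a := by
  have hcomb := toSites_comb_ofSites hr hv
  refine discreteEig_le_of_comb Y₂ hm hr hY u x hk (v := fun i => ofSites hr n (v i))
    (fun c hc h' => h0 c hc ?_) fun c => ?_
  · rw [← hcomb, h']
    ext j i
    simp only [toSites]
    split_ifs <;> rfl
  · rw [inner_hOp _ hm, hcomb]
    have h3 := ha c
    have h4 : ‖comb (fun i => ofSites hr n (v i)) c‖ ^ 2 =
        m * mass m (sites r n) fun l => ∑ i, op (c i) • v i l := by
      rw [mass, ← mul_assoc, mul_inv_cancel₀ hm.ne', one_mul, ← real_inner_self_eq_norm_sq,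
        ← sum_inner_toSites hr, hcomb]
      simp only [real_inner_self_eq_norm_sq]
    rw [h4]
    nlinarith

include hm hr in
/-- The weak form of the discrete eigenvalue equation. -/
theorem IsDiscreteEigen.weak {x : Fin r → ℝ} {l : ℝ} {V : L2 F r}
    (hV : IsDiscreteEigen n m Y₁ Y₂ (specMat u x) l V) :
    ∃ v : ℕ → Vec F r, trunc n v = v ∧ V = stepL m v ∧ ∀ w : ℕ → Vec F r, trunc n w = w →
      dform n m Y₁ Y₂ u x w v = l * ⟪stepL m w, V⟫ := by
  obtain ⟨_, v, h1, h2, h3⟩ := hV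
  have hVe : V = stepL m v := Lp.ext (h3.trans (coeFn_stepL hm (supp_of_trunc hr h1)).symm)
  refine ⟨v, h1, hVe, fun w hw => ?_⟩
  have h4 := sum_inner_discreteH (Y₁ := Y₁) Y₂ hm hr u x hw h1
  simp only [h2, real_inner_smul_right] at h4
  rw [← mul_sum] at h4
  rw [hVe, inner_stepL hm (supp_of_trunc hr hw) (supp_of_trunc hr h1), mul_left_comm, h4,
    ← mul_assoc, inv_mul_cancel₀ hm.ne', one_mul]

include hm hr hY in
theorem discreteEig_eq_of_le {k : ℕ} (hk : n ≤ k) : discreteEig n m Y₁ Y₂ (specMat u x) k = 0 := by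
  have : eigLevels (IsDiscreteEigen n m Y₁ Y₂ (specMat u x)) k = ∅ := by
    rw [eq_empty_iff_forall_notMem]
    rintro a ⟨μ, V, hV, hE⟩
    obtain ⟨y, hort, -⟩ := exists_orthonormal_of_isDiscreteEigen Y₂ hm hr hV fun i => (hE i).1
    have hinj : Function.Injective (comb y) := by
      rw [injective_iff_map_eq_zero]
      intro c hc
      by_contra h0
      exact comb_ne_zero hort h0 hc
    have := LinearMap.finrank_le_finrank_of_injective hinj
    rw [finrank_vec, Module.finrank_pi_fintype] at this
    simp only [sum_const, Finset.card_univ, Fintype.card_fin, smul_eq_mul] at this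
    have := Nat.le_of_mul_le_mul_right this finrank_scalar_pos
    omega
  rw [discreteEig, this, Real.sInf_empty]

end DiscreteOperator

/-! ### Compactness of discrete eigenvectors -/

section Compactness

theorem norm_op_smul (c : F) (v : Vec F r) : ‖op c • v‖ = ‖c‖ * ‖v‖ := by rw [norm_smul, norm_op]

theorem OrthoBasis.norm_eq_one (hu : OrthoBasis u) (i : Fin r) : ‖u i‖ = 1 := by
  have h := hu i i
  rw [if_pos rfl, dag_self, ← map_one (algebraMap ℝ F)] at h
  nlinarith [norm_nonneg (u i), (algebraMap ℝ F).injective h]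

theorem sum_range_le_of_supp {N R : ℕ} {a : ℕ → ℝ} {B : ℝ} (hB : 0 ≤ B) (ha : ∀ l, a l ≤ B)
    (hs : ∀ l, R ≤ l → a l = 0) : ∑ l ∈ range N, a l ≤ R * B := by
  rw [← Finset.sum_filter_of_ne (p := (· < R)) fun l _ h => by_contra fun h' =>
    h (hs l (not_lt.1 h'))]
  refine (Finset.sum_le_card_nsmul _ _ B fun l _ => ha l).trans ?_
  rw [nsmul_eq_mul]
  gcongr
  exact_mod_cast (Finset.card_le_card fun l hl => Finset.mem_range.2
    (Finset.mem_filter.1 hl).2).trans (Finset.card_range R).le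

/-- The tent function of height one on `[2 i, 2 i + 2]`. -/
def tent (i : ℕ) (x : ℝ) : ℝ := max 0 (1 - |x - (2 * i + 1)|)

theorem tent_nonneg (i : ℕ) (x : ℝ) : 0 ≤ tent i x := le_max_left _ _

theorem tent_le_one (i : ℕ) (x : ℝ) : tent i x ≤ 1 :=
  max_le zero_le_one (by linarith [abs_nonneg (x - (2 * i + 1))])

theorem abs_tent_sub_le (i : ℕ) (x y : ℝ) : |tent i x - tent i y| ≤ |x - y| := by
  rw [tent, tent, max_comm 0, max_comm 0]
  refine (abs_max_sub_max_le_abs _ _ _).trans ?_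
  rw [show (1 - |x - (2 * (i : ℝ) + 1)| - (1 - |y - (2 * (i : ℝ) + 1)|)) =
      -(|x - (2 * (i : ℝ) + 1)| - |y - (2 * (i : ℝ) + 1)|) by ring, abs_neg]
  refine (abs_abs_sub_abs_le _ _).trans_eq ?_
  congr 1; ring

theorem tent_eq_zero {i : ℕ} {x : ℝ} (h : 1 ≤ |x - (2 * i + 1)|) : tent i x = 0 :=
  max_eq_left (by linarith)

set_option maxHeartbeats 1000000 in
/-- The ordered eigenvalues are bounded above, uniformly over good data. -/
theorem exists_discreteEig_bound (hr : 0 < r) (hc : IsComparison η ζ) (hC : 1 ≤ C)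
    (k : ℕ) : ∃ Λ ρ : ℝ, ∀ (n : ℕ) (m : ℝ) (Y₁ Y₂ : ℕ → Mat F r), IsGood η ζ C n m Y₁ Y₂ →
      ρ ≤ m → ρ * m ≤ n → ∀ (u : Fin r → Vec F r) (x : Fin r → ℝ), OrthoBasis u →
      discreteEig n m Y₁ Y₂ (specMat u x) k ≤ Λ := by
  obtain ⟨K₁, K₂, hK₁, hK₂, hen⟩ := energy_bounds (F := F) hr hc hC 0
  set H : ℝ := η (2 * k + 4) with hH
  have hH0 : 0 < H := hc.pos_eta _
  set D : ℝ := (2 * k + 3) * ((2 + H) * (k + 1) ^ 2) with hD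
  have hD0 : 0 < D := by positivity
  refine ⟨K₂ * D * 8, (2 * k + 3) * r + 2 + k, fun n m Y₁ Y₂ hg hm hmn u x hu => ?_⟩
  have hm2 : 2 ≤ m := by
    have : (0 : ℝ) ≤ (2 * k + 3) * r := by positivity
    have : (0 : ℝ) ≤ k := by positivity
    linarith
  have hm0 : 0 < m := by linarith
  have hr1 : (1 : ℝ) ≤ r := by exact_mod_cast hr
  have hk0 : (0 : ℝ) ≤ k := by positivity
  set R : ℕ := ⌈(2 * k + 2) * m⌉₊ with hR
  have hRm : (R : ℝ) ≤ (2 * k + 3) * m := by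
    have := (Nat.ceil_lt_add_one (show 0 ≤ (2 * k + 2) * m by positivity)).le
    nlinarith
  have hRn : R * r ≤ n := by
    have : (R : ℝ) * r ≤ n := by
      calc (R : ℝ) * r ≤ (2 * k + 3) * m * r := by gcongr
        _ = (2 * k + 3) * r * m := by ring
        _ ≤ ((2 * k + 3) * r + 2 + k) * m := by gcongr; linarith
        _ ≤ n := hmn
    exact_mod_cast this
  have hkn : k < n := by
    have : (k : ℝ) < n := by nlinarith [show (0 : ℝ) ≤ (2 * k + 3) * r by positivity]
    exact_mod_cast this
  have hRN : R ≤ sites r n := by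
    have := hRn.trans (le_sites_mul hr n)
    exact Nat.le_of_mul_le_mul_right this hr
  set e : Vec F r := u ⟨0, hr⟩ with he
  have he1 : ‖e‖ = 1 := hu.norm_eq_one _
  set v : Fin (k + 1) → ℕ → Vec F r := fun i l => tent i (l / m) • e with hv
  have hsm : ∀ (t : ℝ) (c : F), op c • (t • e) = op (t • c) • e := fun t c => by
    ext a; simp [Algebra.smul_def, mul_assoc, Algebra.commutes]
  have hw : ∀ (c : Fin (k + 1) → F) l, ∑ i, op (c i) • v i l =
      op (∑ i : Fin (k + 1), tent i (l / m) • c i) • e := fun c l => by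
    simp only [hv, hsm, Finset.op_sum, Finset.sum_smul]
  have htz : ∀ (i : Fin (k + 1)) (l : ℕ), R ≤ l → tent i (l / m) = 0 := by
    intro i l hl
    refine tent_eq_zero ?_
    have h1 : (2 * k + 2) * m ≤ l := Nat.ceil_le.1 hl
    have h2 : (2 * k + 2 : ℝ) ≤ l / m := by rwa [le_div_iff₀ hm0]
    have h3 : ((i : ℕ) : ℝ) ≤ k := by exact_mod_cast Nat.lt_succ_iff.1 i.2
    exact le_trans (by linarith) (le_abs_self _)
  have hvs : ∀ i l, R ≤ l → v i l = 0 := fun i l hl => by simp only [hv, htz i l hl, zero_smul]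
  -- the combined lattice function and its energy
  have key : ∀ c : Fin (k + 1) → F,
      dform n m Y₁ Y₂ u x (fun l => ∑ i, op (c i) • v i l) (fun l => ∑ i, op (c i) • v i l) ≤
        K₂ * D * ‖c‖ ^ 2 ∧
      ‖c‖ ^ 2 / 8 ≤ mass m (sites r n) fun l => ∑ i, op (c i) • v i l := by
    intro c
    set w : ℕ → Vec F r := fun l => ∑ i, op (c i) • v i l with hwdef
    have hwn : ∀ l, ‖w l‖ = ‖∑ i : Fin (k + 1), tent i (l / m) • c i‖ := fun l => by
      rw [hwdef]; simp only [hw]; rw [norm_op_smul, he1, mul_one]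
    have hws : ∀ l, R ≤ l → w l = 0 := fun l hl => by
      simp only [hwdef, hvs _ l hl, smul_zero, Finset.sum_const_zero]
    have hsum : ∀ (a : Fin (k + 1) → ℝ) (B : ℝ), 0 ≤ B → (∀ i, |a i| ≤ B) →
        ‖∑ i, a i • c i‖ ≤ (k + 1) * (B * ‖c‖) := by
      intro a B hB ha
      refine (norm_sum_le _ _).trans ((Finset.sum_le_card_nsmul _ _ (B * ‖c‖) fun i _ => ?_).trans
        ?_)
      · rw [norm_smul, Real.norm_eq_abs]
        exact mul_le_mul (ha i) (norm_le_pi_norm c i) (norm_nonneg _) hB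
      · simp
    have hb1 : ∀ l, ‖w l‖ ^ 2 ≤ (k + 1) ^ 2 * ‖c‖ ^ 2 := by
      intro l
      have := hsum (fun i => tent i (l / m)) 1 zero_le_one fun i => by
        rw [abs_of_nonneg (tent_nonneg _ _)]; exact tent_le_one _ _
      rw [one_mul] at this
      rw [← mul_pow, hwn]; gcongr
    have hb2 : ∀ l, ‖dq m w l‖ ^ 2 ≤ (k + 1) ^ 2 * ‖c‖ ^ 2 := by
      intro l
      have e1 : dq m w l = op (∑ i : Fin (k + 1),
          (m * (tent i ((l + 1 : ℕ) / m) - tent i (l / m))) • c i) • e := by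
        rw [dq, hwdef]
        simp only [hw]
        rw [← sub_smul, ← op_sub, ← sum_sub_distrib]
        simp only [← sub_smul, mul_smul, ← smul_sum]
        rw [← hsm, smul_comm]
      rw [e1, norm_op_smul, he1, mul_one, ← mul_pow]
      have := hsum (fun i => m * (tent i ((l + 1 : ℕ) / m) - tent i (l / m))) 1 zero_le_one
        fun i => by
          rw [abs_mul, abs_of_pos hm0]
          have := abs_tent_sub_le i (((l + 1 : ℕ) : ℝ) / m) (l / m)
          rw [← sub_div, abs_div, abs_of_pos hm0] at this
          push_cast at this
          rw [add_sub_cancel_left, abs_one, le_div_iff₀ hm0] at this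
          push_cast
          linarith
      rw [one_mul] at this
      gcongr
    have hsupp : ∀ (a : ℕ → ℝ) (B : ℝ), 0 ≤ B → (∀ l, a l ≤ B) → (∀ l, R ≤ l → a l = 0) →
        m⁻¹ * ∑ l ∈ range (sites r n), a l ≤ (2 * k + 3) * B := fun a B hB ha hs => by
      rw [inv_mul_le_iff₀ hm0]
      nlinarith [sum_range_le_of_supp (N := sites r n) hB ha hs]
    have hkin : kin m (sites r n) w ≤ (2 * k + 3) * ((k + 1) ^ 2 * ‖c‖ ^ 2) :=
      hsupp _ _ (by positivity) hb2 fun l hl => by simp [dq_eq_zero hws l hl]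
    have hmass : mass m (sites r n) w ≤ (2 * k + 3) * ((k + 1) ^ 2 * ‖c‖ ^ 2) :=
      hsupp _ _ (by positivity) hb1 fun l hl => by simp [hws l hl]
    have hwm : wmass m (sites r n) (latticeWeight η m) w ≤
        (2 * k + 3) * (H * ((k + 1) ^ 2 * ‖c‖ ^ 2)) := by
      refine hsupp _ _ (by positivity) (fun l => ?_) fun l hl => by simp [hws l hl]
      by_cases hl : R ≤ l
      · simp only [hws l hl, norm_zero]; simp; positivity
      · refine mul_le_mul (hc.mono_eta ?_) (hb1 l) (sq_nonneg _) hH0.le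
        rw [Real.toNNReal_le_iff_le_coe]
        push_cast
        rw [div_le_iff₀ hm0]
        have : (l : ℝ) ≤ R := by exact_mod_cast (not_le.1 hl).le
        nlinarith
    constructor
    · have hw0 : w 0 = 0 := by
        simp only [hwdef, hv]
        refine sum_eq_zero fun i _ => ?_
        rw [tent_eq_zero, zero_smul, smul_zero]
        simp only [Nat.cast_zero, zero_div, zero_sub, abs_neg]
        have : (0 : ℝ) ≤ 2 * ((i : ℕ) : ℝ) := by positivity
        exact le_trans (by linarith) (le_abs_self _)
      have h2 := (hen n m Y₁ Y₂ hg w fun l hl => hws l (hRN.trans hl)).2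
      rw [dform, hw0, inner_zero_left, add_zero]
      refine (le_abs_self _).trans (h2.trans ?_)
      rw [mul_assoc]
      refine mul_le_mul_of_nonneg_left ?_ hK₂.le
      rw [hD]; linarith
    · obtain ⟨i, hi⟩ : ∃ i, ‖c i‖ = ‖c‖ := by
        obtain ⟨i, -, hi⟩ := Finset.exists_mem_eq_sup' (Finset.univ_nonempty) fun i => ‖c i‖₊
        refine ⟨i, ?_⟩
        rw [Pi.norm_def, ← Finset.sup'_eq_sup Finset.univ_nonempty, hi]; rfl
      set a : ℕ := ⌈m * (2 * i + 1 / 2)⌉₊ with ha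
      have hi' : ((i : ℕ) : ℝ) ≤ k := by exact_mod_cast Nat.lt_succ_iff.1 i.2
      have hfl := Nat.floor_le hm0.le
      have hfl' := Nat.lt_floor_add_one m
      have hlow : ∀ l ∈ Finset.Ico a (a + ⌊m⌋₊), l < R ∧ ‖c‖ ^ 2 / 4 ≤ ‖w l‖ ^ 2 := by
        intro l hl
        rw [Finset.mem_Ico] at hl
        have h1 : m * (2 * i + 1 / 2) ≤ l := Nat.ceil_le.1 hl.1
        have h2 : (l : ℝ) ≤ m * (2 * i + 3 / 2) := by
          have h3 : (l : ℝ) + 1 ≤ a + ⌊m⌋₊ := by exact_mod_cast hl.2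
          have h4 := (Nat.ceil_lt_add_one (show 0 ≤ m * (2 * i + 1 / 2 : ℝ) by positivity))
          linarith
        have h1' : (2 * i + 1 / 2 : ℝ) ≤ l / m := by rw [le_div_iff₀ hm0]; linarith
        have h2' : l / m ≤ (2 * i + 3 / 2 : ℝ) := by rw [div_le_iff₀ hm0]; linarith
        constructor
        · rw [hR, Nat.lt_ceil]; nlinarith
        have hz : ∀ i' : Fin (k + 1), i' ≠ i → tent i' (l / m) • c i' = 0 := by
          intro i' hne
          rw [tent_eq_zero, zero_smul]
          rcases lt_or_gt_of_ne hne with h | h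
          · have : ((i' : ℕ) : ℝ) + 1 ≤ (i : ℕ) := by exact_mod_cast h
            exact le_trans (by linarith) (le_abs_self _)
          · have : ((i : ℕ) : ℝ) + 1 ≤ (i' : ℕ) := by exact_mod_cast h
            exact le_trans (by linarith) (neg_le_abs _)
        rw [hwn, Finset.sum_eq_single i (fun i' _ h => hz i' h) (by simp), norm_smul, hi,
          Real.norm_of_nonneg (tent_nonneg _ _)]
        have ht : 1 / 2 ≤ tent i (l / m) := by
          refine le_max_of_le_right ?_
          have : |(l : ℝ) / m - (2 * ((i : ℕ) : ℝ) + 1)| ≤ 1 / 2 := by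
            rw [abs_le]; constructor <;> linarith
          linarith
        calc ‖c‖ ^ 2 / 4 = (1 / 2 * ‖c‖) ^ 2 := by ring
          _ ≤ _ := by gcongr
      have hsub : Finset.Ico a (a + ⌊m⌋₊) ⊆ range (sites r n) := fun l hl =>
        Finset.mem_range.2 ((hlow l hl).1.trans_le hRN)
      have h5 : (⌊m⌋₊ : ℝ) * (‖c‖ ^ 2 / 4) ≤ ∑ l ∈ range (sites r n), ‖w l‖ ^ 2 := by
        calc (⌊m⌋₊ : ℝ) * (‖c‖ ^ 2 / 4) = ∑ l ∈ Finset.Ico a (a + ⌊m⌋₊), ‖c‖ ^ 2 / 4 := by simp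
          _ ≤ ∑ l ∈ Finset.Ico a (a + ⌊m⌋₊), ‖w l‖ ^ 2 := sum_le_sum fun l hl => (hlow l hl).2
          _ ≤ _ := Finset.sum_le_sum_of_subset_of_nonneg hsub fun _ _ _ => sq_nonneg _
      rw [mass, le_inv_mul_iff₀ hm0]
      refine le_trans ?_ h5
      have : m / 2 ≤ ⌊m⌋₊ := by linarith
      calc m * (‖c‖ ^ 2 / 8) = m / 2 * (‖c‖ ^ 2 / 4) := by ring
        _ ≤ _ := by gcongr
  refine discreteEig_le Y₂ hm0 hr hg.2.2.1 u x hkn (v := v)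
    (fun i => trunc_of_supp hRn (hvs i)) (fun c hc0 h0 => ?_) fun c => ?_
  · have h1 := (key c).2
    rw [h0] at h1
    simp only [mass, Pi.zero_apply, norm_zero] at h1
    simp only [ne_eq, OfNat.ofNat_ne_zero, not_false_eq_true, zero_pow, Finset.sum_const_zero,
      mul_zero] at h1
    have : 0 < ‖c‖ := norm_pos_iff.2 hc0
    nlinarith
  · refine (key c).1.trans ?_
    have := (key c).2
    have h0 : 0 ≤ K₂ * D := by positivity
    nlinarith

theorem LatticeLimit.comp {v : ℕ → ℕ → Vec F r}
    (h : LatticeLimit m v f g) {t : ℕ → ℕ} (ht : StrictMono t) :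
    LatticeLimit (fun j => m (t j)) (fun j => v (t j)) f g :=
  ⟨h.cont, h.memLp, h.memLp_deriv, fun R u hu => ht.tendsto_atTop.eventually (h.unif R u hu),
    h.tendsto.comp ht.tendsto_atTop, fun ψ => (h.weak ψ).comp ht.tendsto_atTop,
    ⟨h.bdd.choose, fun j => h.bdd.choose_spec _⟩⟩

theorem exists_lattice_subseq (hr : 0 < r) (hc : IsComparison η ζ) (hC : 1 ≤ C)
    (hg : ∀ j, IsGood η ζ C (n j) (m j) (Y₁ j) (Y₂ j)) (hmt : Tendsto m atTop atTop)
    (hu' : ∀ j, OrthoBasis (u' j)) (hx : ∀ j i, -b ≤ x j i) {Λ : ℝ} {l : ℕ → ℝ} (hl : ∀ j, l j ≤ Λ)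
      {V : ℕ → L2 F r}
    (hV1 : ∀ j, ‖V j‖ = 1)
    (hV : ∀ j, IsDiscreteEigen (n j) (m j) (Y₁ j) (Y₂ j) (specMat (u' j) (x j)) (l j) (V j)) :
    ∃ (t : ℕ → ℕ) (l₀ : ℝ) (V₀ : L2 F r) (v : ℕ → ℕ → Vec F r) (f g : ℝ → Vec F r),
      StrictMono t ∧ Tendsto (fun j => l (t j)) atTop (𝓝 l₀) ∧
      Tendsto (fun j => V (t j)) atTop (𝓝 V₀) ∧
      (∀ j, trunc (n j) (v j) = v j) ∧ (∀ j w, trunc (n j) w = w →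
        dform (n j) (m j) (Y₁ j) (Y₂ j) (u' j) (x j) w (v j) = l j * ⟪stepL (m j) w, V j⟫) ∧
      LatticeLimit (fun j => m (t j)) (fun j => v (t j)) f g ∧ V₀ =ᵐ[halfLine] f ∧
      (∫⁻ x in ℝ₊, ofReal (η x.toNNReal) * ‖f x‖ₑ ^ 2 < ⊤) ∧
      ∃ K, ∀ j i, max (x j i) 0 * ‖dag (u' j i) (v j 0)‖ ^ 2 ≤ K := by
  obtain ⟨K₁, K₂, hK₁, hK₂, hen⟩ := energy_bounds (F := F) hr hc hC b
  have hm0 : ∀ j, 0 < m j := fun j => zero_lt_one.trans_le (hg j).2.1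
  choose v hv1 hv2 hv3 using fun j => (hV j).weak (Y₂ j) (hm0 j) hr
  have hvs : ∀ j k, sites r (n j) ≤ k → v j k = 0 := fun j => supp_of_trunc hr (hv1 j)
  have hmass : ∀ j, mass (m j) (sites r (n j)) (v j) = 1 := fun j => by
    rw [← norm_stepL_sq (hm0 j) (hvs j), ← hv2, hV1, one_pow]
  have hE : ∀ j, kin (m j) (sites r (n j)) (v j) +
      wmass (m j) (sites r (n j)) (latticeWeight η (m j)) (v j) +
      ∑ i, max (x j i) 0 * ‖dag (u' j i) (v j 0)‖ ^ 2 ≤ K₁ * l j + K₂ := fun j => by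
    have h1 := (hen _ _ _ _ (hg j) (v j) (hvs j)).1 (u' j) (x j) (hu' j) (hx j)
    rwa [hv3 j _ (hv1 j), ← hv2, real_inner_self_eq_norm_sq, hV1, one_pow, mul_one, hmass,
      mul_one] at h1
  have hS : ∀ j i, 0 ≤ max (x j i) 0 * ‖dag (u' j i) (v j 0)‖ ^ 2 := fun j i =>
    mul_nonneg (le_max_right _ _) (sq_nonneg _)
  have hS' : ∀ j, 0 ≤ ∑ i, max (x j i) 0 * ‖dag (u' j i) (v j 0)‖ ^ 2 := fun j =>
    sum_nonneg fun i _ => hS j i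
  have hk0 : ∀ j, 0 ≤ kin (m j) (sites r (n j)) (v j) := fun j => kin_nonneg (hm0 j) _ _
  have hw0 : ∀ j, 0 ≤ wmass (m j) (sites r (n j)) (latticeWeight η (m j)) (v j) := fun j =>
    wmass_nonneg (hm0 j) _ (fun _ => (hc.pos_eta _).le) _
  have hlK : ∀ j, K₁ * l j ≤ K₁ * Λ := fun j => mul_le_mul_of_nonneg_left (hl j) hK₁.le
  set K : ℝ := |K₁ * Λ + K₂| + 1 with hK
  have hKle : ∀ j, K₁ * l j + K₂ ≤ K := fun j => by
    have := le_abs_self (K₁ * Λ + K₂); have := hlK j; linarith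
  have hlow : ∀ j, -K₂ / K₁ ≤ l j := fun j => by
    rw [div_le_iff₀ hK₁]
    linarith [hE j, hS' j, hk0 j, hw0 j]
  obtain ⟨t₁, f, g, ht₁, hL⟩ := exists_latticeLimit hm0 hmt hvs hc.mono_eta hc.pos_eta hc.unbdd_eta
    (C := K) (fun j => by linarith [hE j, hS' j, hw0 j, hKle j])
    (fun j => by rw [hmass]; have := abs_nonneg (K₁ * Λ + K₂); linarith)
    (fun j => by
      linarith [hE j, hS' j, hk0 j, hKle j])
  obtain ⟨l₀, -, t₂, ht₂, hl₀⟩ := tendsto_subseq_of_bounded (Metric.isBounded_Icc (-K₂ / K₁) Λ)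
    (x := fun j => l (t₁ j)) fun j => ⟨hlow _, hl _⟩
  have hL2 : LatticeLimit (fun j => m (t₁ (t₂ j))) (fun j => v (t₁ (t₂ j))) f g := hL.comp ht₂
  refine ⟨fun j => t₁ (t₂ j), l₀, hL.memLp.toLp, v, f, g, ht₁.comp ht₂, hl₀, ?_,
    hv1, hv3, hL2, hL.memLp.coeFn_toLp, ?_, K, fun j i => ?_⟩
  · exact hL2.tendsto.congr fun j => (hv2 _).symm
  · refine (lintegral_weight_le (fun j => hm0 (t₁ j)) (hmt.comp ht₁.tendsto_atTop)
      (fun j => hvs (t₁ j)) hc.cont_eta hc.pos_eta (C := K) (fun j => ?_)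
      fun x => (hL.unif x).tendsto_at (mem_Iic.2 le_rfl)).trans_lt ENNReal.ofReal_lt_top
    linarith [hE (t₁ j), hS' (t₁ j), hk0 (t₁ j), hKle (t₁ j)]
  · refine (single_le_sum (fun i _ => hS j i) (Finset.mem_univ i)).trans ?_
    linarith [hE j, hw0 j, hk0 j, hKle j]

end Compactness

/-! ### Limits of discrete eigenvectors are eigenfunctions -/

section Limit

/-- A sequence of discrete data, with uniform growth and oscillation bounds, that approximates the
continuum problem with integrated potential `Y`. -/
structure Approx (η ζ : ℝ≥0 → ℝ) (C : ℝ) (n : ℕ → ℕ) (m : ℕ → ℝ) (Y₁ Y₂ : ℕ → ℕ → Mat F r)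
    (Y : ℝ≥0 → Mat F r) : Prop where
  pos : 0 < r
  cmp : IsComparison η ζ
  le_C : 1 ≤ C
  good : ∀ j, IsGood η ζ C (n j) (m j) (Y₁ j) (Y₂ j)
  scale : Tendsto m atTop atTop
  ratio : Tendsto (fun j => n j / m j) atTop atTop
  cont : Continuous Y
  lim : TendstoCompactly (fun j => combine (step (m j) (Y₁ j)) (step (m j) (Y₂ j))) Y
  lim₂ : ∃ Z, TendstoCompactly (fun j => step (m j) (Y₂ j)) Z

theorem TendstoCompactly.comp {A : Type*} [UniformSpace A] {f : ℕ → ℝ≥0 → A} {g : ℝ≥0 → A}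
    (h : TendstoCompactly f g) {t : ℕ → ℕ} (ht : StrictMono t) :
    TendstoCompactly (fun j => f (t j)) g := fun K hK u hu =>
  ht.tendsto_atTop.eventually (h K hK u hu)

theorem Approx.comp (h : Approx η ζ C n m Y₁ Y₂ Y) {t : ℕ → ℕ} (ht : StrictMono t) :
    Approx η ζ C (fun j => n (t j)) (fun j => m (t j)) (fun j => Y₁ (t j)) (fun j => Y₂ (t j)) Y :=
  ⟨h.pos, h.cmp, h.le_C, fun j => h.good _, h.scale.comp ht.tendsto_atTop,
    h.ratio.comp ht.tendsto_atTop, h.cont, h.lim.comp ht, h.lim₂.imp fun _ hZ => hZ.comp ht⟩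

theorem Approx.one_le (h : Approx η ζ C n m Y₁ Y₂ Y) (j : ℕ) : 1 ≤ m j := (h.good j).2.1

theorem Approx.scale_pos (h : Approx η ζ C n m Y₁ Y₂ Y) (j : ℕ) : 0 < m j :=
  zero_lt_one.trans_le (h.one_le j)

/-- `V` is a unit eigenvector for the `(k + 1)`st lowest eigenvalue of the discrete operator. -/
abbrev IsUnitEigen (n : ℕ) (m : ℝ) (Y₁ Y₂ : ℕ → Mat F r) (W : Mat F r) (k : ℕ) (V : L2 F r) : Prop
  :=
  ‖V‖ = 1 ∧ IsDiscreteEigen n m Y₁ Y₂ W (discreteEig n m Y₁ Y₂ W k) V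

/-- Boundary terms, bounded below by `-b`, that converge to a boundary condition. -/
structure BoundaryLimit (b : ℝ) (u' : ℕ → Fin r → Vec F r) (x : ℕ → Fin r → ℝ)
    (u : Fin r → Vec F r) (w : Fin r → EReal) : Prop where
  ortho : ∀ j, OrthoBasis (u' j)
  lower : ∀ j i, -b ≤ x j i
  basis : Tendsto u' atTop (𝓝 u)
  tendsto : ∀ i, Tendsto (fun j => (x j i : EReal)) atTop (𝓝 (w i))

theorem BoundaryLimit.comp (h : BoundaryLimit b u' x u w) {t : ℕ → ℕ}
    (ht : StrictMono t) : BoundaryLimit b (fun j => u' (t j)) (fun j => x (t j)) u w :=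
  ⟨fun j => h.ortho _, fun j => h.lower _, h.basis.comp ht.tendsto_atTop,
    fun i => (h.tendsto i).comp ht.tendsto_atTop⟩

theorem BoundaryLimit.lower_le (h : BoundaryLimit b u' x u w) (i : Fin r) :
    ((-b : ℝ) : EReal) ≤ w i :=
  ge_of_tendsto' (h.tendsto i) fun j => EReal.coe_le_coe_iff.2 (h.lower j i)

theorem BoundaryLimit.ne_bot (h : BoundaryLimit b u' x u w) (i : Fin r) :
    w i ≠ ⊥ := ((EReal.bot_lt_coe _).trans_le (h.lower_le i)).ne'

theorem BoundaryLimit.ortho_lim (h : BoundaryLimit b u' x u w) : OrthoBasis u :=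
  OrthoBasis.of_tendsto h.ortho h.basis

theorem BoundaryLimit.tendsto_toReal (h : BoundaryLimit b u' x u w) {i : Fin r}
    (hi : w i ≠ ⊤) : Tendsto (fun j => x j i) atTop (𝓝 (w i).toReal) := by
  have := (EReal.tendsto_toReal hi (h.ne_bot i)).comp (h.tendsto i)
  simpa [Function.comp_def] using this

theorem BoundaryLimit.exists_testLimit (h : BoundaryLimit b u' x u w)
    (hm : ∀ j, 1 ≤ m j) (hmt : Tendsto m atTop atTop) (hφ : IsTest u w φ) :
    ∃ R B, TestLimit m (fun j => discretize (m j) (rot (u' j) u) φ) φ (deriv φ) R B := by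
  have hrot : Tendsto (fun j => rot (u' j) u) atTop (𝓝 1) := by
    rw [← rot_self h.ortho_lim]
    exact ((continuous_rot u).tendsto u).comp h.basis
  exact BlockTridiagonal.exists_testLimit hm hmt hrot hφ.1 hφ.2.1

set_option maxHeartbeats 1000000 in
theorem BoundaryLimit.tendsto_dag (hB : BoundaryLimit b u' x u w) {v : ℕ → ℕ → Vec F r}
    (h : LatticeLimit m v f g) (i : Fin r) :
    Tendsto (fun j => dag (u' j i) (v j 0)) atTop (𝓝 (dag (u i) (f 0))) := by
  have h1 : Tendsto (fun j => u' j i) atTop (𝓝 (u i)) := (tendsto_pi_nhds.1 hB.basis) i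
  exact (continuous_dag.tendsto (u i, f 0)).comp (h1.prodMk_nhds h.tendsto_zero)

theorem TestLimit.eventually_trunc (hr : 0 < r) (hm : ∀ j, 1 ≤ m j)
    (hn : Tendsto (fun j => n j / m j) atTop atTop) {φd : ℕ → ℕ → Vec F r} {φ φ' : ℝ → Vec F r}
    {R B : ℝ} (h : TestLimit m φd φ φ' R B) : ∀ᶠ j in atTop, trunc (n j) (φd j) = φd j := by
  filter_upwards [hn.eventually (eventually_ge_atTop ((|R| + 1) * r))] with j hj
  have hm0 : 0 < m j := zero_lt_one.trans_le (hm j)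
  rw [le_div_iff₀ hm0] at hj
  refine trunc_of_supp (R := ⌈|R| * m j⌉₊) ?_ fun l hl => h.supp j l ?_
  · have h1 := (Nat.ceil_lt_add_one (show 0 ≤ |R| * m j by positivity)).le
    have h2 : (⌈|R| * m j⌉₊ : ℝ) * r ≤ n j := by
      calc (⌈|R| * m j⌉₊ : ℝ) * r ≤ ((|R| + 1) * m j) * r := by
            gcongr; linarith [hm j]
        _ = (|R| + 1) * r * m j := by ring
        _ ≤ n j := hj
    exact_mod_cast h2
  · exact (mul_le_mul_of_nonneg_right (le_abs_self R) hm0.le).trans (Nat.ceil_le.1 hl)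

end Limit

variable (hA : Approx η ζ C n m Y₁ Y₂ Y) (hB : BoundaryLimit b u' x u w)

local notation "ev(" k ", " j ")" => discreteEig (n j) (m j) (Y₁ j) (Y₂ j) (specMat (u' j) (x j)) k

local notation "dt(" j ", " φ ")" => discretize (m j) (rot (u' j) u) φ

include hA hB in
/-- The approximants of a test function converge, and eventually fit into the first sites. -/
theorem Approx.exists_test (hφ : IsTest u w φ) : ∃ R B,
    TestLimit m (fun j => dt(j, φ)) φ (deriv φ) R B ∧ ∀ᶠ j in atTop,
      trunc (n j) dt(j, φ) = dt(j, φ) :=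
  let ⟨R, B, h⟩ := hB.exists_testLimit hA.one_le hA.scale hφ
  ⟨R, B, h, h.eventually_trunc hA.pos hA.one_le hA.ratio⟩

include hA hB in
/-- The discrete forms tested against sampled test functions converge. The test function is rotated,
so that its Dirichlet components vanish exactly with respect to the discrete boundary conditions. -/
theorem Approx.tendsto_dform_test (hφ : IsTest u w φ) {v : ℕ → ℕ → Vec F r}
    (hv : ∀ j l, sites r (n j) ≤ l → v j l = 0) (h : LatticeLimit m v f g) :
    Tendsto (fun j => dform (n j) (m j) (Y₁ j) (Y₂ j) (u' j) (x j) dt(j, φ) (v j)) atTop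
      (𝓝 (re (form Y u w φ f g))) := by
  obtain ⟨R, B, hT⟩ := hB.exists_testLimit hA.one_le hA.scale hφ
  obtain ⟨Z, hZ⟩ := hA.lim₂
  have hYo : ∀ K, TendstoUniformlyOn (fun j => step (m j) fun l => opr (Y₁ j l) +
      (1 / 2 : ℝ) • (opr (Y₂ j l) + adjoint (opr (Y₂ j l))))
      (fun x => opr (Y x)) atTop (Iic K) := by
    intro K
    have h1 := uniformContinuous_opr.comp_tendstoUniformlyOn
      (hA.lim (Iic K) (isCompact_Iic_nnreal K))
    refine h1.congr (.of_forall fun j y _ => ?_)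
    simp only [Function.comp_apply, combine, step, map_add, map_smul, opr_conjTranspose]
  have t1 := tendsto_iform_test hA.one_le hA.scale (Y := fun x => opr (Y x))
    (continuous_opr.comp hA.cont) hYo (fun K => uniformContinuous_opr.comp_tendstoUniformlyOn
      (hZ (Iic K) (isCompact_Iic_nnreal K))) hT hv h
  rw [re_form hA.cont hφ h.memLp h.memLp_deriv]
  refine t1.add ?_
  have e : ∀ j, ⟪dt(j, φ) 0, act (specMat (u' j) (x j)) (v j 0)⟫ =
      ∑ i, x j i * re (star (dag (u i) (φ 0)) * dag (u' j i) (v j 0)) := by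
    intro j
    rw [← re_dag, dag_act_specMat, map_sum]
    simp only [discretize, dag_rot (hB.ortho j), map_smul, smul_eq_mul, Nat.cast_zero, zero_div]
  simp only [e]
  refine tendsto_finsetSum _ fun i _ => ?_
  by_cases hi : w i = ⊤
  · obtain ⟨δ, hδ, h0⟩ := hφ.2.2 i hi
    rw [h0 0 ⟨le_rfl, hδ.le⟩]
    simp
  · have hre : Continuous (re : F →ₗ[ℝ] ℝ) := LinearMap.continuous_of_finiteDimensional _
    exact (hB.tendsto_toReal hi).mul ((hre.tendsto _).comp ((hB.tendsto_dag h i).const_mul _))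

include hA hB in
set_option maxHeartbeats 1000000 in
/-- Along a subsequence, normalized discrete eigenvectors with bounded eigenvalues converge to
normalized eigenfunctions. -/
theorem Approx.exists_eigen_limit {Λ : ℝ} {l : ℕ → ℝ} (hl : ∀ j, l j ≤ Λ) {V : ℕ → L2 F r}
    (hV1 : ∀ j, ‖V j‖ = 1)
    (hV : ∀ j, IsDiscreteEigen (n j) (m j) (Y₁ j) (Y₂ j) (specMat (u' j) (x j)) (l j) (V j)) :
    ∃ (t : ℕ → ℕ) (l₀ : ℝ) (V₀ : L2 F r), StrictMono t ∧
      Tendsto (fun j => l (t j)) atTop (𝓝 l₀) ∧ Tendsto (fun j => V (t j)) atTop (𝓝 V₀) ∧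
      ‖V₀‖ = 1 ∧ IsContinuumEigen η Y u w l₀ V₀ := by
  obtain ⟨t, l₀, V₀, v, f, g, ht, hl₀, hV₀, hv, hweak, hL, hVf, hint, K, hK⟩ :=
    exists_lattice_subseq hA.pos hA.cmp hA.le_C hA.good hA.scale hB.ortho hB.lower hl hV1 hV
  have hn1 : ‖V₀‖ = 1 := by
    refine tendsto_nhds_unique hV₀.norm ?_
    simp only [hV1]; exact tendsto_const_nhds
  have hA' := hA.comp ht
  have hB' := hB.comp ht
  have hvs : ∀ j k, sites r (n (t j)) ≤ k → v (t j) k = 0 := fun j => supp_of_trunc hA.pos (hv _)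
  have hm0 : ∀ j, 0 < m (t j) := fun j => hA'.scale_pos j
  have hfg : ∀ y : ℝ, 0 ≤ y → f y = f 0 + ∫ s in (0 : ℝ)..y, g s := fun y hy =>
    LatticeLimit.eq_integral (m := fun j => m (t j)) (N := fun j => sites r (n (t j)))
      (v := fun j => v (t j)) hm0 hA'.scale hvs hL hy
  refine ⟨t, l₀, V₀, ht, hl₀, hV₀, hn1, fun h0 => by simp [h0] at hn1, f, g, ?_, hVf, ?_⟩
  · refine memLstar_of_energy hA.cmp.cont_eta hA.cmp.pos_eta hL.cont hL.memLp hL.memLp_deriv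
      hfg hint fun i hi => ?_
    -- the energy controls `x ‖u† v(0)‖²`, so the component vanishes in the limit as `x → ∞`
    have h1 := hB'.tendsto_dag hL i
    have h2 : Tendsto (fun j => x (t j) i) atTop atTop := by
      have := hB'.tendsto i
      rw [hi] at this
      exact EReal.tendsto_coe_nhds_top_iff.1 this
    have h3 : ‖dag (u i) (f 0)‖ ^ 2 ≤ 0 := by
      refine le_of_tendsto_of_tendsto (h1.norm.pow 2) (h2.const_div_atTop K) ?_
      filter_upwards [h2.eventually (eventually_gt_atTop 0)] with j hj
      rw [le_div_iff₀ hj, mul_comm]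
      have := hK (t j) i
      rwa [max_eq_left hj.le] at this
    exact norm_eq_zero.1 (pow_eq_zero_iff two_ne_zero |>.1 (le_antisymm h3 (sq_nonneg _)))
  · have hre : ∀ φ, IsTest u w φ → re (form Y u w φ f g) = l₀ * re (ip φ f) := by
      intro φ hφ
      have h1 := hA'.tendsto_dform_test hB' hφ hvs hL
      obtain ⟨R, B, hT, hN⟩ := hA'.exists_test hB' hφ
      have hT2 := (hT.latticeLimit hA'.one_le hA'.scale).tendsto
      have h2 := hl₀.mul (hT2.inner hV₀ (𝕜 := ℝ))
      rw [← ip_congr hφ.memLp.coeFn_toLp hVf, re_ip_L2]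
      refine tendsto_nhds_unique h1 (h2.congr' ?_)
      filter_upwards [hN] with j hj
      exact (hweak (t j) _ hj).symm
    intro φ hφ
    rw [← sub_eq_zero]
    refine eq_zero_of_re_star_mul fun c => ?_
    have h1 := hre _ (hφ.op_smul c)
    rw [form_op_left hA.cont hφ hL.memLp hL.memLp_deriv, ip_op_left hφ.memLp hL.memLp] at h1
    rw [mul_sub, map_sub, h1, mul_smul_comm, map_smul, smul_eq_mul, sub_self]

/-! ### The form on combinations of test functions -/

section FormCalculus

variable {ι : Type*} [Fintype ι]

theorem dag_sum_left {s : Finset ι} (u : Vec F r) (v : ι → Vec F r) :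
    dag (∑ i ∈ s, v i) u = ∑ i ∈ s, dag (v i) u := by
  rw [← star_dag, dag_sum_right, star_sum]
  simp only [star_dag]

/-- The combination `∑ i, f i (x) c i` of functions, with coefficients on the right. -/
def fcomb (f : ι → ℝ → Vec F r) (c : ι → F) (x : ℝ) : Vec F r := ∑ i, op (c i) • f i x

theorem MemLp.fcomb {f : ι → ℝ → Vec F r} (hf : ∀ i, MemL2(f i)) (c : ι → F) :
    MemL2(fcomb f c) := by
  have : BlockTridiagonal.fcomb f c = ∑ i, op (c i) • f i := by
    ext1 x; simp [BlockTridiagonal.fcomb]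
  rw [this]
  exact memLp_finsetSum' _ fun i _ => (hf i).const_smul (op (c i))

theorem ip_fcomb_right {g : ι → ℝ → Vec F r} (hf : MemL2(f)) (hg : ∀ i, MemL2(g i)) (c : ι → F) :
    ip f (fcomb g c) = ∑ i, ip f (g i) * c i := by
  simp only [ip, fcomb, dag_sum_right, dag_op_right]
  rw [integral_finsetSum _ fun i _ => (integrable_dag hf (hg i)).mul_const (c i)]
  exact sum_congr rfl fun i _ => integral_mul_const_of_integrable (integrable_dag hf (hg i))

theorem ip_fcomb_left {f : ι → ℝ → Vec F r} (hf : ∀ i, MemL2(f i)) (hg : MemL2(g)) (c : ι → F) :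
    ip (fcomb f c) g = ∑ i, star (c i) * ip (f i) g := by
  simp only [ip, fcomb, dag_sum_left, dag_op_left]
  rw [integral_finsetSum _ fun i _ => (integrable_dag (hf i) hg).const_mul (star (c i))]
  exact sum_congr rfl fun i _ => integral_const_mul_of_integrable (integrable_dag (hf i) hg)

theorem act_fcomb (M : Mat F r) (f : ι → ℝ → Vec F r) (c : ι → F) (x : ℝ) :
    act M (fcomb f c x) = ∑ i, op (c i) • act M (f i x) := by
  simp only [fcomb, ← act_op]
  exact map_sum (opr M) _ _

theorem IsTest.fcomb {φ : ι → ℝ → Vec F r}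
    (h : ∀ i, IsTest u w (φ i)) (c : ι → F) : IsTest u w (fcomb φ c) := by
  refine ⟨ContDiff.sum fun i _ => ((h i).op_smul (c i)).1, ?_, fun i hi => ?_⟩
  · choose R hR using fun i => (((h i).op_smul (c i)).2.1.isCompact.isBounded).subset_closedBall 0
    obtain ⟨M, hM⟩ := (Set.finite_range R).bddAbove
    refine HasCompactSupport.intro (isCompact_closedBall (0 : ℝ) M) fun x hx => ?_
    refine sum_eq_zero fun i _ => ?_
    refine image_eq_zero_of_notMem_tsupport (f := fun x => op (c i) • φ i x) fun h' => hx ?_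
    exact Metric.closedBall_subset_closedBall (hM ⟨i, rfl⟩) (hR i h')
  · choose δ hδ h0 using fun a => (h a).2.2 i hi
    obtain ⟨d, hd, hdle⟩ : ∃ d > 0, ∀ a, d ≤ δ a := by
      rcases isEmpty_or_nonempty ι with h | h
      · exact ⟨1, one_pos, fun a => (IsEmpty.false a).elim⟩
      · obtain ⟨a, ha⟩ := Finite.exists_min δ
        exact ⟨δ a, hδ a, ha⟩
    refine ⟨d, hd, fun x hx => ?_⟩
    rw [BlockTridiagonal.fcomb, dag_sum_right]
    refine sum_eq_zero fun a _ => ?_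
    rw [dag_op_right, h0 a x ⟨hx.1, hx.2.trans (hdle a)⟩, zero_mul]

theorem IsTest.deriv_fcomb {φ : ι → ℝ → Vec F r} (h : ∀ i, IsTest u w (φ i)) (c : ι → F) :
    deriv (BlockTridiagonal.fcomb φ c) = BlockTridiagonal.fcomb (fun i => deriv (φ i)) c := by
  ext1 x
  unfold BlockTridiagonal.fcomb
  rw [deriv_fun_sum fun i _ => ((h i).op_smul (c i)).1.differentiable (by simp) x]
  exact sum_congr rfl fun i _ => congrFun ((h i).deriv_op (c i)) x

theorem form_fcomb_right (hY : Continuous Y) {f g : ι → ℝ → Vec F r} (hφ : IsTest u w φ)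
    (hf : ∀ i, MemL2(f i)) (hg : ∀ i, MemL2(g i)) (c : ι → F) :
    form Y u w φ (fcomb f c) (fcomb g c) = ∑ i, form Y u w φ (f i) (g i) * c i := by
  obtain ⟨h1, h2⟩ := hφ.memLp_act hY
  simp only [form_eq]
  rw [ip_fcomb_right hφ.memLp_deriv hg, ip_fcomb_right h2 hf, ip_fcomb_right h1 hg]
  simp only [fcomb, dag_sum_right, dag_op_right, add_mul, sub_mul, sum_add_distrib,
    sum_sub_distrib, mul_sum, sum_mul, smul_sum, mul_assoc,
    smul_mul_assoc]
  rw [sum_comm]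

theorem form_fcomb_left (hY : Continuous Y) {φ : ι → ℝ → Vec F r} (hφ : ∀ i, IsTest u w (φ i))
    (hf : MemL2(f)) (hg : MemL2(g)) (c : ι → F) :
    form Y u w (fcomb φ c) f g = ∑ i, star (c i) * form Y u w (φ i) f g := by
  simp only [form_eq]
  rw [IsTest.deriv_fcomb hφ]
  simp only [act_fcomb]
  have e1 := ip_fcomb_left (f := fun i => deriv (φ i)) (fun i => (hφ i).memLp_deriv) hg c
  have e2 := ip_fcomb_left (f := fun i x => act (Y x.toNNReal)ᴴ (deriv (φ i) x))
    (fun i => ((hφ i).memLp_act hY).2) hf c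
  have e3 := ip_fcomb_left (f := fun i x => act (Y x.toNNReal)ᴴ (φ i x))
    (fun i => ((hφ i).memLp_act hY).1) hg c
  unfold fcomb at e1 e2 e3 ⊢
  rw [e1, e2, e3]
  simp only [dag_sum_right, dag_op_right, star_sum, star_mul, mul_add, mul_sub,
    sum_add_distrib, sum_sub_distrib, mul_sum, sum_mul,
    smul_sum, mul_assoc, mul_smul_comm]
  congr 1
  rw [sum_comm]

theorem form_fcomb (hY : Continuous Y) {φ : ι → ℝ → Vec F r} (hφ : ∀ i, IsTest u w (φ i))
    (c : ι → F) :
    form Y u w (fcomb φ c) (fcomb φ c) (deriv (fcomb φ c)) =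
      ∑ i, star (c i) * ∑ k, form Y u w (φ i) (φ k) (deriv (φ k)) * c k := by
  rw [IsTest.deriv_fcomb hφ, form_fcomb_left hY hφ (MemLp.fcomb (fun i => (hφ i).memLp) c)
    (MemLp.fcomb (fun i => (hφ i).memLp_deriv) c)]
  refine sum_congr rfl fun i _ => ?_
  rw [form_fcomb_right hY (hφ i) (fun i => (hφ i).memLp) fun i => (hφ i).memLp_deriv]

theorem IsTest.memLp_weight (h : IsTest u w φ) (hη : Continuous η) :
    MemL2(fun x : ℝ => √(η x.toNNReal) • φ x) :=
  memLp_of_vanish ((hη.comp continuous_real_toNNReal).sqrt.smul h.cont) fun x _ hx => by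
    rw [(h.vanish.choose_spec x hx).1, smul_zero]

/-- The square of the `L*` norm of a test function as a real integral. -/
theorem IsTest.starNormSq_eq (hc : IsComparison η ζ) (h : IsTest u w φ) :
    starNormSq η u w φ (deriv φ) ≠ ⊤ ∧ (starNormSq η u w φ (deriv φ)).toReal =
      (∫ x in ℝ₊, ‖deriv φ x‖ ^ 2) + ((∫ x in ℝ₊, ‖φ x‖ ^ 2) +
        ∫ x in ℝ₊, ‖√(η x.toNNReal) • φ x‖ ^ 2) +
        ∑ i, max (w i).toReal 0 * ‖dag (u i) (φ 0)‖ ^ 2 := by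
  have hL := h.memLp_weight hc.cont_eta
  have i1 := h.memLp_deriv.integrable_norm_pow (by simp)
  have i2 := h.memLp.integrable_norm_pow (by simp)
  have i3 := hL.integrable_norm_pow (by simp)
  simp only [ENNReal.toReal_ofNat] at i1 i2 i3
  have e1 : ∫⁻ x in ℝ₊, (‖deriv φ x‖ₑ ^ 2 + ofReal (1 + η x.toNNReal) * ‖φ x‖ₑ ^ 2) =
      ofReal (∫ x in ℝ₊, (‖deriv φ x‖ ^ 2 + (‖φ x‖ ^ 2 + ‖√(η x.toNNReal) • φ x‖ ^ 2))) := by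
    have h12 : Integrable (fun x : ℝ => ‖deriv φ x‖ ^ 2 + (‖φ x‖ ^ 2 +
        ‖√(η x.toNNReal) • φ x‖ ^ 2)) halfLine := i1.add (i2.add i3)
    rw [ofReal_integral_eq_lintegral_ofReal h12
      (.of_forall fun x => add_nonneg (sq_nonneg _) (add_nonneg (sq_nonneg _) (sq_nonneg _)))]
    refine lintegral_congr fun x => ?_
    have h0 := (hc.pos_eta x.toNNReal).le
    rw [norm_smul, mul_pow, Real.norm_of_nonneg (Real.sqrt_nonneg _), Real.sq_sqrt h0,
      show ‖φ x‖ ^ 2 + η x.toNNReal * ‖φ x‖ ^ 2 = (1 + η x.toNNReal) * ‖φ x‖ ^ 2 by ring,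
      ENNReal.ofReal_add (p := ‖deriv φ x‖ ^ 2) (sq_nonneg _) (by positivity),
      ENNReal.ofReal_mul (by positivity), ENNReal.ofReal_pow (norm_nonneg _),
      ENNReal.ofReal_pow (norm_nonneg _), ofReal_norm, ofReal_norm]
  have e2 : ∑ i, ofReal (max (w i).toReal 0) * ‖dag (u i) (φ 0)‖ₑ ^ 2 =
      ofReal (∑ i, max (w i).toReal 0 * ‖dag (u i) (φ 0)‖ ^ 2) := by
    rw [ENNReal.ofReal_sum_of_nonneg fun i _ => mul_nonneg (le_max_right _ _) (sq_nonneg _)]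
    refine sum_congr rfl fun i _ => ?_
    rw [ENNReal.ofReal_mul (le_max_right _ _), ENNReal.ofReal_pow (norm_nonneg _), ofReal_norm]
  have e3 : (∫ x in ℝ₊, (‖deriv φ x‖ ^ 2 + (‖φ x‖ ^ 2 +
        ‖√(η x.toNNReal) • φ x‖ ^ 2))) = (∫ x in ℝ₊, ‖deriv φ x‖ ^ 2) +
        ((∫ x in ℝ₊, ‖φ x‖ ^ 2) +
        ∫ x in ℝ₊, ‖√(η x.toNNReal) • φ x‖ ^ 2) := by
    rw [← integral_add i2 i3]
    exact integral_add i1 (i2.add i3)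
  rw [starNormSq, e1, e2, ← ENNReal.ofReal_add]
  · refine ⟨ENNReal.ofReal_ne_top, ?_⟩
    rw [ENNReal.toReal_ofReal, e3]
    exact add_nonneg (integral_nonneg fun x => by positivity)
      (sum_nonneg fun i _ => mul_nonneg (le_max_right _ _) (sq_nonneg _))
  · exact integral_nonneg fun x => by positivity
  · exact sum_nonneg fun i _ => mul_nonneg (le_max_right _ _) (sq_nonneg _)

theorem enorm_sq_le_of_norm_le {A B : Type*} [NormedAddCommGroup A] [NormedAddCommGroup B] {z : A}
    (c : ι → F) (a : ι → B) (h : ‖z‖ ≤ ∑ i, ‖c i‖ * ‖a i‖) :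
    ‖z‖ₑ ^ 2 ≤ ofReal (∑ i, ‖c i‖ ^ 2) * ∑ i, ‖a i‖ₑ ^ 2 := by
  have h1 := (pow_le_pow_left₀ (norm_nonneg z) h 2).trans (Finset.sum_mul_sq_le_sq_mul_sq _ _ _)
  have h2 := ENNReal.ofReal_le_ofReal h1
  rw [ENNReal.ofReal_mul (by positivity), ENNReal.ofReal_sum_of_nonneg
    (f := fun i => ‖a i‖ ^ 2) fun i _ => by positivity] at h2
  simpa only [ENNReal.ofReal_pow (norm_nonneg _), ofReal_norm] using h2

theorem enorm_sum_op_sq_le (c : ι → F) (a : ι → Vec F r) :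
    ‖∑ i, op (c i) • a i‖ₑ ^ 2 ≤ ofReal (∑ i, ‖c i‖ ^ 2) * ∑ i, ‖a i‖ₑ ^ 2 :=
  enorm_sq_le_of_norm_le c a
    ((norm_sum_le _ _).trans_eq (sum_congr rfl fun i _ => norm_op_smul _ _))

/-- The `L*` norm of a combination is controlled by the norms of its terms. -/
theorem starNormSq_fcomb_le (hη : Continuous η) (u : Fin r → Vec F r) (w : Fin r → EReal)
    {f g : ι → ℝ → Vec F r} (hf : ∀ i, AEStronglyMeasurable (f i) halfLine)
    (hg : ∀ i, AEStronglyMeasurable (g i) halfLine) (c : ι → F) :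
    starNormSq η u w (fcomb f c) (fcomb g c) ≤
      ofReal (∑ i, ‖c i‖ ^ 2) * ∑ i, starNormSq η u w (f i) (g i) := by
  have hηm : Measurable fun x : ℝ => ofReal (1 + η x.toNNReal) :=
    (continuous_const.add (hη.comp continuous_real_toNNReal)).measurable.ennreal_ofReal
  set S := ofReal (∑ i, ‖c i‖ ^ 2) with hS
  simp only [starNormSq, sum_add_distrib, mul_add]
  refine add_le_add ?_ ?_
  · have hm : ∀ i, AEMeasurable (fun x => ‖g i x‖ₑ ^ 2 +
        ofReal (1 + η x.toNNReal) * ‖f i x‖ₑ ^ 2) halfLine := fun i =>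
      ((hg i).enorm.pow_const 2).add (hηm.aemeasurable.mul ((hf i).enorm.pow_const 2))
    rw [← lintegral_finsetSum' _ fun i _ => hm i,
      ← lintegral_const_mul' _ _ (hS ▸ ENNReal.ofReal_ne_top)]
    refine lintegral_mono fun x => ?_
    rw [sum_add_distrib, mul_add, ← mul_sum, mul_left_comm]
    exact add_le_add (enorm_sum_op_sq_le _ _) (mul_le_mul_right (enorm_sum_op_sq_le _ _) _)
  · rw [sum_comm, mul_sum]
    refine sum_le_sum fun i _ => ?_
    rw [← mul_sum, mul_left_comm]
    refine mul_le_mul_right ?_ _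
    rw [fcomb, dag_sum_right]
    simp only [dag_op_right]
    exact enorm_sq_le_of_norm_le c _ ((norm_sum_le _ _).trans_eq
      (sum_congr rfl fun i _ => by rw [norm_mul, mul_comm]))

/-- Uniform negativity of converging quadratic forms on a finite-dimensional space. -/
theorem eventually_neg_of_tendsto {W : Type*} [NormedAddCommGroup W] [NormedSpace ℝ W]
    [FiniteDimensional ℝ W] {q : ℕ → W → ℝ} {B : ℕ → W →ₗ[ℝ] W →ₗ[ℝ] ℝ}
    (hq : ∀ p c, q p c = B p c c) {q₀ : W → ℝ}
    (hlim : ∀ c, Tendsto (fun p => q p c) atTop (𝓝 (q₀ c))) (hneg : ∀ c, c ≠ 0 → q₀ c < 0) :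
    ∀ᶠ p in atTop, ∀ c, c ≠ 0 → q p c < 0 := by
  by_contra hcon
  rw [not_eventually] at hcon
  push Not at hcon
  obtain ⟨t, ht, hP⟩ := extraction_of_frequently_atTop hcon
  choose c hc0 hcq using hP
  have hn : ∀ j, 0 < ‖c j‖ := fun j => norm_pos_iff.2 (hc0 j)
  have hsmul : ∀ p (s : ℝ) c, q p (s • c) = s ^ 2 * q p c := fun p s c => by
    simp only [hq, map_smul, LinearMap.smul_apply, smul_eq_mul]; ring
  have : ProperSpace W := FiniteDimensional.proper ℝ W
  obtain ⟨c₀, hc₀, s, hs, hcs⟩ := (isCompact_sphere (0 : W) 1).tendsto_subseq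
    (x := fun j => ‖c j‖⁻¹ • c j) fun j => by
      rw [mem_sphere_zero_iff_norm, norm_smul, norm_inv, norm_norm, inv_mul_cancel₀ (hn j).ne']
  let e := Module.finBasis ℝ W
  have hexp : ∀ p c, q p c = ∑ i, ∑ k, e.repr c i * (e.repr c k *
      ((q p (e i + e k) - q p (e i) - q p (e k)) / 2)) := by
    intro p c
    have h1 : q p c = ∑ i, ∑ k, e.repr c i * (e.repr c k * B p (e i) (e k)) := by
      conv_lhs => rw [hq, ← e.sum_repr c]
      simp only [map_sum, LinearMap.sum_apply, map_smul, LinearMap.smul_apply, smul_eq_mul, mul_sum]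
      rw [sum_comm]
      refine sum_congr rfl fun i _ => sum_congr rfl fun k _ => ?_
      ring
    have h2 := h1
    rw [sum_comm] at h2
    rw [show q p c = (q p c + q p c) / 2 by ring]
    nth_rw 1 [h1]
    rw [h2]
    simp only [← sum_add_distrib, Finset.sum_div, hq, map_add, LinearMap.add_apply]
    exact sum_congr rfl fun i _ => sum_congr rfl fun k _ => by ring
  have hcoord : ∀ i, Continuous fun c : W => e.repr c i := fun i =>
    (e.coord i).continuous_of_finiteDimensional
  have key : ∀ d : ℕ → W, Tendsto d atTop (𝓝 c₀) → Tendsto (fun j => q (t (s j)) (d j)) atTop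
      (𝓝 (∑ i, ∑ k, e.repr c₀ i * (e.repr c₀ k *
        ((q₀ (e i + e k) - q₀ (e i) - q₀ (e k)) / 2)))) := by
    intro d hd
    simp only [hexp _ (d _)]
    have hts := (ht.comp hs).tendsto_atTop
    refine tendsto_finsetSum _ fun i _ => tendsto_finsetSum _ fun k _ => ?_
    exact (((hcoord i).tendsto _).comp hd).mul ((((hcoord k).tendsto _).comp hd).mul
      (((((hlim _).comp hts).sub ((hlim _).comp hts)).sub ((hlim _).comp hts)).div_const 2))
  have h1 := key (fun _ => c₀) tendsto_const_nhds
  have h2 := (hlim c₀).comp (ht.comp hs).tendsto_atTop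
  have h3 := key _ hcs
  rw [tendsto_nhds_unique h1 h2] at h3
  have h4 : 0 ≤ q₀ c₀ := ge_of_tendsto' h3 fun j => by
    simp only [Function.comp_apply, hsmul]
    exact mul_nonneg (sq_nonneg _) (hcq _)
  have h5 : c₀ ≠ 0 := by
    rintro rfl; simp at hc₀
  exact absurd (hneg c₀ h5) (not_lt.2 h4)

end FormCalculus

/-! ### Bounds for the continuum form and recovery sequences -/

section Recovery

theorem norm_toLp_sq (hf : MemL2(f)) : ‖hf.toLp‖ ^ 2 = ∫ x in ℝ₊, ‖f x‖ ^ 2 := by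
  rw [norm_LE_sq]
  refine integral_congr_ae ?_
  filter_upwards [hf.coeFn_toLp] with y hy
  rw [hy]

include hA hB in
theorem Approx.tendsto_dform {φ ψ : ℝ → Vec F r} (hφ : IsTest u w φ) (hψ : IsTest u w ψ) :
    Tendsto (fun j => dform (n j) (m j) (Y₁ j) (Y₂ j) (u' j) (x j) dt(j, φ) dt(j, ψ)) atTop
      (𝓝 (re (form Y u w φ ψ (deriv ψ)))) := by
  obtain ⟨R, B, hT, hN⟩ := hA.exists_test hB hψ
  obtain ⟨J, hJ⟩ := eventually_atTop.1 hN
  rw [← tendsto_add_atTop_iff_nat J]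
  have ht : StrictMono fun j => j + J := strictMono_id.add_const J
  have hA' := hA.comp ht
  have hB' := hB.comp ht
  exact hA'.tendsto_dform_test hB' hφ (fun j => supp_of_trunc hA.pos (hJ (j + J) (by omega)))
    ((hT.latticeLimit hA.one_le hA.scale).comp ht)

include hA hB in
theorem Approx.re_form_symm {φ ψ : ℝ → Vec F r} (hφ : IsTest u w φ) (hψ : IsTest u w ψ) :
    re (form Y u w φ ψ (deriv ψ)) = re (form Y u w ψ φ (deriv φ)) :=
  tendsto_nhds_unique (hA.tendsto_dform hB hφ hψ)
    ((hA.tendsto_dform hB hψ hφ).congr fun j => dform_symm _ (hA.good j).2.2.1 _ _ _ _)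

include hA hB in
theorem Approx.tendsto_mass (hφ : IsTest u w φ) :
    Tendsto (fun j => mass (m j) (sites r (n j)) dt(j, φ)) atTop (𝓝 (∫ x in ℝ₊, ‖φ x‖ ^ 2)) := by
  obtain ⟨R, B, hT, hN⟩ := hA.exists_test hB hφ
  rw [← norm_toLp_sq hφ.memLp]
  refine ((hT.latticeLimit hA.one_le hA.scale).tendsto.norm.pow 2).congr' ?_
  filter_upwards [hN] with j hj
  exact norm_stepL_sq (hA.scale_pos j) (supp_of_trunc hA.pos hj)

include hA hB in
theorem Approx.tendsto_kin (hφ : IsTest u w φ) :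
    Tendsto (fun j => kin (m j) (sites r (n j)) dt(j, φ)) atTop
      (𝓝 (∫ x in ℝ₊, ‖deriv φ x‖ ^ 2)) := by
  obtain ⟨R, B, hT, hN⟩ := hA.exists_test hB hφ
  rw [← norm_toLp_sq hφ.memLp_deriv]
  have h1 := tendsto_stepL_of_pointwise hA.one_le hT.nonneg
    (fun j => dq_eq_zero_of_le (hT.supp j)) (fun j l _ => hT.dbound j l) hφ.memLp_deriv.coeFn_toLp
    (ae_tendsto_toNNReal hT.dlim)
  refine (h1.norm.pow 2).congr' ?_
  filter_upwards [hN] with j hj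
  exact norm_stepL_dq_sq (hA.scale_pos j) (supp_of_trunc hA.pos hj)

include hA hB in
theorem Approx.tendsto_wmass (hφ : IsTest u w φ) :
    Tendsto (fun j => wmass (m j) (sites r (n j)) (latticeWeight η (m j)) dt(j, φ)) atTop
      (𝓝 (∫ x in ℝ₊, ‖√(η x.toNNReal) • φ x‖ ^ 2)) := by
  obtain ⟨R, B, hT, hN⟩ := hA.exists_test hB hφ
  have hm0 := hA.scale_pos
  have hL := hφ.memLp_weight hA.cmp.cont_eta
  rw [← norm_toLp_sq hL]
  set a : ℕ → ℕ → Vec F r := fun j l => √(latticeWeight η (m j) l) • dt(j, φ) l with ha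
  have h1 := tendsto_stepL_of_pointwise hA.one_le (a := a) (R := R)
    (B := √(η R.toNNReal) * B) (mul_nonneg (Real.sqrt_nonneg _) hT.nonneg)
    (fun j l hl => by simp only [ha]; rw [hT.supp j l hl, smul_zero])
    (fun j l hl => by
      simp only [ha]
      rw [norm_smul, Real.norm_of_nonneg (Real.sqrt_nonneg _)]
      refine mul_le_mul (Real.sqrt_le_sqrt (hA.cmp.mono_eta (Real.toNNReal_mono ?_))) (hT.bound j l)
        (norm_nonneg _) (Real.sqrt_nonneg _)
      rw [div_le_iff₀ (hm0 j)]; exact hl.le)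
    hL.coeFn_toLp (by
      refine ae_tendsto_toNNReal fun y => ?_
      rw [Real.toNNReal_coe]
      exact ((hA.cmp.cont_eta.tendsto _).comp (tendsto_floor_div hA.scale y)).sqrt.smul
        ((hT.lim y).tendsto_at (mem_Iic.2 le_rfl)))
  refine (h1.norm.pow 2).congr' ?_
  filter_upwards [hN] with j hj
  rw [norm_stepL_sq (hm0 j) (N := sites r (n j)) fun l hl => by
    simp only [ha]; rw [supp_of_trunc hA.pos hj l hl, smul_zero], mass, wmass]
  congr 1
  refine sum_congr rfl fun l _ => ?_
  simp only [ha]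
  rw [norm_smul, mul_pow, Real.norm_of_nonneg (Real.sqrt_nonneg _),
    Real.sq_sqrt (show 0 ≤ latticeWeight η (m j) l from (hA.cmp.pos_eta _).le)]

theorem BoundaryLimit.tendsto_positive (hB : BoundaryLimit b u' x u w) (m : ℕ → ℝ)
    (hφ : IsTest u w φ) :
    Tendsto (fun j => ∑ i, max (x j i) 0 * ‖dag (u' j i) (dt(j, φ) 0)‖ ^ 2) atTop
      (𝓝 (∑ i, max (w i).toReal 0 * ‖dag (u i) (φ 0)‖ ^ 2)) := by
  simp only [discretize, dag_rot (hB.ortho _), Nat.cast_zero, zero_div]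
  refine tendsto_finsetSum _ fun i _ => ?_
  by_cases hi : w i = ⊤
  · obtain ⟨δ, hδ, h0⟩ := hφ.2.2 i hi
    rw [h0 0 ⟨le_rfl, hδ.le⟩]
    simp
  · exact ((hB.tendsto_toReal hi).max tendsto_const_nhds).mul_const _

include hA hB in
theorem Approx.tendsto_energy (hφ : IsTest u w φ) :
    Tendsto (fun j => kin (m j) (sites r (n j)) dt(j, φ) + (mass (m j) (sites r (n j)) dt(j, φ) +
        wmass (m j) (sites r (n j)) (latticeWeight η (m j)) dt(j, φ)) +
      ∑ i, max (x j i) 0 * ‖dag (u' j i) (dt(j, φ) 0)‖ ^ 2) atTop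
      (𝓝 (starNormSq η u w φ (deriv φ)).toReal) := by
  rw [(hφ.starNormSq_eq hA.cmp).2]
  exact ((hA.tendsto_kin hB hφ).add ((hA.tendsto_mass hB hφ).add
    (hA.tendsto_wmass hB hφ))).add (hB.tendsto_positive m hφ)

include hA hB in
/-- The form is bounded by the square of the `L*` norm. -/
theorem Approx.exists_form_bound :
    ∃ K, 0 ≤ K ∧ ∀ φ : ℝ → Vec F r, IsTest u w φ → |re (form Y u w φ φ (deriv φ))| ≤
      K * (starNormSq η u w φ (deriv φ)).toReal := by
  obtain ⟨K₁, K₂, hK₁, hK₂, hen⟩ := energy_bounds (F := F) hA.pos hA.cmp hA.le_C b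
  refine ⟨K₂ + |b| + 1, by positivity, fun φ hφ => ?_⟩
  obtain ⟨R, B, hT, hN⟩ := hA.exists_test hB hφ
  refine le_of_tendsto_of_tendsto (hA.tendsto_dform hB hφ hφ).abs
    ((hA.tendsto_energy hB hφ).const_mul _) ?_
  filter_upwards [hN] with j hj
  have hm0 : 0 < m j := hA.scale_pos j
  set v := dt(j, φ) with hv
  have hvs := supp_of_trunc hA.pos hj
  have h1 := (hen _ _ _ _ (hA.good j) v hvs).2
  have h2 : |inner ℝ (v 0) (act (specMat (u' j) (x j)) (v 0))| ≤
      ∑ i, max (x j i) 0 * ‖dag (u' j i) (v 0)‖ ^ 2 + |b| * ‖v 0‖ ^ 2 := by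
    rw [inner_act_specMat_self, (hB.ortho j).norm_sq_eq (v 0), mul_sum, ← sum_add_distrib]
    refine (abs_sum_le_sum_abs _ _).trans (sum_le_sum fun i _ => ?_)
    rw [abs_mul, abs_of_nonneg (sq_nonneg ‖dag (u' j i) (v 0)‖), ← add_mul]
    refine mul_le_mul_of_nonneg_right ?_ (sq_nonneg _)
    have h3 := hB.lower j i
    have h4 := le_abs_self b
    have h5 := le_max_left (x j i) 0
    have h6 := le_max_right (x j i) 0
    rw [abs_le]; constructor <;> linarith [abs_nonneg b]
  have h3 := norm_sq_le_kin_mass hm0 hvs one_pos 0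
  rw [inv_one, one_mul, one_mul] at h3
  have hk := kin_nonneg hm0 (sites r (n j)) v
  have hM := mass_nonneg hm0 (sites r (n j)) v
  have hw := wmass_nonneg hm0 (sites r (n j)) (h := latticeWeight η (m j))
    (fun l => (hA.cmp.pos_eta _).le) v
  have hS : 0 ≤ ∑ i, max (x j i) 0 * ‖dag (u' j i) (v 0)‖ ^ 2 :=
    sum_nonneg fun i _ => mul_nonneg (le_max_right _ _) (sq_nonneg _)
  refine (abs_add_le _ _).trans ((add_le_add h1 h2).trans ?_)
  generalize (∑ i, max (x j i) 0 * ‖dag (u' j i) (v 0)‖ ^ 2) = S at hS ⊢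
  generalize kin (m j) (sites r (n j)) v = k at *
  generalize mass (m j) (sites r (n j)) v = M at *
  generalize wmass (m j) (sites r (n j)) (latticeWeight η (m j)) v = ω at *
  have hb := abs_nonneg b
  have h5 : |b| * ‖v 0‖ ^ 2 ≤ |b| * (k + M) := by gcongr
  have h6 : 0 ≤ |b| * ω := by positivity
  have h7 : 0 ≤ |b| * S := by positivity
  have h8 : 0 ≤ K₂ * S := by positivity
  linarith

include hA hB in
theorem Approx.norm_sub_sq_le (hφ : IsTest u w φ) (y : ℝ≥0) :
    ‖φ y - φ 0‖ ^ 2 ≤ y * ∫ x in ℝ₊, ‖deriv φ x‖ ^ 2 := by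
  obtain ⟨R, B, hT, hN⟩ := hA.exists_test hB hφ
  have h1 := (hT.lim y).tendsto_at (mem_Iic.2 le_rfl)
  have h2 := (hT.lim y).tendsto_at (mem_Iic.2 (zero_le : 0 ≤ y))
  have h3 := ((tendsto_inv_atTop_zero.comp hA.scale).const_add (y : ℝ)).mul (hA.tendsto_kin hB hφ)
  rw [add_zero] at h3
  refine le_of_tendsto_of_tendsto ((h1.sub h2).norm.pow 2) h3 ?_
  filter_upwards [hN] with j hj
  have := step_holder (hA.scale_pos j) (supp_of_trunc hA.pos hj) y 0
  rwa [NNReal.coe_zero, sub_zero, abs_of_nonneg (NNReal.coe_nonneg y)] at this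

/-! ### Convergence in the `L*` norm -/

/-- The test functions `φ p` converge to `f`, with derivative `g`, in the `L*` norm. -/
structure StarLimit (η : ℝ≥0 → ℝ) (u : Fin r → Vec F r) (w : Fin r → EReal)
    (φ : ℕ → ℝ → Vec F r) (f g : ℝ → Vec F r) : Prop where
  cont : ContinuousOn f (Ici 0)
  meas : AEStronglyMeasurable g halfLine
  test : ∀ p, IsTest u w (φ p)
  tendsto : Tendsto (fun p => starNormSq η u w (fun x => φ p x - f x)
    fun x => deriv (φ p) x - g x) atTop (𝓝 0)

theorem MemLstar.exists_starLimit (h : MemLstar η u w f g) : ∃ φ, StarLimit η u w φ f g := by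
  obtain ⟨h1, h2, φ, h3, h4⟩ := h
  exact ⟨φ, h1, h2, h3, h4⟩

variable {φ : ℕ → ℝ → Vec F r}

theorem StarLimit.meas_fun (h : StarLimit η u w φ f g) : AEStronglyMeasurable f halfLine :=
  h.cont.aestronglyMeasurable measurableSet_Ici

theorem lintegral_le_starNormSq (hc : IsComparison η ζ) (f g : ℝ → Vec F r) :
    ∫⁻ x in ℝ₊, ‖f x‖ₑ ^ 2 ≤ starNormSq η u w f g ∧
      ∫⁻ x in ℝ₊, ‖g x‖ₑ ^ 2 ≤ starNormSq η u w f g := by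
  constructor <;> refine le_trans (lintegral_mono fun x => ?_) le_self_add
  · refine le_trans ?_ le_add_self
    refine le_mul_of_one_le_left' ?_
    rw [← ENNReal.ofReal_one]
    exact ENNReal.ofReal_le_ofReal (by linarith [hc.pos_eta x.toNNReal])
  · exact le_self_add

theorem StarLimit.tendsto_eLpNorm (hc : IsComparison η ζ) (h : StarLimit η u w φ f g) :
    Tendsto (fun p => eLpNorm (φ p - f) 2 halfLine) atTop (𝓝 0) ∧
      Tendsto (fun p => eLpNorm (deriv (φ p) - g) 2 halfLine) atTop (𝓝 0) := by
  have h0 := ((ENNReal.continuous_rpow_const (y := 1 / 2)).tendsto 0)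
  rw [ENNReal.zero_rpow_of_pos (by norm_num)] at h0
  simp only [eLpNorm_two_eq]
  exact ⟨h0.comp (tendsto_of_tendsto_of_tendsto_of_le_of_le tendsto_const_nhds h.tendsto
      (fun _ => zero_le) fun p => (lintegral_le_starNormSq hc _ _).1),
    h0.comp (tendsto_of_tendsto_of_tendsto_of_le_of_le tendsto_const_nhds h.tendsto
      (fun _ => zero_le) fun p => (lintegral_le_starNormSq hc _ _).2)⟩

theorem StarLimit.memLp (hc : IsComparison η ζ) (h : StarLimit η u w φ f g) :
    MemL2(f) ∧ MemL2(g) := by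
  obtain ⟨h1, h2⟩ := h.tendsto_eLpNorm hc
  obtain ⟨p, hp1, hp2⟩ := ((h1.eventually (gt_mem_nhds ENNReal.zero_lt_top)).and
    (h2.eventually (gt_mem_nhds ENNReal.zero_lt_top))).exists
  have e1 : MemL2(φ p - f) := ⟨(h.test p).memLp.1.sub h.meas_fun, hp1⟩
  have e2 : MemL2(deriv (φ p) - g) := ⟨(h.test p).memLp_deriv.1.sub h.meas, hp2⟩
  have e3 := (h.test p).memLp.sub e1
  have e4 := (h.test p).memLp_deriv.sub e2
  rw [sub_sub_cancel] at e3 e4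
  exact ⟨e3, e4⟩

theorem re_ip_comm (hf : MemL2(f)) (hg : MemL2(g)) : re (ip f g) = re (ip g f) := by
  rw [re_ip hf hg, re_ip hg hf]; simp only [real_inner_comm]

theorem re_ip_smul_right (hf : MemL2(f)) (hg : MemL2(g)) (μ : ℝ) :
    re (ip f (μ • g)) = μ * re (ip f g) := by
  rw [re_ip hf hg, re_ip hf (hg.const_smul μ), ← integral_const_mul]
  simp [real_inner_smul_right]

theorem tendsto_re_ip {h : ℝ → Vec F r} (hh : MemL2(h)) (hφ : ∀ p, MemL2(φ p))
    (hf : MemL2(f)) (hl : Tendsto (fun p => eLpNorm (φ p - f) 2 halfLine) atTop (𝓝 0)) :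
    Tendsto (fun p => re (ip h (φ p))) atTop (𝓝 (re (ip h f))) := by
  have e : ∀ {f₁ f₂ : ℝ → Vec F r} (h1 : MemL2(f₁)) (h2 : MemL2(f₂)),
      re (ip f₁ f₂) = ⟪h1.toLp, h2.toLp⟫ := fun h1 h2 => by
    rw [← re_ip_L2, ip_congr h1.coeFn_toLp h2.coeFn_toLp]
  simp only [e hh (hφ _), e hh hf]
  exact tendsto_const_nhds.inner ((Lp.tendsto_Lp_iff_tendsto_eLpNorm'' _ hφ _ hf).2 hl)

include hA hB in
/-- Convergence in the `L*` norm entails convergence at the boundary. -/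
theorem Approx.tendsto_boundary (h : StarLimit η u w φ f g) : Tendsto (fun p => φ p 0) atTop
    (𝓝 (f 0)) := by
  obtain ⟨hf, hg⟩ := h.memLp hA.cmp
  obtain ⟨D, hD⟩ : ∃ D, ∀ p, ∫ x in ℝ₊, ‖deriv (φ p) x‖ ^ 2 ≤ D := by
    have h1 := (Lp.tendsto_Lp_iff_tendsto_eLpNorm'' _ (fun p => (h.test p).memLp_deriv) _ hg).2
      (h.tendsto_eLpNorm hA.cmp).2
    obtain ⟨D, hD⟩ := (h1.norm.pow 2).bddAbove_range
    exact ⟨D, fun p => by rw [← norm_toLp_sq (h.test p).memLp_deriv]; exact hD ⟨p, rfl⟩⟩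
  rw [Metric.tendsto_nhds]
  intro ε hε
  have hD0 : 0 ≤ D := (integral_nonneg fun _ => by positivity).trans (hD 0)
  obtain ⟨δ₁, hδ₁, hfδ⟩ := Metric.continuousOn_iff.1 h.cont 0 self_mem_Ici (ε / 4) (by positivity)
  set δ : ℝ := min (δ₁ / 2) ((ε / 4) ^ 2 / (D + 1)) with hδdef
  have hδ : 0 < δ := by positivity
  have h2 : Tendsto (fun p => ∫⁻ x in ℝ₊, ‖φ p x - f x‖ₑ ^ 2) atTop (𝓝 0) :=
    tendsto_of_tendsto_of_tendsto_of_le_of_le tendsto_const_nhds h.tendsto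
      (fun _ => zero_le) fun p => (lintegral_le_starNormSq hA.cmp _ _).1
  have hpos : 0 < ofReal ((ε / 4) ^ 2) * ofReal δ := by
    rw [← ENNReal.ofReal_mul (by positivity)]
    exact ENNReal.ofReal_pos.2 (by positivity)
  filter_upwards [h2.eventually (gt_mem_nhds hpos)] with p hp
  -- somewhere in `[0, δ]` the function `φ p` is close to `f`
  obtain ⟨y, hy, hyf⟩ : ∃ y ∈ Icc (0 : ℝ) δ, ‖φ p y - f y‖ < ε / 4 := by
    by_contra! hcon
    refine absurd hp (not_lt.2 ?_)
    calc ofReal ((ε / 4) ^ 2) * ofReal δ =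
          ∫⁻ x in Icc (0 : ℝ) δ, ofReal ((ε / 4) ^ 2) := by
            rw [setLIntegral_const, Real.volume_Icc, sub_zero]
      _ ≤ ∫⁻ x in Icc (0 : ℝ) δ, ‖φ p x - f x‖ₑ ^ 2 := by
            refine setLIntegral_mono' measurableSet_Icc fun x hx => ?_
            rw [← ofReal_norm, ← ENNReal.ofReal_pow (norm_nonneg _)]
            refine ENNReal.ofReal_le_ofReal ?_
            have := hcon x hx
            gcongr
      _ ≤ _ := lintegral_mono_set fun x hx => hx.1
  have h3 : ‖φ p y - φ p 0‖ ≤ ε / 4 := by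
    have := hA.norm_sub_sq_le hB (h.test p) y.toNNReal
    rw [Real.coe_toNNReal y hy.1] at this
    refine abs_le_of_sq_le_sq' (this.trans ?_) (by positivity) |>.2
    calc y * _ ≤ δ * D := by
          have := hD p
          exact mul_le_mul hy.2 this (integral_nonneg fun _ => by positivity) hδ.le
      _ ≤ (ε / 4) ^ 2 / (D + 1) * D := by gcongr; exact min_le_right _ _
      _ ≤ (ε / 4) ^ 2 := by
          rw [div_mul_eq_mul_div, div_le_iff₀ (by positivity)]
          nlinarith [sq_nonneg (ε / 4)]
  have h4 : dist (f y) (f 0) < ε / 4 := hfδ y hy.1 (by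
    rw [Real.dist_eq, sub_zero, abs_of_nonneg hy.1]
    have := min_le_left (δ₁ / 2) ((ε / 4) ^ 2 / (D + 1))
    linarith [hy.2])
  calc dist (φ p 0) (f 0) ≤ dist (φ p 0) (φ p y) + dist (φ p y) (f y) + dist (f y) (f 0) :=
        dist_triangle4 _ _ _ _
    _ < ε := by
        rw [dist_eq_norm (φ p 0), norm_sub_rev, dist_eq_norm (φ p y)]
        linarith

include hA hB in
set_option maxHeartbeats 1000000 in
theorem Approx.tendsto_form (h : StarLimit η u w φ f g) {ψ : ℝ → Vec F r} (hψ : IsTest u w ψ) :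
    Tendsto (fun p => re (form Y u w ψ (φ p) (deriv (φ p)))) atTop (𝓝 (re (form Y u w ψ f g))) := by
  obtain ⟨hf, hg⟩ := h.memLp hA.cmp
  obtain ⟨l1, l2⟩ := h.tendsto_eLpNorm hA.cmp
  obtain ⟨h1, h2⟩ := hψ.memLp_act hA.cont
  simp only [form_eq, map_add, map_sub, map_sum]
  refine (((tendsto_re_ip hψ.memLp_deriv (fun p => (h.test p).memLp_deriv) hg l2).sub
    (tendsto_re_ip h2 (fun p => (h.test p).memLp) hf l1)).sub
    (tendsto_re_ip h1 (fun p => (h.test p).memLp_deriv) hg l2)).add ?_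
  refine tendsto_finsetSum _ fun i _ => ?_
  have hre : Continuous (re : F →ₗ[ℝ] ℝ) := LinearMap.continuous_of_finiteDimensional _
  have hb := hA.tendsto_boundary hB h
  have hd : Tendsto (fun p => dag (u i) (φ p 0)) atTop (𝓝 (dag (u i) (f 0))) :=
    (continuous_dag.tendsto (u i, f 0)).comp (tendsto_const_nhds.prodMk_nhds hb)
  exact (hre.tendsto _).comp ((hd.const_mul _).const_smul _)

theorem StarLimit.fcomb {ι : Type*} [Fintype ι] (hη : Continuous η)
    {φ : ι → ℕ → ℝ → Vec F r} {f g : ι → ℝ → Vec F r}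
    (h : ∀ i, StarLimit η u w (φ i) (f i) (g i)) (c : ι → F) :
    StarLimit η u w (fun p => BlockTridiagonal.fcomb (fun i => φ i p) c)
      (BlockTridiagonal.fcomb f c) (BlockTridiagonal.fcomb g c) := by
  refine ⟨continuousOn_finsetSum _ fun i _ => (h i).cont.const_smul (op (c i)), ?_,
    fun p => IsTest.fcomb (fun i => (h i).test p) c, ?_⟩
  · exact Finset.aestronglyMeasurable_fun_sum _ fun i _ => (h i).meas.const_smul (op (c i))
  · have h0 : Tendsto (fun p => ofReal (∑ i, ‖c i‖ ^ 2) *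
        ∑ i, starNormSq η u w (fun x => φ i p x - f i x) fun x => deriv (φ i p) x - g i x)
        atTop (𝓝 0) := by
      have := ENNReal.Tendsto.const_mul (a := ofReal (∑ i, ‖c i‖ ^ 2))
        (tendsto_finsetSum Finset.univ fun i _ => (h i).tendsto) (Or.inr ENNReal.ofReal_ne_top)
      simpa using this
    refine tendsto_of_tendsto_of_tendsto_of_le_of_le tendsto_const_nhds h0 (fun _ => zero_le)
      fun p => ?_
    refine le_of_eq_of_le ?_ (starNormSq_fcomb_le hη u w
      (f := fun i x => φ i p x - f i x) (g := fun i x => deriv (φ i p) x - g i x)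
      (fun i => ((h i).test p).memLp.1.sub (h i).meas_fun)
      (fun i => ((h i).test p).memLp_deriv.1.sub (h i).meas) c)
    rw [IsTest.deriv_fcomb fun i => (h i).test p]
    congr 1 <;> ext1 y <;>
      simp only [BlockTridiagonal.fcomb, smul_sub, sum_sub_distrib]

theorem tendsto_of_double_limit {Q ℓ : ℕ → ℝ} {B : ℕ → ℕ → ℝ} {L : ℝ}
    (hQ : ∀ ε > 0, ∃ P, ∀ p q, P ≤ p → P ≤ q → |Q p + Q q - 2 * B p q| ≤ ε)
    (hB : ∀ p, Tendsto (B p) atTop (𝓝 (ℓ p))) (hℓ : Tendsto ℓ atTop (𝓝 L)) :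
    Tendsto Q atTop (𝓝 L) := by
  rw [Metric.tendsto_atTop]
  intro ε hε
  obtain ⟨P, hP⟩ := hQ (ε / 10) (by positivity)
  obtain ⟨P', hP'⟩ := Metric.tendsto_atTop.1 hℓ (ε / 10) (by positivity)
  have key : ∀ p, P ≤ p → ∃ q₀, ∀ q ≥ q₀, |Q p + Q q - 2 * ℓ p| ≤ 3 * (ε / 10) := by
    intro p hp
    obtain ⟨q₀, hq₀⟩ := Metric.tendsto_atTop.1 (hB p) (ε / 10) (by positivity)
    refine ⟨max q₀ P, fun q hq => ?_⟩
    have h1 := abs_le.1 (hP p q hp ((le_max_right _ _).trans hq))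
    have h2 := abs_lt.1 (hq₀ q ((le_max_left _ _).trans hq))
    rw [abs_le]; constructor <;> linarith
  obtain ⟨q₀, hq₀⟩ := key P le_rfl
  set p := max (max P P') q₀ with hp
  obtain ⟨q₁, hq₁⟩ := key p ((le_max_left _ _).trans (le_max_left _ _))
  refine ⟨max q₀ q₁, fun q hq => ?_⟩
  have h1 := abs_le.1 (hq₁ q ((le_max_right _ _).trans hq))
  have h2 := abs_le.1 (hq₀ q ((le_max_left _ _).trans hq))
  have h3 := abs_le.1 (hq₀ p (le_max_right _ _))
  have h4 := abs_lt.1 (hP' p ((le_max_right _ _).trans (le_max_left _ _)))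
  rw [Real.dist_eq, abs_lt]
  constructor <;> linarith

include hA hB in
/-- The form of the approximants converges, when the limit satisfies a weak equation. -/
theorem Approx.tendsto_form_self (h : StarLimit η u w φ f g) {k : ℝ → Vec F r} (hk : MemL2(k))
    (heq : ∀ ψ, IsTest u w ψ → re (form Y u w ψ f g) = re (ip ψ k)) :
    Tendsto (fun p => re (form Y u w (φ p) (φ p) (deriv (φ p)))) atTop (𝓝 (re (ip f k))) := by
  obtain ⟨K, hK0, hK⟩ := hA.exists_form_bound hB
  obtain ⟨hf, hg⟩ := h.memLp hA.cmp
  refine tendsto_of_double_limit (B := fun p q => re (form Y u w (φ p) (φ q) (deriv (φ q))))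
    (ℓ := fun p => re (ip (φ p) k)) (fun ε hε => ?_) (fun p => ?_) ?_
  · set N : ℕ → ℝ≥0∞ := fun p => starNormSq η u w (fun x => φ p x - f x)
      fun x => deriv (φ p) x - g x with hN
    have hδ : (0 : ℝ≥0∞) < ofReal (ε / (4 * (K + 1))) := ENNReal.ofReal_pos.2 (by positivity)
    obtain ⟨P, hP⟩ := eventually_atTop.1 (h.tendsto.eventually (gt_mem_nhds hδ))
    refine ⟨P, fun p q hp hq => ?_⟩
    set χ : Fin 2 → ℝ → Vec F r := ![φ p, φ q] with hχ
    have hχt : ∀ i, IsTest u w (χ i) := Fin.forall_fin_two.2 ⟨h.test p, h.test q⟩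
    have e1 : re (form Y u w (fcomb χ ![1, -1]) (fcomb χ ![1, -1]) (deriv (fcomb χ ![1, -1]))) =
        re (form Y u w (φ p) (φ p) (deriv (φ p))) + re (form Y u w (φ q) (φ q) (deriv (φ q))) -
          2 * re (form Y u w (φ p) (φ q) (deriv (φ q))) := by
      rw [form_fcomb hA.cont hχt]
      have := hA.re_form_symm hB (h.test p) (h.test q)
      simp only [Fin.sum_univ_two, hχ, Matrix.cons_val_zero, Matrix.cons_val_one, star_one,
        star_neg, one_mul, mul_one, neg_mul, mul_neg, map_add, map_neg, ← this]
      ring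
    rw [← e1]
    refine (hK _ (IsTest.fcomb hχt _)).trans ?_
    have e2 : starNormSq η u w (fcomb χ ![1, -1]) (deriv (fcomb χ ![1, -1])) ≤
        ofReal 2 * (N p + N q) := by
      have := starNormSq_fcomb_le hA.cmp.cont_eta u w
        (f := ![fun x => φ p x - f x, fun x => φ q x - f x])
        (g := ![fun x => deriv (φ p) x - g x, fun x => deriv (φ q) x - g x])
        (Fin.forall_fin_two.2 ⟨(h.test p).memLp.1.sub h.meas_fun,
          (h.test q).memLp.1.sub h.meas_fun⟩)
        (Fin.forall_fin_two.2 ⟨(h.test p).memLp_deriv.1.sub h.meas,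
          (h.test q).memLp_deriv.1.sub h.meas⟩) ![(1 : F), -1]
      simp only [Fin.sum_univ_two, Matrix.cons_val_zero, Matrix.cons_val_one, norm_neg, norm_one,
        one_pow, one_add_one_eq_two] at this
      refine le_of_eq_of_le ?_ this
      rw [IsTest.deriv_fcomb hχt]
      congr 1 <;> ext1 y <;> simp [fcomb, Fin.sum_univ_two, hχ, ← sub_eq_add_neg]
    have e3 : ofReal 2 * (N p + N q) ≤ ofReal (2 * (ε / (4 * (K + 1)) + ε / (4 * (K + 1)))) := by
      rw [ENNReal.ofReal_mul zero_le_two, ENNReal.ofReal_add (by positivity) (by positivity)]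
      exact mul_le_mul_right (add_le_add (hP p hp).le (hP q hq).le) _
    have e4 := ENNReal.toReal_le_of_le_ofReal (by positivity) (e2.trans e3)
    calc _ ≤ K * (2 * (ε / (4 * (K + 1)) + ε / (4 * (K + 1)))) := by gcongr
      _ = ε * (K / (K + 1)) := by field_simp; ring
      _ ≤ ε * 1 := by
          gcongr
          rw [div_le_one (by positivity)]; linarith
      _ = ε := mul_one ε
  · have := hA.tendsto_form hB h (h.test p)
    rwa [heq _ (h.test p)] at this
  · simp only [re_ip_comm (h.test _).memLp hk, re_ip_comm hf hk]
    exact tendsto_re_ip hk (fun p => (h.test p).memLp) hf (h.tendsto_eLpNorm hA.cmp).1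

end Recovery

/-! ### Convergence of the ordered eigenvalues -/

section Convergence

theorem norm_eq_one_of_ip {V : L2 F r} (h : ip V V = 1) : ‖V‖ = 1 := by
  rw [ip_self, ← map_one (algebraMap ℝ F)] at h
  exact (pow_eq_one_iff_of_nonneg (norm_nonneg _) two_ne_zero).1 ((algebraMap ℝ F).injective h)

theorem norm_ip_le (V V' : L2 F r) : ‖ip V V'‖ ≤ ‖V‖ * ‖V'‖ := by
  have h1 := integral_mul_norm_le_Lp_mul_Lq (μ := halfLine) (f := fun x => (V x : Vec F r))
    (g := fun x => (V' x : Vec F r)) Real.HolderConjugate.two_two (by simpa using Lp.memLp V)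
    (by simpa using Lp.memLp V')
  simp only [Real.rpow_ofNat, ← Real.sqrt_eq_rpow] at h1
  have e : ∀ U : L2 F r, √(∫ x, ‖U x‖ ^ 2 ∂halfLine) = ‖U‖ := fun U => by
    rw [← norm_LE_sq U, Real.sqrt_sq (norm_nonneg _)]
  rw [e, e] at h1
  refine le_trans ?_ h1
  refine (norm_integral_le_integral_norm _).trans ?_
  refine integral_mono_of_nonneg (.of_forall fun _ => norm_nonneg _) ?_
    (.of_forall fun y => norm_dag_le _ _)
  exact (Lp.memLp V).norm.integrable_mul (Lp.memLp V').norm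

theorem ip_sub_sub (V V' W W' : L2 F r) :
    ip V W - ip V' W' = ip (V - V' : L2 F r) W + ip V' (W - W' : L2 F r) := by
  have i : ∀ U U' : L2 F r, Integrable (fun x => dag (U x) (U' x)) halfLine := fun U U' =>
    integrable_dag (Lp.memLp U) (Lp.memLp U')
  simp only [ip]
  rw [← integral_sub (i _ _) (i _ _), ← integral_add (i _ _) (i _ _)]
  refine integral_congr_ae ?_
  filter_upwards [Lp.coeFn_sub V V', Lp.coeFn_sub W W'] with y h1 h2
  rw [h1, h2, Pi.sub_apply, Pi.sub_apply, dag_sub_left, dag_sub_right]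
  abel

theorem tendsto_ip {α : Type*} {l : Filter α} {V W : α → L2 F r} {V₀ W₀ : L2 F r}
    (hV : Tendsto V l (𝓝 V₀)) (hW : Tendsto W l (𝓝 W₀)) :
    Tendsto (fun j => ip (V j) (W j)) l (𝓝 (ip V₀ W₀)) := by
  rw [tendsto_iff_norm_sub_tendsto_zero] at hV ⊢
  have hW' := tendsto_iff_norm_sub_tendsto_zero.1 hW
  have h : Tendsto (fun j => ‖V j - V₀‖ * ‖W j‖ + ‖V₀‖ * ‖W j - W₀‖) l (𝓝 0) := by
    simpa using (hV.mul hW.norm).add (hW'.const_mul ‖V₀‖)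
  refine squeeze_zero (fun _ => norm_nonneg _) (fun j => ?_) h
  rw [ip_sub_sub]
  exact (norm_add_le _ _).trans (add_le_add (norm_ip_le _ _) (norm_ip_le _ _))

/-- The real bilinear form `re ∑ c̄ᵢ Gᵢₗ c'ₗ` of a matrix of scalars. -/
def gramForm {ι : Type*} [Fintype ι] (G : ι → ι → F) : (ι → F) →ₗ[ℝ] (ι → F) →ₗ[ℝ] ℝ :=
  LinearMap.mk₂ ℝ (fun c c' => re (∑ i, star (c i) * ∑ l, G i l * c' l))
    (fun c d c' => by simp [add_mul, sum_add_distrib])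
    (fun t c c' => by
      simp only [Pi.smul_apply, (isRealPart_re (F := F)).star_smul, smul_mul_assoc,
        ← smul_sum, map_smul])
    (fun c c' d' => by simp [mul_add, sum_add_distrib])
    (fun t c c' => by simp only [Pi.smul_apply, mul_smul_comm, ← smul_sum, map_smul])

theorem gramForm_apply {ι : Type*} [Fintype ι] (G : ι → ι → F) (c c' : ι → F) :
    gramForm G c c' = re (∑ i, star (c i) * ∑ l, G i l * c' l) := rfl

theorem ip_fcomb {ι : Type*} [Fintype ι] {f : ι → ℝ → Vec F r} (hf : ∀ i, MemL2(f i))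
    (c d : ι → F) : ip (fcomb f c) (fcomb f d) = ∑ i, star (c i) * ∑ l, ip (f i) (f l) * d l := by
  rw [ip_fcomb_left hf (MemLp.fcomb hf d)]
  simp only [fun i => ip_fcomb_right (hf i) hf d]

theorem integral_norm_sq_eq (hf : MemL2(f)) : ∫ x in ℝ₊, ‖f x‖ ^ 2 = re (ip f f) := by
  rw [re_ip hf hf]; simp only [real_inner_self_eq_norm_sq]

include hA hB in
/-- Test functions whose Rayleigh quotients are below any bound that exceeds the given
eigenvalues. -/
theorem Approx.exists_test_family {ι : Type*} [Fintype ι]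
    [DecidableEq ι] {μ : ι → ℝ} {V : ι → L2 F r}
    (hort : ∀ i j, ip (V i) (V j) = if i = j then 1 else 0)
    (hE : ∀ i, IsContinuumEigen η Y u w (μ i) (V i)) {a : ℝ} (hμ : ∀ i, μ i < a) :
    ∃ ψ : ι → ℝ → Vec F r, (∀ i, IsTest u w (ψ i)) ∧ ∀ c : ι → F, c ≠ 0 →
      re (form Y u w (fcomb ψ c) (fcomb ψ c) (deriv (fcomb ψ c))) -
        a * ∫ x in ℝ₊, ‖fcomb ψ c x‖ ^ 2 < 0 := by
  choose f g hfg hVf heq using fun i => (hE i).2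
  choose φ hφ using fun i => (hfg i).exists_starLimit
  have hf : ∀ i, MemL2(f i) := fun i => ((hφ i).memLp hA.cmp).1
  have hg : ∀ i, MemL2(g i) := fun i => ((hφ i).memLp hA.cmp).2
  have hip : ∀ i j, ip (f i) (f j) = if i = j then 1 else 0 := fun i j => by
    rw [← hort i j, ip_congr (hVf i) (hVf j)]
  have hnorm : ∀ c : ι → F, re (ip (fcomb f c) (fcomb f c)) = ∑ i, ‖c i‖ ^ 2 := fun c => by
    rw [ip_fcomb hf]
    simp only [hip, ite_mul, one_mul, zero_mul, Finset.sum_ite_eq, Finset.mem_univ, if_true,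
      map_sum, re_star_mul_self]
  have hlim : ∀ c : ι → F, Tendsto (fun p => re (form Y u w (fcomb (fun i => φ i p) c)
      (fcomb (fun i => φ i p) c) (deriv (fcomb (fun i => φ i p) c))) -
      a * ∫ x in ℝ₊, ‖fcomb (fun i => φ i p) c x‖ ^ 2) atTop
      (𝓝 (∑ i, (μ i - a) * ‖c i‖ ^ 2)) := by
    intro c
    have hS := StarLimit.fcomb hA.cmp.cont_eta hφ c
    have h1 := hA.tendsto_form_self hB hS (k := fcomb f fun i => μ i • c i)
      (MemLp.fcomb hf _) fun ψ hψ => by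
        rw [form_fcomb_right hA.cont hψ hf hg, ip_fcomb_right hψ.memLp hf]
        simp only [heq _ ψ hψ, smul_mul_assoc, mul_smul_comm]
    have h2 : Tendsto (fun p => ∫ x in ℝ₊, ‖fcomb (fun i => φ i p) c x‖ ^ 2) atTop
        (𝓝 (∫ x in ℝ₊, ‖fcomb f c x‖ ^ 2)) := by
      have h3 := (Lp.tendsto_Lp_iff_tendsto_eLpNorm'' _ (fun p => (hS.test p).memLp) _
        (MemLp.fcomb hf c)).2 (hS.tendsto_eLpNorm hA.cmp).1
      simp only [← norm_toLp_sq (hS.test _).memLp, ← norm_toLp_sq (MemLp.fcomb hf c)]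
      exact h3.norm.pow 2
    have h4 : re (ip (fcomb f c) (fcomb f fun i => μ i • c i)) = ∑ i, μ i * ‖c i‖ ^ 2 := by
      rw [ip_fcomb hf]
      simp only [hip, ite_mul, one_mul, zero_mul, Finset.sum_ite_eq, Finset.mem_univ, if_true]
      simp only [map_sum, mul_smul_comm, map_smul, re_star_mul_self, smul_eq_mul]
    rw [h4] at h1
    rw [integral_norm_sq_eq (MemLp.fcomb hf c), hnorm] at h2
    convert h1.sub (h2.const_mul a) using 2
    rw [mul_sum, ← sum_sub_distrib]
    exact sum_congr rfl fun i _ => by ring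
  have key := eventually_neg_of_tendsto
    (B := fun p => gramForm fun i l => form Y u w (φ i p) (φ l p) (deriv (φ l p)) -
      a • ip (φ i p) (φ l p)) (fun p c => ?_) hlim fun c hc0 => ?_
  · obtain ⟨p, hp⟩ := key.exists
    exact ⟨fun i => φ i p, fun i => (hφ i).test p, hp⟩
  · rw [form_fcomb hA.cont fun i => (hφ i).test p, integral_norm_sq_eq
      (MemLp.fcomb (fun i => ((hφ i).test p).memLp) c), ip_fcomb fun i => ((hφ i).test p).memLp,
      gramForm_apply]
    simp only [sub_mul, mul_sub, sum_sub_distrib, smul_mul_assoc, ← smul_sum,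
      mul_smul_comm, map_sub, map_smul, smul_eq_mul]
  · obtain ⟨i, hi⟩ : ∃ i, c i ≠ 0 := by
      by_contra! h; exact hc0 (funext h)
    refine Finset.sum_neg' (fun i _ => ?_) ⟨i, Finset.mem_univ i, ?_⟩
    · exact mul_nonpos_of_nonpos_of_nonneg (by linarith [hμ i]) (sq_nonneg _)
    · have : 0 < ‖c i‖ := norm_pos_iff.2 hi
      exact mul_neg_of_neg_of_pos (by linarith [hμ i]) (by positivity)

include hA in
theorem Approx.eventually_lt (k : ℕ) : ∀ᶠ j in atTop, k < n j := by
  filter_upwards [hA.ratio.eventually (eventually_gt_atTop (k : ℝ))] with j hj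
  have hm := hA.one_le j
  have hm0 : 0 < m j := by linarith
  rw [lt_div_iff₀ hm0] at hj
  have : (k : ℝ) < n j := lt_of_le_of_lt (by nlinarith [show (0 : ℝ) ≤ k by positivity]) hj
  exact_mod_cast this

include hA hB in
set_option maxHeartbeats 1000000 in
/-- The upper bound for the discrete eigenvalues by those of the continuum problem. -/
theorem Approx.eventually_discreteEig_le {k : ℕ} {a a' : ℝ}
    (ha : a ∈ eigLevels (IsContinuumEigen η Y u w) k) (haa : a < a') :
    ∀ᶠ j in atTop, ev(k, j) ≤ a' := by
  obtain ⟨μ, V, hort, hE⟩ := ha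
  obtain ⟨ψ, hψ, hneg⟩ := hA.exists_test_family hB hort (fun i => (hE i).1)
    (fun i => (hE i).2.trans_lt haa)
  have hm0 := hA.scale_pos
  set v : ℕ → Fin (k + 1) → ℕ → Vec F r := fun j i => dt(j, ψ i) with hv
  have hvc : ∀ j (c : Fin (k + 1) → F), (fun l => ∑ i, op (c i) • v j i l) =
      dt(j, fcomb ψ c) := fun j c => by
    ext1 l
    simp only [hv, discretize, fcomb, map_sum, rot_op]
  have htr : ∀ᶠ j in atTop, ∀ i, trunc (n j) (v j i) = v j i := by
    rw [eventually_all]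
    intro i
    obtain ⟨_, _, -, h⟩ := hA.exists_test hB (hψ i)
    exact h
  set e : ∀ j, Fin (k + 1) → Vec F (n j) := fun j i => ofSites hA.pos (n j) (v j i)
  set T : ∀ j, Vec F (n j) →ₗ[ℝ] Vec F (n j) := fun j =>
    hOp (m j) (Y₁ j) (Y₂ j) (specMat (u' j) (x j)) hA.pos (n j) with hT
  set q : ℕ → (Fin (k + 1) → F) → ℝ := fun j c =>
    (m j)⁻¹ * ⟪comb (e j) c, T j (comb (e j) c)⟫ - a' * ((m j)⁻¹ * ‖comb (e j) c‖ ^ 2) with hq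
  have hcomb : ∀ j, (∀ i, trunc (n j) (v j i) = v j i) → ∀ c : Fin (k + 1) → F,
      toSites r (comb (e j) c) = dt(j, fcomb ψ c) := by
    intro j hj c
    rw [toSites_comb_ofSites hA.pos hj, hvc]
  have hqe : ∀ j, (∀ i, trunc (n j) (v j i) = v j i) → ∀ c : Fin (k + 1) → F, q j c =
      dform (n j) (m j) (Y₁ j) (Y₂ j) (u' j) (x j) dt(j, fcomb ψ c) dt(j, fcomb ψ c) -
      a' * mass (m j) (sites r (n j)) dt(j, fcomb ψ c) := by
    intro j hj c
    simp only [hq, hT]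
    rw [inner_hOp _ (hm0 j), ← norm_stepL_toSites (hm0 j) hA.pos, norm_stepL_sq (hm0 j)
      (supp_of_trunc hA.pos (trunc_toSites _)), hcomb j hj, inv_mul_cancel_left₀ (hm0 j).ne']
  have key := eventually_neg_of_tendsto (q := q)
    (B := fun j => LinearMap.mk₂ ℝ (fun c d => (m j)⁻¹ * ⟪comb (e j) c, T j (comb (e j) d)⟫ -
      a' * ((m j)⁻¹ * ⟪comb (e j) c, comb (e j) d⟫))
      (fun c c' d => by simp only [map_add, inner_add_left]; ring)
      (fun t c d => by simp only [map_smul, real_inner_smul_left, smul_eq_mul]; ring)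
      (fun c d d' => by simp only [map_add, inner_add_right]; ring)
      (fun t c d => by simp only [map_smul, real_inner_smul_right, smul_eq_mul]; ring))
    (fun j c => by simp only [hq, LinearMap.mk₂_apply, real_inner_self_eq_norm_sq])
    (fun c => by
      have hψc := IsTest.fcomb hψ c
      refine ((hA.tendsto_dform hB hψc hψc).sub ((hA.tendsto_mass hB hψc).const_mul a')).congr' ?_
      filter_upwards [htr] with j hj
      exact (hqe j hj c).symm) hneg
  filter_upwards [key, hA.eventually_lt k] with j hj hk
  refine discreteEig_le_of_comb (Y₂ j) (hm0 j) hA.pos (hA.good j).2.2.1 (u' j) (x j) hk (v := e j)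
    (fun c hc0 h0 => ?_) fun c => ?_
  · simpa [hq, h0] using hj c hc0
  · rcases eq_or_ne c 0 with rfl | hc0
    · simp
    · have h1 := hj c hc0
      simp only [hq] at h1
      rw [mul_left_comm, ← mul_sub] at h1
      linarith [neg_of_mul_neg_right h1 (inv_pos.2 (hm0 j)).le]

theorem exists_common_subseq {N : ℕ} {P : Fin N → (ℕ → ℕ) → Prop}
    (hsub : ∀ i (t s : ℕ → ℕ), P i t → StrictMono s → P i (t ∘ s))
    (hex : ∀ i (s : ℕ → ℕ), StrictMono s → ∃ t, StrictMono t ∧ P i (s ∘ t)) :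
    ∃ t : ℕ → ℕ, StrictMono t ∧ ∀ i, P i t := by
  induction N with
  | zero => exact ⟨id, strictMono_id, fun i => i.elim0⟩
  | succ N ih =>
    obtain ⟨t, ht, hP⟩ := ih (P := fun i => P i.castSucc) (fun i => hsub _) fun i => hex _
    obtain ⟨s, hs, hP'⟩ := hex (Fin.last N) t ht
    refine ⟨t ∘ s, ht.comp hs, fun i => ?_⟩
    refine Fin.lastCases hP' (fun i => hsub _ _ _ (hP i) hs) i

include hA hB in
/-- Along a subsequence, the lowest discrete eigenvalues, with orthonormal eigenvectors, converge to
eigenvalues of the continuum problem, with orthonormal eigenfunctions. -/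
theorem Approx.exists_subseq_family (k : ℕ) :
    ∃ (t : ℕ → ℕ) (V : ℕ → Fin (k + 1) → L2 F r) (l₀ : Fin (k + 1) → ℝ)
      (V₀ : Fin (k + 1) → L2 F r), StrictMono t ∧
      (∀ j (i : Fin (k + 1)), IsUnitEigen (n (t j)) (m (t j)) (Y₁ (t j)) (Y₂ (t j))
        (specMat (u' (t j)) (x (t j)))
        i (V j i)) ∧
      (∀ i, Tendsto (fun j => V j i) atTop (𝓝 (V₀ i))) ∧
      (∀ i j, ip (V₀ i) (V₀ j) = if i = j then 1 else 0) ∧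
      ∀ i, IsContinuumEigen η Y u w (l₀ i) (V₀ i) ∧ l₀ i ≤ l₀ (Fin.last k) ∧
        Tendsto (fun j => ev(i, t j)) atTop (𝓝 (l₀ i)) := by
  obtain ⟨Λ, ρ, hΛ⟩ := exists_discreteEig_bound (F := F) hA.pos hA.cmp hA.le_C k
  have hm0 := hA.scale_pos
  obtain ⟨J, hJ⟩ := eventually_atTop.1 ((hA.eventually_lt k).and
    ((hA.scale.eventually (eventually_ge_atTop ρ)).and
      (hA.ratio.eventually (eventually_ge_atTop ρ))))
  set s : ℕ → ℕ := fun j => j + J with hs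
  have hsm : StrictMono s := strictMono_id.add_const J
  have hle : ∀ j, ev(k, s j) ≤ Λ := fun j => by
    obtain ⟨-, h2, h3⟩ := hJ (s j) (by simp only [hs]; omega)
    rw [le_div_iff₀ (hm0 _)] at h3
    exact hΛ _ _ _ _ (hA.good _) h2 h3 _ _ (hB.ortho _)
  choose V hort hV using fun j => exists_eigenvectors (n := n (s j)) (Y₂ (s j)) (hm0 (s j)) hA.pos
    (hA.good (s j)).2.2.1 (u' (s j)) (x (s j)) (hJ (s j) (by simp only [hs]; omega)).1
  have hV1 : ∀ j i, ‖V j i‖ = 1 := fun j i => norm_eq_one_of_ip ((hort j i i).trans (if_pos rfl))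
  set l : Fin (k + 1) → ℕ → ℝ := fun i j => ev(i, s j) with hl
  obtain ⟨t, ht, hP⟩ := exists_common_subseq (N := k + 1)
    (P := fun i t => ∃ l₀ V₀, Tendsto (fun j => l i (t j)) atTop (𝓝 l₀) ∧
      Tendsto (fun j => V (t j) i) atTop (𝓝 V₀) ∧ IsContinuumEigen η Y u w l₀ V₀)
    (fun i t s => by
      rintro ⟨l₀, V₀, h1, h2, h3⟩ hs
      exact ⟨l₀, V₀, h1.comp hs.tendsto_atTop, h2.comp hs.tendsto_atTop, h3⟩)
    (fun i t ht => by
      have hst := hsm.comp ht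
      obtain ⟨t', l₀, V₀, ht', h1, h2, -, h3⟩ := (hA.comp hst).exists_eigen_limit
        (hB.comp hst) (Λ := Λ) (l := fun j => l i (t j)) (fun j => ((hV _ i).2).trans (hle _))
        (V := fun j => V (t j) i) (fun j => hV1 _ _) fun j => (hV _ i).1
      exact ⟨t', ht', l₀, V₀, h1, h2, h3⟩)
  choose l₀ V₀ h1 h2 h3 using hP
  refine ⟨s ∘ t, fun j => V (t j), l₀, V₀, hsm.comp ht, fun j i => ⟨hV1 _ i, (hV _ i).1⟩, h2,
    fun i j => ?_, fun i => ⟨h3 i, ?_, h1 i⟩⟩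
  · refine tendsto_nhds_unique (tendsto_ip (h2 i) (h2 j)) ?_
    simp only [hort]; exact tendsto_const_nhds
  · refine le_of_tendsto_of_tendsto' (h1 i) (h1 (Fin.last k)) fun j => ?_
    simpa only [hl, Fin.val_last] using (hV (t j) i).2

include hA hB in
/-- The limit eigenvalues are well defined, and the discrete eigenvalues converge to them. -/
theorem Approx.isLeast (k : ℕ) :
    IsLeast (eigLevels (IsContinuumEigen η Y u w) k) (continuumEig η Y u w k) ∧
      Tendsto (fun j => ev(k, j)) atTop (𝓝 (continuumEig η Y u w k)) := by
  have key : ∀ s : ℕ → ℕ, StrictMono s → ∃ t : ℕ → ℕ, StrictMono t ∧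
      IsLeast (eigLevels (IsContinuumEigen η Y u w) k) (continuumEig η Y u w k) ∧
      Tendsto (fun j => ev(k, s (t j))) atTop (𝓝 (continuumEig η Y u w k)) := by
    intro s hs
    obtain ⟨t, V, l₀, V₀, ht, -, -, hort, hl⟩ := (hA.comp hs).exists_subseq_family (hB.comp hs) k
    have hlim := (hl (Fin.last k)).2.2
    have hleast : IsLeast (eigLevels (IsContinuumEigen η Y u w) k) (l₀ (Fin.last k)) := by
      refine ⟨⟨l₀, V₀, hort, fun i => ⟨(hl i).1, (hl i).2.1⟩⟩,
        fun a' ha' => le_of_forall_pos_le_add fun ε hε => ?_⟩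
      exact le_of_tendsto hlim (((hs.comp ht).tendsto_atTop).eventually
        (hA.eventually_discreteEig_le hB ha' (lt_add_of_pos_right a' hε)))
    have e : continuumEig η Y u w k = l₀ (Fin.last k) := hleast.csInf_eq
    rw [e]
    exact ⟨t, ht, hleast, hlim⟩
  refine ⟨(key id strictMono_id).choose_spec.2.1, tendsto_of_subseq_tendsto fun s hs => ?_⟩
  obtain ⟨s', hs', hss⟩ := strictMono_subseq_of_tendsto_atTop hs
  obtain ⟨t, ht, -, h⟩ := key (s ∘ s') hss
  exact ⟨s' ∘ t, h⟩

include hA hB in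
/-- The ordered eigenvalues and their eigenvectors converge along a subsequence, all at once. -/
theorem Approx.exists_family_limit {N : ℕ} {k : Fin N → ℕ} {V : ℕ → Fin N → L2 F r}
    (hV : ∀ j i, IsUnitEigen (n j) (m j) (Y₁ j) (Y₂ j) (specMat (u' j) (x j)) (k i) (V j i)) :
    ∃ (t : ℕ → ℕ) (V₀ : Fin N → L2 F r), StrictMono t ∧ ∀ i,
      Tendsto (fun j => V (t j) i) atTop (𝓝 (V₀ i)) ∧ ‖V₀ i‖ = 1 ∧
      IsContinuumEigen η Y u w (continuumEig η Y u w (k i)) (V₀ i) := by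
  obtain ⟨t, ht, hP⟩ := exists_common_subseq (N := N)
    (P := fun i t => ∃ V₀, Tendsto (fun j => V (t j) i) atTop (𝓝 V₀) ∧ ‖V₀‖ = 1 ∧
      IsContinuumEigen η Y u w (continuumEig η Y u w (k i)) V₀)
    (fun i t s ⟨V₀, h1, h2⟩ hs => ⟨V₀, h1.comp hs.tendsto_atTop, h2⟩)
    (fun i s hs => by
      have hlim := ((hA.comp hs).isLeast (hB.comp hs) (k i)).2
      obtain ⟨Λ, hΛ⟩ := hlim.bddAbove_range
      obtain ⟨t, l₀, V₀, ht, h1, h2, h3, h4⟩ := (hA.comp hs).exists_eigen_limit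
        (hB.comp hs) (V := fun j => V (s j) i) (fun j => hΛ ⟨j, rfl⟩) (fun j => (hV _ i).1)
        fun j => (hV _ i).2
      have := tendsto_nhds_unique h1 (hlim.comp ht.tendsto_atTop)
      subst this
      exact ⟨t, ht, V₀, h2, h3, h4⟩)
  choose V₀ h using hP
  exact ⟨t, V₀, ht, h⟩

end Convergence

/-! ### Eigenspaces of the continuum operator -/

section Eigenspaces

variable {ι : Type*} [Fintype ι]

theorem ip_sum_right (W : L2 F r) (V : ι → L2 F r) (c : ι → F) :
    ip W (∑ i, op (c i) • V i : L2 F r) = ∑ i, ip W (V i) * c i := by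
  rw [← ip_fcomb_right (Lp.memLp W) (fun i => Lp.memLp (V i)) c]
  refine ip_congr .rfl ?_
  filter_upwards [Lp.coeFn_fun_finsetSum Finset.univ fun i => op (c i) • V i,
    ae_all_iff.2 fun i => Lp.coeFn_smul (op (c i)) (V i)] with x h1 h2
  rw [h1]
  exact sum_congr rfl fun i _ => h2 i

/-- Combinations of eigenfunctions with the same eigenvalue are eigenfunctions. -/
theorem IsContinuumEigen.comb (hc : IsComparison η ζ) (hY : Continuous Y) {μ : ι → ℝ} {Λ : ℝ}
    {V : ι → L2 F r} (h : ∀ i, IsContinuumEigen η Y u w (μ i) (V i)) {c : ι → F}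
    (hμ : ∀ i, c i ≠ 0 → μ i = Λ) (h0 : ∑ i, op (c i) • V i ≠ 0) :
    IsContinuumEigen η Y u w Λ (∑ i, op (c i) • V i) := by
  choose f g hL hV hf using fun i => (h i).2
  choose φ hφ using fun i => (hL i).exists_starLimit
  have hφc := StarLimit.fcomb hc.cont_eta hφ c
  refine ⟨h0, _, _, ⟨hφc.cont, hφc.meas, _, hφc.test, hφc.tendsto⟩, ?_, fun ψ hψ => ?_⟩
  · filter_upwards [Lp.coeFn_fun_finsetSum Finset.univ fun i => op (c i) • V i,
      ae_all_iff.2 fun i => Lp.coeFn_smul (op (c i)) (V i), ae_all_iff.2 hV] with x h1 h2 h3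
    rw [h1]
    exact sum_congr rfl fun i _ => (h2 i).trans (by rw [Pi.smul_apply, h3 i])
  · rw [form_fcomb_right hY hψ (fun i => ((hφ i).memLp hc).1) fun i => ((hφ i).memLp hc).2,
      ip_fcomb_right hψ.memLp fun i => ((hφ i).memLp hc).1, smul_sum]
    refine sum_congr rfl fun i _ => ?_
    by_cases hi : c i = 0
    · simp [hi]
    · rw [hf i ψ hψ, hμ i hi, smul_mul_assoc]

include hA hB in
/-- Weak solutions with different eigenvalues are orthogonal: the form is symmetric on test
functions, and a diagonal argument passes to the limit in both arguments. -/
theorem Approx.re_ip_eq_zero {μ₁ μ₂ : ℝ} (hμ : μ₁ ≠ μ₂)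
    {φ₁ φ₂ : ℕ → ℝ → Vec F r} {f₁ g₁ f₂ g₂ : ℝ → Vec F r} (h₁ : StarLimit η u w φ₁ f₁ g₁)
    (h₂ : StarLimit η u w φ₂ f₂ g₂)
    (e₁ : ∀ ψ, IsTest u w ψ → form Y u w ψ f₁ g₁ = μ₁ • ip ψ f₁)
    (e₂ : ∀ ψ, IsTest u w ψ → form Y u w ψ f₂ g₂ = μ₂ • ip ψ f₂) : re (ip f₁ f₂) = 0 := by
  have key : ∀ p, ∃ q, p ≤ q ∧ |re (form Y u w (φ₁ p) (φ₂ q) (deriv (φ₂ q))) -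
      μ₂ * re (ip (φ₁ p) f₂)| < 1 / (p + 1) := fun p => by
    have := hA.tendsto_form hB h₂ (h₁.test p)
    rw [e₂ _ (h₁.test p), map_smul] at this
    obtain ⟨q, hq, hpq⟩ := ((Metric.tendsto_nhds.1 this _ (Nat.one_div_pos_of_nat (n := p))).and
      (eventually_ge_atTop p)).exists
    exact ⟨q, hpq, hq⟩
  choose q hpq hq using key
  have hqt : Tendsto q atTop atTop := tendsto_atTop_mono hpq tendsto_id
  have h₂' : StarLimit η u w (fun p => φ₂ (q p)) f₂ g₂ :=
    ⟨h₂.cont, h₂.meas, fun p => h₂.test _, h₂.tendsto.comp hqt⟩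
  obtain ⟨m₁, m₁'⟩ := h₁.memLp hA.cmp
  obtain ⟨m₂, m₂'⟩ := h₂.memLp hA.cmp
  have hmix : Tendsto (fun p => re (form Y u w (φ₁ p) (φ₂ (q p)) (deriv (φ₂ (q p))))) atTop
      (𝓝 (μ₂ * re (ip f₁ f₂))) := by
    have hip : Tendsto (fun p => re (ip (φ₁ p) f₂)) atTop (𝓝 (re (ip f₁ f₂))) := by
      have := tendsto_re_ip m₂ (fun p => (h₁.test p).memLp) m₁ (h₁.tendsto_eLpNorm hA.cmp).1
      simpa only [re_ip_comm m₁ m₂, re_ip_comm (h₁.test _).memLp m₂] using this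
    have := (squeeze_zero_norm (fun p => (hq p).le) tendsto_one_div_add_atTop_nhds_zero_nat).add
      (hip.const_mul μ₂)
    simpa using this
  have hsum := StarLimit.fcomb hA.cmp.cont_eta (φ := ![φ₁, fun p => φ₂ (q p)]) (f := ![f₁, f₂])
    (g := ![g₁, g₂]) (Fin.forall_fin_two.2 ⟨h₁, h₂'⟩) (fun _ => (1 : F))
  have hfc : ∀ a c : ℝ → Vec F r, fcomb ![a, c] (fun _ => (1 : F)) = fun y => a y + c y :=
    fun a c => by ext1 y; simp [BlockTridiagonal.fcomb]
  have hfc' : ∀ p, BlockTridiagonal.fcomb (fun i => (![φ₁, fun p => φ₂ (q p)] : Fin 2 → _) i p)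
      (fun _ => (1 : F)) = fcomb ![φ₁ p, φ₂ (q p)] fun _ => (1 : F) := fun p => by
    rw [hfc]; ext1 y; simp [BlockTridiagonal.fcomb]
  simp only [hfc'] at hsum
  have hT : ∀ p i, IsTest u w ((![φ₁ p, φ₂ (q p)] : Fin 2 → ℝ → Vec F r) i) := fun p =>
    Fin.forall_fin_two.2 ⟨h₁.test p, h₂.test _⟩
  have hM : ∀ i, MemL2((![f₁, f₂] : Fin 2 → ℝ → Vec F r) i) := Fin.forall_fin_two.2 ⟨m₁, m₂⟩
  have hM' : ∀ i, MemL2((![g₁, g₂] : Fin 2 → ℝ → Vec F r) i) := Fin.forall_fin_two.2 ⟨m₁', m₂'⟩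
  set k : ℝ → Vec F r := fcomb ![f₁, f₂] fun i => algebraMap ℝ F (![μ₁, μ₂] i)
  have hself := hA.tendsto_form_self hB hsum (MemLp.fcomb hM _ : MemL2(k)) fun ψ hψ => by
      rw [form_fcomb_right hA.cont hψ hM hM', ip_fcomb_right hψ.memLp hM]
      simp [Fin.sum_univ_two, e₁ ψ hψ, e₂ ψ hψ, Algebra.smul_def, Algebra.commutes]
  have hlim : re (ip (fcomb ![f₁, f₂] fun _ => (1 : F)) k) =
      μ₁ * re (ip f₁ f₁) + μ₂ * re (ip f₂ f₂) + (μ₁ + μ₂) * re (ip f₁ f₂) := by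
    rw [ip_fcomb_right (MemLp.fcomb hM _) hM]
    simp only [ip_fcomb_left hM (hM _), Fin.sum_univ_two, ← Algebra.commutes, ← Algebra.smul_def,
      map_add, map_smul]
    simp only [Matrix.cons_val_zero, Matrix.cons_val_one, star_one, one_mul, map_add, smul_eq_mul,
      re_ip_comm m₂ m₁]
    ring
  have hform : ∀ p, re (form Y u w (fcomb ![φ₁ p, φ₂ (q p)] fun _ => (1 : F))
      (fcomb ![φ₁ p, φ₂ (q p)] fun _ => (1 : F))
      (deriv (fcomb ![φ₁ p, φ₂ (q p)] fun _ => (1 : F)))) =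
      re (form Y u w (φ₁ p) (φ₁ p) (deriv (φ₁ p))) +
        re (form Y u w (φ₂ (q p)) (φ₂ (q p)) (deriv (φ₂ (q p)))) +
        2 * re (form Y u w (φ₁ p) (φ₂ (q p)) (deriv (φ₂ (q p)))) := fun p => by
    rw [form_fcomb hA.cont (hT p)]
    simp only [Fin.sum_univ_two, Matrix.cons_val_zero, Matrix.cons_val_one, star_one, one_mul,
      mul_one, map_add, hA.re_form_symm hB (h₂.test (q p)) (h₁.test p)]
    ring
  have s₁ := hA.tendsto_form_self hB h₁ (m₁.const_smul μ₁) fun ψ hψ => by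
    rw [e₁ ψ hψ, map_smul, re_ip_smul_right hψ.memLp m₁, smul_eq_mul]
  have s₂ := hA.tendsto_form_self hB h₂' (m₂.const_smul μ₂) fun ψ hψ => by
    rw [e₂ ψ hψ, map_smul, re_ip_smul_right hψ.memLp m₂, smul_eq_mul]
  simp only [hform] at hself
  have := tendsto_nhds_unique hself ((s₁.add s₂).add (hmix.const_mul 2))
  rw [hlim, re_ip_smul_right m₁ m₁, re_ip_smul_right m₂ m₂] at this
  have h3 : (μ₁ - μ₂) * re (ip f₁ f₂) = 0 := by linarith
  exact (mul_eq_zero.1 h3).resolve_left (sub_ne_zero.2 hμ)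

include hA hB in
/-- Eigenfunctions with different eigenvalues are orthogonal over `F`. -/
theorem Approx.ip_eq_zero {μ₁ μ₂ : ℝ} (hμ : μ₁ ≠ μ₂)
    {V₁ V₂ : L2 F r} (h₁ : IsContinuumEigen η Y u w μ₁ V₁)
    (h₂ : IsContinuumEigen η Y u w μ₂ V₂) : ip V₁ V₂ = 0 := by
  obtain ⟨-, f₁, g₁, L₁, hV₁, e₁⟩ := h₁
  obtain ⟨-, f₂, g₂, L₂, hV₂, e₂⟩ := h₂
  rw [ip_congr hV₁ hV₂]
  obtain ⟨φ₁, s₁⟩ := L₁.exists_starLimit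
  obtain ⟨φ₂, s₂⟩ := L₂.exists_starLimit
  refine eq_zero_of_re_star_mul fun c => ?_
  have := hA.re_ip_eq_zero hB hμ
    (StarLimit.fcomb hA.cmp.cont_eta (ι := Unit) (fun _ => s₁) fun _ => c) s₂
    (fun ψ hψ => by
      rw [form_fcomb_right hA.cont hψ (fun _ => (s₁.memLp hA.cmp).1) fun _ => (s₁.memLp hA.cmp).2,
        ip_fcomb_right hψ.memLp fun _ => (s₁.memLp hA.cmp).1]
      simp [e₁ ψ hψ]) e₂
  rw [ip_fcomb_left (fun _ => (s₁.memLp hA.cmp).1) (s₂.memLp hA.cmp).1] at this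
  simpa using this

include hA hB in
/-- If an orthonormal family of eigenfunctions exhausts the levels up to `Λ`, then it spans the
eigenspace of `Λ`. -/
theorem Approx.eq_sum_of_eigen {H : ℕ} {Λ : ℝ}
    {μ : Fin H → ℝ} {f : Fin H → L2 F r} (hf : ∀ i j, ip (f i) (f j) = if i = j then 1 else 0)
    (hE : ∀ i, IsContinuumEigen η Y u w (μ i) (f i)) (hμ : ∀ i, μ i ≤ Λ)
    (hH : Λ < continuumEig η Y u w H) {V : L2 F r} (hV : IsContinuumEigen η Y u w Λ V) :
    (∀ i, ip (f i) V ≠ 0 → μ i = Λ) ∧ V = ∑ i, op (ip (f i) V) • f i := by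
  have h1 : ∀ i, ip (f i) V ≠ 0 → μ i = Λ := fun i hi => by
    by_contra h
    exact hi (hA.ip_eq_zero hB h (hE i) hV)
  refine ⟨h1, ?_⟩
  by_contra hne
  set g : Fin (H + 1) → L2 F r := Fin.cons V f
  set c : Fin (H + 1) → F := Fin.cons 1 fun i => -ip (f i) V
  have hsum : ∑ i, op (c i) • g i = V - ∑ i, op (ip (f i) V) • f i := by
    simp [g, c, Fin.sum_univ_succ, sub_eq_add_neg]
  set U : L2 F r := ∑ i, op (c i) • g i with hU
  have hU0 : U ≠ 0 := by rw [hsum]; exact sub_ne_zero.2 hne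
  have hort : ∀ i, ip (f i) U = 0 := fun i => by
    rw [hU, ip_sum_right]
    simp [g, c, Fin.sum_univ_succ, hf]
  set t : F := algebraMap ℝ F ‖U‖⁻¹
  have hts : (op t • U : L2 F r) = ∑ _i : Unit, op t • U := by simp
  have hN : ip (op t • U : L2 F r) (op t • U : L2 F r) = 1 := by
    have : (op t • U : L2 F r) = ‖U‖⁻¹ • U := Lp.ext <| by
      filter_upwards [Lp.coeFn_smul (op t) U, Lp.coeFn_smul ‖U‖⁻¹ U] with x h2 h3
      rw [h2, h3]
      ext i
      exact (Algebra.commutes _ _).symm.trans (Algebra.smul_def _ _).symm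
    rw [this, ip_self, norm_smul, norm_inv, norm_norm, inv_mul_cancel₀ (norm_ne_zero_iff.2 hU0)]
    simp
  have hUE : IsContinuumEigen η Y u w Λ (op t • U) := by
    have hUe : IsContinuumEigen η Y u w Λ U :=
      IsContinuumEigen.comb hA.cmp hA.cont (μ := Fin.cons Λ μ)
        (fun i => by refine Fin.cases hV hE i)
        (fun i => Fin.cases (fun _ => rfl) (fun i hi => h1 i (by simpa [c] using hi)) i)
        hU0
    rw [hts]
    refine IsContinuumEigen.comb hA.cmp hA.cont (fun _ => hUe) (fun _ _ => rfl) ?_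
    rw [← hts]
    intro h0
    rw [h0, ip_self] at hN
    simp at hN
  refine hH.not_ge ((hA.isLeast hB H).1.2 ⟨Fin.cons Λ μ, Fin.cons (op t • U) f,
    fun i j => ?_, fun i => ?_⟩)
  · have h2 : ∀ i, ip (f i) (op t • U : L2 F r) = 0 := fun i => by
      rw [hts, ip_sum_right]; simp [hort]
    have h3 : ∀ i, ip (op t • U : L2 F r) (f i) = 0 := fun i => by rw [← star_ip, h2, star_zero]
    refine Fin.cases (Fin.cases ?_ (fun j => ?_) j) (fun i => Fin.cases ?_ (fun j => ?_) j) i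
    · simpa using hN
    · simpa [(Fin.succ_ne_zero j).symm] using h3 j
    · simpa using h2 i
    · simpa using hf i j
  · refine Fin.cases ⟨hUE, le_rfl⟩ (fun i => ⟨hE i, hμ i⟩) i

end Eigenspaces

/-! ### Compactness of the eigenvectors -/

section Compactness

theorem isCompact_closure_iUnion {E : Type*} [MetricSpace E] {S : ℕ → Set E}
    (hS : ∀ j, IsCompact (closure (S j)))
    (hseq : ∀ (t : ℕ → ℕ) (V : ℕ → E), StrictMono t → (∀ j, V j ∈ S (t j)) →
      ∃ (a : E) (p : ℕ → ℕ), StrictMono p ∧ Tendsto (fun j => V (p j)) atTop (𝓝 a)) :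
    IsCompact (closure (⋃ j, S j)) := by
  rw [isCompact_iff_isSeqCompact]
  intro a ha
  choose c hc hac using fun i => Metric.mem_closure_iff.1 (ha i) _ (Nat.one_div_pos_of_nat (n := i))
  choose j hj using fun i => mem_iUnion.1 (hc i)
  obtain ⟨x, p, hp, hx⟩ : ∃ (x : E) (p : ℕ → ℕ), StrictMono p ∧
      Tendsto (fun i => c (p i)) atTop (𝓝 x) := by
    by_cases hjt : Tendsto j atTop atTop
    · obtain ⟨q, hq, hjq⟩ := strictMono_subseq_of_tendsto_atTop hjt
      obtain ⟨x, p, hp, h⟩ := hseq _ (fun i => c (q i)) hjq fun i => hj _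
      exact ⟨x, q ∘ p, hq.comp hp, h⟩
    · rw [tendsto_atTop] at hjt
      push Not at hjt
      obtain ⟨J, hJ⟩ := hjt
      obtain ⟨q, hq, h⟩ := extraction_of_frequently_atTop hJ
      obtain ⟨x, -, p, hp, h⟩ := ((Set.finite_Iio J).isCompact_biUnion fun i _ => hS
        i).tendsto_subseq
        (x := fun i => c (q i)) fun i => mem_biUnion (show j (q i) ∈ Iio J from h i)
          (subset_closure (hj _))
      exact ⟨x, q ∘ p, hq.comp hp, h⟩
  have hap : Tendsto (fun i => a (p i)) atTop (𝓝 x) := by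
    refine hx.congr_dist (squeeze_zero (fun _ => dist_nonneg) (fun i => ?_)
      (tendsto_one_div_add_atTop_nhds_zero_nat.comp hp.tendsto_atTop))
    rw [dist_comm]; exact (hac _).le
  exact ⟨x, isClosed_closure.mem_of_tendsto hap (.of_forall fun i => ha _), p, hp, hap⟩

theorem _root_.StrictMono.exists_shift {t : ℕ → ℕ} (ht : StrictMono t) (J I : ℕ) :
    ∃ q : ℕ → ℕ, StrictMono q ∧ ∀ j, t (j + (I + J)) = q j + J ∧ I ≤ q j := by
  have h : ∀ j, I + J ≤ t (j + (I + J)) := fun j => by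
    have := ht.le_apply (x := j + (I + J)); omega
  refine ⟨fun j => t (j + (I + J)) - J, fun i j hij => ?_, fun j => ?_⟩
  · have := ht (show i + (I + J) < j + (I + J) by omega)
    have := h i
    simp only; omega
  · have := h j
    simp only; omega

/-- The embedded unit eigenvectors of all operators of one size form a precompact set. -/
theorem isCompact_closure_lattice (hr : 0 < r) (n : ℕ) {m : ℝ} (hm : 0 < m) :
    IsCompact (closure {V : L2 F r | ‖V‖ = 1 ∧ ∃ x : Vec F n, V = stepL m (toSites r x)}) := by
  have hcont : Continuous fun x : Vec F n => (stepL m (toSites r x) : L2 F r) := by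
    refine (LipschitzWith.of_dist_le_mul (K := (√m⁻¹).toNNReal) fun x y => ?_).continuous
    rw [dist_eq_norm, dist_eq_norm, Real.coe_toNNReal _ (Real.sqrt_nonneg _)]
    refine abs_le_of_sq_le_sq' ?_ (by positivity) |>.2
    have hi := inner_stepL (E := Vec F r) hm (supp_of_trunc hr (trunc_toSites x))
      (supp_of_trunc hr (trunc_toSites y))
    rw [sum_inner_toSites hr] at hi
    rw [mul_pow, Real.sq_sqrt (inv_nonneg.2 hm.le), norm_sub_sq_real, norm_sub_sq_real, hi,
      norm_stepL_toSites hm hr, norm_stepL_toSites hm hr]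
    exact le_of_eq (by ring)
  have hK := (isCompact_closedBall (0 : Vec F n) √m).image hcont
  refine hK.closure_of_subset ?_
  rintro _ ⟨h1, x, rfl⟩
  refine ⟨x, ?_, rfl⟩
  rw [mem_closedBall_zero_iff]
  refine Real.le_sqrt_of_sq_le ?_
  have := norm_stepL_toSites hm hr x
  rw [h1, inv_mul_eq_div, eq_div_iff hm.ne'] at this
  linarith

/-- Unit eigenvectors, for boundary terms bounded below, of data whose tail is uniformly good and
whose scale diverges form a precompact set, provided that their eigenvalues are bounded. -/
theorem isCompact_closure_eigenvectors (b : ℝ) (k J : ℕ)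
    (hA : Approx η ζ C (fun j => n (j + J)) (fun j => m (j + J)) (fun j => Y₁ (j + J))
      (fun j => Y₂ (j + J)) Y) (hm : ∀ j, 0 < m j) :
    IsCompact (closure {V : L2 F r | ∃ (j : ℕ) (u : Fin r → Vec F r) (x : Fin r → ℝ),
      k < n j ∧ OrthoBasis u ∧ (∀ i, -b ≤ x i) ∧
      IsUnitEigen (n j) (m j) (Y₁ j) (Y₂ j) (specMat u x) k V}) := by
  have := isCompact_closure_iUnion (S := fun j => {V : L2 F r | ∃ (u : Fin r → Vec F r)
    (x : Fin r → ℝ), k < n j ∧ OrthoBasis u ∧ (∀ i, -b ≤ x i) ∧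
      IsUnitEigen (n j) (m j) (Y₁ j) (Y₂ j) (specMat u x) k V}) (fun j => ?_)
    fun t V ht hV => ?_
  · convert this using 2
    ext V
    simp
  · refine (isCompact_closure_lattice hA.pos (n j) (hm j)).closure_of_subset ?_
    rintro V ⟨u, x, -, -, -, h1, h2⟩
    obtain ⟨x, -, -, h⟩ := (isDiscreteEigen_iff _ (hm j) hA.pos).1 h2
    exact subset_closure ⟨h1, x, h⟩
  · choose u x hk hu hx h1 h2 using hV
    obtain ⟨Λ, ρ, hΛ⟩ := exists_discreteEig_bound (F := F) hA.pos hA.cmp hA.le_C k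
    obtain ⟨I, hI⟩ := eventually_atTop.1 ((hA.scale.eventually (eventually_ge_atTop ρ)).and
      (hA.ratio.eventually (eventually_ge_atTop ρ)))
    obtain ⟨q, hqm, hq⟩ := ht.exists_shift J I
    choose hq hqI using hq
    have hA' := hA.comp hqm
    simp only [← hq] at hA'
    obtain ⟨p, l₀, V₀, v, f, g, hp, -, h, -⟩ := exists_lattice_subseq hA.pos
      hA.cmp hA.le_C hA'.good hA'.scale
      (u' := fun j => u (j + (I + J))) (x := fun j => x (j + (I + J))) (fun j => hu _)
      (fun j => hx _) (Λ := Λ) (V := fun j => V (j + (I + J))) (fun j => by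
        obtain ⟨h3, h4⟩ := hI (q j) (hqI j)
        rw [← hq] at h3 h4
        rw [le_div_iff₀ (hm _)] at h4
        exact hΛ _ _ _ _ (hA'.good j) h3 h4 (u (j + (I + J))) (x (j + (I + J))) (hu _))
      (fun j => h1 _) fun j => h2 _
    exact ⟨V₀, fun j => p j + (I + J), fun i j hij => Nat.add_lt_add_right (hp hij) _, h⟩

include hA hB in
/-- The ordered eigenvalues tend to infinity: otherwise there would be arbitrarily large orthonormal
families in a precompact set of discrete eigenvectors. -/
theorem Approx.exists_lt_continuumEig (Λ : ℝ) : ∃ H, Λ < continuumEig η Y u w H := by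
  by_contra! hle
  have hex : ∀ H, ∃ j, H ≤ j ∧ ∃ V : Fin (H + 1) → L2 F r,
      (∀ i i', ip (V i) (V i') = if i = i' then 1 else 0) ∧ ∀ i, ∃ l ≤ Λ + 1,
        IsDiscreteEigen (n j) (m j) (Y₁ j) (Y₂ j) (specMat (u' j) (x j)) l (V i) := fun H => by
    obtain ⟨j, h1, h2, h3⟩ := ((hA.eventually_lt H).and (((hA.isLeast hB H).2.eventually
      (gt_mem_nhds ((hle H).trans_lt (lt_add_one Λ)))).and (eventually_ge_atTop H))).exists
    obtain ⟨V, hV, hE⟩ := exists_eigenvectors (Y₂ j) (hA.scale_pos j) hA.pos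
      (hA.good j).2.2.1 (u' j) (x j) h1
    exact ⟨j, h3, V, hV, fun i => ⟨_, (hE i).2.trans h2.le, (hE i).1⟩⟩
  choose j hj V hV l hl hE using hex
  have hV1 : ∀ H i, ‖V H i‖ = 1 := fun H i => norm_eq_one_of_ip ((hV H i i).trans (if_pos rfl))
  have hjt : Tendsto j atTop atTop := tendsto_atTop_mono hj tendsto_id
  have hK := isCompact_closure_iUnion (S := fun H => range (V H))
    (fun H => (finite_range _).isCompact.closure) fun t U ht hU => by
      obtain ⟨q, hq, hjq⟩ := strictMono_subseq_of_tendsto_atTop (hjt.comp ht.tendsto_atTop)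
      choose i hi using hU
      obtain ⟨p, l₀, V₀, hp, -, h, -⟩ := (hA.comp hjq).exists_eigen_limit (hB.comp hjq)
        (fun a => hl (t (q a)) (i (q a))) (fun a => hV1 _ (i (q a)))
        fun a => hE (t (q a)) (i (q a))
      exact ⟨V₀, q ∘ p, hq.comp hp, h.congr fun a => hi (q (p a))⟩
  obtain ⟨T, hT, hcov⟩ := Metric.totallyBounded_iff.1
    (hK.totallyBounded.subset subset_closure) (1 / 2) (by norm_num)
  set H := hT.toFinset.card
  have hex : ∀ i : Fin (H + 1), ∃ y ∈ hT.toFinset, dist (V H i) y < 1 / 2 := fun i => by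
    obtain ⟨y, hy, h⟩ := mem_iUnion₂.1 (hcov (mem_iUnion.2 ⟨H, mem_range_self i⟩))
    exact ⟨y, hT.mem_toFinset.2 hy, h⟩
  choose y hyT hy using hex
  obtain ⟨i, -, i', -, hii, he⟩ := Finset.exists_ne_map_eq_of_card_lt_of_maps_to
    (s := Finset.univ) (t := hT.toFinset) (by simp [H]) fun i _ => hyT i
  have h1 : ‖V H i - V H i'‖ < 1 := by
    rw [← dist_eq_norm]
    have := dist_triangle_right (V H i) (V H i') (y i)
    have h2 := hy i'
    rw [← he] at h2
    linarith [hy i]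
  have h2 := norm_sub_sq_real (V H i) (V H i')
  rw [← re_ip_L2, hV, if_neg hii, hV1, hV1, map_zero] at h2
  nlinarith [norm_nonneg (V H i - V H i')]

end Compactness

/-! ### Varying the boundary condition -/

section Uniform

/-- Finite boundary terms that approximate the extended boundary term `w`. -/
def cut (b : ℝ) (w : Fin r → EReal) (j : ℕ) (i : Fin r) : ℝ :=
  (min (w i) ((|b| + j : ℝ) : EReal)).toReal

theorem boundaryLimit_cut {u : ℕ → Fin r → Vec F r} {w : ℕ → Fin r → EReal}
    {u₀ : Fin r → Vec F r} {w₀ : Fin r → EReal} (hu : ∀ j, OrthoBasis (u j))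
    (hw : ∀ j i, ((-b : ℝ) : EReal) ≤ w j i) (hu₀ : Tendsto u atTop (𝓝 u₀))
    (hw₀ : Tendsto w atTop (𝓝 w₀)) {q : ℕ → ℕ} (hq : Tendsto q atTop atTop) :
    BoundaryLimit b u (fun j => cut b (w j) (q j)) u₀ w₀ := by
  have hle : ∀ j i, ((-b : ℝ) : EReal) ≤ min (w j i) ((|b| + q j : ℝ) : EReal) := fun j i =>
    le_min (hw j i) (EReal.coe_le_coe_iff.2 (by
      have := neg_le_abs b
      have := Nat.cast_nonneg (α := ℝ) (q j)
      linarith))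
  have hcoe : ∀ j i, (cut b (w j) (q j) i : EReal) = min (w j i) ((|b| + q j : ℝ) : EReal) :=
    fun j i => EReal.coe_toReal ((min_le_right _ _).trans_lt (EReal.coe_lt_top _)).ne
      ((EReal.bot_lt_coe _).trans_le (hle j i)).ne'
  refine ⟨hu, fun j i => EReal.coe_le_coe_iff.1 ((hle j i).trans (hcoe j i).ge), hu₀, fun i => ?_⟩
  simp only [hcoe]
  have h := (tendsto_pi_nhds.1 hw₀ i).min (EReal.tendsto_coe_nhds_top_iff.2
    (tendsto_atTop_add_const_left atTop |b| (tendsto_natCast_atTop_atTop.comp hq)))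
  rwa [min_top_right] at h

include hA in
/-- Along a subsequence, orthonormal eigenfunctions for converging boundary conditions converge to
eigenfunctions of the limiting condition. Each of them is replaced by a nearby discrete
eigenvector, and the discrete problems converge. -/
theorem Approx.exists_eigen_family {u : ℕ → Fin r → Vec F r} {w : ℕ → Fin r → EReal}
    {u₀ : Fin r → Vec F r} {w₀ : Fin r → EReal} (hu : ∀ j, OrthoBasis (u j))
    (hw : ∀ j i, ((-b : ℝ) : EReal) ≤ w j i) (hu₀ : Tendsto u atTop (𝓝 u₀))
    (hw₀ : Tendsto w atTop (𝓝 w₀)) (H : ℕ) :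
    ∃ (t : ℕ → ℕ) (f : ℕ → Fin (H + 1) → L2 F r) (f₀ : Fin (H + 1) → L2 F r), StrictMono t ∧
      (∀ i i', ip (f₀ i) (f₀ i') = if i = i' then 1 else 0) ∧ ∀ i : Fin (H + 1),
      (∀ j, IsContinuumEigen η Y (u (t j)) (w (t j))
        (continuumEig η Y (u (t j)) (w (t j)) i) (f j i)) ∧
      Tendsto (fun j => f j i) atTop (𝓝 (f₀ i)) ∧
      IsContinuumEigen η Y u₀ w₀ (continuumEig η Y u₀ w₀ i) (f₀ i) ∧
      Tendsto (fun j => continuumEig η Y (u (t j)) (w (t j)) i) atTop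
        (𝓝 (continuumEig η Y u₀ w₀ i)) := by
  have hex : ∀ N, ∃ (q : ℕ) (E f : Fin (H + 1) → L2 F r), N ≤ q ∧
      (∀ i i', ip (f i) (f i') = if i = i' then 1 else 0) ∧ ∀ i : Fin (H + 1),
      IsContinuumEigen η Y (u N) (w N) (continuumEig η Y (u N) (w N) i) (f i) ∧
      dist (E i) (f i) < 1 / (N + 1) ∧
      dist (discreteEig (n q) (m q) (Y₁ q) (Y₂ q) (specMat (u N) (cut b (w N) q)) i)
        (continuumEig η Y (u N) (w N) i) < 1 / (N + 1) ∧
      IsUnitEigen (n q) (m q) (Y₁ q) (Y₂ q) (specMat (u N) (cut b (w N) q)) i (E i) := by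
    intro N
    have hB := boundaryLimit_cut (fun _ => hu N) (fun _ => hw N) tendsto_const_nhds
      (tendsto_const_nhds (x := w N)) tendsto_id
    obtain ⟨t, V, l₀, V₀, ht, hV, hV₀, hort, hl⟩ := hA.exists_subseq_family hB H
    have hl₀ : ∀ i : Fin (H + 1), l₀ i = continuumEig η Y (u N) (w N) i := fun i =>
      tendsto_nhds_unique (hl i).2.2 ((hA.isLeast hB i).2.comp ht.tendsto_atTop)
    have hpos := Nat.one_div_pos_of_nat (α := ℝ) (n := N)
    obtain ⟨p, h1, h2⟩ := ((eventually_all.2 fun i => (Metric.tendsto_nhds.1 (hV₀ i) _ hpos).and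
      (Metric.tendsto_nhds.1 (hl i).2.2 _ hpos)).and (eventually_ge_atTop N)).exists
    refine ⟨t p, V p, V₀, h2.trans (ht.id_le p), hort, fun i => ?_⟩
    rw [← hl₀]
    exact ⟨(hl i).1, (h1 i).1, (h1 i).2, hV p i⟩
  choose q E f hNq hort hf using hex
  obtain ⟨σ, hσ, hqσ⟩ := strictMono_subseq_of_tendsto_atTop
    (tendsto_atTop_mono hNq tendsto_id : Tendsto q atTop atTop)
  have hA' := hA.comp hqσ
  have hB := boundaryLimit_cut (fun j => hu (σ j)) (fun j => hw (σ j))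
    (hu₀.comp hσ.tendsto_atTop) (hw₀.comp hσ.tendsto_atTop) hqσ.tendsto_atTop
  obtain ⟨t, f₀, ht, h⟩ := hA'.exists_family_limit hB (k := fun i : Fin (H + 1) => i)
    (V := fun j => E (σ j)) fun j i => (hf (σ j) i).2.2.2
  have hst := (hσ.comp ht).tendsto_atTop
  have hz := tendsto_one_div_add_atTop_nhds_zero_nat (𝕜 := ℝ) |>.comp hst
  have hf₀ : ∀ i, Tendsto (fun j => f (σ (t j)) i) atTop (𝓝 (f₀ i)) := fun i =>
    (h i).1.congr_dist (squeeze_zero (fun _ => dist_nonneg) (fun j => ((hf _ i).2.1).le) hz)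
  refine ⟨σ ∘ t, fun j => f (σ (t j)), f₀, hσ.comp ht, fun i i' => ?_, fun i =>
    ⟨fun j => (hf _ i).1, hf₀ i, (h i).2.2, ?_⟩⟩
  · refine tendsto_nhds_unique (tendsto_ip (hf₀ i) (hf₀ i')) ?_
    simp only [hort]; exact tendsto_const_nhds
  · exact ((hA'.isLeast hB i).2.comp ht.tendsto_atTop).congr_dist
      (squeeze_zero (fun _ => dist_nonneg) (fun j => ((hf _ i).2.2.1).le) hz)

theorem tendsto_of_closeExt {x : ℕ → ℝ} {w : ℕ → EReal} {w₀ : EReal} (hw₀ : w₀ ≠ ⊥)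
    (hw : Tendsto w atTop (𝓝 w₀)) {t : ℕ → ℕ} (ht : StrictMono t)
    (h : ∀ j, CloseExt (1 / (t j + 1)) (t j) (x j) (w j)) :
    Tendsto (fun j => (x j : EReal)) atTop (𝓝 w₀) := by
  have htt : Tendsto (fun j => (t j : ℝ)) atTop atTop :=
    tendsto_natCast_atTop_atTop.comp ht.tendsto_atTop
  by_cases htop : w₀ = ⊤
  · subst htop
    refine EReal.tendsto_coe_nhds_top_iff.2 (tendsto_atTop.2 fun c => ?_)
    filter_upwards [EReal.tendsto_nhds_top_iff_real.1 hw (c + 1), htt.eventually_ge_atTop c]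
      with j h1 h2
    rcases h j with h3 | ⟨h3, h4, h5⟩
    · exact h2.trans h3.1.le
    · have h6 : (1 : ℝ) / (t j + 1) ≤ 1 := (div_le_one (by positivity)).2 (by simp)
      rw [← EReal.coe_toReal h4 h3, EReal.coe_lt_coe_iff] at h1
      linarith [(abs_lt.1 h5).1]
  · have hw₁ := (EReal.tendsto_toReal htop hw₀).comp hw
    rw [← EReal.coe_toReal htop hw₀]
    refine (continuous_coe_real_ereal.tendsto _).comp (hw₁.congr_dist ?_)
    refine squeeze_zero' (.of_forall fun _ => dist_nonneg) ?_
      (tendsto_one_div_add_atTop_nhds_zero_nat.comp ht.tendsto_atTop)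
    have hlt : ∀ᶠ j in atTop, w j < ((w₀.toReal + 1 : ℝ) : EReal) := hw.eventually (gt_mem_nhds (by
      conv_lhs => rw [← EReal.coe_toReal htop hw₀]
      exact EReal.coe_lt_coe_iff.2 (lt_add_one _)))
    filter_upwards [hlt, htt.eventually_ge_atTop (w₀.toReal + 1)] with j h1 h2
    rcases h j with h3 | ⟨h3, h4, h5⟩
    · exact absurd (EReal.coe_lt_coe_iff.1 (h3.2.trans h1)) h2.not_gt
    · rw [dist_comm]; exact h5.le

theorem isCompact_orthoBasis : IsCompact {u : Fin r → Vec F r | OrthoBasis u} := by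
  refine (isCompact_closedBall (0 : Fin r → Vec F r) 1).of_isClosed_subset isClosed_orthoBasis ?_
  intro u hu
  rw [mem_closedBall_zero_iff, pi_norm_le_iff_of_nonneg zero_le_one]
  exact fun i => (hu.norm_eq_one i).le

theorem exists_fin_sum {ι A : Type*} [Fintype ι] [AddCommMonoid A] (p : ι → Prop) :
    ∃ (d : ℕ) (e : Fin d → ι), (∀ a, p (e a)) ∧
      ∀ v : ι → A, (∀ i, ¬ p i → v i = 0) → ∑ a, v (e a) = ∑ i, v i := by
  classical
  refine ⟨_, fun a => ((Fintype.equivFin {i // p i}).symm a : ι),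
    fun a => ((Fintype.equivFin {i // p i}).symm a).2, fun v hv => ?_⟩
  rw [(Fintype.equivFin {i // p i}).symm.sum_comp fun i => v i,
    ← Finset.sum_subtype (Finset.univ.filter p) (by simp) v]
  exact Finset.sum_filter_of_ne fun i _ h => by_contra fun h' => h (hv i h')

include hA in
set_option maxHeartbeats 1000000 in
/-- Uniformity over boundary conditions bounded below, by compactness of `[-b, ∞]` and of the set
of orthonormal bases. -/
theorem Approx.uniform (b : ℝ) (k : ℕ) {ε : ℝ} (hε : 0 < ε) : ∃ δ > 0, ∃ R : ℝ, ∀ᶠ j in atTop,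
      ∀ (u : Fin r → Vec F r) (x : Fin r → ℝ) (w : Fin r → EReal), OrthoBasis u →
        (∀ i, -b ≤ x i) → (∀ i, ((-b : ℝ) : EReal) ≤ w i) → (∀ i, CloseExt δ R (x i) (w i)) →
        |discreteEig (n j) (m j) (Y₁ j) (Y₂ j) (specMat u x) k - continuumEig η Y u w k| < ε ∧
        ∀ V : L2 F r, ‖V‖ = 1 → IsDiscreteEigen (n j) (m j) (Y₁ j) (Y₂ j) (specMat u x)
            (discreteEig (n j) (m j) (Y₁ j) (Y₂ j) (specMat u x) k) V →
          ∃ (d : ℕ) (μ : Fin d → ℝ) (f : Fin d → L2 F r),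
            (∀ i, IsContinuumEigen η Y u w (μ i) (f i) ∧
              |μ i - continuumEig η Y u w k| < ε) ∧ ‖V - ∑ i, f i‖ < ε := by
  by_contra! hcon
  have hex := fun N : ℕ => (hcon (1 / (N + 1)) Nat.one_div_pos_of_nat N).and_eventually
    (eventually_ge_atTop N) |>.exists
  choose j hj hNj using hex
  choose u x w hu hx hw hclose hbad using hj
  have hjt : Tendsto j atTop atTop := tendsto_atTop_mono hNj tendsto_id
  -- a subsequence of converging boundary conditions
  obtain ⟨⟨u₀, w₀⟩, -, σ, hσ, hlim⟩ := (isCompact_orthoBasis.prod isCompact_univ).tendsto_subseq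
    (x := fun N => (u N, w N)) fun N => ⟨hu N, Set.mem_univ _⟩
  obtain ⟨τ, hτ, hjτ⟩ := strictMono_subseq_of_tendsto_atTop (hjt.comp hσ.tendsto_atTop)
  set s := fun N => σ (τ N)
  have hs : StrictMono s := hσ.comp hτ
  have hu₀ : Tendsto (fun N => u (s N)) atTop (𝓝 u₀) :=
    ((continuous_fst.tendsto _).comp hlim).comp hτ.tendsto_atTop
  have hw₀ : Tendsto (fun N => w (s N)) atTop (𝓝 w₀) :=
    ((continuous_snd.tendsto _).comp hlim).comp hτ.tendsto_atTop
  have hb₀ : ∀ i, ((-b : ℝ) : EReal) ≤ w₀ i := fun i =>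
    ge_of_tendsto' (tendsto_pi_nhds.1 hw₀ i) fun N => hw _ i
  have hA₁ := hA.comp hjτ
  have hB₁ : BoundaryLimit b (fun N => u (s N)) (fun N => x (s N)) u₀ w₀ :=
    ⟨fun N => hu _, fun N => hx _, hu₀, fun i => tendsto_of_closeExt
      ((EReal.bot_lt_coe _).trans_le (hb₀ i)).ne' (tendsto_pi_nhds.1 hw₀ i) hs
      fun N => hclose _ i⟩
  obtain ⟨H₀, hH₀⟩ := hA₁.exists_lt_continuumEig hB₁ (continuumEig η Y u₀ w₀ k)
  classical
  have hexH : ∃ H, continuumEig η Y u₀ w₀ k < continuumEig η Y u₀ w₀ H := ⟨H₀, hH₀⟩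
  set H := Nat.find hexH
  obtain ⟨t, f, f₀, ht, hort, hf⟩ := hA.exists_eigen_family (fun N => hu (s N))
    (fun N => hw (s N)) hu₀ hw₀ (k + H)
  have hA₂ := hA₁.comp ht
  have hB₂ := hB₁.comp ht
  have hk := (hf ⟨k, by omega⟩).2.2.2
  have hd := (hA₂.isLeast hB₂ k).2
  obtain ⟨N₀, hN₀⟩ := eventually_atTop.1
    ((hd.dist hk).eventually (gt_mem_nhds (show dist _ _ < ε by simpa using hε)))
  choose V hV1 hV hVbad using fun N => hbad (s (t (N + N₀))) (hN₀ (N + N₀) (by omega))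
  have hsh : StrictMono fun N : ℕ => N + N₀ := strictMono_id.add_const _
  obtain ⟨p, V₀, hp, hVp⟩ := (hA₂.comp hsh).exists_family_limit (hB₂.comp hsh)
    (N := 1) (k := fun _ => k) (V := fun N _ => V N) fun N _ => ⟨hV1 N, hV N⟩
  obtain ⟨hVlim, -, hV₀⟩ := hVp 0
  -- the limit is a combination of the limits of the eigenfunctions
  let c : Fin H → Fin (k + H + 1) := fun i => ⟨i, by omega⟩
  obtain ⟨h1, h2⟩ := hA₂.eq_sum_of_eigen hB₂ (f := fun i : Fin H => f₀ (c i))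
    (μ := fun i => continuumEig η Y u₀ w₀ i)
    (fun i i' => by rw [hort]; simp [c, Fin.ext_iff]) (fun i => (hf (c i)).2.2.1)
    (fun i => not_lt.1 (Nat.find_min hexH i.2)) (Nat.find_spec hexH) hV₀
  obtain ⟨d, e, he, hsum⟩ := exists_fin_sum (A := L2 F r) fun i : Fin H => ip (f₀ (c i)) (V₀ 0) ≠ 0
  have hpt := (hsh.comp hp).tendsto_atTop
  have e1 : Tendsto (fun N => ∑ a, op (ip (f₀ (c (e a))) (V₀ 0)) • f (p N + N₀) (c (e a))) atTop
      (𝓝 (V₀ 0)) := by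
    conv => enter [3, 1]; rw [h2, ← hsum _ fun i hi => by rw [not_not.1 hi, op_zero, zero_smul]]
    exact tendsto_finsetSum _ fun a _ => ((hf (c (e a))).2.1.comp hpt).const_smul _
  have e2 := eventually_all.2 fun a => (((hf (c (e a))).2.2.2.comp hpt).dist
    (hk.comp hpt)).eventually (gt_mem_nhds (show dist _ _ < ε by
      rw [dist_comm, (h1 _ (he a) : continuumEig η Y u₀ w₀ (e a : ℕ) = _), dist_self]; exact hε))
  obtain ⟨N, h3, h4⟩ := (e2.and ((hVlim.dist e1).eventually
    (gt_mem_nhds (by rw [dist_self]; exact hε)))).exists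
  rw [dist_eq_norm] at h4
  refine (hVbad (p N) d _ _ (fun a => ⟨?_, h3 a⟩)).not_gt h4
  have := IsContinuumEigen.comb hA.cmp hA.cont (ι := Unit)
    (c := fun _ => ip (f₀ (c (e a))) (V₀ 0)) (fun _ => (hf (c (e a))).1 (p N + N₀))
    (fun _ _ => rfl) (by
      simp only [Finset.univ_unique, Finset.sum_singleton]
      exact smul_ne_zero (op_ne_zero_iff _ |>.2 (he a)) ((hf (c (e a))).1 (p N + N₀)).1)
  simpa using this

end Uniform

/-! ### The deterministic setting -/

section Deterministic

theorem uniformContinuous_star' : UniformContinuous (star : F → F) :=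
  AddMonoidHomClass.uniformContinuous_of_bound (starAddEquiv : F ≃+ F) 1 fun a => by
    rw [one_mul]; exact ((isRealPart_re (F := F)).norm_star a).le

theorem uniformContinuous_combine :
    UniformContinuous fun p : Mat F r × Mat F r => p.1 + (1 / 2 : ℝ) • (p.2 + p.2ᴴ) := by
  refine uniformContinuous_pi.2 fun i => uniformContinuous_pi.2 fun l => ?_
  have h1 : ∀ a c, UniformContinuous fun M : Mat F r => M a c := fun a c =>
    (Pi.uniformContinuous_proj (fun _ : Fin r => F) c).comp
      (Pi.uniformContinuous_proj (fun _ : Fin r => Fin r → F) a)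
  exact ((h1 i l).comp uniformContinuous_fst).add
    ((((h1 i l).comp uniformContinuous_snd).add (uniformContinuous_star'.comp ((h1 l i).comp
      uniformContinuous_snd))).const_smul (1 / 2 : ℝ))

theorem TendstoCompactly.combine {f₁ f₂ : ℕ → ℝ≥0 → Mat F r} {g₁ g₂ : ℝ≥0 → Mat F r}
    (h₁ : TendstoCompactly f₁ g₁) (h₂ : TendstoCompactly f₂ g₂) :
    TendstoCompactly (fun j => BlockTridiagonal.combine (f₁ j) (f₂ j))
      (BlockTridiagonal.combine g₁ g₂) := fun K hK =>
  uniformContinuous_combine.comp_tendstoUniformlyOn fun u hu =>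
    (tendsto_id.prodMk tendsto_id).eventually ((h₁ K hK).prodMk (h₂ K hK) u hu)

theorem TendstoCompactly.tendsto {A : Type*} [UniformSpace A] {f : ℕ → ℝ≥0 → A} {g : ℝ≥0 → A}
    (h : TendstoCompactly f g) (x : ℝ≥0) : Tendsto (fun j => f j x) atTop (𝓝 (g x)) :=
  (h {x} isCompact_singleton).tendsto_at (mem_singleton x)

theorem exists_norm_opr_le {Y : ℕ → ℕ → Mat F r} {Z : ℝ≥0 → Mat F r}
    (h : TendstoCompactly (fun j => step (m j) (Y j)) Z) : ∃ C, ∀ j, ‖opr (Y j 0)‖ ≤ C := by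
  have hn : Continuous fun M : Mat F r => ‖opr M‖ :=
    Continuous.comp (g := norm) (continuous_norm (E := Vec F r →L[ℝ] Vec F r)) continuous_opr
  obtain ⟨C, hC⟩ := ((hn.tendsto _).comp (h.tendsto 0)).bddAbove_range
  exact ⟨C, fun j => by simpa [step] using hC (mem_range_self j)⟩

theorem IsScale.tendsto_ratio (hm : IsScale m) : Tendsto (fun n : ℕ => n / m n) atTop atTop := by
  have h : Tendsto (fun n : ℕ => m n / n) atTop (𝓝[>] 0) := by
    refine tendsto_nhdsWithin_iff.2 ⟨hm.isLittleO.tendsto_div_nhds_zero, ?_⟩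
    filter_upwards [eventually_gt_atTop 0] with n hn
    exact div_pos (hm.pos n) (Nat.cast_pos.2 hn)
  exact h.inv_tendsto_nhdsGT_zero.congr fun n => inv_div _ _

/-- The tail of a coupled family approximates the continuum problem. -/
theorem IsCoupled.exists_approx (hr : 0 < r) (hc : IsComparison η ζ) (hm : IsScale m)
    {s : ℕ → ℕ} (hs : StrictMono s) (h : IsCoupled m η ζ s Y₁ Y₂ Y) :
    ∃ (C : ℝ) (J : ℕ), Approx η ζ C (fun j => s (j + J)) (fun j => m (s (j + J)))
      (fun j => Y₁ (s (j + J))) (fun j => Y₂ (s (j + J))) Y := by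
  obtain ⟨hherm, hY, -, η₁, η₂, ω₁, ω₂, κ, κ₀, Z₁, Z₂, -, -, hd, hZ₁, hZ₂, -, -, hκ, rfl⟩ := h
  have hst := hs.tendsto_atTop
  obtain ⟨C₁, hC₁⟩ := exists_norm_opr_le hZ₁
  obtain ⟨C₂, hC₂⟩ := exists_norm_opr_le hZ₂
  obtain ⟨C₃, hC₃⟩ := hκ.bddAbove_range
  obtain ⟨J, hJ⟩ := eventually_atTop.1 (((hm.tendsto.comp hst).eventually_ge_atTop 1).and
    (hst.eventually_ge_atTop 1))
  have hmon : StrictMono fun j => s (j + J) := hs.comp (strictMono_id.add_const J)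
  have hJm : StrictMono fun j : ℕ => j + J := strictMono_id.add_const J
  refine ⟨max (max C₁ C₂) C₃, J, hr, hc, ?_, fun j => ?_, hm.tendsto.comp hmon.tendsto_atTop,
    ?_, hY, (hZ₁.combine hZ₂).comp hJm, Z₂, hZ₂.comp hJm⟩
  · exact (hd 0).1.trans ((hC₃ (mem_range_self 0)).trans (le_max_right _ _))
  · obtain ⟨h1, h2⟩ := hJ (j + J) (by omega)
    obtain ⟨h3, h4, h5, h6⟩ := hd (j + J)
    exact ⟨h2, h1, hherm _, (hC₁ _).trans ((le_max_left _ _).trans (le_max_left _ _)),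
      (hC₂ _).trans ((le_max_right _ _).trans (le_max_left _ _)), _, _, _, _, _, h3,
      (hC₃ (mem_range_self _)).trans (le_max_right _ _), h4, h5, h6⟩
  · exact hm.tendsto_ratio.comp hmon.tendsto_atTop

theorem exists_lower_bound {wn : ℕ → Fin r → ℝ} (hw : ∀ i, w i ≠ ⊥)
    (h : ∀ i, Tendsto (fun n => (wn n i : EReal)) atTop (𝓝 (w i))) : ∃ b, ∀ n i, -b ≤ wn n i := by
  have hex : ∀ i, ∃ b, ∀ n, -b ≤ wn n i := fun i => by
    obtain ⟨c, -, hc⟩ := EReal.lt_iff_exists_real_btwn.1 (bot_lt_iff_ne_bot.2 (hw i))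
    obtain ⟨B, hB⟩ := (show IsBoundedUnder (· ≥ ·) atTop fun n => wn n i from
      isBoundedUnder_of_eventually_ge (a := c) (((h i).eventually (lt_mem_nhds hc)).mono
        fun n hn => (EReal.coe_lt_coe_iff.1 hn).le)).bddBelow_range
    exact ⟨-B, fun n => by rw [neg_neg]; exact hB (mem_range_self n)⟩
  choose b hb using hex
  refine ⟨∑ i, |b i|, fun n i => ?_⟩
  linarith [hb i n, le_abs_self (b i),
    single_le_sum (f := fun i => |b i|) (fun i _ => abs_nonneg (b i)) (Finset.mem_univ i)]

theorem IsSubcritical.exists_boundaryLimit {wn : ℕ → Fin r → ℝ} (h : IsSubcritical u wn w) : ∃ b,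
    (∀ n i, -b ≤ wn n i) ∧
      ∀ t : ℕ → ℕ, StrictMono t → BoundaryLimit b (fun _ => u) (fun j => wn (t j)) u w := by
  obtain ⟨b, hb⟩ := exists_lower_bound h.bc.2 h.tendsto
  exact ⟨b, hb, fun t ht => ⟨fun _ => h.bc.1, fun j i => hb _ i, tendsto_const_nhds,
    fun i => (h.tendsto i).comp ht.tendsto_atTop⟩⟩

theorem IsBoundaryCondition.exists_boundaryLimit (h : IsBoundaryCondition u w) :
    ∃ b x, BoundaryLimit b (fun _ => u) x u w := by
  have hb : ∀ i, ((-∑ i, |(w i).toReal| : ℝ) : EReal) ≤ w i := fun i => by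
    by_cases hi : w i = ⊤
    · rw [hi]; exact le_top
    · rw [← EReal.coe_toReal hi (h.2 i)]
      refine EReal.coe_le_coe_iff.2 ?_
      linarith [neg_abs_le (w i).toReal, single_le_sum (f := fun i => |(w i).toReal|)
        (fun i _ => abs_nonneg _) (Finset.mem_univ i)]
  exact ⟨_, _, boundaryLimit_cut (fun _ => h.1) (fun _ => hb) tendsto_const_nhds
    (tendsto_const_nhds (x := w)) tendsto_id⟩

end Deterministic

/-! ### Tightness and limit laws through sequences of outcomes -/

section SeqLikely

variable {Ω : ℕ → Type*} [∀ n, MeasurableSpace (Ω n)] {P : ∀ n, Measure (Ω n)}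

/-- With probability arbitrarily close to one, uniformly in `n`, outcomes can be restricted so that
all sequences `ω i` of outcomes with indices `t i` increasing to infinity satisfy `Q t ω`. -/
def SeqLikely (P : ∀ n, Measure (Ω n)) (Q : ∀ t : ℕ → ℕ, (∀ i, Ω (t i)) → Prop) : Prop :=
  ∀ ε : ℝ≥0∞, 0 < ε → ∃ G : ∀ n, Set (Ω n), (∀ n, P n (G n)ᶜ ≤ ε) ∧
    ∀ t, StrictMono t → ∀ ω : ∀ i, Ω (t i), (∀ i, ω i ∈ G (t i)) → Q t ω

theorem SeqLikely.mono {Q Q' : ∀ t : ℕ → ℕ, (∀ i, Ω (t i)) → Prop} (h : SeqLikely P Q)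
    (hQ : ∀ t ω, StrictMono t → Q t ω → Q' t ω) : SeqLikely P Q' := fun ε hε =>
  let ⟨G, h1, h2⟩ := h ε hε
  ⟨G, h1, fun t ht ω hω => hQ t ω ht (h2 t ht ω hω)⟩

variable {E : Type*} [TopologicalSpace E] [PolishSpace E] [MeasurableSpace E] [BorelSpace E] {X : ∀
  n, Ω n → E}

theorem SeqLikely.tightInLaw [∀ n, IsProbabilityMeasure (P n)] (hX : ∀ n, AEMeasurable (X n) (P n))
    (h : SeqLikely P fun t ω => ∃ (p : ℕ → ℕ) (a : E), StrictMono p ∧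
      Tendsto (fun j => X (t (p j)) (ω (p j))) atTop (𝓝 a)) : TightInLaw P X := by
  intro ε hε
  let := TopologicalSpace.upgradeIsCompletelyMetrizable E
  have hε2 : 0 < ε / 2 := ENNReal.half_pos hε.ne'
  obtain ⟨G, hG, hseq⟩ := h _ hε2
  have hK : ∀ n, ∃ K : Set E, IsCompact K ∧ P n {ω | X n ω ∉ K} ≤ ε / 2 := fun n => by
    have := Measure.isProbabilityMeasure_map (hX n)
    obtain ⟨K, hK, h1⟩ := isTightMeasureSet_iff_exists_isCompact_measure_compl_le.1
      (isTightMeasureSet_singleton (μ := (P n).map (X n))) _ hε2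
    refine ⟨K, hK, ?_⟩
    have := h1 _ (mem_singleton _)
    rwa [Measure.map_apply_of_aemeasurable (hX n) hK.isClosed.measurableSet.compl] at this
  choose K hK hPK using hK
  refine ⟨_, isCompact_closure_iUnion (S := fun n => X n '' G n ∩ K n)
    (fun n => (hK n).closure_of_subset inter_subset_right) fun t V ht hV => ?_, fun n => ?_⟩
  · choose ω hω hωV using fun j => (hV j).1
    obtain ⟨p, a, hp, hlim⟩ := hseq t ht ω hω
    exact ⟨a, p, hp, hlim.congr fun j => hωV (p j)⟩
  · calc _ ≤ P n ((G n)ᶜ ∪ {ω | X n ω ∉ K n}) := measure_mono fun ω hω => by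
          by_contra hn
          rw [mem_union, not_or, mem_compl_iff, not_not, mem_ofPred_eq, not_not] at hn
          exact hω (subset_closure (mem_iUnion.2 ⟨n, ⟨ω, hn.1, rfl⟩, hn.2⟩))
      _ ≤ ε / 2 + ε / 2 := (measure_union_le _ _).trans (add_le_add (hG n) (hPK n))
      _ = ε := ENNReal.add_halves ε

/-- A property of all limits of likely sequences of outcomes holds almost surely for limit laws, by
the portmanteau theorem. -/
theorem SeqLikely.ae (hX : ∀ n, AEMeasurable (X n) (P n)) {s : ℕ → ℕ} (hs : StrictMono s)
    {μ : ℕ → ProbabilityMeasure E} {ν : ProbabilityMeasure E}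
    (hμ : ∀ j, (μ j : Measure E) = (P (s j)).map (X (s j))) (hlim : Tendsto μ atTop (𝓝 ν))
    {Q : E → Prop} (h : SeqLikely P fun t ω => ∀ x,
      Tendsto (fun j => X (t j) (ω j)) atTop (𝓝 x) → Q x) : ∀ᵐ x ∂(ν : Measure E), Q x := by
  let := TopologicalSpace.upgradeIsCompletelyMetrizable E
  rw [ae_iff, ← nonpos_iff_eq_zero]
  refine le_of_forall_gt_imp_ge_of_dense fun ε hε => ?_
  obtain ⟨G, hG, hseq⟩ := h ε hε
  set U : ℕ → Set E := fun T => (closure (⋃ j ≥ T, X (s j) '' G (s j)))ᶜ with hU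
  have hmono : Monotone U := fun T T' hT => compl_subset_compl.2 (closure_mono
    (biUnion_subset_biUnion_left fun j hj => hT.trans hj))
  have hUm : ∀ T, (ν : Measure E) (U T) ≤ ε := fun T => by
    refine (ProbabilityMeasure.le_liminf_measure_open_of_tendsto hlim
      isClosed_closure.isOpen_compl).trans ?_
    refine liminf_le_of_frequently_le' (Eventually.frequently ?_)
    filter_upwards [eventually_ge_atTop T] with j hj
    rw [hμ, Measure.map_apply_of_aemeasurable (hX _) isClosed_closure.measurableSet.compl]
    refine (measure_mono (t := (G (s j))ᶜ) fun ω hω hG => ?_).trans (hG (s j))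
    exact hω (subset_closure (mem_biUnion (show T ≤ j from hj) ⟨ω, hG, rfl⟩))
  calc (ν : Measure E) {x | ¬Q x} ≤ (ν : Measure E) (⋃ T, U T) := measure_mono fun x hx => by
        by_contra hn
        have hcl : ∀ T, x ∈ closure (⋃ j ≥ T, X (s j) '' G (s j)) := fun T => by
          by_contra h0; exact hn (mem_iUnion.2 ⟨T, h0⟩)
        have hex : ∀ T : ℕ, ∃ j ≥ T, ∃ ω ∈ G (s j), dist x (X (s j) ω) < 1 / (T + 1) := fun T => by
          obtain ⟨y, hy, hd⟩ := Metric.mem_closure_iff.1 (hcl T) _ (Nat.one_div_pos_of_nat (n := T))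
          obtain ⟨j, hj, ω, hω, rfl⟩ := mem_iUnion₂.1 hy
          exact ⟨j, hj, ω, hω, hd⟩
        choose j hj ω hω hd using hex
        obtain ⟨σ, hσ, hjσ⟩ := strictMono_subseq_of_tendsto_atTop
          (tendsto_atTop_mono hj tendsto_id : Tendsto j atTop atTop)
        refine hx (hseq (fun i => s (j (σ i))) (hs.comp hjσ) (fun i => ω (σ i)) (fun i => hω _) x
          ?_)
        refine tendsto_iff_dist_tendsto_zero.2 (squeeze_zero (fun _ => dist_nonneg) (fun i => ?_)
          (tendsto_one_div_add_atTop_nhds_zero_nat.comp hσ.tendsto_atTop))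
        rw [dist_comm]; exact (hd _).le
    _ = ⨆ T, (ν : Measure E) (U T) := hmono.measure_iUnion
    _ ≤ ε := iSup_le hUm

end SeqLikely

/-! ### Sampled paths -/

section Paths

/-- The values of a path at a dense sequence of times. -/
def sample (Y : ℝ≥0 → Mat F r) (l : ℕ) : Fin r → Fin r → F := Y (TopologicalSpace.denseSeq ℝ≥0 l)

theorem TendstoCompactly.sample {Y : ℕ → ℝ≥0 → Mat F r} {Z : ℝ≥0 → Mat F r}
    (h : TendstoCompactly Y Z) :
    Tendsto (fun j => BlockTridiagonal.sample (Y j)) atTop (𝓝 (BlockTridiagonal.sample Z)) :=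
  tendsto_pi_nhds.2 fun _ => h.tendsto _

theorem eq_of_sample_eq {Y Z : ℝ≥0 → Mat F r} (hY : Continuous Y) (hZ : Continuous Z)
    (h : sample Y = sample Z) : Y = Z :=
  (TopologicalSpace.denseRange_denseSeq ℝ≥0).equalizer hY hZ h

/-- A compact limit of step functions is right-continuous, hence determined by its sample. -/
theorem TendstoCompactly.eq_of_sample (hm : ∀ j, 0 < m j) {a : ℕ → ℕ → Mat F r}
    {y Y : ℝ≥0 → Mat F r} (h : TendstoCompactly (fun j => step (m j) (a j)) y) (hY : Continuous Y)
    (hs : BlockTridiagonal.sample y = BlockTridiagonal.sample Y) : y = Y := by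
  funext x
  ext i l
  refine eq_of_forall_dist_le fun ε hε => ?_
  have hu : TendstoUniformlyOn (fun j z => step (m j) (a j) z i l) (fun z => y z i l) atTop
      (Icc x (x + 1)) :=
    ((Pi.uniformContinuous_proj (fun _ : Fin r => F) l).comp (Pi.uniformContinuous_proj
      (fun _ : Fin r => Fin r → F) i)).comp_tendstoUniformlyOn (h _ isCompact_Icc)
  obtain ⟨j, hj⟩ := (Metric.tendstoUniformlyOn_iff.1 hu (ε / 3) (by positivity)).exists
  have hYc : Continuous fun z => Y z i l := (continuous_apply l).comp ((continuous_apply i).comp hY)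
  have hev : ∀ᶠ z in 𝓝[>] x, z ≤ x + 1 ∧ m j * z < ⌊m j * (x : ℝ)⌋₊ + 1 ∧
      dist (Y z i l) (Y x i l) < ε / 3 := by
    refine nhdsWithin_le_nhds ((eventually_le_nhds (lt_add_one x)).and (Eventually.and ?_
      (Metric.tendsto_nhds.1 (hYc.tendsto x) _ (by positivity))))
    exact (show Continuous fun z : ℝ≥0 => m j * (z : ℝ) by fun_prop).continuousAt.eventually
      (gt_mem_nhds (Nat.lt_floor_add_one _))
  obtain ⟨c, hc, hsub⟩ := (mem_nhdsGT_iff_exists_Ioo_subset).1 hev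
  obtain ⟨q, hq⟩ := (TopologicalSpace.denseRange_denseSeq ℝ≥0).exists_mem_open isOpen_Ioo
    (nonempty_Ioo.2 hc)
  set z := TopologicalSpace.denseSeq ℝ≥0 q with hz
  obtain ⟨h1, h2, h3⟩ := hsub hq
  have hfl : step (m j) (a j) z = step (m j) (a j) x := by
    have : ⌊m j * (z : ℝ)⌋₊ = ⌊m j * (x : ℝ)⌋₊ := by
      refine (Nat.floor_eq_iff (mul_nonneg (hm j).le z.2)).2 ⟨(Nat.floor_le
        (mul_nonneg (hm j).le x.2)).trans (mul_le_mul_of_nonneg_left ?_ (hm j).le), h2⟩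
      exact NNReal.coe_le_coe.2 hq.1.le
    simp only [step, this]
  have hyY : y z i l = Y z i l := congrFun (congrFun (congrFun hs q) i) l
  have d1 := hj x (left_mem_Icc.2 (le_add_of_nonneg_right zero_le_one))
  have d2 := hj z ⟨hq.1.le, h1⟩
  rw [hfl, hyY] at d2
  linarith [dist_triangle (y x i l) (step (m j) (a j) x i l) (Y z i l),
    dist_triangle (y x i l) (Y z i l) (Y x i l), dist_comm (step (m j) (a j) x i l) (Y z i l)]

theorem exists_subseq_path {K : Set (PathSpace F r)} (hK : IsCompact K) {f : ℕ → ℝ≥0 → Mat F r}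
    (hf : ∀ j, toPath (f j) ∈ K) :
    ∃ (Z : ℝ≥0 → Mat F r) (t : ℕ → ℕ), StrictMono t ∧ TendstoCompactly (fun j => f (t j)) Z := by
  have : (uniformity (Mat F r)).IsCountablyGenerated :=
    inferInstanceAs (uniformity (Fin r → Fin r → F)).IsCountablyGenerated
  have := UniformOnFun.isCountablyGenerated_uniformity (β := Mat F r) {K : Set ℝ≥0 | IsCompact K}
    (t := fun n : ℕ => Iic (n : ℝ≥0)) (fun n => isCompact_Iic_nnreal _)
    (fun a c h => Iic_subset_Iic.2 (Nat.cast_le.2 h)) fun s hs => by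
      obtain ⟨B, hB⟩ := hs.bddAbove
      obtain ⟨n, hn⟩ := exists_nat_ge B
      exact ⟨n, fun x hx => (hB hx).trans hn⟩
  obtain ⟨Z, -, t, ht, h⟩ := hK.tendsto_subseq hf
  exact ⟨UniformOnFun.toFun _ Z, t, ht, UniformOnFun.tendsto_iff_tendstoUniformlyOn.1 h⟩

end Paths

/-! ### Measurability of the discrete eigenvalues -/

section Measurability

variable {n : ℕ}

/-- Weyl's inequality: the ordered eigenvalues depend monotonically on the quadratic form. -/
theorem discreteEig_le_add (hr : 0 < r) {m : ℝ} (hm : 0 < m) {Y₁ Y₁' : ℕ → Mat F r}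
    (hY : ∀ l, (Y₁ l).IsHermitian) (hY' : ∀ l, (Y₁' l).IsHermitian) (Y₂ Y₂' : ℕ → Mat F r)
    (u : Fin r → Vec F r) (x : Fin r → ℝ) {k : ℕ} (hk : k < n) {ε : ℝ}
    (h : ∀ v : Vec F n, ⟪v, hOp m Y₁ Y₂ (specMat u x) hr n v⟫ ≤
      ⟪v, hOp m Y₁' Y₂' (specMat u x) hr n v⟫ + ε * ‖v‖ ^ 2) :
    discreteEig n m Y₁ Y₂ (specMat u x) k ≤ discreteEig n m Y₁' Y₂' (specMat u x) k + ε := by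
  obtain ⟨e, l, hf, hl, -⟩ := exists_flag_isLeast (n := n) Y₂ hm hr hY u x
  obtain ⟨e', l', hf', hl', -⟩ := exists_flag_isLeast (n := n) Y₂' hm hr hY' u x
  rw [(hl k hk).2, (hl' k hk).2]
  have hort : ∀ i j : Fin (k + 1), dag (e' i) (e' j) = if i = j then 1 else 0 := fun i j => by
    rw [hf'.orthonormal (by omega) (by omega)]; simp only [Fin.ext_iff]
  refine IsEigenFlag.le_of_comb (k := k) (v := fun i : Fin (k + 1) => e' i)
    (fun i hi => hf i (by omega)) (fun c hc => comb_ne_zero hort hc) fun c => (h _).trans ?_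
  rw [add_mul]
  exact add_le_add_left (inner_comb_le (μ := fun i : Fin (k + 1) => l' i)
    hort (hOp_op m Y₁' Y₂' (specMat u x) hr) (fun i => (hf' i (by omega)).2.2.1)
    (fun i => hf'.mono (by omega) hk) c) _

theorem measurable_discreteEig (hr : 0 < r) {m : ℝ} (hm : 0 < m) {Ω : Type*} [MeasurableSpace Ω]
    {Y₁ Y₂ : Ω → ℕ → Mat F r} (h₁ : ∀ l i j, StronglyMeasurable fun ω => Y₁ ω l i j)
    (h₂ : ∀ l i j, StronglyMeasurable fun ω => Y₂ ω l i j) (hY : ∀ ω l, (Y₁ ω l).IsHermitian)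
    (u : Fin r → Vec F r) (x : Fin r → ℝ) (k : ℕ) :
    Measurable fun ω => discreteEig n m (Y₁ ω) (Y₂ ω) (specMat u x) k := by
  rcases le_or_gt n k with hk | hk
  · simp only [discreteEig_eq_of_le _ hm hr (hY _) u x hk]; exact measurable_const
  let : MeasurableSpace F := borel F
  have : BorelSpace F := ⟨rfl⟩
  have hop : ∀ {Y : Ω → ℕ → Mat F r}, (∀ l i j, StronglyMeasurable fun ω => Y ω l i j) → ∀ l,
      StronglyMeasurable fun ω => opr (Y ω l) := fun h l =>
    Continuous.comp_stronglyMeasurable (f := fun ω => (_ : Fin r → Fin r → F)) continuous_opr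
      (measurable_pi_iff.2 fun i => measurable_pi_iff.2 fun j =>
        (h l i j).measurable).stronglyMeasurable
  have hinc : ∀ {Y : Ω → ℕ → Mat F r}, (∀ l i j, StronglyMeasurable fun ω => Y ω l i j) →
      ∀ l v, StronglyMeasurable fun ω => incr m (fun l => opr (Y ω l)) l v := fun h l v => by
    by_cases h0 : l = 0
    · simp only [incr, prev, h0, if_true, sub_zero]
      exact (StronglyMeasurable.apply_continuousLinearMap (hop h 0) v).const_smul m
    · simp only [incr, prev, h0, if_false]
      exact (StronglyMeasurable.apply_continuousLinearMap
        (StronglyMeasurable.sub (hop h l) (hop h (l - 1))) v).const_smul m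
  set B := stdOrthonormalBasis ℝ (Vec F n)
  set a : Ω → (_ × _ → ℝ) := fun ω p => inner ℝ (B p.1)
    (hOp m (Y₁ ω) (Y₂ ω) (specMat u x) hr n (B p.2))
    with ha
  have ham : Measurable a := measurable_pi_iff.2 fun p => by
    simp only [ha, inner_hOp _ hm, dform, iform]
    refine StronglyMeasurable.measurable ?_
    refine (StronglyMeasurable.const_mul ?_ _).add_const _ |>.const_mul _
    refine Finset.stronglyMeasurable_fun_sum _ fun l _ => ?_
    have c : ∀ v : Vec F r, StronglyMeasurable fun _ : Ω => v := fun v => stronglyMeasurable_const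
    exact (stronglyMeasurable_const.add ((c _).inner (hinc h₁ _ _))).add
      ((((c _).inner (hinc h₂ _ _)).add ((hinc h₂ _ _).inner (c _))).const_mul _)
  -- the eigenvalue is a Lipschitz function of the matrix entries
  set N : ℕ := Fintype.card (Fin (Module.finrank ℝ (Vec F n)))
  have hq : ∀ (T : Vec F n →ₗ[ℝ] Vec F n) (v : Vec F n), ⟪v, T v⟫ =
      ∑ i, ∑ j, ⟪v, B i⟫ * (⟪B j, v⟫ * ⟪B i, T (B j)⟫) := fun T v => by
    rw [← B.sum_inner_mul_inner v (T v)]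
    refine sum_congr rfl fun i _ => ?_
    conv_lhs => rw [← B.sum_repr' v, map_sum, inner_sum, B.sum_repr' v]
    simp only [map_smul, real_inner_smul_right, mul_sum]
  have hle : ∀ ω ω', discreteEig n m (Y₁ ω) (Y₂ ω) (specMat u x) k ≤
      discreteEig n m (Y₁ ω') (Y₂ ω') (specMat u x) k + (N * N : ℕ) * dist (a ω) (a ω') :=
    fun ω ω' => by
    refine discreteEig_le_add hr hm (hY ω) (hY ω') _ _ u x hk fun v => ?_
    rw [← sub_le_iff_le_add', hq, hq, ← sum_sub_distrib]
    simp only [← sum_sub_distrib]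
    have hb : ∀ i, |inner ℝ v (B i)| ≤ ‖v‖ := fun i => by
      simpa [B.norm_eq_one i] using abs_real_inner_le_norm v (B i)
    calc _ ≤ ∑ _i : Fin (Module.finrank ℝ (Vec F n)), ∑ _j : Fin (Module.finrank ℝ (Vec F n)),
          ‖v‖ * (‖v‖ * dist (a ω) (a ω')) := by
          refine sum_le_sum fun i _ => sum_le_sum fun j _ => ?_
          rw [← mul_sub, ← mul_sub]
          refine (le_abs_self _).trans ?_
          rw [abs_mul, abs_mul]
          have h1 : |inner ℝ (B j) v| ≤ ‖v‖ := by rw [real_inner_comm]; exact hb j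
          exact mul_le_mul (hb i) (mul_le_mul h1 (dist_le_pi_dist (a ω) (a ω') (i, j))
            (abs_nonneg _) (norm_nonneg _)) (by positivity) (norm_nonneg _)
      _ = _ := by
          simp only [sum_const, Finset.card_univ, nsmul_eq_mul]
          push_cast; ring
  have hdist : ∀ ω ω', dist (discreteEig n m (Y₁ ω) (Y₂ ω) (specMat u x) k)
      (discreteEig n m (Y₁ ω') (Y₂ ω') (specMat u x) k) ≤ (N * N : ℕ) * dist (a ω) (a ω') :=
    fun ω ω' => by
    have h1 := hle ω ω'
    have h2 := hle ω' ω
    rw [dist_comm (a ω')] at h2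
    rw [Real.dist_eq, abs_le]
    constructor <;> linarith
  rcases isEmpty_or_nonempty Ω with hΩ | hΩ
  · exact measurable_of_empty _
  obtain ⟨g, hg, hfg⟩ := (show LipschitzOnWith (N * N : ℕ) (fun y =>
    discreteEig n m (Y₁ (Function.invFun a y)) (Y₂ (Function.invFun a y)) (specMat u x) k) (range a)
    from LipschitzOnWith.of_dist_le_mul fun y hy z hz => by
      have := hdist (Function.invFun a y) (Function.invFun a z)
      rwa [Function.invFun_eq hy, Function.invFun_eq hz] at this).extend_real
  convert hg.continuous.measurable.comp ham using 2 with ω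
  refine (dist_le_zero.1 ((hdist _ _).trans ?_)).trans (hfg (mem_range_self ω))
  rw [Function.invFun_eq (f := a) ⟨ω, rfl⟩, dist_self, mul_zero]

end Measurability

/-! ### The random ensemble along likely sequences -/

section Random

variable {Ω : ℕ → Type*} [∀ n, MeasurableSpace (Ω n)] {P : ∀ n, Measure (Ω n)}
  {Y₁ Y₂ : ∀ n, Ω n → ℕ → Mat F r}

/-- The `(k + 1)`st lowest eigenvalue of the operator of size `n`, for the outcome `ω`. -/
abbrev sampleEig (m : ℕ → ℝ) (Y₁ Y₂ : ∀ n, Ω n → ℕ → Mat F r) (u : Fin r → Vec F r)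
    (wn : ℕ → Fin r → ℝ) (k n : ℕ) (ω : Ω n) : ℝ :=
  discreteEig n (m n) (Y₁ n ω) (Y₂ n ω) (specMat u (wn n)) k

/-- Outcomes `ω j` of the ensembles of sizes `t j`, with uniformly good data, whose integrated
potentials converge compactly and that satisfy `A`. -/
structure GoodSeq (η ζ : ℝ≥0 → ℝ) (m : ℕ → ℝ) (Y₁ Y₂ : ∀ n, Ω n → ℕ → Mat F r)
    (A : ∀ n, Ω n → Prop) (C : ℝ) (t : ℕ → ℕ) (ω : ∀ j, Ω (t j)) (Z₁ Z₂ : ℝ≥0 → Mat F r) :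
    Prop where
  pos : 0 < r
  cmp : IsComparison η ζ
  isScale : IsScale m
  one_le : 1 ≤ C
  mono : StrictMono t
  good : ∀ j, IsGood η ζ C (t j) (m (t j)) (Y₁ (t j) (ω j)) (Y₂ (t j) (ω j))
  prop : ∀ j, A (t j) (ω j)
  lim₁ : TendstoCompactly (fun j => step (m (t j)) (Y₁ (t j) (ω j))) Z₁
  lim₂ : TendstoCompactly (fun j => step (m (t j)) (Y₂ (t j) (ω j))) Z₂

variable {A : ∀ n, Ω n → Prop} {t : ℕ → ℕ} {ω : ∀ j, Ω (t j)} {Z₁ Z₂ : ℝ≥0 → Mat F r}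

theorem GoodSeq.approx (h : GoodSeq η ζ m Y₁ Y₂ A C t ω Z₁ Z₂) (hY : Continuous (combine Z₁ Z₂)) :
    Approx η ζ C t (fun j => m (t j))
      (fun j => Y₁ (t j) (ω j)) (fun j => Y₂ (t j) (ω j)) (combine Z₁ Z₂) :=
  ⟨h.pos, h.cmp, h.one_le, h.good, h.isScale.tendsto.comp h.mono.tendsto_atTop,
    h.isScale.tendsto_ratio.comp h.mono.tendsto_atTop, hY, h.lim₁.combine h.lim₂, Z₂, h.lim₂⟩

/-- With probability close to one, outcomes have subsequences with uniformly good data and compactly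
converging potentials. -/
theorem seqLikely_good (hr : 0 < r) (hc : IsComparison η ζ) (hm : IsScale m)
    (hpot : IsPotentialProcess Y₁ Y₂)
    (ht₁ : TightInLaw P fun n ω => toPath (step (m n) (Y₁ n ω)))
    (ht₂ : TightInLaw P fun n ω => toPath (step (m n) (Y₂ n ω)))
    (hgo : GrowthOscillation P m Y₁ Y₂ η ζ) (hA : ∀ n, ∀ᵐ ω ∂(P n), A n ω) :
    SeqLikely P fun t ω => ∃ (p : ℕ → ℕ) (C : ℝ) (Z₁ Z₂ : ℝ≥0 → Mat F r), StrictMono p ∧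
      GoodSeq η ζ m Y₁ Y₂ A C (fun j => t (p j)) (fun j => ω (p j)) Z₁ Z₂ := by
  obtain ⟨η₁, η₂, ω₁, ω₂, κ, -, -, -, hκ1, hκt, hdec⟩ := hgo
  intro ε hε
  have hε3 : 0 < ε / 3 := ENNReal.div_pos hε.ne' (by simp)
  obtain ⟨K₀, hK₀, hP₀⟩ := hκt _ hε3
  obtain ⟨K₁, hK₁, hP₁⟩ := ht₁ _ hε3
  obtain ⟨K₂, hK₂, hP₂⟩ := ht₂ _ hε3
  obtain ⟨C₀, hC₀⟩ := hK₀.bddAbove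
  refine ⟨fun n => {ω | (A n ω ∧ Decomposes (m n) (Y₁ n ω) (η₁ n ω) (ω₁ n ω) ∧
      Decomposes (m n) (Y₂ n ω) (η₂ n ω) (ω₂ n ω) ∧
      GrowthBounds n (m n) (κ n ω) η ζ (η₁ n ω) (η₂ n ω) (ω₁ n ω) (ω₂ n ω)) ∧ κ n ω ∈ K₀ ∧
      toPath (step (m n) (Y₁ n ω)) ∈ K₁ ∧ toPath (step (m n) (Y₂ n ω)) ∈ K₂}, fun n => ?_,
    fun t ht ω hω => ?_⟩
  · rw [← ENNReal.add_thirds ε, ← zero_add (ε / 3 + ε / 3 + ε / 3), ← ae_iff.1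
      ((hA n).and (hdec n))]
    simp only [add_assoc]
    refine (measure_mono (t := _ ∪ ({ω | κ n ω ∉ K₀} ∪ ({ω | toPath (step (m n) (Y₁ n ω)) ∉ K₁} ∪
      {ω | toPath (step (m n) (Y₂ n ω)) ∉ K₂}))) fun ω hω => ?_).trans
      ((measure_union_le _ _).trans (add_le_add_right ((measure_union_le _ _).trans (add_le_add
        (hP₀ n) ((measure_union_le _ _).trans (add_le_add (hP₁ n) (hP₂ n))))) _))
    simp only [mem_compl_iff, mem_ofPred_eq, mem_union] at hω ⊢
    tauto
  · obtain ⟨Z₁, p₁, hp₁, hZ₁⟩ := exists_subseq_path hK₁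
      (f := fun j => step (m (t j)) (Y₁ (t j) (ω j))) fun j => (hω j).2.2.1
    obtain ⟨Z₂, p₂, hp₂, hZ₂⟩ := exists_subseq_path hK₂
      (f := fun j => step (m (t (p₁ j))) (Y₂ (t (p₁ j)) (ω (p₁ j)))) fun j => (hω _).2.2.2
    have hp := hp₁.comp hp₂
    have hZ₁' := hZ₁.comp hp₂
    obtain ⟨C₁, hC₁⟩ := exists_norm_opr_le hZ₁'
    obtain ⟨C₂, hC₂⟩ := exists_norm_opr_le hZ₂
    have htp := (ht.comp hp).tendsto_atTop
    obtain ⟨J, hJ⟩ := eventually_atTop.1 (((hm.tendsto.comp htp).eventually_ge_atTop 1).and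
      (htp.eventually_ge_atTop 1))
    have hJm : StrictMono fun j : ℕ => j + J := strictMono_id.add_const J
    refine ⟨fun j => p₁ (p₂ (j + J)), max (max C₁ C₂) C₀, Z₁, Z₂, hp.comp hJm, hr, hc, hm,
      (hκ1 _ _).trans ((hC₀ (hω 0).2.1).trans (le_max_right _ _)), (ht.comp hp).comp hJm,
      fun j => ?_, fun j => (hω _).1.1, hZ₁'.comp hJm, hZ₂.comp hJm⟩
    obtain ⟨h1, h2⟩ := hJ (j + J) (by omega)
    exact ⟨h2, h1, hpot.herm _ _, (hC₁ _).trans ((le_max_left _ _).trans (le_max_left _ _)),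
      (hC₂ _).trans ((le_max_right _ _).trans (le_max_left _ _)), _, _, _, _, _, hκ1 _ _,
      (hC₀ (hω _).2.1).trans (le_max_right _ _), (hω _).1.2⟩

/-- Along good sequences, discrete eigenvalues and unit eigenvectors are precompact. -/
theorem GoodSeq.exists_subseq (h : GoodSeq η ζ m Y₁ Y₂ A C t ω Z₁ Z₂) {wn : ℕ → Fin r → ℝ}
    (hw : IsSubcritical u wn w) (k : ℕ) {V : ℕ → L2 F r}
    (hV : ∀ j, k < t j → IsUnitEigen (t j) (m (t j)) (Y₁ (t j) (ω j)) (Y₂ (t j) (ω j))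
      (specMat u (wn (t j))) k (V j)) :
    ∃ (p : ℕ → ℕ) (l : ℝ) (V₀ : L2 F r), StrictMono p ∧
      Tendsto (fun j => sampleEig m Y₁ Y₂ u wn k (t (p j)) (ω (p j))) atTop (𝓝 l) ∧
      Tendsto (fun j => V (p j)) atTop (𝓝 V₀) := by
  obtain ⟨b, hb, -⟩ := hw.exists_boundaryLimit
  obtain ⟨Λ, ρ, hΛ⟩ := exists_discreteEig_bound (F := F) h.pos h.cmp h.one_le k
  have ht := h.mono.tendsto_atTop
  have hm := h.isScale
  obtain ⟨J, hJ⟩ := eventually_atTop.1 ((ht.eventually_gt_atTop k).and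
    (((hm.tendsto.comp ht).eventually_ge_atTop ρ).and
      ((hm.tendsto_ratio.comp ht).eventually_ge_atTop ρ)))
  have hJm : StrictMono fun j : ℕ => j + J := strictMono_id.add_const J
  obtain ⟨p, l, V₀, -, -, -, hp, h1, h2, -⟩ := exists_lattice_subseq h.pos h.cmp h.one_le
    (n := fun j => t (j + J)) (fun j => h.good (j + J)) ((hm.tendsto.comp ht).comp
      hJm.tendsto_atTop) (u' := fun _ => u) (x := fun j => wn (t (j + J))) (fun _ => hw.bc.1)
    (fun j i => hb _ i) (Λ := Λ) (fun j => by
      obtain ⟨-, h3, h4⟩ := hJ (j + J) (by omega)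
      exact hΛ _ _ _ _ (h.good (j + J)) h3 ((le_div_iff₀ (hm.pos _)).1 h4) u (wn (t (j + J)))
        hw.bc.1)
    (V := fun j => V (j + J)) (fun j => (hV _ (hJ (j + J) (by omega)).1).1)
    fun j => (hV _ (hJ (j + J) (by omega)).1).2
  exact ⟨fun j => p j + J, l, V₀, hJm.comp hp, h1, h2⟩

end Random

/-! ### Limit laws of the random ensemble -/

section LimitLaw

/-- If a measure on a product of Polish spaces is carried by the graph of a function, then that
function is measurable up to null sets, by the Lusin–Souslin theorem. -/
theorem aemeasurable_of_graph {α β : Type*} [TopologicalSpace α] [PolishSpace α]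
    [MeasurableSpace α] [BorelSpace α] [TopologicalSpace β] [PolishSpace β] [MeasurableSpace β]
    [BorelSpace β] {ν : Measure (α × β)} {g : α → β} (h : ∀ᵐ x ∂ν, x.2 = g x.1) :
    AEMeasurable g (ν.map Prod.fst) := by
  obtain ⟨T, hT, hTm, hT0⟩ := exists_measurable_superset_of_null (ae_iff.1 h)
  have hB : ∀ x ∈ Tᶜ, x.2 = g x.1 := fun x hx => by_contra fun hn => hx (hT hn)
  have himg : ∀ S, MeasurableSet S → S ⊆ Tᶜ → MeasurableSet (Prod.fst '' S) := fun S hS hST =>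
    hS.image_of_measurable_injOn measurable_fst fun x hx y hy hxy =>
      Prod.ext hxy (by rw [hB x (hST hx), hB y (hST hy), hxy])
  have hD := himg _ hTm.compl subset_rfl
  have hDae : ∀ᵐ p ∂(ν.map Prod.fst), p ∈ Prod.fst '' Tᶜ := by
    rw [ae_iff, show {p | p ∉ Prod.fst '' Tᶜ} = (Prod.fst '' Tᶜ)ᶜ from rfl,
      Measure.map_apply measurable_fst hD.compl]
    exact measure_mono_null (fun x hx => by_contra fun hn => hx ⟨x, hn, rfl⟩) hT0
  rw [← Measure.restrict_eq_self_of_ae_mem hDae]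
  refine aemeasurable_restrict_of_measurable_subtype hD fun S hS => ?_
  convert measurable_subtype_coe (himg _ (hTm.compl.inter (measurable_snd hS)) inter_subset_left)
    using 1
  ext ⟨p, x, hx, rfl⟩
  constructor
  · exact fun hp => ⟨x, ⟨hx, by rw [mem_preimage, hB x hx]; exact hp⟩, rfl⟩
  · rintro ⟨y, ⟨hy, hyS⟩, hyx⟩
    change g x.1 ∈ S
    simp only at hyx
    rw [← hyx, ← hB y hy]; exact hyS

variable (F r) in

/-- Continuous paths of self-adjoint matrices that start at zero. -/
abbrev PathC : Type :=
  {c : C(ℝ≥0, Fin r → Fin r → F) // c 0 = 0 ∧ ∀ x i j, star (c x j i) = c x i j}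

instance : PolishSpace (PathC F r) := by
  refine IsClosed.polishSpace ?_
  have he : ∀ x i j, Continuous fun c : C(ℝ≥0, Fin r → Fin r → F) => c x i j := fun x i j =>
    (continuous_apply j).comp ((continuous_apply i).comp (continuous_eval_const x))
  refine (isClosed_eq (continuous_eval_const 0) continuous_const).inter ?_
  change IsClosed {c : C(ℝ≥0, Fin r → Fin r → F) | ∀ x i j, star (c x j i) = c x i j}
  rw [show {c : C(ℝ≥0, Fin r → Fin r → F) | ∀ x i j, star (c x j i) = c x i j} =
    ⋂ x, ⋂ i, ⋂ j, {c | star (c x j i) = c x i j} by ext; simp]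
  exact isClosed_iInter fun x => isClosed_iInter fun i => isClosed_iInter fun j =>
    isClosed_eq (uniformContinuous_star'.continuous.comp (he x j i)) (he x i j)

instance : MeasurableSpace (PathC F r) := borel _

instance : BorelSpace (PathC F r) := ⟨rfl⟩

/-- A path as a function with values in the matrices. -/
def PathC.path (c : PathC F r) : ℝ≥0 → Mat F r := c.1

theorem PathC.continuous_path (c : PathC F r) : Continuous c.path := c.1.continuous

/-- The continuous path with a given sample, or zero. -/
def fromSample : (ℕ → Fin r → Fin r → F) → PathC F r :=
  Function.extend (fun c : PathC F r => sample c.path) id fun _ =>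
    ⟨0, rfl, fun _ _ _ => star_zero _⟩

theorem sample_injective : Function.Injective fun c : PathC F r => sample c.path := fun c d h =>
  Subtype.ext (ContinuousMap.ext fun x =>
    congrFun (eq_of_sample_eq c.continuous_path d.continuous_path h) x)

theorem fromSample_sample (c : PathC F r) : fromSample (sample c.path) = c :=
  sample_injective.extend_apply _ _ c

instance : PolishSpace (ℕ → Fin r → Fin r → F) := { }

variable [MeasurableSpace F] [BorelSpace F]

theorem measurableEmbedding_sample : MeasurableEmbedding fun c : PathC F r => sample c.path :=
  Continuous.measurableEmbedding (continuous_pi fun _ =>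
    (continuous_eval_const _).comp continuous_subtype_val) sample_injective

theorem measurable_fromSample : Measurable (fromSample : _ → PathC F r) :=
  measurableEmbedding_sample.measurable_extend measurable_id measurable_const

theorem isContinuousProcess_fromSample {Ω : Type*} [MeasurableSpace Ω]
    {X : Ω → ℕ → Fin r → Fin r → F} (hX : Measurable X) :
    IsContinuousProcess fun ω => (fromSample (X ω)).path where
  meas x i j := by
    have he : Continuous fun c : PathC F r => c.path x i j := (continuous_apply j).comp
      ((continuous_apply i).comp ((continuous_eval_const x).comp continuous_subtype_val))
    exact (he.measurable.comp (measurable_fromSample.comp hX)).stronglyMeasurable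
  cont ω := (fromSample (X ω)).continuous_path
  zero ω := (fromSample (X ω)).2.1
  herm ω x := Matrix.IsHermitian.ext ((fromSample (X ω)).2.2 x)

variable {Ω' : Type*} [MeasurableSpace Ω'] {P' : Measure Ω'} {Y : Ω' → ℝ≥0 → Mat F r}

theorem IsContinuousProcess.exists_pathC (hY : IsContinuousProcess Y) (ω : Ω') :
    ∃ c : PathC F r, c.path = Y ω :=
  ⟨⟨⟨Y ω, hY.cont ω⟩, hY.zero ω, fun x i j => (hY.herm ω x).apply i j⟩, rfl⟩

theorem IsContinuousProcess.measurable_sample (hY : IsContinuousProcess Y) :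
    Measurable fun ω => sample (Y ω) :=
  measurable_pi_iff.2 fun _ => measurable_pi_iff.2 fun i => measurable_pi_iff.2 fun j =>
    (hY.meas _ i j).measurable

theorem IsContinuousProcess.fromSample_eq (hY : IsContinuousProcess Y) (ω : Ω') :
    (fromSample (sample (Y ω))).path = Y ω := by
  obtain ⟨c, hc⟩ := hY.exists_pathC ω
  rw [← hc, fromSample_sample]

theorem continuous_toPath : Continuous fun c : PathC F r => toPath c.path := by
  refine continuous_iff_continuousAt.2 fun c => UniformOnFun.tendsto_iff_tendstoUniformlyOn.2 ?_
  exact ContinuousMap.tendsto_iff_forall_isCompact_tendstoUniformlyOn.1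
    (continuous_subtype_val.tendsto c)

/-- The law of a continuous process is determined by that of its sample. -/
theorem IsContinuousProcess.equalInLaw (hY : IsContinuousProcess Y) {Ω : Type*}
    [MeasurableSpace Ω] {ν : Measure Ω} {X : Ω → ℕ → Fin r → Fin r → F} (hX : Measurable X)
    (h : ν.map X = P'.map fun ω => sample (Y ω)) :
    EqualInLaw ν (fun ω => toPath (fromSample (X ω)).path) P' fun ω => toPath (Y ω) := by
  intro Φ
  have hm : Measurable fun p => Φ (toPath (fromSample (F := F) (r := r) p).path) :=
    (Φ.continuous.comp continuous_toPath).measurable.comp measurable_fromSample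
  have h1 := integral_map (μ := ν) hX.aemeasurable hm.aestronglyMeasurable
  have h2 := integral_map (μ := P') hY.measurable_sample.aemeasurable hm.aestronglyMeasurable
  simp only [hY.fromSample_eq] at h2
  rw [← h1, ← h2, h]

variable {Ω : ℕ → Type*} [∀ n, MeasurableSpace (Ω n)] {P : ∀ n, Measure (Ω n)} [∀ n,
  IsProbabilityMeasure (P n)] [IsProbabilityMeasure P'] {Y₁ Y₂ : ∀ n, Ω n → ℕ → Mat F r}

/-- Sampled paths, together with a further observable with values in `S`. -/
abbrev Sample (F : Type) (r : ℕ) (S : Type*) := (ℕ → Fin r → Fin r → F) × S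

variable (hr : 0 < r) (hc : IsComparison η ζ) (hm : IsScale m) (hpot : IsPotentialProcess Y₁ Y₂)
  (htc : TightConvergent P m Y₁ Y₂ P' Y) (hgo : GrowthOscillation P m Y₁ Y₂ η ζ)

include hr hc hm hpot htc hgo in
/-- Joint subsequential limit laws of the sampled integrated potential and of a further observable
`Z`. Almost every point of the limit law is the limit of a good sequence of outcomes. -/
theorem exists_limit_law {S : Type*} [TopologicalSpace S] [PolishSpace S] [MeasurableSpace S]
    [BorelSpace S]
    {Z : ∀ n, Ω n → S} (hZ : ∀ n, AEMeasurable (Z n) (P n)) {A : ∀ n, Ω n → Prop}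
    (hA : ∀ n, ∀ᵐ ω ∂(P n), A n ω)
    (hsub : ∀ (C : ℝ) (t : ℕ → ℕ) (ω : ∀ j, Ω (t j)) (Z₁ Z₂ : ℝ≥0 → Mat F r),
      GoodSeq η ζ m Y₁ Y₂ A C t ω Z₁ Z₂ → ∃ (p : ℕ → ℕ) (a : S), StrictMono p ∧
        Tendsto (fun j => Z (t (p j)) (ω (p j))) atTop (𝓝 a))
    {s : ℕ → ℕ} (hs : StrictMono s) :
    ∃ t : ℕ → ℕ, StrictMono t ∧ ∃ ν : Measure (Sample F r S),
      IsProbabilityMeasure ν ∧ ν.map Prod.fst = P'.map (fun ω => sample (Y ω)) ∧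
      (∀ Φ : S →ᵇ ℝ, Tendsto (fun j => ∫ ω, Φ (Z (s (t j)) ω) ∂(P (s (t j)))) atTop
        (𝓝 (∫ x, Φ x.2 ∂ν))) ∧
      ∀ᵐ x ∂ν, ∃ (C : ℝ) (τ : ℕ → ℕ) (ω : ∀ j, Ω (τ j)) (Z₁ Z₂ : ℝ≥0 → Mat F r),
        GoodSeq η ζ m Y₁ Y₂ A C τ ω Z₁ Z₂ ∧ combine Z₁ Z₂ = (fromSample x.1).path ∧
        Tendsto (fun j => Z (τ j) (ω j)) atTop (𝓝 x.2) := by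
  have : PolishSpace (Sample F r S) := { }
  have : BorelSpace (Sample F r S) := Prod.borelSpace
  have : OpensMeasurableSpace (Sample F r S) := inferInstance
  set R : ∀ n, Ω n → ℕ → Fin r → Fin r → F := fun n ω =>
    sample (combine (step (m n) (Y₁ n ω)) (step (m n) (Y₂ n ω))) with hR
  have hRm : ∀ n, Measurable (R n) := fun n => measurable_pi_iff.2 fun l =>
    measurable_pi_iff.2 fun i => measurable_pi_iff.2 fun j =>
      ((hpot.meas₁ n _ i j).add (((hpot.meas₂ n _ i j).add
        (uniformContinuous_star'.continuous.comp_stronglyMeasurable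
          (hpot.meas₂ n _ j i))).const_smul (1 / 2 : ℝ))).measurable
  have hX : ∀ n, AEMeasurable (fun ω => (R n ω, Z n ω)) (P n) := fun n =>
    (hRm n).aemeasurable.prodMk (hZ n)
  have hgood := seqLikely_good hr hc hm hpot htc.tight₁ htc.tight₂ hgo hA
  have htight : TightInLaw P fun n ω => (R n ω, Z n ω) :=
    SeqLikely.tightInLaw hX <| hgood.mono fun t ω _ ⟨p, C, Z₁, Z₂, hp, h⟩ => by
      obtain ⟨q, a, hq, ha⟩ := hsub _ _ _ _ _ h
      exact ⟨p ∘ q, _, hp.comp hq, (((h.lim₁.combine h.lim₂).comp hq).sample).prodMk_nhds ha⟩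
  set μ : ℕ → ProbabilityMeasure (Sample F r S) := fun j =>
    ⟨(P (s j)).map fun ω => (R (s j) ω, Z (s j) ω), Measure.isProbabilityMeasure_map (hX _)⟩ with hμ
  have hcpt : IsCompact (closure (range μ)) := by
    refine isCompact_closure_of_isTightMeasureSet ?_
    refine isTightMeasureSet_iff_exists_isCompact_measure_compl_le.2 fun ε hε => ?_
    obtain ⟨K, hK, h⟩ := htight ε hε
    refine ⟨K, hK, ?_⟩
    rintro _ ⟨_, ⟨j, rfl⟩, rfl⟩
    exact (Measure.map_apply_of_aemeasurable (hX _) hK.isClosed.measurableSet.compl).trans_le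
      (h (s j))
  obtain ⟨ν, -, t, ht, hν⟩ := hcpt.tendsto_subseq fun j => subset_closure (mem_range_self j)
  have hint : ∀ Φ : (Sample F r S) →ᵇ ℝ, Tendsto (fun j =>
      ∫ ω, Φ (R (s (t j)) ω, Z (s (t j)) ω) ∂(P (s (t j)))) atTop
        (𝓝 (∫ x, Φ x ∂(ν : Measure (Sample F r S)))) :=
    fun Φ => by
      refine (ProbabilityMeasure.tendsto_iff_forall_integral_tendsto.1 hν Φ).congr fun j => ?_
      exact integral_map (hX _) Φ.continuous.measurable.aestronglyMeasurable
  have hfst : (ν : Measure (Sample F r S)).map Prod.fst = P'.map fun ω => sample (Y ω) := by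
    have := Measure.isProbabilityMeasure_map (μ := (ν : Measure (Sample F r S)))
      measurable_fst.aemeasurable
    have := Measure.isProbabilityMeasure_map (μ := P') htc.limit.measurable_sample.aemeasurable
    refine ext_of_forall_integral_eq_of_IsFiniteMeasure fun φ => ?_
    rw [integral_map measurable_fst.aemeasurable φ.continuous.measurable.aestronglyMeasurable,
      integral_map htc.limit.measurable_sample.aemeasurable
        φ.continuous.measurable.aestronglyMeasurable]
    have hc : Continuous fun f : PathSpace F r => sample (UniformOnFun.toFun _ f) :=
      continuous_pi fun l => (UniformOnFun.uniformContinuous_eval_of_mem (Mat F r) _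
        (mem_singleton (TopologicalSpace.denseSeq ℝ≥0 l)) isCompact_singleton).continuous
    refine tendsto_nhds_unique (hint (φ.compContinuous ⟨_, continuous_fst⟩)) ?_
    exact (htc.conv (φ.compContinuous ⟨_, hc⟩)).comp (hs.comp ht).tendsto_atTop
  refine ⟨t, ht, ν, ν.2, hfst, fun Φ => hint (Φ.compContinuous ⟨_, continuous_snd⟩), ?_⟩
  have hpath : ∀ᵐ x ∂(ν : Measure (Sample F r S)), x.1 ∈
      range fun c : PathC F r => sample c.path := by
    refine ae_of_ae_map measurable_fst.aemeasurable ?_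
    rw [hfst]
    refine (ae_map_iff htc.limit.measurable_sample.aemeasurable
      measurableEmbedding_sample.measurableSet_range).2 (ae_of_all _ fun ω => ?_)
    obtain ⟨c, hc⟩ := htc.limit.exists_pathC ω
    exact ⟨c, by rw [← hc]⟩
  have hae := SeqLikely.ae (X := fun n ω => (R n ω, Z n ω)) hX (hs.comp ht) (μ := μ ∘ t)
    (fun j => rfl) hν (Q := fun x => x.1 ∈ (range fun c : PathC F r => sample c.path) →
      ∃ (C : ℝ) (τ : ℕ → ℕ) (ω : ∀ j, Ω (τ j)) (Z₁ Z₂ : ℝ≥0 → Mat F r),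
        GoodSeq η ζ m Y₁ Y₂ A C τ ω Z₁ Z₂ ∧ combine Z₁ Z₂ = (fromSample x.1).path ∧
        Tendsto (fun j => Z (τ j) (ω j)) atTop (𝓝 x.2)) <|
    hgood.mono fun t ω _ ⟨p, C, Z₁, Z₂, hp, h⟩ x hx ⟨c, hc⟩ => by
      have hx' := hx.comp hp.tendsto_atTop
      have hl := h.lim₁.combine h.lim₂
      refine ⟨C, _, _, Z₁, Z₂, h, ?_, (continuous_snd.tendsto _).comp hx'⟩
      rw [← hc, fromSample_sample]
      refine hl.eq_of_sample (a := fun j => combine (Y₁ (t (p j)) (ω (p j)))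
        (Y₂ (t (p j)) (ω (p j)))) (fun _ => hm.pos _) c.continuous_path ?_
      exact (tendsto_nhds_unique hl.sample ((continuous_fst.tendsto _).comp hx')).trans hc.symm
  filter_upwards [hpath, hae] with x h1 h2 using h2 h1

end LimitLaw

/-! ### Joint convergence in law -/

section Conclusions

include hA hB in
/-- Limits of unit eigenvectors for the `(k + 1)`st eigenvalue are unit eigenfunctions. -/
theorem Approx.eigen_of_tendsto (hn : StrictMono n)
    {k : ℕ} {V : ℕ → L2 F r} {f : L2 F r} (hV : ∀ j, k < n j →
      IsUnitEigen (n j) (m j) (Y₁ j) (Y₂ j) (specMat (u' j) (x j)) k (V j))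
    (hf : Tendsto V atTop (𝓝 f)) :
    ‖f‖ = 1 ∧ IsContinuumEigen η Y u w (continuumEig η Y u w k) f := by
  have hs : StrictMono fun j : ℕ => j + (k + 1) := strictMono_id.add_const _
  obtain ⟨p, f', hp, h⟩ := (hA.comp hs).exists_family_limit (hB.comp hs)
    (N := 1) (k := fun _ => k) (V := fun j _ => V (j + (k + 1))) fun j _ => hV _
      (by have := hn.le_apply (x := j + (k + 1)); omega)
  rw [tendsto_nhds_unique (hf.comp (hs.comp hp).tendsto_atTop) (h 0).1]
  exact (h 0).2

variable {Ω : ℕ → Type*} [∀ n, MeasurableSpace (Ω n)] {P : ∀ n, Measure (Ω n)}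
  {Y₁ Y₂ : ∀ n, Ω n → ℕ → Mat F r} {A : ∀ n, Ω n → Prop} {t : ℕ → ℕ} {ω : ∀ j, Ω (t j)} {Z₁ Z₂ : ℝ≥0 → Mat F r}

theorem GoodSeq.comp (h : GoodSeq η ζ m Y₁ Y₂ A C t ω Z₁ Z₂) {s : ℕ → ℕ} (hs : StrictMono s) :
    GoodSeq η ζ m Y₁ Y₂ A C (fun j => t (s j)) (fun j => ω (s j)) Z₁ Z₂ :=
  ⟨h.pos, h.cmp, h.isScale, h.one_le, h.mono.comp hs, fun _ => h.good _, fun _ => h.prop _,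
    h.lim₁.comp hs, h.lim₂.comp hs⟩

theorem GoodSeq.tendsto_discreteEig (h : GoodSeq η ζ m Y₁ Y₂ A C t ω Z₁ Z₂)
    (hY : Continuous (combine Z₁ Z₂)) {wn : ℕ → Fin r → ℝ} (hw : IsSubcritical u wn w)
    (k : ℕ) : Tendsto (fun j => sampleEig m Y₁ Y₂ u wn k (t j) (ω j)) atTop
      (𝓝 (continuumEig η (combine Z₁ Z₂) u w k)) := by
  obtain ⟨b, -, hB⟩ := hw.exists_boundaryLimit
  exact ((h.approx hY).isLeast (hB t h.mono) k).2

variable {N : ℕ} {k : Fin N → ℕ} {u : Fin N → Fin r → Vec F r} {wn : Fin N → ℕ → Fin r → ℝ}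
  {w : Fin N → Fin r → EReal}

theorem GoodSeq.exists_subseq_family (h : GoodSeq η ζ m Y₁ Y₂ A C t ω Z₁ Z₂)
    (hw : ∀ a, IsSubcritical (u a) (wn a) (w a))
    {V : Fin N → ℕ → L2 F r} (hV : ∀ a j, k a < t j →
      IsUnitEigen (t j) (m (t j)) (Y₁ (t j) (ω j)) (Y₂ (t j) (ω j)) (specMat (u a) (wn a (t j)))
        (k a) (V a j)) :
    ∃ (p : ℕ → ℕ) (x : Fin N → ℝ × L2 F r), StrictMono p ∧ Tendsto (fun j a =>
      (sampleEig m Y₁ Y₂ (u a) (wn a) (k a) (t (p j)) (ω (p j)), V a (p j))) atTop (𝓝 x) := by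
  obtain ⟨p, hp, hx⟩ := exists_common_subseq (N := N) (P := fun a p => ∃ x : ℝ × L2 F r,
    Tendsto (fun j => (sampleEig m Y₁ Y₂ (u a) (wn a) (k a) (t (p j)) (ω (p j)), V a (p j))) atTop
      (𝓝 x))
    (fun a p s ⟨x, hx⟩ hs => ⟨x, hx.comp hs.tendsto_atTop⟩)
    fun a s hs => by
      obtain ⟨p, l, V₀, hp, h1, h2⟩ := (h.comp hs).exists_subseq (hw a) (k a) fun j => hV a (s j)
      exact ⟨p, hp, _, h1.prodMk_nhds h2⟩
  choose x hx using hx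
  exact ⟨p, x, hp, tendsto_pi_nhds.2 hx⟩

variable [∀ n, IsProbabilityMeasure (P n)] {Ω' : Type*} [MeasurableSpace Ω'] {P' : Measure Ω'}
  [IsProbabilityMeasure P'] {Y : Ω' → ℝ≥0 → Mat F r}

variable (hr : 0 < r) (hc : IsComparison η ζ) (hm : IsScale m) (hpot : IsPotentialProcess Y₁ Y₂)
  (htc : TightConvergent P m Y₁ Y₂ P' Y) (hgo : GrowthOscillation P m Y₁ Y₂ η ζ)

include hr hc hm hpot htc hgo in
/-- Almost surely, the eigenvalues of the limit are well defined for all boundary conditions at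
once: the limit path is the limit of the potentials along some good sequence of outcomes. -/
theorem ae_isLeast_continuumEig :
    ∀ᵐ ω ∂P', ∀ (u : Fin r → Vec F r) (w : Fin r → EReal) (k : ℕ), IsBoundaryCondition u w →
      IsLeast (eigLevels (IsContinuumEigen η (Y ω) u w) k) (continuumEig η (Y ω) u w k) := by
  let : MeasurableSpace F := borel F
  have : BorelSpace F := ⟨rfl⟩
  obtain ⟨t, ht, ν, hν, hfst, -, hae⟩ := exists_limit_law (S := Unit) (A := fun _ _ => True)
    (Z := fun _ _ => ()) hr hc hm hpot htc hgo (fun _ => aemeasurable_const)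
    (fun _ => ae_of_all _ fun _ => trivial)
    (fun _ _ _ _ _ _ => ⟨id, (), strictMono_id, tendsto_const_nhds⟩) strictMono_id
  have h : ∀ᵐ p ∂(ν.map Prod.fst), ∀ (u : Fin r → Vec F r) (w : Fin r → EReal) (k : ℕ),
      IsBoundaryCondition u w → IsLeast (eigLevels (IsContinuumEigen η (fromSample p).path u w) k)
        (continuumEig η (fromSample p).path u w k) := by
    refine ((Homeomorph.prodPUnit _).measurableEmbedding.ae_map_iff (f := Prod.fst)).2 ?_
    filter_upwards [hae] with x ⟨C, τ, ω, Z₁, Z₂, h, hY, _⟩ u w k hw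
    obtain ⟨b, x', hB⟩ := hw.exists_boundaryLimit
    have hA := h.approx (hY ▸ (fromSample x.1).continuous_path)
    rw [hY] at hA
    exact (hA.isLeast hB k).1
  rw [hfst] at h
  have h' := ae_of_ae_map htc.limit.measurable_sample.aemeasurable h
  simpa only [htc.limit.fromSample_eq] using h'

include hr hc hm hpot htc hgo in
/-- The eigenvalues converge jointly in law: in any limit law of potentials and eigenvalues, the
eigenvalues are a function of the potential. -/
theorem tendstoInDistribution_discreteEig (hw : ∀ a, IsSubcritical (u a) (wn a) (w a)) :
    TendstoInDistribution (E := Fin N → ℝ)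
      (fun n ω a => sampleEig m Y₁ Y₂ (u a) (wn a) (k a) n ω) atTop
      (fun ω a => continuumEig η (Y ω) (u a) (w a) (k a)) P P' := by
  let : MeasurableSpace F := borel F
  have : BorelSpace F := ⟨rfl⟩
  set Z : ∀ n, Ω n → Fin N → ℝ := fun n ω a => sampleEig m Y₁ Y₂ (u a) (wn a) (k a) n ω with hZ
  set g : (ℕ → Fin r → Fin r → F) → Fin N → ℝ := fun p a =>
    continuumEig η (fromSample p).path (u a) (w a) (k a) with hg
  have hZm : ∀ n, Measurable (Z n) := fun n => measurable_pi_iff.2 fun a =>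
    measurable_discreteEig hr (hm.pos n) (hpot.meas₁ n) (hpot.meas₂ n) (hpot.herm n) _ _ _
  have key : ∀ s : ℕ → ℕ, StrictMono s → ∃ t : ℕ → ℕ, StrictMono t ∧
      AEMeasurable g (P'.map fun ω => sample (Y ω)) ∧ ∀ Φ : (Fin N → ℝ) →ᵇ ℝ,
        Tendsto (fun j => ∫ ω, Φ (Z (s (t j)) ω) ∂(P (s (t j)))) atTop
          (𝓝 (∫ p, Φ (g p) ∂(P'.map fun ω => sample (Y ω)))) := by
    intro s hs
    obtain ⟨t, ht, ν, hν, hfst, hint, hae⟩ := exists_limit_law (A := fun _ _ => True) hr hc hm hpot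
      htc hgo (fun n => (hZm n).aemeasurable) (fun _ => ae_of_all _ fun _ => trivial)
      (fun C t ω Z₁ Z₂ h => by
        have hV : ∀ a j, ∃ V : L2 F r, k a < t j → IsUnitEigen (t j) (m (t j))
            (Y₁ (t j) (ω j)) (Y₂ (t j) (ω j)) (specMat (u a) (wn a (t j))) (k a) V := fun a j => by
          by_cases hj : k a < t j
          · obtain ⟨V, hV, h⟩ := exists_eigenvectors (Y₂ := Y₂ (t j) (ω j)) (hm.pos (t j)) hr
              (hpot.herm _ (ω j)) (u a) (wn a (t j)) hj
            exact ⟨V (Fin.last _), fun _ => ⟨norm_eq_one_of_ip ((hV _ _).trans (if_pos rfl)),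
              (h (Fin.last _)).1⟩⟩
          · exact ⟨0, fun h => (hj h).elim⟩
        choose V hV using hV
        obtain ⟨p, x, hp, hx⟩ := h.exists_subseq_family hw hV
        exact ⟨p, _, hp, tendsto_pi_nhds.2 fun a =>
          (continuous_fst.tendsto _).comp (tendsto_pi_nhds.1 hx a)⟩) hs
    have hgr : ∀ᵐ x ∂ν, x.2 = g x.1 := by
      filter_upwards [hae] with x ⟨C, τ, ω, Z₁, Z₂, h, hY, hl⟩
      funext a
      refine tendsto_nhds_unique (tendsto_pi_nhds.1 hl a) ?_
      simp only [hg, ← hY]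
      exact h.tendsto_discreteEig (hY ▸ (fromSample x.1).continuous_path) (hw a) (k a)
    have hgm := aemeasurable_of_graph hgr
    refine ⟨t, ht, hfst ▸ hgm, fun Φ => ?_⟩
    rw [← hfst, integral_map (f := fun p => Φ (g p)) measurable_fst.aemeasurable
      (Φ.continuous.measurable.comp_aemeasurable hgm).aestronglyMeasurable]
    rw [← integral_congr_ae (hgr.mono fun x hx => congrArg Φ hx)]
    exact hint Φ
  obtain ⟨-, -, hgm, -⟩ := key id strictMono_id
  have hlim : (fun ω a => continuumEig η (Y ω) (u a) (w a) (k a)) = fun ω => g (sample (Y ω)) := by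
    simp only [hg, htc.limit.fromSample_eq]
  have hmeas := htc.limit.measurable_sample.aemeasurable (μ := P')
  have hgm' : AEMeasurable (fun ω => g (sample (Y ω))) P' := hgm.comp_aemeasurable hmeas
  refine ⟨fun n => (hZm n).aemeasurable, hlim ▸ hgm', tendsto_of_subseq_tendsto fun s hs => ?_⟩
  obtain ⟨q, hq, hsq⟩ := strictMono_subseq_of_tendsto_atTop hs
  obtain ⟨t, ht, -, h⟩ := key _ hsq
  refine ⟨fun j => q (t j), ProbabilityMeasure.tendsto_iff_forall_integral_tendsto.2 fun Φ => ?_⟩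
  have h1 := h Φ
  rw [integral_map (f := fun p => Φ (g p)) hmeas
    (Φ.continuous.measurable.comp_aemeasurable hgm).aestronglyMeasurable] at h1
  simp only [ProbabilityMeasure.coe_mk, hlim]
  rw [integral_map hgm' Φ.continuous.measurable.aestronglyMeasurable]
  refine h1.congr fun j => ?_
  rw [integral_map (hZm _).aemeasurable Φ.continuous.measurable.aestronglyMeasurable]
  rfl

variable (hw : ∀ a, IsSubcritical (u a) (wn a) (w a)) {V : Fin N → ∀ n, Ω n → L2 F r}
  (hVm : ∀ a n, AEStronglyMeasurable (V a n) (P n))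
  (hV : ∀ a n, k a < n → ∀ᵐ ω ∂(P n), IsUnitEigen n (m n) (Y₁ n ω) (Y₂ n ω)
    (specMat (u a) (wn a n)) (k a) (V a n ω))

include hr hc hm hpot htc hgo hw hVm hV in
/-- Unit eigenvectors are tight, as they are precompact along good sequences of outcomes. -/
theorem tightInLaw_eigenvectors (a : Fin N) : TightInLaw P (V a) := by
  let : MeasurableSpace (L2 F r) := borel _
  have : BorelSpace (L2 F r) := ⟨rfl⟩
  have : Fact ((2 : ℝ≥0∞) ≠ ⊤) := ⟨by simp⟩
  have : PolishSpace (L2 F r) := { }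
  refine SeqLikely.tightInLaw (fun n => (hVm a n).aemeasurable) <|
    (seqLikely_good hr hc hm hpot htc.tight₁ htc.tight₂ hgo fun n => ae_all_iff.2 fun a =>
      ae_all_iff.2 fun h => hV a n h).mono fun t ω _ ⟨p, C, Z₁, Z₂, hp, h⟩ => ?_
  obtain ⟨q, x, hq, hx⟩ := h.exists_subseq_family hw fun a j hj => h.prop j a hj
  exact ⟨p ∘ q, _, hp.comp hq, (continuous_snd.tendsto _).comp (tendsto_pi_nhds.1 hx a)⟩

end Conclusions

end BlockTridiagonal

end

theorem theorem3 (F : Type) [NormedDivisionRing F] [NormedAlgebra ℝ F] [StarRing F]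
    [ClassicalScalar F] (r : ℕ) (hr : 0 < r)
    (m : ℕ → ℝ) (hm : IsScale m) (ηbar ζ : ℝ≥0 → ℝ) (hc : IsComparison ηbar ζ) :
    -- the deterministic setting of subsequential pathwise coupling
    (∀ (s : ℕ → ℕ) (Y₁ Y₂ : ℕ → ℕ → Mat F r) (Y : ℝ≥0 → Mat F r), StrictMono s →
      IsCoupled m ηbar ζ s Y₁ Y₂ Y →
      -- the ordered eigenvalues are well defined
      (∀ (u : Fin r → Vec F r) (w : Fin r → EReal) (k : ℕ), IsBoundaryCondition u w →
        IsLeast (eigLevels (IsContinuumEigen ηbar Y u w) k) (continuumEig ηbar Y u w k)) ∧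
      (∀ (u : Fin r → Vec F r) (x : Fin r → ℝ) (j k : ℕ), OrthoBasis u → k < s j →
        IsLeast (eigLevels (IsDiscreteEigen (s j) (m (s j)) (Y₁ (s j)) (Y₂ (s j)) (specMat u x)) k)
          (discreteEig (s j) (m (s j)) (Y₁ (s j)) (Y₂ (s j)) (specMat u x) k)) ∧
      -- convergence of eigenvalues, pre-compactness of eigenvectors, identification of the limits
      (∀ (u : Fin r → Vec F r) (wn : ℕ → Fin r → ℝ) (w : Fin r → EReal), IsSubcritical u wn w →
        ∀ k : ℕ,
        Tendsto (fun j => discreteEig (s j) (m (s j)) (Y₁ (s j)) (Y₂ (s j))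
          (specMat u (wn (s j))) k) atTop (𝓝 (continuumEig ηbar Y u w k)) ∧
        ∀ V : ℕ → L2 F r,
          (∀ j, k < s j → ‖V j‖ = 1 ∧
            IsDiscreteEigen (s j) (m (s j)) (Y₁ (s j)) (Y₂ (s j)) (specMat u (wn (s j)))
              (discreteEig (s j) (m (s j)) (Y₁ (s j)) (Y₂ (s j)) (specMat u (wn (s j))) k) (V j)) →
          IsCompact (closure (range V)) ∧
          ∀ (t : ℕ → ℕ) (f : L2 F r), StrictMono t → Tendsto (fun j => V (t j)) atTop (𝓝 f) →
            ‖f‖ = 1 ∧ IsContinuumEigen ηbar Y u w (continuumEig ηbar Y u w k) f) ∧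
      -- uniformity over boundary terms bounded below
      (∀ (b : ℝ) (k : ℕ),
        (∀ ε : ℝ, 0 < ε → ∃ δ > 0, ∃ R : ℝ, ∀ᶠ j in atTop,
          ∀ (u : Fin r → Vec F r) (x : Fin r → ℝ) (w : Fin r → EReal), OrthoBasis u →
            (∀ i, -b ≤ x i) → (∀ i, ((-b : ℝ) : EReal) ≤ w i) → (∀ i, CloseExt δ R (x i) (w i)) →
            |discreteEig (s j) (m (s j)) (Y₁ (s j)) (Y₂ (s j)) (specMat u x) k -
              continuumEig ηbar Y u w k| < ε ∧
            ∀ V : L2 F r, ‖V‖ = 1 →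
              IsDiscreteEigen (s j) (m (s j)) (Y₁ (s j)) (Y₂ (s j)) (specMat u x)
                (discreteEig (s j) (m (s j)) (Y₁ (s j)) (Y₂ (s j)) (specMat u x) k) V →
              ∃ (d : ℕ) (μ : Fin d → ℝ) (f : Fin d → L2 F r),
                (∀ i, IsContinuumEigen ηbar Y u w (μ i) (f i) ∧
                  |μ i - continuumEig ηbar Y u w k| < ε) ∧ ‖V - ∑ i, f i‖ < ε) ∧
        IsCompact (closure {V : L2 F r | ∃ (j : ℕ) (u : Fin r → Vec F r) (x : Fin r → ℝ),
          k < s j ∧ OrthoBasis u ∧ (∀ i, -b ≤ x i) ∧ ‖V‖ = 1 ∧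
          IsDiscreteEigen (s j) (m (s j)) (Y₁ (s j)) (Y₂ (s j)) (specMat u x)
            (discreteEig (s j) (m (s j)) (Y₁ (s j)) (Y₂ (s j)) (specMat u x) k) V}))) ∧
    -- the random ensemble
    (∀ (Ω : ℕ → Type*) [∀ n, MeasurableSpace (Ω n)] (P : ∀ n, Measure (Ω n))
      [∀ n, IsProbabilityMeasure (P n)] (Y₁ Y₂ : ∀ n, Ω n → ℕ → Mat F r)
      (Ω' : Type*) [MeasurableSpace Ω'] (P' : Measure Ω') [IsProbabilityMeasure P']
      (Y : Ω' → ℝ≥0 → Mat F r),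
      IsPotentialProcess Y₁ Y₂ → TightConvergent P m Y₁ Y₂ P' Y →
      GrowthOscillation P m Y₁ Y₂ ηbar ζ →
      -- the limiting eigenvalues are almost surely well defined
      (∀ᵐ ω ∂P', ∀ (u : Fin r → Vec F r) (w : Fin r → EReal) (k : ℕ), IsBoundaryCondition u w →
        IsLeast (eigLevels (IsContinuumEigen ηbar (Y ω) u w) k)
          (continuumEig ηbar (Y ω) u w k)) ∧
      -- finitely many pairs of an eigenvalue index and a boundary term
      ∀ (N : ℕ) (k : Fin N → ℕ) (u : Fin N → Fin r → Vec F r) (wn : Fin N → ℕ → Fin r → ℝ)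
        (w : Fin N → Fin r → EReal), (∀ a, IsSubcritical (u a) (wn a) (w a)) →
        -- joint convergence in law of the eigenvalues
        TendstoInDistribution (E := Fin N → ℝ)
          (fun n ω a => discreteEig n (m n) (Y₁ n ω) (Y₂ n ω) (specMat (u a) (wn a n)) (k a)) atTop
          (fun ω a => continuumEig ηbar (Y ω) (u a) (w a) (k a)) P P' ∧
        -- tightness and joint subsequential convergence in law of the eigenvectors
        ∀ V : Fin N → ∀ n, Ω n → L2 F r,
          (∀ a n, AEStronglyMeasurable (V a n) (P n)) →
          (∀ a n, k a < n → ∀ᵐ ω ∂(P n), ‖V a n ω‖ = 1 ∧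
            IsDiscreteEigen n (m n) (Y₁ n ω) (Y₂ n ω) (specMat (u a) (wn a n))
              (discreteEig n (m n) (Y₁ n ω) (Y₂ n ω) (specMat (u a) (wn a n)) (k a)) (V a n ω)) →
          (∀ a, TightInLaw P (V a)) ∧
          ∀ s : ℕ → ℕ, StrictMono s → ∃ t : ℕ → ℕ, StrictMono t ∧
            ∃ (Ω'' : Type) (_ : MeasurableSpace Ω'') (P'' : Measure Ω'')
              (Y'' : Ω'' → ℝ≥0 → Mat F r) (f : Fin N → Ω'' → L2 F r),
              IsProbabilityMeasure P'' ∧ IsContinuousProcess Y'' ∧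
              EqualInLaw P'' (fun ω => toPath (Y'' ω)) P' (fun ω => toPath (Y ω)) ∧
              (∀ a, AEMeasurable (fun ω => continuumEig ηbar (Y'' ω) (u a) (w a) (k a)) P'') ∧
              (∀ a, AEStronglyMeasurable (f a) P'') ∧
              (∀ᵐ ω ∂P'', ∀ a, ‖f a ω‖ = 1 ∧ IsContinuumEigen ηbar (Y'' ω) (u a) (w a)
                (continuumEig ηbar (Y'' ω) (u a) (w a) (k a)) (f a ω)) ∧
              TendstoInLaw (S := Fin N → ℝ × L2 F r) (fun j => P (s (t j)))
                (fun j ω a => (discreteEig (s (t j)) (m (s (t j))) (Y₁ (s (t j)) ω)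
                  (Y₂ (s (t j)) ω) (specMat (u a) (wn a (s (t j)))) (k a), V a (s (t j)) ω))
                P'' (fun ω a => (continuumEig ηbar (Y'' ω) (u a) (w a) (k a), f a ω))) := by
  refine ⟨fun s Y₁ Y₂ Y hs hY => ?_, ?_⟩
  · obtain ⟨C, J, hA⟩ := hY.exists_approx hr hc hm hs
    have hm0 : ∀ j, 0 < m (s j) := fun j => hm.pos _
    refine ⟨fun u w k hw => ?_, fun u x j k hu hk => isLeast_discreteEig _ (hm0 j) hr
      (hY.1 (s j)) u x hk, fun u wn w hw k => ⟨?_, fun V hV => ⟨?_, fun t f ht hf => ?_⟩⟩,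
      fun b k => ⟨fun ε hε => ?_, ?_⟩⟩
    · obtain ⟨b, x, hB⟩ := hw.exists_boundaryLimit
      exact (hA.isLeast hB k).1
    · obtain ⟨b, -, hB⟩ := hw.exists_boundaryLimit
      exact (tendsto_add_atTop_iff_nat J).1 (hA.isLeast
        (hB (fun j => s (j + J)) (hs.comp (strictMono_id.add_const J))) k).2
    · obtain ⟨b, hb, -⟩ := hw.exists_boundaryLimit
      have hfin : (V '' {j | j ≤ k}).Finite := (finite_Iic k).image V
      refine ((isCompact_closure_eigenvectors (n := s) (m := fun j => m (s j))
        (Y₁ := fun j => Y₁ (s j)) (Y₂ := fun j => Y₂ (s j)) b k J hA hm0).union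
        hfin.isCompact).closure_of_subset ?_
      rintro _ ⟨j, rfl⟩
      by_cases hj : k < s j
      · exact Or.inl (subset_closure ⟨j, u, wn (s j), hj, hw.bc.1, fun i => hb _ i, hV j hj⟩)
      · exact Or.inr ⟨j, (hs.le_apply (x := j)).trans (not_lt.1 hj), rfl⟩
    · obtain ⟨b, -, hB⟩ := hw.exists_boundaryLimit
      obtain ⟨q, hq, hqJ⟩ := ht.exists_shift J 0
      have hA' := hA.comp hq
      simp only [← (hqJ _).1] at hA'
      have hts := (hs.comp ht).comp (strictMono_id.add_const (0 + J))
      exact hA'.eigen_of_tendsto (hB _ hts) hts (fun j hj => hV _ hj)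
        (hf.comp (tendsto_add_atTop_nat (0 + J)))
    · obtain ⟨δ, hδ, R, h⟩ := hA.uniform b k hε
      refine ⟨δ, hδ, R, ?_⟩
      rw [← map_add_atTop_eq_nat J]
      exact eventually_map.2 h
    · exact isCompact_closure_eigenvectors (n := s) (m := fun j => m (s j))
        (Y₁ := fun j => Y₁ (s j)) (Y₂ := fun j => Y₂ (s j)) b k J hA hm0
  · intro Ω _ P _ Y₁ Y₂ Ω' _ P' _ Y hpot htc hgo
    refine ⟨ae_isLeast_continuumEig hr hc hm hpot htc hgo, fun N k u wn w hw =>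
      ⟨tendstoInDistribution_discreteEig hr hc hm hpot htc hgo hw, fun V hVm hV =>
        ⟨tightInLaw_eigenvectors hr hc hm hpot htc hgo hw hVm hV, fun s hs => ?_⟩⟩⟩
    let : MeasurableSpace F := borel F
    have : BorelSpace F := ⟨rfl⟩
    let : MeasurableSpace (L2 F r) := borel _
    have : BorelSpace (L2 F r) := ⟨rfl⟩
    haveI : Fact ((2 : ℝ≥0∞) ≠ ⊤) := ⟨by simp⟩
    haveI : PolishSpace (L2 F r) := { }
    haveI : BorelSpace (ℝ × L2 F r) := Prod.borelSpace
    obtain ⟨t, ht, ν, hν, hfst, hint, hae⟩ := exists_limit_law (S := Fin N → ℝ × L2 F r)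
      (Z := fun n ω a => (sampleEig m Y₁ Y₂ (u a) (wn a) (k a) n ω, V a n ω)) hr hc hm hpot htc hgo
      (fun n => aemeasurable_pi_iff.2 fun a => (measurable_discreteEig hr (hm.pos n) (hpot.meas₁ n)
        (hpot.meas₂ n) (hpot.herm n) _ _ _).aemeasurable.prodMk (hVm a n).aemeasurable)
      (fun n => ae_all_iff.2 fun a => ae_all_iff.2 fun h => hV a n h)
      (fun C t ω Z₁ Z₂ h =>
        let ⟨p, x, hp, hx⟩ := h.exists_subseq_family hw fun a j hj => h.prop j a hj
        ⟨p, x, hp, hx⟩) hs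
    have hg : ∀ᵐ x ∂ν, ∀ a, continuumEig ηbar (fromSample x.1).path (u a) (w a) (k a) = (x.2 a).1 ∧
        ‖(x.2 a).2‖ = 1 ∧ IsContinuumEigen ηbar (fromSample x.1).path (u a) (w a)
          (continuumEig ηbar (fromSample x.1).path (u a) (w a) (k a)) (x.2 a).2 := by
      filter_upwards [hae] with x ⟨C, τ, ω, Z₁, Z₂, h, hY, hl⟩ a
      have hc' : Continuous (combine Z₁ Z₂) := hY ▸ (fromSample x.1).continuous_path
      have hl' := tendsto_pi_nhds.1 hl a
      rw [← hY]
      obtain ⟨b, -, hB⟩ := (hw a).exists_boundaryLimit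
      exact ⟨tendsto_nhds_unique (h.tendsto_discreteEig hc' (hw a) (k a))
        ((continuous_fst.tendsto _).comp hl'), (h.approx hc').eigen_of_tendsto
        (hB τ h.mono) h.mono (fun j hj => h.prop j a hj) ((continuous_snd.tendsto _).comp hl')⟩
    have hm2 : ∀ a, Measurable fun x : (ℕ → Fin r → Fin r → F) × (Fin N → ℝ × L2 F r) => x.2 a :=
      fun a => (measurable_pi_apply a).comp measurable_snd
    refine ⟨t, ht, _, _, ν, fun x => (fromSample x.1).path, fun a x => (x.2 a).2, hν,
      isContinuousProcess_fromSample measurable_fst, htc.limit.equalInLaw measurable_fst hfst,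
      fun a => (hm2 a).fst.aemeasurable.congr (hg.mono fun x hx => (hx a).1.symm),
      fun a => (hm2 a).snd.aemeasurable.aestronglyMeasurable, hg.mono fun x hx a => (hx a).2,
      fun Φ => ?_⟩
    convert hint Φ using 2
    exact integral_congr_ae (hg.mono fun x hx => congrArg Φ (funext fun a => Prod.ext (hx a).1 rfl))
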